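/- **Setting.** Let $\overline{\mathbb Q}\subset\mathbb C$ be the field of algebraic numbers, $p\ge 2$, $m\ge 1$ integers, $A\in{\rm GL}_m(\overline{\mathbb Q}(z))$, and $\phi_k(f)(z)=f(z^k)$. Let $v_0$ of a rational function be its valuation at $0$, and $v_0$ of a matrix the minimum of the valuations of its entries; put $v=-(v_0(A)+v_0(A^{-1}))$. Write $A=Q^{-1}S$ with $Q\in\overline{\mathbb Q}[z]$ the least common denominator of the entries and $S$ a polynomial matrix; $\deg(A)$ is the maximum of the degrees of $Q$ and of the entries of $S$. Let $\deg_{\rm e}(A)$ be the maximum of the degrees of the entries of $A$ (the degree of a reduced fraction being the maximum of the degrees of numerator and denominator). For $d\ge1$ put $\nu_d=\lceil d v_0(A)/(p-1)\rceil$, $\mu_d=\lceil -d v_0(A^{-1})/(p-1)\rceil$, $\phi_d(A^{-1})=\sum_n B_n(d)z^n$ (Laurent expansion at $0$), $M_d=(B_{i-pj}(d))_{\nu_d\le i,j\le\mu_d}$, and $N_d=(B_{i-pj}(d))_{dv_0(A^{-1})+p\nu_d\le i\le\nu_d-1,\ \nu_d\le j\le\mu_d}$ if $\nu_d<\mu_d$,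 $N_d=0$ (one block row) if $\nu_d=\mu_d$. A block matrix $(D_{i,j})$ is *$d$-gridded* if $D_{i_0,j_0}\ne0$ implies $D_{i_0,j}=0$ for all $j\not\equiv j_0$ and $D_{i,j_0}=0$ for all $i\not\equiv i_0 \pmod d$. **Algorithm** (on input the coefficients of $Q$ and $S$; it decides whether $\phi_p(Y)=AY$ is regular singular at $0$). 1. For $f=\sum_{k\le h}f_kz^k$ with $f_h\neq 0$ put $\|f\|=1+\max_{k<h}|f_k/f_h|$ (an empty maximum is $0$), and let $z_0=\max(2,\|\det S\|,\|Q\|)$. Find the row vector $r\in\overline{\mathbb Q}[z]^m$ of polynomials of degree $<m$ with $r(z_0^{p^{i-1}})=e_iA(z_0)^{-1}A(z_0^p)^{-1}\cdots A(z_0^{p^{i-2}})^{-1}$ for $1\le i\le m$. Compute the matrix $P$ with rows $r_1=r$, $r_{i+1}=\phi_p(r_i)A$, and $(q_0,\dots,q_{m-1})=\phi_p(r_m)AP^{-1}$. 2. Let $d$ be the least common multiple of those denominators of the slopes of the lower hull of $\{(p^i,v_0(q_i)) : q_i\ne0\}\cup\{(p^m,0)\}$ which are prime to $p$. 3. Compute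 $\nu_d,\mu_d,M_d,N_d$; put $c=m(\mu_d-\nu_d+1)$, $\mathfrak X:=\ker N_d$, $Y:=N_d$. For $i=0,\dots,c$: $\mathfrak X:=\mathfrak X\cap M_d^i\mathfrak X$. Then, again $c+1$ times: $Y:=YM_d$, $\mathfrak X:=\mathfrak X\cap\ker Y$. 4. If $\dim\mathfrak X=m$, compute a matrix $E$ whose columns form a basis of $\mathfrak X$, the matrix $R$ with $M_dE=ER$, and $\Lambda=R^{-1}$, and answer "regular singular"; otherwise answer "not regular singular". (The full algorithm then goes on to compute further Puiseux coefficients of a gauge transformation $\Psi$; that part is not counted.) **Cost.** Computations are algebraic computation trees over $\overline{\mathbb Q}$, one for each $(p,m,\deg A)$. Unit cost is charged for each constant, operation $+,-,\times,\div$, absolute value, test $x=0$ and comparison $|x|\le|y|$; handling integers and indices is free. An implementation of the algorithm has to produce the values of all the variables above, at every pass of the loops, subspaces being given by bases and rational functions by a numerator and a denominator. Let ${\rm M},{\rm MM}:\mathbb N\to\mathbb R$ be such that two polynomials of degree at most $n$, resp. two $n\times n$ matrices, over $\overline{\mathbb Q}$ can be multiplied by a straight-line program with at most ${\rm M}(n)$,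 resp. ${\rm MM}(n)$, instructions (ring operations and constants), and assume, as is usual, that ${\rm M}(n)/n$ and ${\rm MM}(n)/n^2$ are nondecreasing for $n\ge1$. **Proposition.** One has $v\ge0$, and $M_d$ and $N_d$ are $d$-gridded for every $d\ge1$ prime to $p$. There is an implementation of the algorithm whose number of operations is, for all $p$, $m$ and $A$, at most $$\kappa\Big({\rm MM}(m)\,{\rm M}\big(p^m(\deg(A)+m)\big)+p^{2m-1}\,m\,v\,{\rm MM}(mv)\Big),$$ where $\kappa>0$ depends only on the functions ${\rm M}$ and ${\rm MM}$. If moreover ${\rm M}(2n)=\mathcal O({\rm M}(n))$, then, for this same implementation and each fixed $m$, the bound also holds with $\deg_{\rm e}(A)$ in place of $\deg(A)$, with a constant that may depend on $m$ too. -/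

import Mathlib

open scoped NNReal Polynomial LaurentSeries

noncomputable section

namespace Mahler

/-! ## The base field -/

/-- The field of algebraic numbers, as a subfield of `ℂ`. -/
abbrev Qbar : Type := algebraicClosure ℚ ℂ

/-- The absolute value of an algebraic number is algebraic. -/
theorem norm_mem_Qbar (x : Qbar) : ((‖(x : ℂ)‖ : ℝ) : ℂ) ∈ algebraicClosure ℚ ℂ := by
  have hx : IsAlgebraic ℚ (x : ℂ) := mem_algebraicClosure_iff.1 x.2
  have hc : IsAlgebraic ℚ ((starRingEnd ℂ) (x : ℂ)) :=
    hx.algHom (Complex.conjAe.toAlgHom.restrictScalars ℚ)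
  have h2 : IsAlgebraic ℚ (((‖(x : ℂ)‖ : ℝ) : ℂ) ^ 2) := by
    have h := hx.mul hc
    rwa [Complex.mul_conj, Complex.normSq_eq_norm_sq, Complex.ofReal_pow] at h
  exact mem_algebraicClosure_iff.2 (h2.of_pow (by norm_num))

/-- The absolute value, as an operation of the field of algebraic numbers. -/
def absQ (x : Qbar) : Qbar := ⟨((‖(x : ℂ)‖ : ℝ) : ℂ), norm_mem_Qbar x⟩

/-! ## Counting arithmetic operations: straight-line programs and computation trees

A memory is a list of algebraic numbers (the registers); every instruction appends the value that
it computes. -/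

/-- The instructions. The arguments are register numbers. -/
inductive Instr : Type
  | const : Qbar → Instr
  | add : ℕ → ℕ → Instr
  | sub : ℕ → ℕ → Instr
  | mul : ℕ → ℕ → Instr
  | div : ℕ → ℕ → Instr
  | abs : ℕ → Instr

/-- The content of a register. -/
def reg (env : List Qbar) (i : ℕ) : Qbar := env.getD i 0

/-- The value computed by an instruction. (Division by zero gives zero, as usual in Mathlib; zero
can be tested for, so that this does not add to the power of the model.) -/
def Instr.eval (env : List Qbar) : Instr → Qbar
  | .const c => c
  | .add i j => reg env i + reg env j
  | .sub i j => reg env i - reg env j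
  | .mul i j => reg env i * reg env j
  | .div i j => reg env i / reg env j
  | .abs i => absQ (reg env i)

/-- Ring operations: no division, no absolute value. -/
def Instr.IsRing : Instr → Prop
  | .div _ _ => False
  | .abs _ => False
  | _ => True

/-- The final memory of a straight-line program. Its number of operations is its length. -/
def runSLP (s : List Instr) (env : List Qbar) : List Qbar :=
  s.foldl (fun e i => e ++ [i.eval e]) env

/-- The straight-line program `s`, made of ring operations, multiplies two polynomials of degree at
most `n`, given by their coefficients. -/
def IsPolyMul (n : ℕ) (s : List Instr) : Prop :=
  (∀ i ∈ s, i.IsRing) ∧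
    ∃ out : Fin (2 * n + 1) → ℕ, ∀ f g : Fin (n + 1) → Qbar, ∀ k : Fin (2 * n + 1),
      reg (runSLP s (List.ofFn f ++ List.ofFn g)) (out k) =
        ∑ i : Fin (n + 1), ∑ j : Fin (n + 1), if (i : ℕ) + j = k then f i * g j else 0

/-- The entries of a matrix, row after row. -/
def matrixWord {n : ℕ} (a : Matrix (Fin n) (Fin n) Qbar) : List Qbar :=
  (List.ofFn fun i => List.ofFn (a i)).flatten

/-- The straight-line program `s`, made of ring operations, multiplies two matrices of size `n`. -/
def IsMatMul (n : ℕ) (s : List Instr) : Prop :=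
  (∀ i ∈ s, i.IsRing) ∧
    ∃ out : Fin n → Fin n → ℕ, ∀ a b : Matrix (Fin n) (Fin n) Qbar, ∀ i j,
      reg (runSLP s (matrixWord a ++ matrixWord b)) (out i j) = (a * b) i j

/-- Algebraic computation trees with results in `β`. A node performs an instruction, or branches
on whether a register is zero, or branches on whether the absolute value of a register is at most
that of another one. -/
inductive CompTree (β : Type) : Type
  | leaf : β → CompTree β
  | step : Instr → CompTree β → CompTree β
  | ifZero : ℕ → CompTree β → CompTree β → CompTree β
  | ifNormLe : ℕ → ℕ → CompTree β → CompTree β → CompTree β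

open Classical in
/-- The label of the leaf that is reached, and the final memory. -/
def CompTree.run {β : Type} : CompTree β → List Qbar → β × List Qbar
  | .leaf b, env => (b, env)
  | .step i t, env => t.run (env ++ [i.eval env])
  | .ifZero i t u, env => if reg env i = 0 then t.run env else u.run env
  | .ifNormLe i j t u, env =>
      if ‖(reg env i : ℂ)‖ ≤ ‖(reg env j : ℂ)‖ then t.run env else u.run env

open Classical in
/-- The number of operations and tests performed on the given input. -/
def CompTree.cost {β : Type} : CompTree β → List Qbar → ℕ
  | .leaf _, _ => 0
  | .step i t, env => t.cost (env ++ [i.eval env]) + 1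
  | .ifZero i t u, env => (if reg env i = 0 then t.cost env else u.cost env) + 1
  | .ifNormLe i j t u, env =>
      (if ‖(reg env i : ℂ)‖ ≤ ‖(reg env j : ℂ)‖ then t.cost env else u.cost env) + 1

/-! ## Rational functions and Mahler systems -/

/-- The operator `f(z) ↦ f(z ^ p)` on rational functions (`p ≥ 1`). -/
def phi (p : ℕ) (f : RatFunc Qbar) : RatFunc Qbar :=
  algebraMap Qbar[X] (RatFunc Qbar) (Polynomial.expand Qbar p f.num) /
    algebraMap Qbar[X] (RatFunc Qbar) (Polynomial.expand Qbar p f.denom)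

/-- The valuation at `0` of a nonzero rational function. -/
def val0 (f : RatFunc Qbar) : ℤ := (f : Qbar⸨X⸩).order

/-- The valuation at `0` of a nonzero matrix: the minimum of the valuations of its nonzero
entries. -/
def matVal0 {m : ℕ} (A : Matrix (Fin m) (Fin m) (RatFunc Qbar)) : ℤ :=
  sInf {v : ℤ | ∃ i j, A i j ≠ 0 ∧ val0 (A i j) = v}

/-- `A = Q⁻¹ S` for a polynomial `Q ≠ 0` and a polynomial matrix `S`, all of degree at most `δ`. -/
def IsPresentation {m : ℕ} (A : Matrix (Fin m) (Fin m) (RatFunc Qbar)) (Q : Qbar[X])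
    (S : Matrix (Fin m) (Fin m) Qbar[X]) (δ : ℕ) : Prop :=
  Q ≠ 0 ∧ Q.natDegree ≤ δ ∧ (∀ i j, (S i j).natDegree ≤ δ) ∧
    ∀ i j, A i j = algebraMap Qbar[X] (RatFunc Qbar) (S i j) / algebraMap Qbar[X] (RatFunc Qbar) Q

/-- The degree of a matrix of rational functions: the maximum of the degrees of its least common
denominator and of the corresponding numerators. -/
def matDegree {m : ℕ} (A : Matrix (Fin m) (Fin m) (RatFunc Qbar)) : ℕ :=
  sInf {δ : ℕ | ∃ Q S, IsPresentation A Q S δ}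

/-- The maximum of the degrees of the entries, where the degree of an entry is the maximum of the
degrees of its numerator and denominator in lowest terms. -/
def entryDegree {m : ℕ} (A : Matrix (Fin m) (Fin m) (RatFunc Qbar)) : ℕ :=
  Finset.univ.sup fun ij : Fin m × Fin m =>
    max (A ij.1 ij.2).num.natDegree (A ij.1 ij.2).denom.natDegree

/-- The input of the algorithm: the coefficients of `Q` and those of the entries of `S`. -/
def inputWord {m : ℕ} (δ : ℕ) (Q : Qbar[X]) (S : Matrix (Fin m) (Fin m) Qbar[X]) : List Qbar :=
  (List.ofFn fun k : Fin (δ + 1) => Q.coeff k) ++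
    (List.ofFn fun i => (List.ofFn fun j =>
      List.ofFn fun k : Fin (δ + 1) => (S i j).coeff k).flatten).flatten

/-! ## The matrices `M_d` and `N_d` -/

section blocks

variable {m : ℕ} (p : ℕ) (A : GL (Fin m) (RatFunc Qbar)) (d : ℕ)

/-- `v_0(A)`. -/
def vA : ℤ := matVal0 (A : Matrix (Fin m) (Fin m) (RatFunc Qbar))

/-- `v_0(A⁻¹)`. -/
def vAinv : ℤ := matVal0 ((A⁻¹ : GL (Fin m) (RatFunc Qbar)) : Matrix (Fin m) (Fin m) (RatFunc Qbar))

/-- `ν_d`. -/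
def nu : ℤ := ⌈((d : ℚ) * (vA A : ℚ)) / ((p : ℚ) - 1)⌉

/-- `μ_d`. -/
def mu : ℤ := ⌈(-((d : ℚ) * (vAinv A : ℚ))) / ((p : ℚ) - 1)⌉

/-- `B_k(d)`, the coefficient of `z ^ k` in the Laurent expansion of `φ_d(A⁻¹)` at `0`. -/
def Bcoeff (k : ℤ) : Matrix (Fin m) (Fin m) Qbar := fun a b =>
  ((phi d (((A⁻¹ : GL (Fin m) (RatFunc Qbar)) : Matrix (Fin m) (Fin m) (RatFunc Qbar)) a b) :
    RatFunc Qbar) : Qbar⸨X⸩).coeff k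

/-- The number `μ_d - ν_d + 1` of block rows of `M_d`. -/
def colCount : ℕ := (mu p A d - nu p A d + 1).toNat

/-- The number of block rows of `N_d`: its block rows are indexed by
`d v_0(A⁻¹) + p ν_d ≤ i ≤ ν_d - 1` if `ν_d < μ_d`, and there is a single one if `ν_d = μ_d`. -/
def rowCount : ℕ :=
  if nu p A d < mu p A d then (nu p A d - (d * vAinv A + p * nu p A d)).toNat else 1

/-- `M_d = (B_{i - p j}(d))` for `ν_d ≤ i, j < ν_d + n`; in use, `n = colCount p A d`. -/
def Mmat (n : ℕ) : Matrix (Fin n × Fin m) (Fin n × Fin m) Qbar := fun x y =>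
  Bcoeff A d ((nu p A d + x.1) - p * (nu p A d + y.1)) x.2 y.2

/-- `N_d = (B_{i - p j}(d))` for `d v_0(A⁻¹) + p ν_d ≤ i < d v_0(A⁻¹) + p ν_d + k` and
`ν_d ≤ j < ν_d + n` if `ν_d < μ_d`, and `N_d = 0` if `ν_d = μ_d`; in use, `k = rowCount p A d` and
`n = colCount p A d`. -/
def Nmat (k n : ℕ) : Matrix (Fin k × Fin m) (Fin n × Fin m) Qbar := fun x y =>
  if nu p A d < mu p A d then
    Bcoeff A d ((d * vAinv A + p * nu p A d + x.1) - p * (nu p A d + y.1)) x.2 y.2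
  else 0

end blocks

/-- The block matrix `D`, with blocks of size `m`, is a `d`-gridded matrix. -/
def IsGridded {m r s : ℕ} (d : ℕ) (D : Matrix (Fin r × Fin m) (Fin s × Fin m) Qbar) : Prop :=
  ∀ (i₀ : Fin r) (j₀ : Fin s), (∃ a b, D (i₀, a) (j₀, b) ≠ 0) →
    (∀ j : Fin s, ¬ (j : ℕ) ≡ j₀ [MOD d] → ∀ a b, D (i₀, a) (j, b) = 0) ∧
    (∀ i : Fin r, ¬ (i : ℕ) ≡ i₀ [MOD d] → ∀ a b, D (i, a) (j₀, b) = 0)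

/-! ## The subspaces computed by the loops -/

section loops

variable {ι κ : Type} [Fintype ι] [DecidableEq ι] [Fintype κ]

/-- The value of `𝔛` after `i` passes of the first loop. It starts from `ker N`; the pass of index
`i` replaces `𝔛` by `𝔛 ∩ M ^ i 𝔛`. -/
def loopOne (M : Matrix ι ι Qbar) (N : Matrix κ ι Qbar) : ℕ → Submodule Qbar (ι → Qbar)
  | 0 => LinearMap.ker N.mulVecLin
  | i + 1 => loopOne M N i ⊓ (loopOne M N i).map (M ^ i).mulVecLin

/-- The value of `Y` after `i` passes of the second loop. It starts from `N`; a pass replaces `Y`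
by `Y M`. -/
def loopY (M : Matrix ι ι Qbar) (N : Matrix κ ι Qbar) : ℕ → Matrix κ ι Qbar
  | 0 => N
  | i + 1 => loopY M N i * M

/-- The value of `𝔛` after `i` passes of the second loop. It starts from the result `X₀` of the
first loop; a pass replaces `𝔛` by `𝔛 ∩ ker Y`, for the new `Y`. -/
def loopTwo (M : Matrix ι ι Qbar) (N : Matrix κ ι Qbar) (X₀ : Submodule Qbar (ι → Qbar)) :
    ℕ → Submodule Qbar (ι → Qbar)
  | 0 => X₀
  | i + 1 => loopTwo M N X₀ i ⊓ LinearMap.ker (loopY M N (i + 1)).mulVecLin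

end loops

/-- The list `l` of vectors is a basis of the subspace `X`. -/
def IsBasisOf {ι : Type} (l : List (ι → Qbar)) (X : Submodule Qbar (ι → Qbar)) : Prop :=
  LinearIndependent Qbar (fun i : Fin l.length => l.get i) ∧
    Submodule.span Qbar (Set.range fun i : Fin l.length => l.get i) = X

/-! ## The ingredients of the computation of `d` -/

/-- `1 + max |f_k| / |f_h|` over `k < h`, where `h` is the degree of `f`; an empty maximum is `0`.
The roots of `f` have smaller absolute value. -/
def polyNorm (f : Qbar[X]) : ℝ≥0 :=
  1 + (Finset.range f.natDegree).sup fun k => ‖(f.coeff k : ℂ)‖₊ / ‖(f.leadingCoeff : ℂ)‖₊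

/-- The slopes of the lower hull of the points `(p ^ i, v_0(q_i))`, for `i < m` and `q_i ≠ 0`, and
`(p ^ m, 0)`. The segment between two of these points lies on the lower hull if and only if all the
points are on or above the line through both. -/
def hullSlopes {m : ℕ} (p : ℕ) (q : Fin m → RatFunc Qbar) : Set ℚ :=
  let pts : Set (ℚ × ℚ) :=
    {x | (∃ i : Fin m, q i ≠ 0 ∧ x = ((p : ℚ) ^ (i : ℕ), (val0 (q i) : ℚ))) ∨ x = ((p : ℚ) ^ m, 0)}
  {s | ∃ x ∈ pts, ∃ y ∈ pts, x.1 < y.1 ∧ s = (y.2 - x.2) / (y.1 - x.1) ∧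
    ∀ w ∈ pts, x.2 + s * (w.1 - x.1) ≤ w.2}

/-- `d` is the least common multiple of the denominators, prime to `p`, of the slopes. -/
def IsRamificationIndex {m : ℕ} (p : ℕ) (q : Fin m → RatFunc Qbar) (d : ℕ) : Prop :=
  (∀ s ∈ hullSlopes p q, s.den.Coprime p → s.den ∣ d) ∧
    ∀ e : ℕ, (∀ s ∈ hullSlopes p q, s.den.Coprime p → s.den ∣ e) → d ∣ e

/-! ## The runs of the algorithm -/

/-- The record of a run: the values that the variables of the algorithm take, step by step, up to
the verdict. The numbers are of type `R`: it is `Qbar` for the values themselves, and `ℕ` when each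
number is given by the register that contains it. A polynomial is given by the list of its
coefficients, a rational function by a numerator and a denominator, and a subspace by the list of
the vectors of a basis. -/
structure Trace (m : ℕ) (R : Type) where
  /-- the point of interpolation -/
  z₀ : R
  /-- the coefficients of the entries of the cyclic vector -/
  r : Fin m → Fin m → R
  /-- the matrix whose rows are `r, φ_p(r) A, …` -/
  P : Fin m → Fin m → List R × List R
  /-- the last row of the companion matrix -/
  q : Fin m → List R × List R
  /-- the ramification index -/
  d : ℕ
  /-- `ν_d` -/
  ν : ℤ
  /-- `μ_d` -/
  μ : ℤ
  /-- the number of block rows of `M_d` -/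
  n : ℕ
  /-- the number of block rows of `N_d` -/
  k : ℕ
  /-- `M_d` -/
  M : Matrix (Fin n × Fin m) (Fin n × Fin m) R
  /-- `N_d` -/
  N : Matrix (Fin k × Fin m) (Fin n × Fin m) R
  /-- the subspace `𝔛` after each pass of the first loop -/
  X₁ : ℕ → List (Fin n × Fin m → R)
  /-- the matrix `Y` after each pass of the second loop -/
  Y : ℕ → Matrix (Fin k × Fin m) (Fin n × Fin m) R
  /-- the subspace `𝔛` after each pass of the second loop -/
  X₂ : ℕ → List (Fin n × Fin m → R)
  /-- the verdict: `none` if the system is not regular singular at `0`, and otherwise the matrix `E`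
  of the blocks `E_ν, …, E_μ`, the matrix `R` and the constant matrix `Λ` -/
  verdict : Option (Matrix (Fin n × Fin m) (Fin m) R × Matrix (Fin m) (Fin m) R ×
    Matrix (Fin m) (Fin m) R)

/-- Applies a function to all the numbers of a record. -/
def Trace.map {m : ℕ} {R R' : Type} (f : R → R') (t : Trace m R) : Trace m R' where
  z₀ := f t.z₀
  r := fun i j => f (t.r i j)
  P := fun i j => ((t.P i j).1.map f, (t.P i j).2.map f)
  q := fun i => ((t.q i).1.map f, (t.q i).2.map f)
  d := t.d
  ν := t.ν
  μ := t.μ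
  n := t.n
  k := t.k
  M := Matrix.map t.M f
  N := Matrix.map t.N f
  X₁ := fun i => (t.X₁ i).map fun x y => f (x y)
  Y := fun i => Matrix.map (t.Y i) f
  X₂ := fun i => (t.X₂ i).map fun x y => f (x y)
  verdict := t.verdict.map fun e => (Matrix.map e.1 f, Matrix.map e.2.1 f, Matrix.map e.2.2 f)

/-- The polynomial with a given list of coefficients. -/
def listPoly (l : List Qbar) : Qbar[X] :=
  l.foldr (fun a f => Polynomial.C a + Polynomial.X * f) 0

/-- The pair of lists `x` represents the rational function `f`. -/
def Represents (x : List Qbar × List Qbar) (f : RatFunc Qbar) : Prop :=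
  listPoly x.2 ≠ 0 ∧
    f = algebraMap Qbar[X] (RatFunc Qbar) (listPoly x.1) /
      algebraMap Qbar[X] (RatFunc Qbar) (listPoly x.2)

/-- The value at `z` of the matrix `Q⁻¹ S`. -/
def evalAt {m : ℕ} (Q : Qbar[X]) (S : Matrix (Fin m) (Fin m) Qbar[X]) (z : Qbar) :
    Matrix (Fin m) (Fin m) Qbar :=
  (Q.eval z)⁻¹ • S.map (Polynomial.eval z)

/-- The rows `r_1 = r`, `r_{i+1} = φ_p(r_i) A`. -/
def cyclicRow {m : ℕ} (p : ℕ) (A : Matrix (Fin m) (Fin m) (RatFunc Qbar))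
    (r : Fin m → RatFunc Qbar) : ℕ → Fin m → RatFunc Qbar
  | 0 => r
  | i + 1 => Matrix.vecMul (fun j => phi p (cyclicRow p A r i j)) A

/-- The search for a cyclic vector: `z₀` is the maximum of `2` and of the norms of the numerator
`det S` of `det A` and of the denominator `Q`; the vector `r` of polynomials of degree less than `m`
takes the value `e_i A(z₀)⁻¹ A(z₀ ^ p)⁻¹ ⋯ A(z₀ ^ (p ^ (i - 2)))⁻¹` at `z₀ ^ (p ^ (i - 1))`; the rows
of `P` are `r, φ_p(r) A, …`; and `q = φ_p(r_m) A P⁻¹`. -/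
def IsCyclicStep {m : ℕ} (p : ℕ) (A : Matrix (Fin m) (Fin m) (RatFunc Qbar)) (Q : Qbar[X])
    (S : Matrix (Fin m) (Fin m) Qbar[X]) (t : Trace m Qbar)
    (q : Fin m → RatFunc Qbar) : Prop :=
  (t.z₀ : ℂ) = ((max 2 (max (polyNorm S.det : ℝ) (polyNorm Q : ℝ)) : ℝ) : ℂ) ∧
  (∀ i j : Fin m, ∑ l : Fin m, t.r j l * (t.z₀ ^ p ^ (i : ℕ)) ^ (l : ℕ) =
    (((List.range i).map fun k => (evalAt Q S (t.z₀ ^ p ^ k))⁻¹).prod) i j) ∧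
  ∃ P : Matrix (Fin m) (Fin m) (RatFunc Qbar),
    (∀ i j, P i j = cyclicRow p A (fun j' => algebraMap Qbar[X] (RatFunc Qbar)
      (∑ l : Fin m, Polynomial.C (t.r j' l) * Polynomial.X ^ (l : ℕ))) i j) ∧
    IsUnit P ∧
    (∀ i j, Represents (t.P i j) (P i j)) ∧
    (∀ i : Fin m, (i : ℕ) + 1 = m →
      q = Matrix.vecMul (Matrix.vecMul (fun j => phi p (P i j)) A) P⁻¹) ∧
    ∀ i, Represents (t.q i) (q i)

/-- The verdict recorded in `t` is the right one for the final subspace `X`: it is positive if and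
only if `dim X = m`, and then the columns of `E` are a basis of `X`, `M E = E R` and `Λ = R⁻¹`. -/
def IsVerdict {m : ℕ} (t : Trace m Qbar) (X : Submodule Qbar (Fin t.n × Fin m → Qbar)) : Prop :=
  match t.verdict with
  | none => Module.finrank Qbar X ≠ m
  | some (E, R, L) =>
      Module.finrank Qbar X = m ∧
      LinearIndependent Qbar (fun j : Fin m => fun x => E x j) ∧
      Submodule.span Qbar (Set.range fun j : Fin m => fun x => E x j) = X ∧
      t.M * E = E * R ∧ R * L = 1

/-- The record `t` is the record of a run of the algorithm, from its beginning to its verdict, on the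
`p`-Mahler system of matrix `A = Q⁻¹ S`. -/
def IsRun {m : ℕ} (p : ℕ) (A : GL (Fin m) (RatFunc Qbar)) (Q : Qbar[X])
    (S : Matrix (Fin m) (Fin m) Qbar[X]) (t : Trace m Qbar) : Prop :=
  (∃ q : Fin m → RatFunc Qbar,
    IsCyclicStep p (A : Matrix (Fin m) (Fin m) (RatFunc Qbar)) Q S t q ∧
    IsRamificationIndex p q t.d) ∧
  t.ν = nu p A t.d ∧ t.μ = mu p A t.d ∧
  t.n = colCount p A t.d ∧ t.k = rowCount p A t.d ∧
  t.M = Mmat p A t.d t.n ∧ t.N = Nmat p A t.d t.k t.n ∧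
  (∀ i ≤ m * t.n + 1, IsBasisOf (t.X₁ i) (loopOne t.M t.N i)) ∧
  (∀ i ≤ m * t.n + 1, t.Y i = loopY t.M t.N i) ∧
  (∀ i ≤ m * t.n + 1,
    IsBasisOf (t.X₂ i) (loopTwo t.M t.N (loopOne t.M t.N (m * t.n + 1)) i)) ∧
  IsVerdict t (loopTwo t.M t.N (loopOne t.M t.N (m * t.n + 1)) (m * t.n + 1))

/-- The record obtained by running a computation tree, with its register numbers replaced by the
contents of the registers. -/
def output {m : ℕ} (T : CompTree (Trace m ℕ)) (env : List Qbar) : Trace m Qbar :=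
  (T.run env).1.map (reg (T.run env).2)

/-- The integer `v = -(v_0(A) + v_0(A⁻¹))`. -/
def gap {m : ℕ} (A : GL (Fin m) (RatFunc Qbar)) : ℤ := -(vA A + vAinv A)

/-- The bound, as a function of the degree `δ`. -/
def bound (M MM : ℕ → ℝ) {m : ℕ} (p : ℕ) (A : GL (Fin m) (RatFunc Qbar)) (δ : ℕ) : ℝ :=
  MM m * M (p ^ m * (δ + m)) +
    (p : ℝ) ^ (2 * m - 1) * m * (gap A).toNat * MM (m * (gap A).toNat)

end Mahler

end

noncomputable section

namespace Mahler

/-! ## Programs -/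

/-! The algorithm is written as a program in a small monad. Its Hoare triples `Sat` carry an
operation count next to a postcondition, so correctness and cost are proved together. Constants may
be large; only the dependence on `p`, `m`, `deg A` and `v` matters.

The structural claims are short. One has `v ≥ 0` because a diagonal entry of `A A⁻¹ = 1` has a
nonzero constant coefficient (`gap_nonneg`). The matrices are gridded because `φ_d(A⁻¹)` is a series
in `z ^ d`: a nonzero block in column `j` lies in a row of class `p j + const` modulo `d`, and
multiplication by `p` permutes the classes (`Mmat_class`, `Nmat_class`).

First summand. Put `N = p ^ m (deg A + m)`; the polynomials of steps 1 and 2 have degree `O(N)`, and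
`U = M(N) / N` is the price of one coefficient. The choice of `z₀` makes `P(z₀)` the identity, so
all leading minors of the numerators of `P` are nonzero (`leadM_augM_ne_zero`), and fraction-free
elimination (`sylvester`) yields `q` without pivoting. Row `i` of that elimination has degree `O(p ^
i (deg A + m))`. This growth is geometric, so each of the `m` steps costs `O(m M(N))` and the whole
costs `O(m² M(N))`, which is `O(MM(m) M(N))`. The adjugate matrix and the determinant of `S` come
from the Faddeev–LeVerrier recursion, whose extra powers of `m` are absorbed by `p ^ m`.

Second summand. The denominators of the slopes divide numbers `p ^ (b - a) - 1` for disjoint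
intervals `[a, b)` in `[0, m)`, hence `d ≤ p ^ m` (`ramIdx_props`), and for `v ≥ 1` there are `n =
O(p ^ (m - 1) v)` block columns (`colCount_le_pow`). By the grading, `M_d` and `N_d` split into `d`
pieces of size `O(m v)`, so a pass should cost `O(d MM(m v))`, and there are `O(m n)` passes. To
reach this price, the image `M ^ i 𝔛` is described by equations through an orthogonal projection
obtained from fast multiplications without any pivoting (`ginv_spec`, with conjugation computed as
`|x|² / x`). The intersection is then found by an elimination whose cost is proportional to the drop
in dimension (`sat_elim`). Over all passes the drops telescope (`sat_loopsP`). If `v = 0`, then `n =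
1` and this part is charged to the first summand.

The verdict requires `R` to be invertible, which rests on a fact about the first loop alone: after
its `c + 1` passes, `M` maps `𝔛` onto itself (`map_loopE_eq`). Hence the second loop changes nothing
(`loopTwo_eq`) and `M` acts bijectively on `𝔛` (`verdict_algebra`).

For the last claim, `deg A ≤ m² deg_e A` (`matDegree_le`), and iterating the doubling hypothesis
removes the factor `m²` at the price of a constant depending on `m`. -/

def CompTree.bind {α β : Type} : CompTree α → (α → CompTree β) → CompTree β
  | .leaf a, f => f a
  | .step i t, f => .step i (t.bind f)
  | .ifZero i t u, f => .ifZero i (t.bind f) (u.bind f)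
  | .ifNormLe i j t u, f => .ifNormLe i j (t.bind f) (u.bind f)

theorem CompTree.run_bind {α β : Type} (t : CompTree α) (f : α → CompTree β) (env : List Qbar) :
    (t.bind f).run env = (f (t.run env).1).run (t.run env).2 := by
  induction t generalizing env with
  | leaf a => rfl
  | step i t ih => exact ih _
  | ifZero i t u iht ihu => simp only [bind, run]; split_ifs <;> simp [iht, ihu]
  | ifNormLe i j t u iht ihu => simp only [bind, run]; split_ifs <;> simp [iht, ihu]

theorem CompTree.cost_bind {α β : Type} (t : CompTree α) (f : α → CompTree β) (env : List Qbar) :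
    (t.bind f).cost env = t.cost env + (f (t.run env).1).cost (t.run env).2 := by
  induction t generalizing env with
  | leaf a => simp [bind, cost, run]
  | step i t ih => simp only [bind, cost, run, ih]; omega
  | ifZero i t u iht ihu => simp only [bind, run, cost]; split_ifs <;> simp [iht, ihu] <;> omega
  | ifNormLe i j t u iht ihu =>
    simp only [bind, run, cost]; split_ifs <;> simp [iht, ihu] <;> omega

/-- A computation tree parametrized by the number of registers in use; the label of a leaf contains
the new number of registers. -/
def Prog (α : Type) : Type := ℕ → CompTree (α × ℕ)

instance : Monad Prog where
  pure a := fun n => .leaf (a, n)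
  bind x f := fun n => (x n).bind fun r => f r.1 r.2

/-- Register numbers. -/
abbrev Reg : Type := ℕ

def emit (i : Instr) : Prog Reg := fun n => .step i (.leaf (n, n + 1))

def ifz {α : Type} (r : Reg) (x y : Prog α) : Prog α := fun n => .ifZero r (x n) (y n)

def ifle {α : Type} (r s : Reg) (x y : Prog α) : Prog α := fun n => .ifNormLe r s (x n) (y n)

/-- Run on the memory `env`, the program only appends registers, uses at most `c` operations, and
its result and the final memory satisfy `P`. -/
def Sat {α : Type} (x : Prog α) (env : List Qbar) (c : ℝ) (P : List Qbar → α → Prop) : Prop :=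
  env <+: ((x env.length).run env).2 ∧
    ((x env.length).run env).1.2 = ((x env.length).run env).2.length ∧
    ((x env.length).cost env : ℝ) ≤ c ∧
    P ((x env.length).run env).2 ((x env.length).run env).1.1

theorem Sat.mono {α : Type} {x : Prog α} {env : List Qbar} {c c' : ℝ} {P P' : List Qbar → α → Prop}
    (h : Sat x env c P) (hc : c ≤ c') (hP : ∀ env' a, env <+: env' → P env' a → P' env' a) :
    Sat x env c' P' :=
  ⟨h.1, h.2.1, h.2.2.1.trans hc, hP _ _ h.1 h.2.2.2⟩

theorem Sat.pure {α : Type} {a : α} {env : List Qbar} {c : ℝ} {P : List Qbar → α → Prop}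
    (hc : 0 ≤ c) (h : P env a) : Sat (pure a) env c P :=
  ⟨List.prefix_refl _, rfl, by simpa [Pure.pure, CompTree.cost] using hc, h⟩

/-- The counter returned by `x` is the length of its final memory, which is exactly where `f` has to
start. Leaving the budget `c - c₁` to the continuation postpones all arithmetic on costs to the last
instruction of a program. -/
theorem Sat.bind {α β : Type} {x : Prog α} {f : α → Prog β} {env : List Qbar} {c c₁ : ℝ}
    {P : List Qbar → α → Prop} {Q : List Qbar → β → Prop} (hx : Sat x env c₁ P)
    (hf : ∀ env' a, env <+: env' → P env' a → Sat (f a) env' (c - c₁) Q) :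
    Sat (x >>= f) env c Q := by
  obtain ⟨h1, h2, h3, h4⟩ := hx
  obtain ⟨g1, g2, g3, g4⟩ := hf _ _ h1 h4
  have hrun : ((x >>= f) env.length).run env =
      (f ((x env.length).run env).1.1 ((x env.length).run env).2.length).run
        ((x env.length).run env).2 := by
    rw [← h2]; exact CompTree.run_bind _ _ _
  have hcost : ((x >>= f) env.length).cost env = (x env.length).cost env +
      (f ((x env.length).run env).1.1 ((x env.length).run env).2.length).cost
        ((x env.length).run env).2 := by
    rw [← h2]; exact CompTree.cost_bind _ _ _
  refine ⟨?_, ?_, ?_, ?_⟩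
  · rw [hrun]; exact h1.trans g1
  · rw [hrun]; exact g2
  · rw [hcost]; push_cast; linarith
  · rw [hrun]; exact g4

/-- The objects of type `α`, which contain register numbers, represent objects of type `β`. -/
class Rep (α : Type) (β : outParam Type) where
  rep : List Qbar → α → β → Prop
  mono : ∀ {env env' : List Qbar} {a : α} {b : β}, env <+: env' → rep env a b → rep env' a b

open Mahler.Rep (rep)

/-- The register is required to exist: a number beyond the end of the memory reads as zero through
`reg`, but may be filled later, which would break monotonicity. -/
instance : Rep Reg Qbar where
  rep env r x := env[(r : ℕ)]? = some x
  mono h hr := by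
    obtain ⟨t, rfl⟩ := h
    rw [List.getElem?_append_left]
    · exact hr
    · by_contra hlt
      rw [List.getElem?_eq_none (not_lt.1 hlt)] at hr
      cases hr

instance {ι α β : Type} [Rep α β] : Rep (ι → α) (ι → β) where
  rep env f g := ∀ i, rep env (f i) (g i)
  mono h hf i := Rep.mono h (hf i)

instance {α β α' β' : Type} [Rep α β] [Rep α' β'] : Rep (α × α') (β × β') where
  rep env x y := rep env x.1 y.1 ∧ rep env x.2 y.2
  mono h hx := ⟨Rep.mono h hx.1, Rep.mono h hx.2⟩

instance {α β : Type} [Rep α β] : Rep (List α) (List β) where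
  rep env l l' := List.Forall₂ (rep env) l l'
  mono h hl := hl.imp fun _ _ => Rep.mono h

/-- The program computes (a representation of) `v` with at most `c` operations. -/
def Comp {α β : Type} [Rep α β] (x : Prog α) (env : List Qbar) (c : ℝ) (v : β) : Prop :=
  Sat x env c fun env' a => rep env' a v

theorem Comp.bind {α β γ : Type} [Rep α γ] {x : Prog α} {f : α → Prog β} {env : List Qbar}
    {c c₁ : ℝ} {v : γ} {Q : List Qbar → β → Prop} (hx : Comp x env c₁ v)
    (hf : ∀ env' a, env <+: env' → rep env' a v → Sat (f a) env' (c - c₁) Q) :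
    Sat (x >>= f) env c Q :=
  Sat.bind hx hf

theorem Comp.mono {α β : Type} [Rep α β] {x : Prog α} {env : List Qbar} {c c' : ℝ} {v v' : β}
    (h : Comp x env c v) (hc : c ≤ c') (hv : v = v') : Comp x env c' v' := by
  subst hv; exact Sat.mono h hc fun _ _ _ h => h

theorem reg_eq {env : List Qbar} {r : Reg} {x : Qbar} (h : rep env r x) :
    reg env r = x := by
  have h' : env[(r : ℕ)]? = some x := h
  unfold reg
  rw [List.getD_eq_getElem?_getD, h']; rfl

theorem sat_emit (i : Instr) (env : List Qbar) {v : Qbar} (hv : i.eval env = v) :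
    Comp (emit i) env 1 v := by
  subst hv
  refine ⟨List.prefix_append _ _, ?_, ?_, ?_⟩
  · simp [emit, CompTree.run]
  · simp [emit, CompTree.cost]
  · change (env ++ [i.eval env])[env.length]? = _
    simp

def pconst (c : Qbar) : Prog Reg := emit (.const c)
def padd (a b : Reg) : Prog Reg := emit (.add a b)
def psub (a b : Reg) : Prog Reg := emit (.sub a b)
def pmul (a b : Reg) : Prog Reg := emit (.mul a b)
def pdiv (a b : Reg) : Prog Reg := emit (.div a b)
def pabs (a : Reg) : Prog Reg := emit (.abs a)

section ops
variable {env : List Qbar} {a b : Reg} {x y : Qbar}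

theorem comp_const (c : Qbar) : Comp (pconst c) env 1 c := sat_emit _ _ rfl
theorem comp_add (ha : rep env a x) (hb : rep env b y) : Comp (padd a b) env 1 (x + y) :=
  sat_emit _ _ (by simp only [Instr.eval]; rw [reg_eq ha, reg_eq hb])
theorem comp_sub (ha : rep env a x) (hb : rep env b y) : Comp (psub a b) env 1 (x - y) :=
  sat_emit _ _ (by simp only [Instr.eval]; rw [reg_eq ha, reg_eq hb])
theorem comp_mul (ha : rep env a x) (hb : rep env b y) : Comp (pmul a b) env 1 (x * y) :=
  sat_emit _ _ (by simp only [Instr.eval]; rw [reg_eq ha, reg_eq hb])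
theorem comp_div (ha : rep env a x) (hb : rep env b y) : Comp (pdiv a b) env 1 (x / y) :=
  sat_emit _ _ (by simp only [Instr.eval]; rw [reg_eq ha, reg_eq hb])
theorem comp_abs (ha : rep env a x) : Comp (pabs a) env 1 (absQ x) :=
  sat_emit _ _ (by simp only [Instr.eval]; rw [reg_eq ha])

theorem sat_ifz {α : Type} {p q : Prog α} {c : ℝ} {P : List Qbar → α → Prop} (ha : rep env a x)
    (hp : x = 0 → Sat p env (c - 1) P) (hq : x ≠ 0 → Sat q env (c - 1) P) :
    Sat (ifz a p q) env c P := by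
  have h := reg_eq ha
  by_cases hx : x = 0
  · obtain ⟨h1, h2, h3, h4⟩ := hp hx
    simp only [Sat, ifz, CompTree.run, CompTree.cost, h, hx, if_true]
    exact ⟨h1, h2, by push_cast; linarith, h4⟩
  · obtain ⟨h1, h2, h3, h4⟩ := hq hx
    simp only [Sat, ifz, CompTree.run, CompTree.cost, h, hx, if_false]
    exact ⟨h1, h2, by push_cast; linarith, h4⟩

theorem sat_ifle {α : Type} {p q : Prog α} {c : ℝ} {P : List Qbar → α → Prop} (ha : rep env a x)
    (hb : rep env b y)
    (hp : ‖(x : ℂ)‖ ≤ ‖(y : ℂ)‖ → Sat p env (c - 1) P)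
    (hq : ‖(y : ℂ)‖ < ‖(x : ℂ)‖ → Sat q env (c - 1) P) :
    Sat (ifle a b p q) env c P := by
  have h := reg_eq ha
  have h' := reg_eq hb
  by_cases hx : ‖(x : ℂ)‖ ≤ ‖(y : ℂ)‖
  · obtain ⟨h1, h2, h3, h4⟩ := hp hx
    simp only [Sat, ifle, CompTree.run, CompTree.cost, h, h', hx, if_true]
    exact ⟨h1, h2, by push_cast; linarith, h4⟩
  · obtain ⟨h1, h2, h3, h4⟩ := hq (not_le.1 hx)
    simp only [Sat, ifle, CompTree.run, CompTree.cost, h, h', hx, if_false]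
    exact ⟨h1, h2, by push_cast; linarith, h4⟩

end ops

/-- Rearranging register numbers is free. Truncations, shifts, submatrices and Frobenius expansions
all cost nothing for this reason. -/
theorem Comp.toSat {α β γ : Type} [Rep α γ] {x : Prog α} {g : α → β} {env : List Qbar}
    {c : ℝ} {v : γ} {Q : List Qbar → β → Prop} (hx : Comp x env c v)
    (hf : ∀ env' a, env <+: env' → rep env' a v → Q env' (g a)) :
    Sat (do let a ← x; pure (g a)) env c Q :=
  Comp.bind hx fun env' a h ha => Sat.pure (by simp) (hf env' a h ha)

/-! ## Families -/

def forFin {α : Type} : (n : ℕ) → (Fin n → Prog α) → Prog (Fin n → α)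
  | 0, _ => pure Fin.elim0
  | n + 1, f => do
    let g ← forFin n fun i => f i.castSucc
    let a ← f (Fin.last n)
    pure (Fin.snoc (α := fun _ => α) g a)

/-- The postconditions must survive an extension of the memory, since earlier members of the family
are followed by the computation of later ones. -/
theorem sat_forFin {α : Type} {n : ℕ} {f : Fin n → Prog α} {env : List Qbar} {c : Fin n → ℝ}
    {P : Fin n → List Qbar → α → Prop} (hP : ∀ i e e' a, e <+: e' → P i e a → P i e' a)
    (h : ∀ i env', env <+: env' → Sat (f i) env' (c i) (P i)) :
    Sat (forFin n f) env (∑ i, c i) fun e g => ∀ i, P i e (g i) := by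
  induction n with
  | zero => exact Sat.pure (by simp) fun i => i.elim0
  | succ n ih =>
    refine Sat.bind (ih (P := fun i => P i.castSucc) (fun i => hP i.castSucc)
      fun i env' he => h i.castSucc env' he) fun env₁ g h₁ hg => ?_
    refine Sat.bind (h (Fin.last n) env₁ h₁) fun env₂ a h₂ ha => ?_
    refine Sat.pure (by rw [Fin.sum_univ_castSucc]; simp) fun i => ?_
    refine Fin.lastCases ?_ (fun i => ?_) i
    · rw [Fin.snoc_last]; exact ha
    · rw [Fin.snoc_castSucc]; exact hP _ _ _ _ h₂ (hg i)

theorem comp_forFin {α β : Type} [Rep α β] {n : ℕ} {f : Fin n → Prog α} {env : List Qbar}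
    {c : Fin n → ℝ} {v : Fin n → β}
    (h : ∀ i env', env <+: env' → Comp (f i) env' (c i) (v i)) :
    Comp (forFin n f) env (∑ i, c i) v :=
  sat_forFin (P := fun i e a => rep e a (v i)) (fun _ _ _ _ => Rep.mono) h

def forAll {ι α : Type} [Fintype ι] (f : ι → Prog α) : Prog (ι → α) := do
  let g ← forFin (Fintype.card ι) fun i => f ((Fintype.equivFin ι).symm i)
  pure fun i => g (Fintype.equivFin ι i)

theorem sat_forAll {ι α : Type} [Fintype ι] {f : ι → Prog α} {env : List Qbar} {c : ι → ℝ}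
    {P : ι → List Qbar → α → Prop} (hP : ∀ i e e' a, e <+: e' → P i e a → P i e' a)
    (h : ∀ i env', env <+: env' → Sat (f i) env' (c i) (P i)) :
    Sat (forAll f) env (∑ i, c i) fun e g => ∀ i, P i e (g i) := by
  rw [← Equiv.sum_comp (Fintype.equivFin ι).symm c]
  refine Sat.bind (sat_forFin (P := fun i => P ((Fintype.equivFin ι).symm i))
    (fun i => hP _) fun i env' he => h _ env' he) fun env' g _ hg => ?_
  refine Sat.pure (by simp) fun i => ?_
  simpa using hg (Fintype.equivFin ι i)

theorem comp_forAll {ι α β : Type} [Fintype ι] [Rep α β] {f : ι → Prog α} {env : List Qbar}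
    {c : ι → ℝ} {v : ι → β}
    (h : ∀ i env', env <+: env' → Comp (f i) env' (c i) (v i)) :
    Comp (forAll f) env (∑ i, c i) v :=
  sat_forAll (P := fun i e a => rep e a (v i)) (fun _ _ _ _ => Rep.mono) h

/-- A family with constant cost. -/
theorem comp_forAll' {ι α β : Type} [Fintype ι] [Rep α β] {f : ι → Prog α} {env : List Qbar}
    {c : ℝ} {v : ι → β}
    (h : ∀ i env', env <+: env' → Comp (f i) env' c (v i)) :
    Comp (forAll f) env (Fintype.card ι * c) v := by
  simpa [Finset.sum_const, nsmul_eq_mul] using comp_forAll (c := fun _ => c) h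

def sumFin (z : Reg) : (n : ℕ) → (Fin n → Reg) → Prog Reg
  | 0, _ => pure z
  | n + 1, r => do
    let s ← sumFin z n fun i => r i.castSucc
    padd s (r (Fin.last n))

theorem comp_sumFin {z : Reg} {n : ℕ} {r : Fin n → Reg} {env : List Qbar} {x : Fin n → Qbar}
    (hz : rep env z 0) (h : rep env r x) : Comp (sumFin z n r) env n (∑ i, x i) := by
  induction n with
  | zero => exact Sat.pure (by simp) (by simpa using hz)
  | succ n ih =>
    refine Comp.bind (ih (x := fun i => x i.castSucc) fun i => h i.castSucc) fun env₁ g h₁ hg => ?_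
    exact (comp_add hg (Rep.mono h₁ (h (Fin.last n)))).mono (by push_cast; linarith)
      (Fin.sum_univ_castSucc x).symm

def sumAll {ι : Type} [Fintype ι] (z : Reg) (r : ι → Reg) : Prog Reg :=
  sumFin z (Fintype.card ι) fun i => r ((Fintype.equivFin ι).symm i)

theorem comp_sumAll {ι : Type} [Fintype ι] {z : Reg} {r : ι → Reg} {env : List Qbar} {x : ι → Qbar}
    (hz : rep env z 0) (h : rep env r x) :
    Comp (sumAll z r) env (Fintype.card ι) (∑ i, x i) :=
  (comp_sumFin (x := fun i => x ((Fintype.equivFin ι).symm i)) hz fun i => h _).mono le_rfl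
    (Equiv.sum_comp _ x)

/-- The first `n` values are computed, the other ones are the zero register. -/
def tab (z : Reg) (n : ℕ) (f : ℕ → Prog Reg) : Prog (ℕ → Reg) := do
  let g ← forFin n fun i => f i
  pure fun k => if h : k < n then g ⟨k, h⟩ else z

theorem comp_tab {z : Reg} {n : ℕ} {f : ℕ → Prog Reg} {env : List Qbar} {c : ℝ} {v : ℕ → Qbar}
    (hz : rep env z 0) (h : ∀ k env', k < n → env <+: env' → Comp (f k) env' c (v k))
    (hv : ∀ k, n ≤ k → v k = 0) : Comp (tab z n f) env (n * c) v := by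
  have h1 : Comp (forFin n fun i => f i) env (n * c) (fun i : Fin n => v i) := by
    simpa [Finset.sum_const, nsmul_eq_mul] using
      comp_forFin (c := fun _ => c) (v := fun i : Fin n => v i) fun i env' he => h i env' i.2 he
  refine Comp.toSat h1 fun env' g he hg k => ?_
  by_cases hk : k < n
  · simpa [hk] using hg ⟨k, hk⟩
  · simpa [hk, hv k (not_lt.1 hk)] using Rep.mono he hz

/-! ## Straight-line programs -/

def Instr.rename (f : ℕ → Reg) : Instr → Instr
  | .const c => .const c
  | .add i j => .add (f i) (f j)
  | .sub i j => .sub (f i) (f j)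
  | .mul i j => .mul (f i) (f j)
  | .div i j => .div (f i) (f j)
  | .abs i => .abs (f i)

/-- The list plays the memory of the simulated program: position `k` holds the actual register
number. Positions out of range fall back to the zero register, in agreement with the default value
of `reg`. -/
def slp (z : Reg) : List Instr → List Reg → Prog (List Reg)
  | [], l => pure l
  | i :: s, l => do
    let r ← emit (i.rename fun k => l.getD k z)
    slp z s (l ++ [r])

theorem rep_getD {env : List Qbar} {z : Reg} {l : List Reg} {v : List Qbar} (hz : rep env z 0)
    (h : rep env l v) (k : ℕ) : rep env (l.getD k z) (v.getD k 0) := by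
  change List.Forall₂ _ _ _ at h
  induction h generalizing k with
  | nil => simpa using hz
  | cons h1 _ ih =>
    cases k with
    | zero => simpa using h1
    | succ k => simpa using ih k

theorem comp_slp {z : Reg} (s : List Instr) {l : List Reg} {env v : List Qbar}
    (hz : rep env z 0) (h : rep env l v) : Comp (slp z s l) env s.length (runSLP s v) := by
  induction s generalizing l env v with
  | nil => exact Sat.pure (by simp) h
  | cons i s ih =>
    have hk := fun k => reg_eq (rep_getD hz h k)
    have hi : (i.rename fun k => l.getD k z).eval env = i.eval v := by
      cases i <;> simp only [Instr.rename, Instr.eval, hk] <;> rfl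
    refine Comp.bind (sat_emit _ env hi) fun env₁ r h₁ hr => ?_
    have hl : rep env₁ (l ++ [r]) (v ++ [i.eval v]) :=
      List.rel_append (Rep.mono h₁ h) (List.Forall₂.cons hr List.Forall₂.nil)
    exact (ih (Rep.mono h₁ hz) hl).mono (by simp) rfl

theorem rep_ofFn {n : ℕ} {α β : Type} [Rep α β] {r : Fin n → α} {x : Fin n → β} {env : List Qbar}
    (h : rep env r x) : rep env (List.ofFn r) (List.ofFn x) := by
  induction n with
  | zero => simp only [List.ofFn_zero]; exact List.Forall₂.nil
  | succ n ih =>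
    rw [List.ofFn_succ, List.ofFn_succ]
    exact List.Forall₂.cons (h 0) (ih fun i => h i.succ)

/-! ## Polynomial arithmetic -/

open Polynomial

/-- The family `s` of straight-line programs multiplies polynomials; up to degree `N`, the cost is
at most `U` per coefficient. -/
structure PolyMul (s : ℕ → List Instr) (N : ℕ) (U : ℝ) : Prop where
  isMul : ∀ n, IsPolyMul n (s n)
  cost : ∀ n, 1 ≤ n → n ≤ N → ((s n).length : ℝ) ≤ n * U
  one_le : 1 ≤ U
  pos : 1 ≤ N

open Classical in
/-- The register of the coefficient of degree `k` of the product. -/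
def polyOut (n : ℕ) (s : List Instr) (k : ℕ) : ℕ :=
  if h : IsPolyMul n s then if hk : k < 2 * n + 1 then h.2.choose ⟨k, hk⟩ else 0 else 0

def mulSmall (s : ℕ → List Instr) (z : Reg) (n : ℕ) (a b : ℕ → Reg) : Prog (ℕ → Reg) := do
  let l ← slp z (s n) (List.ofFn (fun i : Fin (n + 1) => a i) ++ List.ofFn fun i : Fin (n + 1) => b i)
  pure fun k => if k < 2 * n + 1 then l.getD (polyOut n (s n) k) z else z

theorem coeff_mul_eq_double_sum {f g : Qbar[X]} {n : ℕ} (hf : f.natDegree ≤ n)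
    (hg : g.natDegree ≤ n) (k : ℕ) :
    (f * g).coeff k = ∑ i : Fin (n + 1), ∑ j : Fin (n + 1),
      if (i : ℕ) + j = k then f.coeff i * g.coeff j else 0 := by
  have hs : ∀ h : Qbar[X], h.natDegree ≤ n →
      h = ∑ i : Fin (n + 1), C (h.coeff i) * X ^ (i : ℕ) := fun h hh => by
    conv_lhs => rw [h.as_sum_range_C_mul_X_pow' (Nat.lt_succ_of_le hh)]
    rw [Finset.sum_range]
  conv_lhs => rw [hs f hf, hs g hg, Finset.sum_mul_sum]
  simp only [finsetSum_coeff]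
  refine Finset.sum_congr rfl fun i _ => Finset.sum_congr rfl fun j _ => ?_
  rw [show C (f.coeff i) * X ^ (i : ℕ) * (C (g.coeff j) * X ^ (j : ℕ)) =
    C (f.coeff i * g.coeff j) * X ^ ((i : ℕ) + j) by rw [C_mul, pow_add]; ring, coeff_C_mul_X_pow]
  simp only [eq_comm]

theorem comp_mulSmall {s : ℕ → List Instr} {z : Reg} {n : ℕ} {a b : ℕ → Reg} {f g : Qbar[X]}
    {env : List Qbar} (hs : IsPolyMul n (s n)) (hz : rep env z 0) (ha : rep env a f.coeff)
    (hb : rep env b g.coeff) (hf : f.natDegree ≤ n) (hg : g.natDegree ≤ n) :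
    Comp (mulSmall s z n a b) env (s n).length (f * g).coeff := by
  refine Comp.toSat (comp_slp (s n) hz (List.rel_append
    (rep_ofFn (x := fun i : Fin (n + 1) => f.coeff i) fun i => ha i)
    (rep_ofFn (x := fun i : Fin (n + 1) => g.coeff i) fun i => hb i))) fun env' l he hl k => ?_
  by_cases hk : k < 2 * n + 1
  · have h1 := hs.2.choose_spec (fun i => f.coeff i) (fun i => g.coeff i) ⟨k, hk⟩
    have h2 := rep_getD (Rep.mono he hz) hl (polyOut n (s n) k)
    rw [coeff_mul_eq_double_sum hf hg, if_pos hk]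
    simp only [polyOut, dif_pos hs, dif_pos hk] at h2 ⊢
    simp only at h1
    rw [← h1]; exact h2
  · rw [if_neg hk, coeff_eq_zero_of_natDegree_lt]
    · exact Rep.mono he hz
    · exact lt_of_le_of_lt natDegree_mul_le (by omega)

/-- The polynomial without its terms of degree less than `n`, divided by `X ^ n`. -/
def hi (n : ℕ) (f : Qbar[X]) : Qbar[X] := divX^[n] f

theorem coeff_hi (n : ℕ) (f : Qbar[X]) (k : ℕ) : (hi n f).coeff k = f.coeff (k + n) := by
  induction n generalizing f k with
  | zero => rfl
  | succ n ih =>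
    have : hi (n + 1) f = hi n f.divX := rfl
    rw [this, ih, coeff_divX]; rfl

/-- The terms of degree less than `n`. -/
def lo (n : ℕ) (f : Qbar[X]) : Qbar[X] := f - X ^ n * hi n f

theorem coeff_lo (n : ℕ) (f : Qbar[X]) (k : ℕ) :
    (lo n f).coeff k = if k < n then f.coeff k else 0 := by
  rw [lo, coeff_sub, coeff_X_pow_mul', coeff_hi]
  split_ifs with h1 h2 h2
  · omega
  · simp [Nat.sub_add_cancel h1]
  · simp
  · omega

theorem lo_add_hi (n : ℕ) (f : Qbar[X]) : lo n f + X ^ n * hi n f = f := by simp [lo]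

theorem natDegree_lo_lt {n : ℕ} (hn : 0 < n) (f : Qbar[X]) : (lo n f).natDegree < n := by
  have : (lo n f).natDegree ≤ n - 1 := natDegree_le_iff_coeff_eq_zero.2 fun k hk => by
    rw [coeff_lo, if_neg (by omega)]
  omega

theorem natDegree_hi_lt {n d : ℕ} {f : Qbar[X]} (hf : f.natDegree < d + n) (hd : 0 < d) :
    (hi n f).natDegree < d := by
  have : (hi n f).natDegree ≤ d - 1 := natDegree_le_iff_coeff_eq_zero.2 fun k hk => by
    rw [coeff_hi, coeff_eq_zero_of_natDegree_lt (by omega)]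
  omega

def truncR (z : Reg) (n : ℕ) (a : ℕ → Reg) : ℕ → Reg := fun k => if k < n then a k else z

def shiftR (n : ℕ) (a : ℕ → Reg) : ℕ → Reg := fun k => a (k + n)

theorem rep_truncR {z : Reg} {n : ℕ} {a : ℕ → Reg} {f : Qbar[X]} {env : List Qbar}
    (hz : rep env z 0) (ha : rep env a f.coeff) : rep env (truncR z n a) (lo n f).coeff := fun k => by
  rw [coeff_lo, truncR]; split_ifs
  · exact ha k
  · exact hz

theorem rep_shiftR {n : ℕ} {a : ℕ → Reg} {f : Qbar[X]} {env : List Qbar}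
    (ha : rep env a f.coeff) : rep env (shiftR n a) (hi n f).coeff := fun k => by
  rw [coeff_hi]; exact ha (k + n)

def unshiftR (z : Reg) (n : ℕ) (a : ℕ → Reg) : ℕ → Reg := fun k => if n ≤ k then a (k - n) else z

theorem rep_unshiftR {z : Reg} {n : ℕ} {a : ℕ → Reg} {f : Qbar[X]} {env : List Qbar}
    (hz : rep env z 0) (ha : rep env a f.coeff) :
    rep env (unshiftR z n a) (X ^ n * f).coeff := fun k => by
  rw [coeff_X_pow_mul', unshiftR]; split_ifs
  · exact ha _
  · exact hz

/-- Multiplication of polynomials of degree less than `2 ^ j (N + 1)`. -/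
def mulL (s : ℕ → List Instr) (z : Reg) (N : ℕ) : ℕ → (ℕ → Reg) → (ℕ → Reg) → Prog (ℕ → Reg)
  | 0, a, b => mulSmall s z N a b
  | j + 1, a, b => do
    let h := 2 ^ j * (N + 1)
    let p ← mulL s z N j (truncR z h a) (truncR z h b)
    let q ← mulL s z N j (truncR z h a) (shiftR h b)
    let r ← mulL s z N j (shiftR h a) (truncR z h b)
    let t ← mulL s z N j (shiftR h a) (shiftR h b)
    tab z (4 * h) fun k => do
      let u ← padd (p k) (unshiftR z h q k)
      let v ← padd u (unshiftR z h r k)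
      padd v (unshiftR z (2 * h) t k)

/-- No bound on `M(2N)` in terms of `M(N)` is available, so products of degree a bounded multiple of
`N` are cut into products of degree at most `N`. With `h = 2 ^ j (N + 1)`, four recursive calls and
`12 h` additions give the cost recursion, and `h ≤ 2 ^ (j + 1) N U` leads to the solution `13 * 4 ^
j - 12 * 2 ^ j`. -/
theorem comp_mulL {s : ℕ → List Instr} {z : Reg} {N : ℕ} {U : ℝ} (hs : PolyMul s N U) (j : ℕ)
    {a b : ℕ → Reg} {f g : Qbar[X]} {env : List Qbar} (hz : rep env z 0) (ha : rep env a f.coeff)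
    (hb : rep env b g.coeff) (hf : f.natDegree < 2 ^ j * (N + 1))
    (hg : g.natDegree < 2 ^ j * (N + 1)) :
    Comp (mulL s z N j a b) env ((13 * 4 ^ j - 12 * 2 ^ j) * (N * U)) (f * g).coeff := by
  have hN : (1 : ℝ) ≤ N := by exact_mod_cast hs.pos
  induction j generalizing a b f g env with
  | zero =>
    refine (comp_mulSmall (hs.isMul N) hz ha hb (by omega) (by omega)).mono ?_ rfl
    have := hs.cost N hs.pos le_rfl
    norm_num; linarith
  | succ j ih =>
    have hh : 0 < 2 ^ j * (N + 1) := by positivity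
    have hpow : 2 ^ (j + 1) * (N + 1) = 2 ^ j * (N + 1) + 2 ^ j * (N + 1) := by ring
    simp only [mulL]
    set h := 2 ^ j * (N + 1) with hdef
    refine Comp.bind (ih hz (rep_truncR (n := h) hz ha) (rep_truncR (n := h) hz hb)
      (natDegree_lo_lt hh f) (natDegree_lo_lt hh g)) fun e1 p h1 hp => ?_
    replace hz := Rep.mono h1 hz; replace ha := Rep.mono h1 ha; replace hb := Rep.mono h1 hb
    refine Comp.bind (ih hz (rep_truncR (n := h) hz ha) (rep_shiftR (n := h) hb)
      (natDegree_lo_lt hh f) (natDegree_hi_lt (by omega) hh)) fun e2 q h2 hq => ?_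
    replace hz := Rep.mono h2 hz; replace ha := Rep.mono h2 ha; replace hb := Rep.mono h2 hb
    replace hp := Rep.mono h2 hp
    refine Comp.bind (ih hz (rep_shiftR (n := h) ha) (rep_truncR (n := h) hz hb)
      (natDegree_hi_lt (by omega) hh) (natDegree_lo_lt hh g)) fun e3 r h3 hr => ?_
    replace hz := Rep.mono h3 hz; replace ha := Rep.mono h3 ha; replace hb := Rep.mono h3 hb
    replace hp := Rep.mono h3 hp; replace hq := Rep.mono h3 hq
    refine Comp.bind (ih hz (rep_shiftR (n := h) ha) (rep_shiftR (n := h) hb)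
      (natDegree_hi_lt (by omega) hh) (natDegree_hi_lt (by omega) hh)) fun e4 t h4 ht => ?_
    replace hz := Rep.mono h4 hz; replace hp := Rep.mono h4 hp; replace hq := Rep.mono h4 hq
    replace hr := Rep.mono h4 hr
    have hfg : f * g = lo h f * lo h g + X ^ h * (lo h f * hi h g) + X ^ h * (hi h f * lo h g) +
        X ^ (2 * h) * (hi h f * hi h g) := by
      conv_lhs => rw [← lo_add_hi h f, ← lo_add_hi h g]
      ring
    have hU := hs.one_le
    refine (comp_tab (c := 3) (v := (f * g).coeff) hz (fun k e _ he => ?_) fun k hk => ?_).mono ?_ rfl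
    · rw [hfg]; simp only [coeff_add]
      refine Comp.bind (comp_add (Rep.mono he (hp k)) (Rep.mono he (rep_unshiftR (n := h) hz hq k)))
        fun e5 u h5 hu => ?_
      refine Comp.bind (comp_add hu (Rep.mono (he.trans h5) (rep_unshiftR (n := h) hz hr k)))
        fun e6 v h6 hv => ?_
      exact (comp_add hv (Rep.mono ((he.trans h5).trans h6)
        (rep_unshiftR (n := 2 * h) hz ht k))).mono (by norm_num) rfl
    · exact coeff_eq_zero_of_natDegree_lt (lt_of_le_of_lt natDegree_mul_le (by omega))
    · have e1 : (h : ℝ) = 2 ^ j * (N + 1) := by rw [hdef]; push_cast; ring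
      have e2 : (h : ℝ) ≤ 2 ^ j * (2 * (N * U)) := by
        rw [e1]; apply mul_le_mul_of_nonneg_left _ (by positivity)
        nlinarith
      push_cast
      rw [pow_succ, pow_succ]
      nlinarith

/-- Multiplication of polynomials of degree at most `n`, for `n ≤ 8 N`. -/
def mulP (s : ℕ → List Instr) (z : Reg) (N n : ℕ) (a b : ℕ → Reg) : Prog (ℕ → Reg) :=
  if n ≤ N then mulSmall s z n a b else mulL s z N 3 a b

variable {s : ℕ → List Instr} {z : Reg} {N : ℕ} {U : ℝ} {env : List Qbar}

/-- The constant is `13 * 4 ^ 3 - 12 * 2 ^ 3 = 736`. The long product is used only for `N < n`,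
where `N U` is at most `n U`. -/
theorem comp_mulP (hs : PolyMul s N U) {n : ℕ} (hn : 1 ≤ n) (hnN : n ≤ 8 * N)
    {a b : ℕ → Reg} {f g : Qbar[X]} (hz : rep env z 0) (ha : rep env a f.coeff)
    (hb : rep env b g.coeff) (hf : f.natDegree ≤ n) (hg : g.natDegree ≤ n) :
    Comp (mulP s z N n a b) env (736 * (n * U)) (f * g).coeff := by
  have hU := hs.one_le
  have hn' : (1 : ℝ) ≤ n := by exact_mod_cast hn
  unfold mulP
  split_ifs with h
  · refine (comp_mulSmall (hs.isMul n) hz ha hb hf hg).mono ?_ rfl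
    have := hs.cost n hn h
    nlinarith
  · refine (comp_mulL hs 3 hz ha hb (by omega) (by omega)).mono ?_ rfl
    have : (N : ℝ) ≤ n := by exact_mod_cast (not_le.1 h).le
    norm_num
    exact mul_le_mul_of_nonneg_right this (by linarith)

/-- The sum of the products `a i * b i`, for polynomials of degree at most `n`. -/
def polyDot (s : ℕ → List Instr) (z : Reg) (N n : ℕ) {ι : Type} [Fintype ι] (a b : ι → ℕ → Reg) :
    Prog (ℕ → Reg) := do
  let p ← forAll fun i => mulP s z N n (a i) (b i)
  tab z (2 * n + 1) fun k => sumAll z fun i => p i k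

theorem comp_polyDot (hs : PolyMul s N U) {n : ℕ} (hn : 1 ≤ n) (hnN : n ≤ 8 * N)
    {ι : Type} [Fintype ι] {a b : ι → ℕ → Reg} {f g : ι → Qbar[X]} (hz : rep env z 0)
    (ha : rep env a fun i => (f i).coeff) (hb : rep env b fun i => (g i).coeff)
    (hf : ∀ i, (f i).natDegree ≤ n) (hg : ∀ i, (g i).natDegree ≤ n) :
    Comp (polyDot s z N n a b) env (739 * (Fintype.card ι * (n * U))) (∑ i, f i * g i).coeff := by
  have hU := hs.one_le
  have hn' : (1 : ℝ) ≤ n := by exact_mod_cast hn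
  refine Comp.bind (comp_forAll' fun i e he => comp_mulP hs hn hnN (Rep.mono he hz)
    (Rep.mono he (ha i)) (Rep.mono he (hb i)) (hf i) (hg i)) fun e1 p h1 hp => ?_
  refine (comp_tab (c := Fintype.card ι) (Rep.mono h1 hz) (fun k e _ he => ?_) fun k hk => ?_).mono
    ?_ rfl
  · rw [finsetSum_coeff]
    exact comp_sumAll (Rep.mono (h1.trans he) hz) fun i => Rep.mono he (hp i k)
  · rw [finsetSum_coeff]
    refine Finset.sum_eq_zero fun i _ => coeff_eq_zero_of_natDegree_lt
      (lt_of_le_of_lt natDegree_mul_le ?_)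
    have := hf i; have := hg i; omega
  · push_cast
    have : (2 * n + 1 : ℝ) ≤ 3 * (n * U) := by nlinarith
    nlinarith [mul_le_mul_of_nonneg_right this (Nat.cast_nonneg (α := ℝ) (Fintype.card ι))]

theorem lo_eq_trunc (n : ℕ) (f : Qbar[X]) : lo n f = PowerSeries.trunc n (f : PowerSeries Qbar) := by
  ext k : 1; simp [coeff_lo, PowerSeries.coeff_trunc]

/-- Multiplication modulo `X ^ n`. -/
def mulT (s : ℕ → List Instr) (z : Reg) (N n : ℕ) (a b : ℕ → Reg) : Prog (ℕ → Reg) := do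
  let p ← mulP s z N n (truncR z n a) (truncR z n b)
  pure (truncR z n p)

theorem comp_mulT (hs : PolyMul s N U) {n : ℕ} (hn : 1 ≤ n) (hnN : n ≤ 8 * N)
    {a b : ℕ → Reg} {f g : Qbar[X]} (hz : rep env z 0) (ha : rep env a f.coeff)
    (hb : rep env b g.coeff) :
    Comp (mulT s z N n a b) env (736 * (n * U)) (lo n (f * g)).coeff := by
  refine Comp.toSat (comp_mulP hs hn hnN hz (rep_truncR hz ha) (rep_truncR hz hb)
    (natDegree_lo_lt hn f).le (natDegree_lo_lt hn g).le) fun e p he hp => ?_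
  have : lo n (f * g) = lo n (lo n f * lo n g) := by
    simp only [lo_eq_trunc, coe_mul]
    rw [PowerSeries.trunc_trunc_mul_trunc]
  rw [this]
  exact rep_truncR (Rep.mono he hz) hp

/-- The inverse modulo `X ^ (2 ^ j)`. -/
def invP (s : ℕ → List Instr) (z : Reg) (N : ℕ) (a : ℕ → Reg) : ℕ → Prog (ℕ → Reg)
  | 0 => do
    let o ← pconst 1
    let r ← pdiv o (a 0)
    pure fun k => if k = 0 then r else z
  | j + 1 => do
    let g ← invP s z N a j
    let t ← mulT s z N (2 ^ (j + 1)) g a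
    let u ← tab z (2 ^ (j + 1)) fun k => do
      let c ← pconst (if k = 0 then 2 else 0)
      psub c (t k)
    mulT s z N (2 ^ (j + 1)) g u

/-- Newton iteration: for an approximation `g` of `f⁻¹`, the new error `f⁻¹ - g (2 - g f)` equals `f
(f⁻¹ - g) ^ 2`, so the precision doubles. -/
theorem trunc_inv_newton {f : PowerSeries Qbar} (hf : PowerSeries.constantCoeff f ≠ 0) (n : ℕ) :
    PowerSeries.trunc (2 * n) (f⁻¹) = PowerSeries.trunc (2 * n)
      (((PowerSeries.trunc n f⁻¹ : Qbar[X]) : PowerSeries Qbar) * (2 - ((PowerSeries.trunc n f⁻¹ : Qbar[X]) : PowerSeries Qbar) * f)) := by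
  obtain ⟨h, hh⟩ : PowerSeries.X ^ n ∣ f⁻¹ - ((PowerSeries.trunc n f⁻¹ : Qbar[X]) : PowerSeries Qbar) := by
    rw [PowerSeries.X_pow_dvd_iff]
    intro m hm
    simp [PowerSeries.coeff_trunc, hm]
  set g : PowerSeries Qbar := ((PowerSeries.trunc n f⁻¹ : Qbar[X]) : PowerSeries Qbar) with hg
  have hinv : f⁻¹ * f = 1 := PowerSeries.inv_mul_cancel f hf
  have key : f⁻¹ - g * (2 - g * f) = PowerSeries.X ^ (2 * n) * (f * h ^ 2) := by
    have : f⁻¹ - g * (2 - g * f) = f * (f⁻¹ - g) ^ 2 := by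
      have e : f * (f⁻¹ - g) ^ 2 = f⁻¹ * (f⁻¹ * f) - 2 * g * (f⁻¹ * f) + g ^ 2 * f := by ring
      rw [e, hinv]; ring
    rw [this, hh]; ring
  ext k : 1
  simp only [PowerSeries.coeff_trunc]
  split_ifs with hk
  · have := (PowerSeries.X_pow_dvd_iff (n := 2 * n)).1 ⟨_, key⟩ k hk
    rw [map_sub, sub_eq_zero] at this
    exact this
  · rfl

/-- Each stage costs two products and one pass of subtractions at double precision. The sum is
geometric, and `2948` solves `c + 2 * (2 * 736) + 4 = 2 * c`. -/
theorem comp_invP (hs : PolyMul s N U) {a : ℕ → Reg} {f : Qbar[X]} (hf : f.coeff 0 ≠ 0) (j : ℕ)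
    (hj : 2 ^ j ≤ 8 * N) (hz : rep env z 0) (ha : rep env a f.coeff) :
    Comp (invP s z N a j) env (2948 * (2 ^ j * U))
      (PowerSeries.trunc (2 ^ j) (f : PowerSeries Qbar)⁻¹).coeff := by
  have hU := hs.one_le
  induction j with
  | zero =>
    refine Comp.bind (comp_const 1) fun e1 o h1 ho => ?_
    refine Comp.bind (comp_div ho (Rep.mono h1 (ha 0))) fun e2 r h2 hr => ?_
    refine Sat.pure (by norm_num; linarith) fun k => ?_
    rw [PowerSeries.coeff_trunc]
    rcases Nat.eq_zero_or_pos k with rfl | hk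
    · simpa [PowerSeries.coeff_inv] using hr
    · rw [if_neg (by omega), if_neg (by simp; omega)]
      exact Rep.mono (h1.trans h2) hz
  | succ j ih =>
    have hp : 2 ^ (j + 1) = 2 * 2 ^ j := by ring
    have h1j : 1 ≤ 2 ^ (j + 1) := Nat.one_le_two_pow
    set g := PowerSeries.trunc (2 ^ j) (f : PowerSeries Qbar)⁻¹ with hg
    refine Comp.bind (ih (by omega)) fun e1 rg h1 hrg => ?_
    refine Comp.bind (comp_mulT hs h1j hj (Rep.mono h1 hz) hrg (Rep.mono h1 ha))
      fun e2 t h2 ht => ?_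
    refine Comp.bind (comp_tab (c := 2) (v := (lo (2 ^ (j + 1)) (2 - g * f)).coeff)
      (Rep.mono (h1.trans h2) hz) (fun k e hk he => ?_) fun k hk => ?_) fun e3 u h3 hu => ?_
    · refine Comp.bind (comp_const _) fun e4 c h4 hc => ?_
      refine (comp_sub hc (Rep.mono (he.trans h4) (ht k))).mono (by norm_num) ?_
      rw [coeff_lo, coeff_lo, if_pos hk, if_pos hk, coeff_sub]
      congr 1
      have : (2 : Qbar[X]) = C 2 := (map_ofNat C 2).symm
      rw [this, coeff_C]
    · rw [coeff_lo, if_neg (by omega)]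
    · refine (comp_mulT hs h1j hj (Rep.mono ((h1.trans h2).trans h3) hz)
        (Rep.mono (h2.trans h3) hrg) hu).mono ?_ ?_
      · push_cast; rw [pow_succ]; nlinarith [pow_pos (two_pos : (0 : ℝ) < 2) j]
      · congr 1
        have hc : PowerSeries.constantCoeff (f : PowerSeries Qbar) ≠ 0 := by
          simpa [constantCoeff_coe] using hf
        rw [hp, trunc_inv_newton hc, lo_eq_trunc, lo_eq_trunc, coe_mul,
          PowerSeries.trunc_mul_trunc, coe_sub, coe_mul]
        congr 3
        exact (map_ofNat (coeToPowerSeries.ringHom (R := Qbar)) 2)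

/-- The quotient of `h` by `f`, of degree less than `n`; the valuation of `f` at `0` is `w`. -/
def divP (s : ℕ → List Instr) (z : Reg) (N n w : ℕ) (a h : ℕ → Reg) : Prog (ℕ → Reg) := do
  let i ← invP s z N (shiftR w a) (Nat.clog 2 n)
  mulT s z N n (shiftR w h) i

theorem hi_eq_of_mul {w : ℕ} {f g : Qbar[X]} (hw : ∀ k < w, f.coeff k = 0) :
    hi w (f * g) = hi w f * g := by
  have h1 : lo w f = 0 := by
    ext k : 1; rw [coeff_lo, coeff_zero]; split_ifs with h
    · exact hw k h
    · rfl
  have h2 : f = X ^ w * hi w f := by conv_lhs => rw [← lo_add_hi w f, h1, zero_add]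
  ext k : 1
  rw [coeff_hi, h2, mul_assoc, coeff_X_pow_mul, ← h2]

theorem two_pow_clog_le {n : ℕ} (hn : 1 ≤ n) : 2 ^ Nat.clog 2 n ≤ 2 * n := by
  rcases Nat.lt_or_ge 1 n with h | h
  · have h1 := Nat.pow_pred_clog_lt_self (b := 2) one_lt_two h
    have h2 : 0 < Nat.clog 2 n := Nat.clog_pos one_lt_two h
    obtain ⟨j, hj⟩ := Nat.exists_eq_succ_of_ne_zero h2.ne'
    rw [hj] at h1 ⊢
    simp only [Nat.pred_succ, Nat.succ_eq_add_one] at h1 ⊢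
    rw [pow_succ]; omega
  · have : n = 1 := by omega
    subst this; simp

/-- An exact quotient of degree less than `n` is determined modulo `X ^ n`, so it is computed as a
power series once the common factor `X ^ w` is removed. The precision is rounded up to a power of
two, at most `2 n`, whence `2 * 2948 + 736 = 6632`. -/
theorem comp_divP (hs : PolyMul s N U) {n w : ℕ} (hn : 1 ≤ n) (hnN : n ≤ 4 * N) {a h : ℕ → Reg}
    {f g q : Qbar[X]} (hw : ∀ k < w, f.coeff k = 0) (hw' : f.coeff w ≠ 0) (hg : g = f * q)
    (hq : q.natDegree < n) (hz : rep env z 0) (ha : rep env a f.coeff) (hh : rep env h g.coeff) :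
    Comp (divP s z N n w a h) env (6632 * (n * U)) q.coeff := by
  have hU := hs.one_le
  have h2 := two_pow_clog_le hn
  have h2' : (2 : ℝ) ^ Nat.clog 2 n ≤ 2 * n := by exact_mod_cast h2
  have hf0 : (hi w f).coeff 0 ≠ 0 := by rw [coeff_hi, zero_add]; exact hw'
  refine Comp.bind (comp_invP hs hf0 _ (by omega) hz (rep_shiftR ha)) fun e1 i h1 hi' => ?_
  refine (comp_mulT hs hn (by omega) (Rep.mono h1 hz) (Rep.mono h1 (rep_shiftR (n := w) hh))
    hi').mono ?_ ?_
  · nlinarith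
  · congr 1
    have hc : PowerSeries.constantCoeff ((hi w f : Qbar[X]) : PowerSeries Qbar) ≠ 0 := by
      simpa [constantCoeff_coe] using hf0
    have hle : n ≤ 2 ^ Nat.clog 2 n := Nat.le_pow_clog one_lt_two n
    have hq' : q = lo n q := by
      ext k : 1; rw [coeff_lo]; split_ifs with hk
      · rfl
      · exact coeff_eq_zero_of_natDegree_lt (by omega)
    rw [hg, hi_eq_of_mul hw, lo_eq_trunc, coe_mul]
    have e : PowerSeries.trunc n (((hi w f * q : Qbar[X]) : PowerSeries Qbar) *
        ((PowerSeries.trunc (2 ^ Nat.clog 2 n) (((hi w f : Qbar[X]) : PowerSeries Qbar)⁻¹) : Qbar[X]) :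
          PowerSeries Qbar))
        = PowerSeries.trunc n (((hi w f * q : Qbar[X]) : PowerSeries Qbar) *
          ((hi w f : Qbar[X]) : PowerSeries Qbar)⁻¹) := by
      rw [← PowerSeries.trunc_mul_trunc (n := n), ← PowerSeries.trunc_mul_trunc (n := n)
        (g := ((hi w f : Qbar[X]) : PowerSeries Qbar)⁻¹)]
      congr 3
      ext k : 1
      simp only [PowerSeries.coeff_trunc, coeff_coe]
      split_ifs with h1 h2
      · rfl
      · omega
      · rfl
    rw [e, coe_mul, mul_right_comm, PowerSeries.mul_inv_cancel _ hc, one_mul, ← lo_eq_trunc]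
    exact hq'.symm

/-! ### Tests and evaluation -/

/-- The least index `≥ k` of a nonzero coefficient, if it is less than `k + n`. -/
def findNZ (a : ℕ → Reg) : ℕ → ℕ → Prog ℕ
  | 0, k => pure k
  | n + 1, k => ifz (a k) (findNZ a n (k + 1)) (pure k)

theorem sat_findNZ {a : ℕ → Reg} {v : ℕ → Qbar} (n k : ℕ) (ha : rep env a v) :
    Sat (findNZ a n k) env n fun _ w => k ≤ w ∧ w ≤ k + n ∧ (∀ i, k ≤ i → i < w → v i = 0) ∧
      (w < k + n → v w ≠ 0) := by
  induction n generalizing k with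
  | zero => exact Sat.pure (by simp) ⟨le_rfl, le_rfl, fun i h1 h2 => by omega, fun h => by omega⟩
  | succ n ih =>
    refine sat_ifz (ha k) (fun h => ?_) fun h => ?_
    · refine (ih (k + 1)).mono (by push_cast; linarith) fun e w he ⟨h1, h2, h3, h4⟩ =>
        ⟨by omega, by omega, fun i hi hi' => ?_, fun hw => h4 (by omega)⟩
      rcases hi.eq_or_lt with rfl | h'
      · exact h
      · exact h3 i h' hi'
    · exact Sat.pure (by push_cast; linarith [(Nat.cast_nonneg n : (0 : ℝ) ≤ n)])
        ⟨le_rfl, by omega, fun i h1 h2 => by omega, fun _ => h⟩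

/-- The valuation at `0`; the result is `n` for the zero polynomial. -/
def valP (n : ℕ) (a : ℕ → Reg) : Prog ℕ := findNZ a n 0

theorem sat_valP {n : ℕ} {a : ℕ → Reg} {f : Qbar[X]} (hf : f.natDegree < n)
    (ha : rep env a f.coeff) :
    Sat (valP n a) env n fun _ w => w = if f = 0 then n else f.natTrailingDegree := by
  refine (sat_findNZ n 0 ha).mono le_rfl fun e w _ ⟨_, h2, h3, h4⟩ => ?_
  rw [zero_add] at h2 h4
  split_ifs with h0
  · by_contra hne
    exact h4 (lt_of_le_of_ne h2 hne) (by simp [h0])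
  · have h5 : f.natTrailingDegree < n := lt_of_le_of_lt f.natTrailingDegree_le_natDegree hf
    have h6 : f.coeff f.natTrailingDegree ≠ 0 := by
      rw [← trailingCoeff]; exact trailingCoeff_nonzero_iff_nonzero.2 h0
    have h7 : w ≤ f.natTrailingDegree := by
      by_contra hlt
      exact h6 (h3 _ (Nat.zero_le _) (by omega))
    exact le_antisymm h7 (natTrailingDegree_le_of_ne_zero (h4 (by omega)))

def horner (z : Reg) : ℕ → (ℕ → Reg) → Reg → Prog Reg
  | 0, _, _ => pure z
  | n + 1, a, x => do
    let u ← horner z n (shiftR 1 a) x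
    let v ← pmul u x
    padd v (a 0)

theorem comp_horner {n : ℕ} {a : ℕ → Reg} {v : ℕ → Qbar} {x : Reg} {y : Qbar} (hz : rep env z 0)
    (ha : rep env a v) (hx : rep env x y) :
    Comp (horner z n a x) env (2 * n) (∑ k ∈ Finset.range n, v k * y ^ k) := by
  induction n generalizing a v with
  | zero => exact Sat.pure (by simp) (by simpa using hz)
  | succ n ih =>
    refine Comp.bind (ih (a := shiftR 1 a) (v := fun k => v (k + 1)) fun k => ha (k + 1))
      fun e1 u h1 hu => ?_
    refine Comp.bind (comp_mul hu (Rep.mono h1 hx)) fun e2 w h2 hw => ?_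
    refine (comp_add hw (Rep.mono (h1.trans h2) (ha 0))).mono (by push_cast; linarith) ?_
    rw [Finset.sum_range_succ', Finset.sum_mul]
    simp [pow_succ, mul_assoc]

theorem comp_horner_eval {n : ℕ} {a : ℕ → Reg} {f : Qbar[X]} {x : Reg} {y : Qbar} (hz : rep env z 0)
    (ha : rep env a f.coeff) (hx : rep env x y) (hf : f.natDegree < n) :
    Comp (horner z n a x) env (2 * n) (f.eval y) :=
  (comp_horner hz ha hx).mono le_rfl (eval_eq_sum_range' hf y).symm

/-! ## Complex conjugation -/

theorem conj_mem_Qbar (x : Qbar) : (starRingEnd ℂ) (x : ℂ) ∈ algebraicClosure ℚ ℂ :=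
  mem_algebraicClosure_iff.2
    ((mem_algebraicClosure_iff.1 x.2).algHom (Complex.conjAe.toAlgHom.restrictScalars ℚ))

/-- Complex conjugation makes `conjTranspose` available, and with it Gram matrices and orthogonal
projections over `Qbar`. -/
instance : StarRing Qbar where
  star x := ⟨(starRingEnd ℂ) (x : ℂ), conj_mem_Qbar x⟩
  star_involutive x := Subtype.ext (Complex.conj_conj _)
  star_mul x y := Subtype.ext (by
    change (starRingEnd ℂ) ((x : ℂ) * y) = (starRingEnd ℂ) (y : ℂ) * (starRingEnd ℂ) (x : ℂ)
    rw [map_mul, mul_comm])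
  star_add x y := Subtype.ext (map_add (starRingEnd ℂ) (x : ℂ) y)

theorem absQ_mul_self (x : Qbar) : absQ x * absQ x = x * star x :=
  Subtype.ext (by
    change ((‖(x : ℂ)‖ : ℝ) : ℂ) * ((‖(x : ℂ)‖ : ℝ) : ℂ) = (x : ℂ) * (starRingEnd ℂ) (x : ℂ)
    rw [Complex.mul_conj, Complex.normSq_eq_norm_sq, sq]; push_cast; rfl)

/-- Conjugation is not an instruction; it is obtained from the absolute value as `|x|² / x`. The
convention for division by zero gives the right value at `0`, so no test is needed. -/
theorem star_eq_abs_div (x : Qbar) : absQ x * absQ x / x = star x := by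
  rcases eq_or_ne x 0 with rfl | hx
  · simp
  · rw [absQ_mul_self, mul_div_cancel_left₀ _ hx]

/-- Definiteness of the standard Hermitian form. This is what makes a vanishing pivot harmless in
`ginv`. -/
theorem sum_star_mul_self_eq_zero {ι : Type} [Fintype ι] {x : ι → Qbar}
    (h : ∑ i, star (x i) * x i = 0) (i : ι) : x i = 0 := by
  have h2 : ∑ i, ‖(x i : ℂ)‖ ^ 2 = 0 := by
    have h1 := congrArg (fun y : Qbar => (y : ℂ)) h
    have h3 : ((∑ i, star (x i) * x i : Qbar) : ℂ) = ((∑ i, ‖(x i : ℂ)‖ ^ 2 : ℝ) : ℂ) := by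
      rw [show ((∑ i, star (x i) * x i : Qbar) : ℂ) = ∑ i, ((star (x i) * x i : Qbar) : ℂ) from
        map_sum (algebraMap Qbar ℂ) _ _]
      push_cast
      refine Finset.sum_congr rfl fun i _ => ?_
      have h4 := congrArg (fun y : Qbar => (y : ℂ)) (absQ_mul_self (x i))
      rw [mul_comm, sq]; exact h4.symm
    rw [h3] at h1
    exact Complex.ofReal_eq_zero.1 h1
  have h5 := (Finset.sum_eq_zero_iff_of_nonneg fun i _ => sq_nonneg _).1 h2 i (Finset.mem_univ i)
  exact Subtype.ext (by simpa using h5)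

def pconj (a : Reg) : Prog Reg := do
  let b ← pabs a
  let c ← pmul b b
  pdiv c a

theorem comp_conj {env : List Qbar} {a : Reg} {x : Qbar} (ha : rep env a x) :
    Comp (pconj a) env 3 (star x) := by
  refine Comp.bind (comp_abs ha) fun e1 b h1 hb => ?_
  refine Comp.bind (comp_mul hb hb) fun e2 c h2 hc => ?_
  exact (comp_div hc (Rep.mono (h1.trans h2) ha)).mono (by norm_num) (star_eq_abs_div x)

/-! ## Fast matrix arithmetic -/

/-- A set with `2 ^ k` elements. -/
def Ix : ℕ → Type
  | 0 => Unit
  | k + 1 => Ix k ⊕ Ix k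

instance instFintypeIx : (k : ℕ) → Fintype (Ix k)
  | 0 => inferInstanceAs (Fintype Unit)
  | k + 1 =>
    letI := instFintypeIx k
    inferInstanceAs (Fintype (Ix k ⊕ Ix k))

instance instDecidableEqIx : (k : ℕ) → DecidableEq (Ix k)
  | 0 => inferInstanceAs (DecidableEq Unit)
  | k + 1 =>
    letI := instDecidableEqIx k
    inferInstanceAs (DecidableEq (Ix k ⊕ Ix k))

theorem card_Ix (k : ℕ) : Fintype.card (Ix k) = 2 ^ k := by
  induction k with
  | zero => rfl
  | succ k ih =>
    have : Fintype.card (Ix (k + 1)) = Fintype.card (Ix k ⊕ Ix k) := rfl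
    rw [this, Fintype.card_sum, ih, pow_succ]; ring

def ixEquiv (k : ℕ) : Ix k ≃ Fin (2 ^ k) := Fintype.equivFinOfCardEq (card_Ix k)

/-- The family `s` of straight-line programs multiplies matrices; for the sizes `2 ^ k`, `k ≤ j`,
the cost is at most `V` per entry. -/
structure MatMul (s : ℕ → List Instr) (j : ℕ) (V : ℝ) : Prop where
  isMul : ∀ n, IsMatMul n (s n)
  cost : ∀ k ≤ j, ((s (2 ^ k)).length : ℝ) ≤ 4 ^ k * V
  one_le : 1 ≤ V

open Classical in
/-- The register of an entry of the product. -/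
def matOut (n : ℕ) (s : List Instr) (i j : Fin n) : ℕ :=
  if h : IsMatMul n s then h.2.choose i j else 0

def mmBase (s : ℕ → List Instr) (z : Reg) (k : ℕ) (a b : Ix k → Ix k → Reg) :
    Prog (Ix k → Ix k → Reg) := do
  let w := fun c : Ix k → Ix k → Reg => (List.ofFn fun i => List.ofFn fun j =>
    c ((ixEquiv k).symm i) ((ixEquiv k).symm j)).flatten
  let l ← slp z (s (2 ^ k)) (w a ++ w b)
  pure fun x y => l.getD (matOut (2 ^ k) (s (2 ^ k)) (ixEquiv k x) (ixEquiv k y)) z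

theorem rep_matrixWord {k : ℕ} {a : Ix k → Ix k → Reg} {A : Matrix (Ix k) (Ix k) Qbar}
    {env : List Qbar} (ha : rep env a A) :
    rep env (List.ofFn fun i => List.ofFn fun j =>
      a ((ixEquiv k).symm i) ((ixEquiv k).symm j)).flatten
      (matrixWord (A.submatrix (ixEquiv k).symm (ixEquiv k).symm)) := by
  have h := rep_ofFn (env := env)
    (r := fun i => List.ofFn fun j => a ((ixEquiv k).symm i) ((ixEquiv k).symm j))
    (x := fun i => List.ofFn fun j => A ((ixEquiv k).symm i) ((ixEquiv k).symm j))
    fun i => rep_ofFn (x := fun j => A ((ixEquiv k).symm i) ((ixEquiv k).symm j)) fun j => ha _ _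
  exact List.rel_flatten h

section fast
variable {s : ℕ → List Instr} {z : Reg} {j : ℕ} {V : ℝ} {env : List Qbar}

theorem comp_mmBase {k : ℕ} {a b : Ix k → Ix k → Reg} {A B : Matrix (Ix k) (Ix k) Qbar}
    (hs : IsMatMul (2 ^ k) (s (2 ^ k))) (hz : rep env z 0) (ha : rep env a A) (hb : rep env b B) :
    Comp (mmBase s z k a b) env (s (2 ^ k)).length (A * B) := by
  refine Comp.toSat (comp_slp _ hz (List.rel_append (rep_matrixWord ha) (rep_matrixWord hb)))
    fun e l he hl x y => ?_
  have h1 := hs.2.choose_spec (A.submatrix (ixEquiv k).symm (ixEquiv k).symm)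
    (B.submatrix (ixEquiv k).symm (ixEquiv k).symm) (ixEquiv k x) (ixEquiv k y)
  rw [Matrix.submatrix_mul_equiv, Matrix.submatrix_apply, Equiv.symm_apply_apply,
    Equiv.symm_apply_apply] at h1
  have h2 := rep_getD (Rep.mono he hz) hl (matOut (2 ^ k) (s (2 ^ k)) (ixEquiv k x) (ixEquiv k y))
  simp only [matOut, dif_pos hs] at h2 ⊢
  rw [← h1]; exact h2

/-- Entrywise operation on two matrices. -/
def zipM {ι κ : Type} [Fintype ι] [Fintype κ] (f : Reg → Reg → Prog Reg) (a b : ι → κ → Reg) :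
    Prog (ι → κ → Reg) :=
  forAll fun i => forAll fun j => f (a i j) (b i j)

theorem comp_zipM {ι κ : Type} [Fintype ι] [Fintype κ] {f : Reg → Reg → Prog Reg}
    {g : Qbar → Qbar → Qbar} {c : ℝ}
    (hf : ∀ e r s x y, rep e r x → rep e s y → Comp (f r s) e c (g x y)) {a b : ι → κ → Reg}
    {A B : Matrix ι κ Qbar} (ha : rep env a A) (hb : rep env b B) :
    Comp (zipM f a b) env (Fintype.card ι * (Fintype.card κ * c)) fun i j => g (A i j) (B i j) :=
  comp_forAll' fun i _ h1 => comp_forAll' fun j _ h2 =>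
    hf _ _ _ _ _ (Rep.mono (h1.trans h2) (ha i j)) (Rep.mono (h1.trans h2) (hb i j))

theorem comp_zipAdd {k : ℕ} {a b : Ix k → Ix k → Reg} {A B : Matrix (Ix k) (Ix k) Qbar}
    (ha : rep env a A) (hb : rep env b B) : Comp (zipM padd a b) env (4 ^ k) (A + B) :=
  (comp_zipM (g := fun x y => x + y) (c := 1) (fun _ _ _ _ _ => comp_add) ha hb).mono
    (by rw [card_Ix]; push_cast; rw [mul_one, ← mul_pow]; norm_num) rfl

theorem comp_zipSub {k : ℕ} {a b : Ix k → Ix k → Reg} {A B : Matrix (Ix k) (Ix k) Qbar}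
    (ha : rep env a A) (hb : rep env b B) : Comp (zipM psub a b) env (4 ^ k) (A - B) :=
  (comp_zipM (g := fun x y => x - y) (c := 1) (fun _ _ _ _ _ => comp_sub) ha hb).mono
    (by rw [card_Ix]; push_cast; rw [mul_one, ← mul_pow]; norm_num) rfl

def blk {k : ℕ} (a : Ix (k + 1) → Ix (k + 1) → Reg) (f g : Ix k → Ix (k + 1)) :
    Ix k → Ix k → Reg := fun i j => a (f i) (g j)

def ixl {k : ℕ} : Ix k → Ix (k + 1) := Sum.inl
def ixr {k : ℕ} : Ix k → Ix (k + 1) := Sum.inr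

def ofBlk {k : ℕ} {R : Type} (a b c d : Ix k → Ix k → R) : Ix (k + 1) → Ix (k + 1) → R :=
  Sum.elim (fun i => Sum.elim (a i) (b i)) fun i => Sum.elim (c i) (d i)

theorem rep_ofBlk {k : ℕ} {a b c d : Ix k → Ix k → Reg} {A B C D : Matrix (Ix k) (Ix k) Qbar}
    (ha : rep env a A) (hb : rep env b B) (hc : rep env c C) (hd : rep env d D) :
    rep env (ofBlk a b c d) (ofBlk A B C D) := by
  rintro (i | i) (j | j)
  · exact ha i j
  · exact hb i j
  · exact hc i j
  · exact hd i j

def mm (s : ℕ → List Instr) (z : Reg) (j : ℕ) :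
    (k : ℕ) → (Ix k → Ix k → Reg) → (Ix k → Ix k → Reg) → Prog (Ix k → Ix k → Reg)
  | 0, a, b => mmBase s z 0 a b
  | k + 1, a, b =>
    if k + 1 ≤ j then mmBase s z (k + 1) a b else do
      let p1 ← mm s z j k (blk a ixl ixl) (blk b ixl ixl)
      let p2 ← mm s z j k (blk a ixl ixr) (blk b ixr ixl)
      let p3 ← mm s z j k (blk a ixl ixl) (blk b ixl ixr)
      let p4 ← mm s z j k (blk a ixl ixr) (blk b ixr ixr)
      let p5 ← mm s z j k (blk a ixr ixl) (blk b ixl ixl)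
      let p6 ← mm s z j k (blk a ixr ixr) (blk b ixr ixl)
      let p7 ← mm s z j k (blk a ixr ixl) (blk b ixl ixr)
      let p8 ← mm s z j k (blk a ixr ixr) (blk b ixr ixr)
      let q1 ← zipM padd p1 p2
      let q2 ← zipM padd p3 p4
      let q3 ← zipM padd p5 p6
      let q4 ← zipM padd p7 p8
      pure (ofBlk q1 q2 q3 q4)

def mblk {k : ℕ} (A : Matrix (Ix (k + 1)) (Ix (k + 1)) Qbar) (f g : Ix k → Ix (k + 1)) :
    Matrix (Ix k) (Ix k) Qbar := A.submatrix f g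

theorem rep_blk {k : ℕ} {a : Ix (k + 1) → Ix (k + 1) → Reg}
    {A : Matrix (Ix (k + 1)) (Ix (k + 1)) Qbar} (ha : rep env a A) (f g : Ix k → Ix (k + 1)) :
    rep env (blk a f g) (mblk A f g) := fun i j => ha (f i) (g j)

theorem ofBlk_eq_fromBlocks {k : ℕ} (A B C D : Matrix (Ix k) (Ix k) Qbar) :
    ofBlk A B C D = (Matrix.fromBlocks A B C D : Matrix (Ix k ⊕ Ix k) (Ix k ⊕ Ix k) Qbar) := by
  funext x y
  rcases x with i | i <;> rcases y with l | l <;> rfl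

theorem fromBlocks_mblk {k : ℕ} (A : Matrix (Ix (k + 1)) (Ix (k + 1)) Qbar) :
    A = (Matrix.fromBlocks (mblk A ixl ixl) (mblk A ixl ixr) (mblk A ixr ixl) (mblk A ixr ixr) :
      Matrix (Ix k ⊕ Ix k) (Ix k ⊕ Ix k) Qbar) := by
  funext x y
  rcases x with i | i <;> rcases y with l | l <;> rfl

theorem mul_eq_ofBlk {k : ℕ} (A B : Matrix (Ix (k + 1)) (Ix (k + 1)) Qbar) :
    A * B = ofBlk (mblk A ixl ixl * mblk B ixl ixl + mblk A ixl ixr * mblk B ixr ixl)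
      (mblk A ixl ixl * mblk B ixl ixr + mblk A ixl ixr * mblk B ixr ixr)
      (mblk A ixr ixl * mblk B ixl ixl + mblk A ixr ixr * mblk B ixr ixl)
      (mblk A ixr ixl * mblk B ixl ixr + mblk A ixr ixr * mblk B ixr ixr) := by
  rw [ofBlk_eq_fromBlocks, ← Matrix.fromBlocks_multiply]
  conv_lhs => rw [fromBlocks_mblk A, fromBlocks_mblk B]
  rfl

theorem comp_mm_le (hs : MatMul s j V) {k : ℕ} (hk : k ≤ j) {a b : Ix k → Ix k → Reg}
    {A B : Matrix (Ix k) (Ix k) Qbar} (hz : rep env z 0) (ha : rep env a A) (hb : rep env b B) :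
    Comp (mm s z j k a b) env (4 ^ k * V) (A * B) := by
  cases k with
  | zero => exact (comp_mmBase (hs.isMul _) hz ha hb).mono (hs.cost 0 hk) rfl
  | succ k =>
    rw [mm, if_pos hk]
    exact (comp_mmBase (hs.isMul _) hz ha hb).mono (hs.cost _ hk) rfl

/-- The ordinary product of two-by-two block matrices: eight products and four sums of half the
size. -/
theorem comp_mm_succ {k : ℕ} {c : ℝ} (hk : j ≤ k)
    (hc : ∀ (e : List Qbar) (a b : Ix k → Ix k → Reg) (A B : Matrix (Ix k) (Ix k) Qbar), rep e z 0 →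
      rep e a A → rep e b B → Comp (mm s z j k a b) e c (A * B))
    {a b : Ix (k + 1) → Ix (k + 1) → Reg}
    {A B : Matrix (Ix (k + 1)) (Ix (k + 1)) Qbar} (hz : rep env z 0) (ha : rep env a A)
    (hb : rep env b B) : Comp (mm s z j (k + 1) a b) env (8 * c + 4 * 4 ^ k) (A * B) := by
  rw [mm, if_neg (by omega), mul_eq_ofBlk]
  refine Comp.bind (hc _ _ _ _ _ hz (rep_blk ha _ _) (rep_blk hb _ _)) fun e1 p1 h1 hp1 => ?_
  replace hz := Rep.mono h1 hz; replace ha := Rep.mono h1 ha; replace hb := Rep.mono h1 hb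
  refine Comp.bind (hc _ _ _ _ _ hz (rep_blk ha _ _) (rep_blk hb _ _)) fun e2 p2 h2 hp2 => ?_
  replace hz := Rep.mono h2 hz; replace ha := Rep.mono h2 ha; replace hb := Rep.mono h2 hb
  refine Comp.bind (hc _ _ _ _ _ hz (rep_blk ha _ _) (rep_blk hb _ _)) fun e3 p3 h3 hp3 => ?_
  replace hz := Rep.mono h3 hz; replace ha := Rep.mono h3 ha; replace hb := Rep.mono h3 hb
  refine Comp.bind (hc _ _ _ _ _ hz (rep_blk ha _ _) (rep_blk hb _ _)) fun e4 p4 h4 hp4 => ?_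
  replace hz := Rep.mono h4 hz; replace ha := Rep.mono h4 ha; replace hb := Rep.mono h4 hb
  refine Comp.bind (hc _ _ _ _ _ hz (rep_blk ha _ _) (rep_blk hb _ _)) fun e5 p5 h5 hp5 => ?_
  replace hz := Rep.mono h5 hz; replace ha := Rep.mono h5 ha; replace hb := Rep.mono h5 hb
  refine Comp.bind (hc _ _ _ _ _ hz (rep_blk ha _ _) (rep_blk hb _ _)) fun e6 p6 h6 hp6 => ?_
  replace hz := Rep.mono h6 hz; replace ha := Rep.mono h6 ha; replace hb := Rep.mono h6 hb
  refine Comp.bind (hc _ _ _ _ _ hz (rep_blk ha _ _) (rep_blk hb _ _)) fun e7 p7 h7 hp7 => ?_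
  replace hz := Rep.mono h7 hz; replace ha := Rep.mono h7 ha; replace hb := Rep.mono h7 hb
  refine Comp.bind (hc _ _ _ _ _ hz (rep_blk ha _ _) (rep_blk hb _ _)) fun e8 p8 h8 hp8 => ?_
  refine Comp.bind (comp_zipAdd (Rep.mono ((((((h2.trans h3).trans h4).trans h5).trans h6).trans
    h7).trans h8) hp1) (Rep.mono (((((h3.trans h4).trans h5).trans h6).trans h7).trans h8) hp2))
    fun e9 q1 h9 hq1 => ?_
  refine Comp.bind (comp_zipAdd (Rep.mono (((((h4.trans h5).trans h6).trans h7).trans h8).trans h9)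
    hp3) (Rep.mono ((((h5.trans h6).trans h7).trans h8).trans h9) hp4)) fun e10 q2 h10 hq2 => ?_
  refine Comp.bind (comp_zipAdd (Rep.mono ((((h6.trans h7).trans h8).trans h9).trans h10) hp5)
    (Rep.mono (((h7.trans h8).trans h9).trans h10) hp6)) fun e11 q3 h11 hq3 => ?_
  refine Comp.bind (comp_zipAdd (Rep.mono (((h8.trans h9).trans h10).trans h11) hp7)
    (Rep.mono ((h9.trans h10).trans h11) hp8)) fun e12 q4 h12 hq4 => ?_
  exact Sat.pure (by linarith) (rep_ofBlk (Rep.mono ((h10.trans h11).trans h12) hq1)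
    (Rep.mono (h11.trans h12) hq2) (Rep.mono h12 hq3) hq4)

/-- The price per entry is only known up to size `2 ^ j`; two further doublings multiply it by at
most `7`. Size `2 ^ (j + 2)` is needed because `j` will be a rounded down logarithm of `m v`, while
a class may have nearly `2 m v` coordinates. -/
theorem comp_mm (hs : MatMul s j V) {k : ℕ} (hk : k ≤ j + 2) {a b : Ix k → Ix k → Reg}
    {A B : Matrix (Ix k) (Ix k) Qbar} (hz : rep env z 0) (ha : rep env a A) (hb : rep env b B) :
    Comp (mm s z j k a b) env (7 * (4 ^ k * V)) (A * B) := by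
  have hV := hs.one_le
  have h4 : (0 : ℝ) < 4 ^ j := by positivity
  have H1 : ∀ (e : List Qbar) (a b : Ix (j + 1) → Ix (j + 1) → Reg)
      (A B : Matrix (Ix (j + 1)) (Ix (j + 1)) Qbar), rep e z 0 → rep e a A → rep e b B →
      Comp (mm s z j (j + 1) a b) e (3 * (4 ^ (j + 1) * V)) (A * B) := fun e a b A B hz ha hb =>
    (comp_mm_succ le_rfl (fun e a b A B => comp_mm_le hs le_rfl) hz ha hb).mono
      (by rw [pow_succ]; nlinarith) rfl
  rcases Nat.lt_or_ge j k with h | h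
  · obtain rfl | rfl : k = j + 1 ∨ k = j + 1 + 1 := by omega
    · exact (H1 _ _ _ _ _ hz ha hb).mono (by nlinarith [pow_pos (four_pos : (0 : ℝ) < 4) (j + 1)]) rfl
    · exact (comp_mm_succ (by omega) H1 hz ha hb).mono (by simp only [pow_succ]; nlinarith) rfl
  · exact (comp_mm_le hs h hz ha hb).mono (by nlinarith [pow_pos (four_pos : (0 : ℝ) < 4) k]) rfl

end fast

/-! ## Generalized inverses of Gram matrices -/

open Matrix

/-- For a Gram matrix `H = Fᴴ F`, a Hermitian matrix `G` with `F G Fᴴ F = F`. -/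
def ginv : (k : ℕ) → Matrix (Ix k) (Ix k) Qbar → Matrix (Ix k) (Ix k) Qbar
  -- A zero pivot gets the value `1 / 0 = 0`, which is a correct generalized inverse of zero.
  | 0, h => fun i j => 1 / h i j
  | k + 1, h =>
    let g := ginv k (mblk h ixl ixl)
    let t := g * mblk h ixl ixr
    let t' := mblk h ixr ixl * g
    let g' := ginv k (mblk h ixr ixr - mblk h ixr ixl * t)
    ofBlk (g + t * g' * t' : Matrix (Ix k) (Ix k) Qbar) (0 - t * g' : Matrix (Ix k) (Ix k) Qbar)
      (0 - g' * t' : Matrix (Ix k) (Ix k) Qbar) g'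

/-- Split `F` into two halves `F₁`, `F₂` of its columns. By induction `P = F₁ g F₁ᴴ` is the
orthogonal projection onto the columns of `F₁`, and the Schur complement is again a Gram matrix,
namely that of `W = F₂ - P F₂`. So block inversion goes through with no pivoting, no branching and
no assumption on the rank, and `F G Fᴴ` is the projection onto the columns of `F`. -/
theorem ginv_spec {ρ : Type} [Fintype ρ] [DecidableEq ρ] (k : ℕ) (F : Matrix ρ (Ix k) Qbar) :
    (ginv k (Fᴴ * F))ᴴ = ginv k (Fᴴ * F) ∧ F * ginv k (Fᴴ * F) * Fᴴ * F = F := by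
  induction k with
  | zero =>
    have hsub : ∀ a b : Ix 0, a = b := fun a b => (inferInstance : Subsingleton Unit).elim a b
    let u : Ix 0 := ()
    have hu : ∀ f : Ix 0 → Qbar, ∑ a, f a = f u := fun f => Fintype.sum_unique (ι := Unit) f
    constructor
    · ext a b : 1
      rw [conjTranspose_apply, hsub a b]
      simp only [ginv, star_div₀, star_one]
      have := congrFun (congrFun (isHermitian_conjTranspose_mul_self F) b) b
      rw [conjTranspose_apply] at this
      rw [this]
    · ext r a : 1
      rw [Matrix.mul_assoc, Matrix.mul_assoc, mul_apply]
      rw [hu, mul_apply, hu]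
      obtain rfl : a = u := hsub _ _
      set h := (Fᴴ * F) u u with hh
      have hg : ginv 0 (Fᴴ * F) u u = 1 / h := rfl
      rw [hg]
      -- If the squared norm of the single column vanishes, the column itself is zero and nothing
      -- has to be inverted.
      by_cases h0 : h = 0
      · have : F r u = 0 := by
          refine sum_star_mul_self_eq_zero (x := fun r => F r u) ?_ r
          rw [← h0, hh, mul_apply]; rfl
        rw [this, zero_mul]
      · rw [one_div, inv_mul_cancel₀ h0, mul_one]
  | succ k ih =>
    set F₁ : Matrix ρ (Ix k) Qbar := fun r i => F r (ixl i) with hF₁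
    set F₂ : Matrix ρ (Ix k) Qbar := fun r i => F r (ixr i) with hF₂
    have hF : F = (fromCols F₁ F₂ : Matrix ρ (Ix k ⊕ Ix k) Qbar) := by
      funext r x; rcases x with i | i <;> rfl
    have b11 : mblk (Fᴴ * F) ixl ixl = F₁ᴴ * F₁ := rfl
    have b12 : mblk (Fᴴ * F) ixl ixr = F₁ᴴ * F₂ := rfl
    have b21 : mblk (Fᴴ * F) ixr ixl = F₂ᴴ * F₁ := rfl
    have b22 : mblk (Fᴴ * F) ixr ixr = F₂ᴴ * F₂ := rfl
    simp only [ginv, b11, b12, b21, b22]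
    set g := ginv k (F₁ᴴ * F₁) with hg
    obtain ⟨hg1, hg2⟩ := ih F₁
    rw [← hg] at hg1 hg2
    set P := F₁ * g * F₁ᴴ with hP
    have hPh : Pᴴ = P := by
      rw [hP, conjTranspose_mul, conjTranspose_mul, hg1, conjTranspose_conjTranspose,
        Matrix.mul_assoc]
    have hPP : P * P = P := by
      conv_lhs => rw [hP]
      rw [show F₁ * g * F₁ᴴ * (F₁ * g * F₁ᴴ) = (F₁ * g * F₁ᴴ * F₁) * g * F₁ᴴ by
        simp only [Matrix.mul_assoc], hg2]
    set W := F₂ - P * F₂ with hW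
    -- The Schur complement has the form required by the induction hypothesis because `P` is
    -- Hermitian and idempotent.
    have hS : F₂ᴴ * F₂ - F₂ᴴ * F₁ * (g * (F₁ᴴ * F₂)) = Wᴴ * W := by
      have e1 : F₂ᴴ * F₁ * (g * (F₁ᴴ * F₂)) = F₂ᴴ * (P * F₂) := by
        rw [hP]; simp only [Matrix.mul_assoc]
      rw [e1, hW, conjTranspose_sub, conjTranspose_mul, hPh]
      rw [Matrix.sub_mul, Matrix.mul_sub, Matrix.mul_sub]
      have e2 : F₂ᴴ * P * (P * F₂) = F₂ᴴ * (P * F₂) := by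
        rw [Matrix.mul_assoc, ← Matrix.mul_assoc P P, hPP]
      rw [e2, Matrix.mul_assoc F₂ᴴ P F₂]; abel
    rw [hS]
    set g' := ginv k (Wᴴ * W) with hg'
    obtain ⟨hg1', hg2'⟩ := ih W
    rw [← hg'] at hg1' hg2'
    set t := g * (F₁ᴴ * F₂) with ht
    have ht' : F₂ᴴ * F₁ * g = tᴴ := by
      rw [ht, conjTranspose_mul, conjTranspose_mul, conjTranspose_conjTranspose, hg1]
    rw [ht', ofBlk_eq_fromBlocks]
    constructor
    · change (fromBlocks (g + t * g' * tᴴ) (0 - t * g') (0 - g' * tᴴ) g')ᴴ = _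
      rw [fromBlocks_conjTranspose]
      congr 1
      · rw [conjTranspose_add, conjTranspose_mul (t * g') tᴴ, conjTranspose_mul t g', hg1, hg1',
          conjTranspose_conjTranspose, Matrix.mul_assoc t g' tᴴ]
      · rw [conjTranspose_sub, conjTranspose_mul g' tᴴ, hg1', conjTranspose_conjTranspose]; simp
      · rw [conjTranspose_sub, conjTranspose_mul t g', hg1']; simp
    · rw [hF]
      change (fromCols F₁ F₂ * fromBlocks (g + t * g' * tᴴ) (0 - t * g') (0 - g' * tᴴ) g' *
        (fromCols F₁ F₂)ᴴ * fromCols F₁ F₂ : Matrix ρ (Ix k ⊕ Ix k) Qbar) = fromCols F₁ F₂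
      have hF₁t : F₁ * t = P * F₂ := by rw [ht, hP]; simp only [Matrix.mul_assoc]
      -- The projection onto all columns is the sum of the projections onto the columns of `F₁` and
      -- onto those of `W`, which are orthogonal to them.
      have hproj : fromCols F₁ F₂ * fromBlocks (g + t * g' * tᴴ) (0 - t * g') (0 - g' * tᴴ) g' *
          (fromCols F₁ F₂)ᴴ = P + W * g' * Wᴴ := by
        rw [fromCols_mul_fromBlocks, conjTranspose_fromCols_eq_fromRows_conjTranspose,
          fromCols_mul_fromRows]
        have hWt : Wᴴ = F₂ᴴ - tᴴ * F₁ᴴ := by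
          rw [hW, ← hF₁t, conjTranspose_sub, conjTranspose_mul]
        rw [hWt, hW, ← hF₁t, hP]
        simp only [Matrix.mul_add, Matrix.add_mul, Matrix.mul_sub, Matrix.sub_mul, Matrix.mul_assoc,
          Matrix.mul_zero, Matrix.zero_mul]
        abel
      rw [hproj, mul_fromCols]
      have hPF₁ : P * F₁ = F₁ := hg2
      have hWF₁ : Wᴴ * F₁ = 0 := by
        rw [hW, conjTranspose_sub, conjTranspose_mul, hPh, Matrix.sub_mul, Matrix.mul_assoc, hPF₁,
          sub_self]
      have hWP : Wᴴ * P = 0 := by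
        rw [hP, ← Matrix.mul_assoc, ← Matrix.mul_assoc, hWF₁, Matrix.zero_mul, Matrix.zero_mul]
      have hF₂W : F₂ = P * F₂ + W := by rw [hW]; abel
      congr 1
      · rw [Matrix.add_mul, hPF₁, Matrix.mul_assoc, hWF₁, Matrix.mul_zero, add_zero]
      · rw [Matrix.add_mul]
        have : W * g' * Wᴴ * F₂ = W := by
          conv_lhs => rw [hF₂W]
          rw [Matrix.mul_add, hg2', Matrix.mul_assoc (W * g'), ← Matrix.mul_assoc Wᴴ P F₂, hWP]
          simp
        rw [this]; exact hF₂W.symm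

/-! ### Programs for generalized inverses and for equations of a column space. -/

section fast
variable {s : ℕ → List Instr} {z : Reg} {j : ℕ} {V : ℝ} {env : List Qbar}

def zeroM (z : Reg) {ι κ : Type} : ι → κ → Reg := fun _ _ => z

def pginv (s : ℕ → List Instr) (z : Reg) (j : ℕ) :
    (k : ℕ) → (Ix k → Ix k → Reg) → Prog (Ix k → Ix k → Reg)
  | 0, h => do
    let o ← pconst 1
    forAll fun i => forAll fun j => pdiv o (h i j)
  | k + 1, h => do
    let g ← pginv s z j k (blk h ixl ixl)
    let t ← mm s z j k g (blk h ixl ixr)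
    let t' ← mm s z j k (blk h ixr ixl) g
    let u ← mm s z j k (blk h ixr ixl) t
    let v ← zipM psub (blk h ixr ixr) u
    let g' ← pginv s z j k v
    let tg ← mm s z j k t g'
    let tgt ← mm s z j k tg t'
    let gt ← mm s z j k g' t'
    let q1 ← zipM padd g tgt
    let q2 ← zipM psub (zeroM z) tg
    let q3 ← zipM psub (zeroM z) gt
    pure (ofBlk q1 q2 q3 g')

/-- Only two recursive calls against a fourfold growth of the size, so the products dominate. The
constant satisfies `2 * 23 + 6 * 7 + 4 = 4 * 23`. -/
theorem comp_pginv (hs : MatMul s j V) {k : ℕ} (hk : k ≤ j + 2) {h : Ix k → Ix k → Reg}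
    {H : Matrix (Ix k) (Ix k) Qbar} (hz : rep env z 0) (hh : rep env h H) :
    Comp (pginv s z j k h) env (23 * (4 ^ k * V)) (ginv k H) := by
  have hV := hs.one_le
  induction k generalizing env with
  | zero =>
    refine Comp.bind (comp_const 1) fun e1 o h1 ho => ?_
    refine (comp_forAll' fun i e2 h2 => comp_forAll' fun i' e3 h3 => comp_div
      (Rep.mono (h2.trans h3) ho) (Rep.mono ((h1.trans h2).trans h3) (hh i i'))).mono ?_ rfl
    rw [card_Ix]; norm_num; linarith
  | succ k ih =>
    have hk' : k ≤ j + 2 := by omega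
    refine Comp.bind (ih hk' hz (rep_blk hh _ _)) fun e1 g h1 hg => ?_
    replace hz := Rep.mono h1 hz; replace hh := Rep.mono h1 hh
    refine Comp.bind (comp_mm hs hk' hz hg (rep_blk hh _ _)) fun e2 t h2 ht => ?_
    replace hz := Rep.mono h2 hz; replace hh := Rep.mono h2 hh; replace hg := Rep.mono h2 hg
    refine Comp.bind (comp_mm hs hk' hz (rep_blk hh _ _) hg) fun e3 t' h3 ht' => ?_
    replace hz := Rep.mono h3 hz; replace hh := Rep.mono h3 hh; replace hg := Rep.mono h3 hg
    replace ht := Rep.mono h3 ht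
    refine Comp.bind (comp_mm hs hk' hz (rep_blk hh _ _) ht) fun e4 u h4 hu => ?_
    replace hz := Rep.mono h4 hz; replace hh := Rep.mono h4 hh; replace hg := Rep.mono h4 hg
    replace ht := Rep.mono h4 ht; replace ht' := Rep.mono h4 ht'
    refine Comp.bind (comp_zipSub (rep_blk hh _ _) hu) fun e5 v h5 hv => ?_
    refine Comp.bind (ih hk' (Rep.mono h5 hz) hv) fun e6 g' h6 hg' => ?_
    have h56 := h5.trans h6
    replace hz := Rep.mono h56 hz; replace hg := Rep.mono h56 hg
    replace ht := Rep.mono h56 ht; replace ht' := Rep.mono h56 ht'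
    refine Comp.bind (comp_mm hs hk' hz ht hg') fun e7 tg h7 htg => ?_
    replace hz := Rep.mono h7 hz; replace hg := Rep.mono h7 hg; replace hg' := Rep.mono h7 hg'
    replace ht' := Rep.mono h7 ht'
    refine Comp.bind (comp_mm hs hk' hz htg ht') fun e8 tgt h8 htgt => ?_
    replace hz := Rep.mono h8 hz; replace hg := Rep.mono h8 hg; replace hg' := Rep.mono h8 hg'
    replace ht' := Rep.mono h8 ht'; replace htg := Rep.mono h8 htg
    refine Comp.bind (comp_mm hs hk' hz hg' ht') fun e9 gt h9 hgt => ?_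
    replace hz := Rep.mono h9 hz; replace hg := Rep.mono h9 hg; replace hg' := Rep.mono h9 hg'
    replace htgt := Rep.mono h9 htgt; replace htg := Rep.mono h9 htg
    refine Comp.bind (comp_zipAdd hg htgt) fun e10 q1 h10 hq1 => ?_
    have hz0 : ∀ e, rep e z 0 → rep e (zeroM z : Ix k → Ix k → Reg)
      (0 : Matrix (Ix k) (Ix k) Qbar) := fun e he i j => he
    refine Comp.bind (comp_zipSub (hz0 _ (Rep.mono h10 hz)) (Rep.mono h10 htg))
      fun e11 q2 h11 hq2 => ?_
    refine Comp.bind (comp_zipSub (hz0 _ (Rep.mono (h10.trans h11) hz))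
      (Rep.mono (h10.trans h11) hgt)) fun e12 q3 h12 hq3 => ?_
    refine Sat.pure ?_ (rep_ofBlk (Rep.mono (h11.trans h12) hq1) (Rep.mono h12 hq2) hq3
      (Rep.mono ((h10.trans h11).trans h12) hg'))
    rw [pow_succ]
    nlinarith [pow_pos (four_pos : (0 : ℝ) < 4) k]

/-- A matrix whose kernel is the column space of `F`. -/
def annih (k : ℕ) (F : Matrix (Ix k) (Ix k) Qbar) : Matrix (Ix k) (Ix k) Qbar :=
  1 - F * ginv k (Fᴴ * F) * Fᴴ

/-- `F G Fᴴ` fixes the columns of `F` and has its values in their span. Membership in an image thus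
becomes a linear equation, and intersecting with an image becomes intersecting with a kernel. -/
theorem annih_mulVec_eq_zero {k : ℕ} {F : Matrix (Ix k) (Ix k) Qbar} {x : Ix k → Qbar} :
    annih k F *ᵥ x = 0 ↔ ∃ y, F *ᵥ y = x := by
  obtain ⟨_, h⟩ := ginv_spec k F
  rw [annih, sub_mulVec, one_mulVec, sub_eq_zero]
  constructor
  · intro hx
    refine ⟨(ginv k (Fᴴ * F) * Fᴴ) *ᵥ x, ?_⟩
    rw [mulVec_mulVec, ← Matrix.mul_assoc]; exact hx.symm
  · rintro ⟨y, rfl⟩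
    rw [mulVec_mulVec, h]

def conjT {ι κ : Type} [Fintype ι] [Fintype κ] (a : ι → κ → Reg) : Prog (κ → ι → Reg) :=
  forAll fun j => forAll fun i => pconj (a i j)

theorem comp_conjT {ι κ : Type} [Fintype ι] [Fintype κ] {a : ι → κ → Reg} {A : Matrix ι κ Qbar}
    (ha : rep env a A) :
    Comp (conjT a) env (Fintype.card κ * (Fintype.card ι * 3)) Aᴴ :=
  comp_forAll' fun j _ h1 => comp_forAll' fun i _ h2 => comp_conj (Rep.mono (h1.trans h2) (ha i j))

def pannih (s : ℕ → List Instr) (z : Reg) (j k : ℕ) (f : Ix k → Ix k → Reg) :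
    Prog (Ix k → Ix k → Reg) := do
  let o ← pconst 1
  let f' ← conjT f
  let h ← mm s z j k f' f
  let g ← pginv s z j k h
  let u ← mm s z j k f g
  let v ← mm s z j k u f'
  zipM psub (fun x y => if x = y then o else z) v

theorem comp_pannih (hs : MatMul s j V) {k : ℕ} (hk : k ≤ j + 2) {f : Ix k → Ix k → Reg}
    {F : Matrix (Ix k) (Ix k) Qbar} (hz : rep env z 0) (hf : rep env f F) :
    Comp (pannih s z j k f) env (49 * (4 ^ k * V)) (annih k F) := by
  have hV := hs.one_le
  refine Comp.bind (comp_const 1) fun e0 o h0 ho => ?_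
  replace hz := Rep.mono h0 hz; replace hf := Rep.mono h0 hf
  refine Comp.bind (comp_conjT hf) fun e1 f' h1 hf' => ?_
  replace hz := Rep.mono h1 hz; replace hf := Rep.mono h1 hf; replace ho := Rep.mono h1 ho
  refine Comp.bind (comp_mm hs hk hz hf' hf) fun e2 h h2 hh => ?_
  replace hz := Rep.mono h2 hz; replace hf := Rep.mono h2 hf; replace ho := Rep.mono h2 ho
  replace hf' := Rep.mono h2 hf'
  refine Comp.bind (comp_pginv hs hk hz hh) fun e3 g h3 hg => ?_
  replace hz := Rep.mono h3 hz; replace hf := Rep.mono h3 hf; replace ho := Rep.mono h3 ho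
  replace hf' := Rep.mono h3 hf'
  refine Comp.bind (comp_mm hs hk hz hf hg) fun e4 u h4 hu => ?_
  replace hz := Rep.mono h4 hz; replace ho := Rep.mono h4 ho
  replace hf' := Rep.mono h4 hf'
  refine Comp.bind (comp_mm hs hk hz hu hf') fun e5 v h5 hv => ?_
  have hone : rep e5 (fun x y : Ix k => if x = y then o else z)
      (1 : Matrix (Ix k) (Ix k) Qbar) := fun x y => by
    change rep e5 (if x = y then o else z) ((1 : Matrix (Ix k) (Ix k) Qbar) x y)
    rw [one_apply]; split_ifs
    · exact Rep.mono h5 ho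
    · exact Rep.mono h5 hz
  refine (comp_zipSub hone hv).mono ?_ rfl
  rw [card_Ix]; push_cast
  have : (2 : ℝ) ^ k * (2 ^ k * 3) = 3 * 4 ^ k := by
    rw [show (4 : ℝ) = 2 * 2 by norm_num, mul_pow]; ring
  have h4 : (1 : ℝ) ≤ 4 ^ k := one_le_pow₀ (by norm_num)
  rw [this]
  nlinarith

/-! ### Left inverses of matrices with few columns -/

/-- Naive product of matrices. -/
def mulN {ι κ μ : Type} [Fintype ι] [Fintype κ] [Fintype μ] (z : Reg) (a : ι → κ → Reg)
    (b : κ → μ → Reg) : Prog (ι → μ → Reg) :=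
  forAll fun i => forAll fun l => do
    let p ← forAll fun k => pmul (a i k) (b k l)
    sumAll z p

theorem comp_mulN {ι κ μ : Type} [Fintype ι] [Fintype κ] [Fintype μ] {a : ι → κ → Reg}
    {b : κ → μ → Reg} {A : Matrix ι κ Qbar} {B : Matrix κ μ Qbar} (hz : rep env z 0)
    (ha : rep env a A) (hb : rep env b B) :
    Comp (mulN z a b) env (Fintype.card ι * (Fintype.card μ * (2 * Fintype.card κ))) (A * B) := by
  refine comp_forAll' fun i e1 h1 => comp_forAll' fun l e2 h2 => ?_
  have h12 := h1.trans h2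
  refine Comp.bind (comp_forAll' fun k e3 h3 => comp_mul (Rep.mono (h12.trans h3) (ha i k))
    (Rep.mono (h12.trans h3) (hb k l))) fun e3 p h3 hp => ?_
  exact (comp_sumAll (Rep.mono (h12.trans h3) hz) hp).mono (by linarith) rfl

/-- The indices of the columns of a matrix of width `m`, padded to the width `2 ^ k`. -/
def padIx {m k : ℕ} {R : Type} (z : R) (h : Fin m → R) (x : Ix k) : R :=
  if hx : (ixEquiv k x : ℕ) < m then h ⟨_, hx⟩ else z

def ixOf {m k : ℕ} (hm : m ≤ 2 ^ k) (i : Fin m) : Ix k := (ixEquiv k).symm (i.castLE hm)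

theorem padIx_ixOf {m k : ℕ} {R : Type} (hm : m ≤ 2 ^ k) (z : R) (h : Fin m → R) (i : Fin m) :
    padIx z h (ixOf hm i) = h i := by
  simp [padIx, ixOf]

theorem sum_padIx {m k : ℕ} (hm : m ≤ 2 ^ k) (h : Fin m → Qbar) (w : Ix k → Qbar) :
    ∑ x, w x * padIx 0 h x = ∑ i, w (ixOf hm i) * h i := by
  have hinj : Function.Injective (ixOf (m := m) hm) := fun a b hab => by
    simpa [ixOf] using hab
  rw [← Finset.sum_subset (Finset.subset_univ (Finset.univ.image (ixOf (m := m) hm))),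
    Finset.sum_image fun a _ b _ h => hinj h]
  · simp only [padIx_ixOf]
  · intro x _ hx
    have : ¬ (ixEquiv k x : ℕ) < m := fun hlt => hx (Finset.mem_image.2
      ⟨⟨_, hlt⟩, Finset.mem_univ _, by simp [ixOf]⟩)
    simp [padIx, this]

/-- A matrix `L` with `F L F = F`. -/
def pinv {ρ : Type} [Fintype ρ] (m k : ℕ) (F : Matrix ρ (Fin m) Qbar) : Matrix (Fin m) ρ Qbar :=
  if hm : m ≤ 2 ^ k then
    ((ginv k fun x y => padIx 0 (fun i => padIx 0 (fun l => (Fᴴ * F) i l) y) x).submatrix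
      (ixOf hm) (ixOf hm)) * Fᴴ
  else 0

/-- Completing `F` by zero columns up to the width `2 ^ k` reduces this to `ginv_spec`; the padded
indices contribute nothing to the sums. -/
theorem mul_pinv_mul {ρ : Type} [Fintype ρ] [DecidableEq ρ] {m k : ℕ} (hm : m ≤ 2 ^ k)
    (F : Matrix ρ (Fin m) Qbar) : F * pinv m k F * F = F := by
  set F' : Matrix ρ (Ix k) Qbar := of fun r x => padIx 0 (fun i => F r i) x with hF'
  have e2 : ∀ (r : ρ) (x : Ix k), F' r x = padIx 0 (fun i => F r i) x := fun _ _ => rfl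
  have hG : (fun x y => padIx 0 (fun i => padIx 0 (fun l => (Fᴴ * F) i l) y) x) = F'ᴴ * F' := by
    funext x y
    refine Eq.trans ?_ (Matrix.mul_apply (M := F'ᴴ) (N := F')).symm
    simp only [conjTranspose_apply, e2, padIx]
    split_ifs with h1 h2
    · exact Matrix.mul_apply
    · simp
    · simp
    · simp
  obtain ⟨_, h⟩ := ginv_spec k F'
  rw [pinv, dif_pos hm]
  rw [hG]
  set G := ginv k (F'ᴴ * F')
  ext r i : 1
  have h1 := congrFun (congrFun h r) (ixOf hm i)
  have h2 : ∀ r i, F' r (ixOf hm i) = F r i := fun r i => padIx_ixOf hm 0 (fun i => F r i) i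
  have e3 : ∀ (r' : ρ) (x : Ix k), star (padIx (0 : Qbar) (fun i => F r' i) x) =
      padIx 0 (fun i => star (F r' i)) x := by
    intro r' x; unfold padIx; split_ifs <;> simp
  have h3 : ∀ r r', (F' * G * F'ᴴ) r r' =
      (F * (G.submatrix (ixOf hm) (ixOf hm) * Fᴴ)) r r' := fun r r' => by
    rw [← Matrix.mul_assoc]
    simp only [mul_apply, Matrix.submatrix_apply, conjTranspose_apply, e2, e3]
    rw [sum_padIx hm (fun i => star (F r' i))
      (fun x => ∑ y : Ix k, padIx 0 (fun i => F r i) y * G y x)]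
    refine Finset.sum_congr rfl fun l _ => ?_
    congr 1
    have := sum_padIx hm (fun i => F r i) (fun y => G y (ixOf hm l))
    simp only [mul_comm (G _ _)] at this
    exact this
  rw [h2] at h1
  rw [← h1]
  simp only [mul_apply (N := F), mul_apply (N := F')]
  exact Finset.sum_congr rfl fun r' _ => by rw [h3, h2]

def ppinv (s : ℕ → List Instr) (z : Reg) (j : ℕ) {ρ : Type} [Fintype ρ] (m k : ℕ)
    (f : ρ → Fin m → Reg) : Prog (Fin m → ρ → Reg) := do
  let f' ← conjT f
  let h ← mulN z f' f
  let g ← pginv s z j k fun x y => padIx z (fun i => padIx z (fun l => h i l) y) x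
  mulN z (fun i l => if hm : m ≤ 2 ^ k then g (ixOf hm i) (ixOf hm l) else z) f'

theorem rep_padIx {m k : ℕ} {α β : Type} [Rep α β] {z : α} {zv : β} {h : Fin m → α} {v : Fin m → β}
    (hz : rep env z zv) (hh : rep env h v) (x : Ix k) : rep env (padIx z h x) (padIx zv v x) := by
  unfold padIx; split_ifs
  · exact hh _
  · exact hz

theorem comp_ppinv (hs : MatMul s j V) {ρ : Type} [Fintype ρ] {m k : ℕ} (hk : k ≤ j + 2)
    (hm : m ≤ 2 ^ k) {f : ρ → Fin m → Reg} {F : Matrix ρ (Fin m) Qbar} (hz : rep env z 0)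
    (hf : rep env f F) :
    Comp (ppinv s z j m k f) env (7 * (Fintype.card ρ * m ^ 2) + 23 * (4 ^ k * V)) (pinv m k F) := by
  refine Comp.bind (comp_conjT hf) fun e1 f' h1 hf' => ?_
  replace hz := Rep.mono h1 hz; replace hf := Rep.mono h1 hf
  refine Comp.bind (comp_mulN hz hf' hf) fun e2 h h2 hh => ?_
  replace hz := Rep.mono h2 hz; replace hf' := Rep.mono h2 hf'
  refine Comp.bind (comp_pginv (H := fun x y => padIx 0 (fun i => padIx 0 (fun l => (Fᴴ * F) i l) y) x)
    hs hk hz fun x y => rep_padIx hz (fun i => rep_padIx hz (fun l => hh i l) y) x)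
    fun e3 g h3 hg => ?_
  refine (comp_mulN (A := (ginv k fun x y => padIx 0 (fun i => padIx 0 (fun l => (Fᴴ * F) i l) y)
    x).submatrix (ixOf hm) (ixOf hm)) (Rep.mono h3 hz) (fun i l => ?_) (Rep.mono h3 hf')).mono ?_ ?_
  · simp only [dif_pos hm]; exact hg _ _
  · simp only [Fintype.card_fin]
    have hmm : (m : ℝ) ≤ m ^ 2 := by
      rcases Nat.eq_zero_or_pos m with rfl | h
      · simp
      · have : (1 : ℝ) ≤ m := by exact_mod_cast h
        nlinarith
    nlinarith [mul_le_mul_of_nonneg_left hmm (Nat.cast_nonneg (α := ℝ) (Fintype.card ρ))]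
  · rw [pinv, dif_pos hm]

end fast

/-! ## Bases given by lists -/

section lists
variable {ι : Type}

/-- Together with `spanL`, this is the form of `IsBasisOf` suited to induction on the list. -/
def LIl (l : List (ι → Qbar)) : Prop := LinearIndependent Qbar (fun i : Fin l.length => l.get i)

def spanL (l : List (ι → Qbar)) : Submodule Qbar (ι → Qbar) := Submodule.span Qbar {x | x ∈ l}

theorem isBasisOf_iff {l : List (ι → Qbar)} {X : Submodule Qbar (ι → Qbar)} :
    IsBasisOf l X ↔ LIl l ∧ spanL l = X := by
  unfold IsBasisOf LIl spanL
  rw [show (fun i : Fin l.length => l.get i) = l.get from rfl, Set.range_list_get]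

theorem LIl_nil : LIl ([] : List (ι → Qbar)) :=
  linearIndependent_empty_type (ι := Fin 0)

theorem LIl_cons {e : ι → Qbar} {l : List (ι → Qbar)} : LIl (e :: l) ↔ LIl l ∧ e ∉ spanL l := by
  unfold LIl spanL
  have : (fun i : Fin (e :: l).length => (e :: l).get i) =
      (Fin.cons e l.get : Fin (l.length + 1) → ι → Qbar) := by
    funext i; refine Fin.cases rfl (fun i => rfl) i
  rw [this]
  refine linearIndependent_finCons.trans ?_
  rw [Set.range_list_get]

theorem spanL_nil : spanL ([] : List (ι → Qbar)) = ⊥ := by simp [spanL]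

theorem spanL_cons (e : ι → Qbar) (l : List (ι → Qbar)) :
    spanL (e :: l) = Submodule.span Qbar {e} ⊔ spanL l := by
  rw [spanL, spanL, ← Submodule.span_union]; congr 1; ext x; simp

theorem spanL_append (l l' : List (ι → Qbar)) : spanL (l ++ l') = spanL l ⊔ spanL l' := by
  rw [spanL, spanL, spanL, ← Submodule.span_union]; congr 1; ext x; simp

theorem spanL_map {κ : Type} (T : (ι → Qbar) →ₗ[Qbar] (κ → Qbar)) (l : List (ι → Qbar)) :
    spanL (l.map T) = (spanL l).map T := by
  rw [spanL, spanL, Submodule.map_span]; congr 1; ext x; simp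

theorem LIl_map {κ : Type} (T : (ι → Qbar) →ₗ[Qbar] (κ → Qbar)) {l : List (ι → Qbar)}
    (h : LIl l) (hT : ∀ x ∈ spanL l, T x = 0 → x = 0) : LIl (l.map T) := by
  induction l with
  | nil => exact LIl_nil
  | cons e l ih =>
    rw [LIl_cons] at h
    rw [List.map_cons, LIl_cons]
    refine ⟨ih h.1 fun x hx => hT x (by rw [spanL_cons]; exact Submodule.mem_sup_right hx), ?_⟩
    rw [spanL_map]
    rintro ⟨y, hy, hye⟩
    have h1 : y - e = 0 := hT _ (by
      rw [spanL_cons]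
      exact Submodule.sub_mem _ (Submodule.mem_sup_right hy)
        (Submodule.mem_sup_left (Submodule.mem_span_singleton_self e))) (by
      rw [map_sub, hye, sub_self])
    rw [sub_eq_zero] at h1
    exact h.2 (h1 ▸ hy)

theorem LIl_append {l l' : List (ι → Qbar)} (h : LIl l) (h' : LIl l')
    (hd : ∀ x, x ∈ spanL l → x ∈ spanL l' → x = 0) : LIl (l ++ l') := by
  induction l with
  | nil => exact h'
  | cons e l ih =>
    rw [LIl_cons] at h
    rw [List.cons_append, LIl_cons]
    have hsub : spanL l ≤ spanL (e :: l) := by rw [spanL_cons]; exact le_sup_right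
    have he : e ∈ spanL (e :: l) := by
      rw [spanL_cons]; exact Submodule.mem_sup_left (Submodule.mem_span_singleton_self e)
    refine ⟨ih h.1 fun x hx => hd x (hsub hx), fun hmem => ?_⟩
    rw [spanL_append, Submodule.mem_sup] at hmem
    obtain ⟨a, ha, b, hb, hab⟩ := hmem
    have : b = 0 := hd b (by
      rw [show b = e - a by rw [← hab]; abel]
      exact Submodule.sub_mem _ he (hsub ha)) hb
    rw [this, add_zero] at hab
    exact h.2 (hab ▸ ha)

theorem finrank_spanL [Fintype ι] {l : List (ι → Qbar)} (h : LIl l) :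
    Module.finrank Qbar (spanL l) = l.length := by
  have := finrank_span_eq_card h
  rw [Fintype.card_fin] at this
  rw [← this, spanL, ← Set.range_list_get]

theorem isBasisOf_length [Fintype ι] {l : List (ι → Qbar)} {X : Submodule Qbar (ι → Qbar)}
    (h : IsBasisOf l X) : l.length = Module.finrank Qbar X := by
  rw [isBasisOf_iff] at h
  rw [← finrank_spanL h.1, h.2]

end lists

/-! ## Elimination -/

section elim

variable {κ μ : Type}

/-- A nonzero coordinate of a vector, if there is one. -/
def findIdx (w : μ → Reg) : List μ → Prog (Option μ)
  | [] => pure none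
  | i :: l => ifz (w i) (findIdx w l) (pure (some i))

theorem sat_findIdx {w : μ → Reg} {v : μ → Qbar} {env : List Qbar} (hw : rep env w v) (l : List μ) :
    Sat (findIdx w l) env l.length fun _ o =>
      (o = none → ∀ i ∈ l, v i = 0) ∧ ∀ i, o = some i → v i ≠ 0 := by
  induction l with
  | nil => exact Sat.pure (by simp) (by simp)
  | cons i l ih =>
    refine sat_ifz (hw i) (fun h => ?_) fun h => ?_
    · refine ih.mono (by simp) fun _ o _ ⟨h1, h2⟩ => ⟨fun ho j hj => ?_, h2⟩
      rcases List.mem_cons.1 hj with rfl | hj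
      · exact h
      · exact h1 ho j hj
    · refine Sat.pure ?_ ⟨fun ho => by simp at ho, fun j hj => ?_⟩
      · rw [List.length_cons]; push_cast; linarith [(Nat.cast_nonneg l.length : (0 : ℝ) ≤ _)]
      · rw [← Option.some_injective _ hj]; exact h

def mapL {α β : Type} (f : α → Prog β) : List α → Prog (List β)
  | [] => pure []
  | a :: l => do
    let b ← f a
    let r ← mapL f l
    pure (b :: r)

theorem comp_mapL {α β α' β' : Type} [Rep α α'] [Rep β β'] {f : α → Prog β} {g : α' → β'}
    {env : List Qbar} {c : ℝ}
    (hf : ∀ env' a v, env <+: env' → rep env' a v → Comp (f a) env' c (g v)) {l : List α}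
    {v : List α'} (h : rep env l v) : Comp (mapL f l) env (v.length * c) (v.map g) := by
  induction l generalizing env v with
  | nil =>
    cases h
    exact Sat.pure (by simp) List.Forall₂.nil
  | cons a l ih =>
    obtain _ | ⟨h1, h2⟩ := h
    rename_i v1 v2
    refine Comp.bind (hf _ _ _ (List.prefix_refl _) h1) fun e1 b k1 hb => ?_
    refine Comp.bind (ih (fun e a v he => hf e a v (k1.trans he))
      (Rep.mono k1 (show rep env l v2 from h2))) fun e2 r k2 hr => ?_
    exact Sat.pure (by rw [List.length_cons]; push_cast; linarith)
      (List.Forall₂.cons (Rep.mono k2 hb) hr)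

variable [Fintype κ] [Fintype μ]

/-- The vectors `e` of the list come with their images `w` under a linear map. The result is a
basis of the kernel of this map on their span. -/
def elim : ℕ → List ((κ → Reg) × (μ → Reg)) → Prog (List (κ → Reg))
  | 0, _ => pure []
  | _ + 1, [] => pure []
  | n + 1, x :: t => do
    let o ← findIdx x.2 Finset.univ.toList
    match o with
    | none => do
      let r ← elim n t
      pure (x.1 :: r)
    | some i => do
      let t' ← mapL (fun y : (κ → Reg) × (μ → Reg) => do
        let c ← pdiv (y.2 i) (x.2 i)
        let e ← forAll fun k => do
          let p ← pmul c (x.1 k)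
          psub (y.1 k) p
        let w ← forAll fun k => do
          let p ← pmul c (x.2 k)
          psub (y.2 k) p
        pure (e, w)) t
      elim n t'

/-- Every vector costs one search for a nonzero coordinate of its image. A vector with nonzero image
serves as a pivot, is subtracted from at most `L` others, and is lost for the kernel. Hence the
expensive part is paid once per dimension lost, which makes the total over all passes of a loop
small. -/
theorem sat_elim (Z : Matrix μ κ Qbar) (n : ℕ) {L : ℝ} {l : List ((κ → Reg) × (μ → Reg))}
    {lv : List (κ → Qbar)} {env : List Qbar} (hn : lv.length ≤ n) (hL : (lv.length : ℝ) ≤ L)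
    (h : rep env l (lv.map fun e => (e, Z *ᵥ e))) (hLI : LIl lv) :
    Sat (elim n l) env (lv.length * Fintype.card μ +
      (lv.length - Module.finrank Qbar ↥(spanL lv ⊓ LinearMap.ker Z.mulVecLin)) *
        (L * (1 + 2 * Fintype.card κ + 2 * Fintype.card μ)))
      fun env' r => ∃ lv', rep env' r lv' ∧
        IsBasisOf lv' (spanL lv ⊓ LinearMap.ker Z.mulVecLin) := by
  induction n generalizing l lv env with
  | zero =>
    obtain rfl : lv = [] := List.length_eq_zero_iff.1 (by omega)
    refine Sat.pure ?_ ⟨[], List.Forall₂.nil, isBasisOf_iff.2 ⟨LIl_nil, by simp [spanL_nil]⟩⟩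
    rw [spanL_nil, bot_inf_eq]; simp
  | succ n ih =>
    cases lv with
    | nil =>
      cases h
      refine Sat.pure ?_ ⟨[], List.Forall₂.nil, isBasisOf_iff.2 ⟨LIl_nil, by simp [spanL_nil]⟩⟩
      rw [spanL_nil, bot_inf_eq]; simp
    | cons e lv =>
      rw [List.map_cons] at h
      obtain _ | ⟨h1, h2⟩ := h
      rename_i x t
      replace h2 : rep env t (lv.map fun e => (e, Z *ᵥ e)) := h2
      obtain ⟨hx1, hx2⟩ := h1
      simp only at hx1 hx2
      rw [List.length_cons] at hn hL ⊢
      rw [LIl_cons] at hLI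
      push_cast at hL
      have hn' : lv.length ≤ n := by omega
      have hK : (0 : ℝ) ≤ 1 + 2 * Fintype.card κ + 2 * Fintype.card μ := by positivity
      have hl0 : (0 : ℝ) ≤ lv.length := Nat.cast_nonneg _
      refine Sat.bind (sat_findIdx hx2 Finset.univ.toList) fun e1 o k1 ⟨ho1, ho2⟩ => ?_
      replace hx1 := Rep.mono k1 hx1; replace hx2 := Rep.mono k1 hx2
      replace h2 := Rep.mono k1 h2
      rw [Finset.length_toList, Finset.card_univ]
      cases o with
      | none =>
        have hZe : Z *ᵥ e = 0 := funext fun i => ho1 rfl i (Finset.mem_toList.2 (Finset.mem_univ i))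
        have hker : Submodule.span Qbar {e} ≤ LinearMap.ker Z.mulVecLin := by
          rw [Submodule.span_singleton_le_iff_mem, LinearMap.mem_ker, mulVecLin_apply, hZe]
        have hspan : spanL (e :: lv) ⊓ LinearMap.ker Z.mulVecLin =
            Submodule.span Qbar {e} ⊔ (spanL lv ⊓ LinearMap.ker Z.mulVecLin) := by
          -- The modular law, since `e` already lies in the kernel.
          rw [spanL_cons, sup_inf_assoc_of_le _ hker]
        have hbas : ∀ lv', IsBasisOf lv' (spanL lv ⊓ LinearMap.ker Z.mulVecLin) →
            IsBasisOf (e :: lv') (spanL (e :: lv) ⊓ LinearMap.ker Z.mulVecLin) := by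
          intro lv' hlv'
          rw [isBasisOf_iff] at hlv' ⊢
          rw [LIl_cons, spanL_cons, hlv'.2, hspan]
          exact ⟨⟨hlv'.1, fun hmem => hLI.2 hmem.1⟩, rfl⟩
        have hih := ih hn' (by linarith) h2 hLI.1
        obtain ⟨lv', -, hlv'⟩ := hih.2.2.2
        have hd : (Module.finrank Qbar ↥(spanL (e :: lv) ⊓ LinearMap.ker Z.mulVecLin) : ℝ) =
            Module.finrank Qbar ↥(spanL lv ⊓ LinearMap.ker Z.mulVecLin) + 1 := by
          rw [← isBasisOf_length hlv', ← isBasisOf_length (hbas lv' hlv'), List.length_cons]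
          push_cast; rfl
        refine Sat.bind hih fun e2 r k2 hr => ?_
        obtain ⟨lv', hr, hlv'⟩ := hr
        refine Sat.pure ?_ ⟨e :: lv', List.Forall₂.cons (Rep.mono k2 hx1) hr, hbas _ hlv'⟩
        rw [hd]; push_cast
        linarith
      | some i =>
        have hα := ho2 i rfl
        set α := (Z *ᵥ e) i with hαdef
        -- The pivot coordinate of the image, normalized so that `φ e = 1`. It vanishes on the
        -- kernel of `Z`.
        let φ : (κ → Qbar) →ₗ[Qbar] Qbar := α⁻¹ • (LinearMap.proj i ∘ₗ Z.mulVecLin)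
        have hφ : ∀ x, φ x = (Z *ᵥ x) i / α := fun x => by
          simp [φ, div_eq_inv_mul]
        have hφe : φ e = 1 := by rw [hφ, ← hαdef, div_self hα]
        -- The projection along `e` onto the kernel of `φ`. It kills the pivot and fixes the kernel
        -- of `Z`, so replacing the other vectors by their images under `T` keeps the intersection
        -- unchanged.
        let T : (κ → Qbar) →ₗ[Qbar] (κ → Qbar) := LinearMap.id - φ.smulRight e
        have hT : ∀ x, T x = x - φ x • e := fun x => rfl
        have hTspan : spanL (e :: lv) ⊓ LinearMap.ker Z.mulVecLin =
            spanL (lv.map T) ⊓ LinearMap.ker Z.mulVecLin := by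
          rw [spanL_cons, spanL_map]
          ext y
          simp only [Submodule.mem_inf, LinearMap.mem_ker, mulVecLin_apply]
          refine and_congr_left fun hy => ?_
          have hφy : φ y = 0 := by rw [hφ, hy]; simp
          constructor
          · intro hmem
            obtain ⟨a, ha, b, hb, hab⟩ := Submodule.mem_sup.1 hmem
            obtain ⟨c, rfl⟩ := Submodule.mem_span_singleton.1 ha
            refine ⟨b, hb, ?_⟩
            have : T y = T b := by
              rw [← hab, map_add, map_smul, hT e, hφe, one_smul, sub_self, smul_zero, zero_add]
            rw [← this, hT, hφy, zero_smul, sub_zero]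
          · rintro ⟨b, hb, rfl⟩
            rw [hT]
            exact Submodule.sub_mem _ (Submodule.mem_sup_right hb) (Submodule.mem_sup_left
              (Submodule.smul_mem _ _ (Submodule.mem_span_singleton_self e)))
        have hLI' : LIl (lv.map T) := LIl_map T hLI.1 fun y hy hTy => by
          rw [hT, sub_eq_zero] at hTy
          by_cases h0 : φ y = 0
          · rw [hTy, h0, zero_smul]
          · refine absurd ?_ hLI.2
            have h1 : (φ y)⁻¹ • y = e := (inv_smul_eq_iff₀ h0).2 hTy
            rw [← h1]
            exact Submodule.smul_mem _ _ hy
        rw [hTspan]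
        have hmap : ∀ env' (y : (κ → Reg) × (μ → Reg)) (v : (κ → Qbar) × (μ → Qbar)),
            e1 <+: env' → rep env' y v → Comp (do
              let c ← pdiv (y.2 i) (x.2 i)
              let e ← forAll fun k => do
                let p ← pmul c (x.1 k)
                psub (y.1 k) p
              let w ← forAll fun k => do
                let p ← pmul c (x.2 k)
                psub (y.2 k) p
              pure (e, w)) env' (1 + 2 * Fintype.card κ + 2 * Fintype.card μ)
              ((fun k => v.1 k - v.2 i / α * e k, fun k => v.2 k - v.2 i / α * (Z *ᵥ e) k) :
                (κ → Qbar) × (μ → Qbar)) := by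
          intro env' y v k hy
          obtain ⟨hy1, hy2⟩ := hy
          refine Comp.bind (comp_div (hy2 i) (Rep.mono k (hx2 i))) fun e2 c k2 hc => ?_
          refine Comp.bind (comp_forAll' (c := 2) (v := fun q => v.1 q - v.2 i / α * e q)
            fun q e3 k3 => ?_) fun e3 u k3 hu => ?_
          · refine Comp.bind (comp_mul (Rep.mono k3 hc) (Rep.mono ((k.trans k2).trans k3) (hx1 q)))
              fun e4 p k4 hp => ?_
            exact (comp_sub (Rep.mono ((k2.trans k3).trans k4) (hy1 q)) hp).mono (by norm_num) rfl
          refine Comp.bind (comp_forAll' (c := 2) (v := fun q => v.2 q - v.2 i / α * (Z *ᵥ e) q)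
            fun q e3' k3' => ?_) fun e4 w k4 hw => ?_
          · have k33 := k3.trans k3'
            refine Comp.bind (comp_mul (Rep.mono k33 hc) (Rep.mono ((k.trans k2).trans k33) (hx2 q)))
              fun e4 p k4 hp => ?_
            exact (comp_sub (Rep.mono ((k2.trans k33).trans k4) (hy2 q)) hp).mono (by norm_num) rfl
          exact Sat.pure (by linarith) ⟨Rep.mono k4 hu, hw⟩
        refine Comp.bind (comp_mapL hmap h2) fun e2 t' k2 ht' => ?_
        have hval : (List.map (fun v : (κ → Qbar) × (μ → Qbar) =>
            ((fun k => v.1 k - v.2 i / α * e k, fun k => v.2 k - v.2 i / α * (Z *ᵥ e) k) :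
                (κ → Qbar) × (μ → Qbar))) (lv.map fun e => (e, Z *ᵥ e))) =
            (lv.map T).map fun e => (e, Z *ᵥ e) := by
          rw [List.map_map, List.map_map]
          refine List.map_congr_left fun y _ => ?_
          simp only [Function.comp, hT, hφ]
          refine Prod.ext (funext fun k => ?_) (funext fun k => ?_)
          · simp
          · simp [mulVec_sub, mulVec_smul]
        rw [hval] at ht'
        refine (ih (by simpa using hn') (by simp; linarith) ht' hLI').mono ?_ fun _ _ _ h => h
        simp only [List.length_map]
        push_cast
        nlinarith [mul_le_mul_of_nonneg_right (show (lv.length : ℝ) ≤ L by linarith) hK]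

end elim

/-! ## The two loops -/

section stable
variable {V : Type} [AddCommGroup V] [Module Qbar V] [FiniteDimensional Qbar V]

/-- The subspaces computed by the first loop, for an endomorphism `f`. -/
def loopE (f : V →ₗ[Qbar] V) (K : Submodule Qbar V) : ℕ → Submodule Qbar V
  | 0 => K
  | i + 1 => loopE f K i ⊓ (loopE f K i).map (f ^ i)

/-- Since `f ^ i` maps `X` onto itself, `X` and its images under powers of `f` lie in the range of
every power of `f`. By Fitting's lemma `f` is injective there, so powers of `f` can be cancelled. -/
theorem eq_of_injOn_of_map_pow_eq {f : V →ₗ[Qbar] V} {X : Submodule Qbar V} {i : ℕ} (hi : 1 ≤ i)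
    (hX : X.map (f ^ i) = X) {x y : V} (hx : x ∈ X) (hy : y ∈ X) (a b : ℕ)
    (h : (f ^ a) x = (f ^ (a + b)) y) : x = (f ^ b) y := by
  obtain ⟨n₀, hn₀⟩ := Filter.eventually_atTop.1 (Module.End.eventually_disjoint_ker_pow_range_pow f)
  obtain ⟨n, hn, hna⟩ : ∃ n, Disjoint (LinearMap.ker (f ^ n)) (LinearMap.range (f ^ n)) ∧ a ≤ n :=
    ⟨max n₀ a, hn₀ _ (le_max_left _ _), le_max_right _ _⟩
  have hXr : ∀ k, X.map (f ^ (i * k)) = X := fun k => by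
    induction k with
    | zero => simp [Module.End.one_eq_id]
    | succ k ih =>
      rw [Nat.mul_succ, pow_add, Module.End.mul_eq_comp, Submodule.map_comp, hX, ih]
  have hr : ∀ w ∈ X, ∀ b, (f ^ b) w ∈ LinearMap.range (f ^ n) := by
    intro w hw b
    rw [← hXr n] at hw
    obtain ⟨u, -, rfl⟩ := hw
    have e : b + i * n = n + (b + (i - 1) * n) := by
      obtain ⟨i, rfl⟩ := Nat.exists_eq_add_of_le' hi
      simp; ring
    refine ⟨(f ^ (b + (i - 1) * n)) u, ?_⟩
    rw [← Module.End.mul_apply, ← Module.End.mul_apply, ← pow_add, ← pow_add, e]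
  have h0 : x - (f ^ b) y ∈ LinearMap.range (f ^ n) :=
    Submodule.sub_mem _ (by simpa using hr x hx 0) (hr y hy b)
  have h1 : x - (f ^ b) y ∈ LinearMap.ker (f ^ n) := by
    have : (f ^ a) (x - (f ^ b) y) = 0 := by
      rw [map_sub, h, ← Module.End.mul_apply, ← pow_add, sub_self]
    rw [LinearMap.mem_ker, ← Nat.sub_add_cancel hna, pow_add, Module.End.mul_apply, this, map_zero]
  exact sub_eq_zero.1 (Submodule.disjoint_def.1 hn _ h1 h0)

theorem finrank_lt_of_lt' {X Y : Submodule Qbar V} (h : X ≤ Y) (hne : X ≠ Y) :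
    Module.finrank Qbar X + 1 ≤ Module.finrank Qbar Y :=
  Submodule.finrank_lt_finrank_of_lt (lt_of_le_of_ne h hne)

theorem map_eq_of_le_map {f : V →ₗ[Qbar] V} {X : Submodule Qbar V} (h : X ≤ X.map f) :
    X.map f = X :=
  (Submodule.eq_of_le_of_finrank_le h (Submodule.finrank_map_le f X)).symm

omit [FiniteDimensional Qbar V] in
theorem loopE_succ_le (f : V →ₗ[Qbar] V) (K : Submodule Qbar V) (i : ℕ) :
    loopE f K (i + 1) ≤ loopE f K i := inf_le_left

omit [FiniteDimensional Qbar V] in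
theorem loopE_stable {f : V →ₗ[Qbar] V} {K : Submodule Qbar V} {i : ℕ}
    (h : (loopE f K i).map f = loopE f K i) (k : ℕ) : loopE f K (i + k) = loopE f K i := by
  have hp : ∀ j, (loopE f K i).map (f ^ j) = loopE f K i := fun j => by
    induction j with
    | zero => simp [Module.End.one_eq_id]
    | succ j ih => rw [pow_succ, Module.End.mul_eq_comp, Submodule.map_comp, h, ih]
  induction k with
  | zero => rfl
  | succ k ih => rw [← add_assoc, loopE, ih, hp, inf_idem]

/-- After more passes than the dimension of the space, the first loop reaches a subspace that the
endomorphism maps onto itself. -/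
theorem map_loopE_eq (f : V →ₗ[Qbar] V) (K : Submodule Qbar V) :
    (loopE f K (Module.finrank Qbar V + 1)).map f = loopE f K (Module.finrank Qbar V + 1) := by
  classical
  set c := Module.finrank Qbar V with hc
  have h1 : loopE f K 1 = K := by
    simp [loopE, Module.End.one_eq_id]
  -- Stagnation is sought from index `1` on: the pass of index `0` intersects with the image under
  -- `f ^ 0` and changes nothing.
  by_cases hex : ∃ i, 1 ≤ i ∧ i ≤ c ∧ loopE f K (i + 1) = loopE f K i
  · obtain ⟨i, ⟨hi1, hic, hi⟩, hlt⟩ : ∃ i, (1 ≤ i ∧ i ≤ c ∧ loopE f K (i + 1) = loopE f K i) ∧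
        ∀ j < i, ¬ (1 ≤ j ∧ j ≤ c ∧ loopE f K (j + 1) = loopE f K j) :=
      ⟨Nat.find hex, Nat.find_spec hex, fun j hj => Nat.find_min hex hj⟩
    -- Before the first stagnation each pass lowers the dimension.
    have hmin : ∀ j, 1 ≤ j → j ≤ i →
        Module.finrank Qbar (loopE f K j) + (j - 1) ≤ Module.finrank Qbar K := by
      intro j hj1 hji
      induction j, hj1 using Nat.le_induction with
      | base => rw [h1]; simp
      | succ j hj1 ih =>
        have h2 := ih (by omega)
        have h3 : loopE f K (j + 1) ≠ loopE f K j := fun he =>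
          hlt j (by omega) ⟨hj1, by omega, he⟩
        have := finrank_lt_of_lt' (loopE_succ_le f K j) h3
        omega
    obtain ⟨X, hX⟩ : ∃ X, X = loopE f K i := ⟨_, rfl⟩
    -- Stagnation at pass `i` only gives invariance under `f ^ i`; invariance under `f` still has to
    -- be gained from the remaining passes.
    have hXi : X.map (f ^ i) = X := by
      refine (Submodule.eq_of_le_of_finrank_le ?_ (Submodule.finrank_map_le _ X)).symm
      have : X ⊓ X.map (f ^ i) = X := by rw [hX]; exact hi
      exact inf_eq_left.1 this
    have hend : ∀ j, i ≤ j → j ≤ c + 1 → (loopE f K j).map f = loopE f K j →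
        (loopE f K (c + 1)).map f = loopE f K (c + 1) := by
      intro j _ hj h
      have := loopE_stable h (c + 1 - j)
      rw [Nat.add_sub_cancel' hj] at this
      rw [this, h]
    -- With `K = ⊤` no dimension is saved at the start and the count below would be short by one,
    -- but then every subspace of the loop is stable under `f`, and `X = f ^ i X ≤ f X`.
    by_cases hK : K = ⊤
    · have hinv : ∀ j, (loopE f K j).map f ≤ loopE f K j := by
        intro j
        induction j with
        | zero => rw [loopE, hK]; exact le_top
        | succ j ih =>
          refine le_inf ((Submodule.map_mono inf_le_left).trans ih) ?_
          refine (Submodule.map_mono inf_le_right).trans ?_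
          rw [← Submodule.map_comp, ← Module.End.mul_eq_comp, ← pow_succ', pow_succ,
            Module.End.mul_eq_comp, Submodule.map_comp]
          exact Submodule.map_mono ih
      refine hend i le_rfl (by omega) (le_antisymm (hinv i) ?_)
      have hpow : ∀ j, X.map (f ^ j) ≤ X := fun j => by
        induction j with
        | zero => simp [Module.End.one_eq_id]
        | succ j ih =>
          rw [pow_succ, Module.End.mul_eq_comp, Submodule.map_comp]
          exact (Submodule.map_mono (hX ▸ hinv i)).trans ih
      rw [← hX]
      conv_lhs => rw [← hXi]
      obtain ⟨i', hi'⟩ := Nat.exists_eq_add_of_le' hi1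
      rw [hi', pow_succ', Module.End.mul_eq_comp, Submodule.map_comp]
      exact Submodule.map_mono (hpow i')
    -- The dimension missing from `K` gives `dim X ≤ c - i`, exactly the number of passes that
    -- remain useful.
    · have hKc : Module.finrank Qbar K + 1 ≤ c := by
        have := Submodule.finrank_lt (s := K) (lt_top_iff_ne_top.2 hK).ne
        omega
      have hdim : Module.finrank Qbar X ≤ c - i := by
        have := hmin i hi1 le_rfl
        rw [← hX] at this
        omega
      -- After stagnation the loop keeps intersecting the translates `f ^ j X`, which are periodic
      -- in `j` with period `i`.
      let Y : ℕ → Submodule Qbar V := fun J => ⨅ j : Fin (J + 1), X.map (f ^ (j : ℕ))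
      have memY : ∀ J x, x ∈ Y J ↔ ∀ j ≤ J, x ∈ X.map (f ^ j) := fun J x => by
        simp only [Y, Submodule.mem_iInf]
        exact ⟨fun h j hj => h ⟨j, by omega⟩, fun h j => h j (by omega)⟩
      -- Images commute with this intersection thanks to the injectivity of
      -- `eq_of_injOn_of_map_pow_eq`.
      have hshift : ∀ J a x, x ∈ (Y J).map (f ^ a) ↔ ∀ j ≤ J, x ∈ X.map (f ^ (a + j)) := by
        intro J a x
        constructor
        · rintro ⟨y, hy, rfl⟩ j hj
          obtain ⟨w, hw, rfl⟩ := (memY J y).1 hy j hj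
          exact ⟨w, hw, by rw [pow_add]; rfl⟩
        · intro h
          obtain ⟨y, hy, hyx⟩ := h 0 (Nat.zero_le _)
          refine ⟨y, (memY J y).2 fun j hj => ?_, by simpa using hyx⟩
          obtain ⟨w, hw, hwx⟩ := h j hj
          exact ⟨w, hw, (eq_of_injOn_of_map_pow_eq hi1 hXi hy hw a j
            (by rw [hwx, ← hyx]; simp)).symm⟩
      have hper : ∀ j, X.map (f ^ (j + i)) = X.map (f ^ j) := fun j => by
        rw [pow_add, Module.End.mul_eq_comp, Submodule.map_comp, hXi]
      -- The pass of index `i + 1 + k` uses the exponent `i + 1 + k`, which by periodicity acts as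
      -- `k + 1`. It therefore appends the translates with exponents `k + 1, …, k + 1 + J`; as `k ≤
      -- J` there is no gap.
      have hstep : ∀ k, ∃ J, k ≤ J ∧ loopE f K (i + 1 + k) = Y J := by
        intro k
        induction k with
        | zero =>
          refine ⟨0, le_rfl, ?_⟩
          rw [add_zero, hi, ← hX]
          ext x
          rw [memY]
          simp [Module.End.one_eq_id]
        | succ k ih =>
          obtain ⟨J, hkJ, hJ⟩ := ih
          refine ⟨J + (k + 1), by omega, ?_⟩
          rw [← add_assoc, loopE, hJ]
          ext x
          rw [Submodule.mem_inf, hshift, memY, memY]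
          have e : ∀ j, X.map (f ^ (i + 1 + k + j)) = X.map (f ^ (k + 1 + j)) := fun j => by
            rw [show i + 1 + k + j = k + 1 + j + i by ring, hper]
          simp only [e]
          constructor
          · rintro ⟨ha, hb⟩ j hj
            rcases Nat.lt_or_ge J j with h | h
            · have := hb (j - (k + 1)) (by omega)
              rwa [Nat.add_sub_cancel' (by omega)] at this
            · exact ha j h
          · exact fun h => ⟨fun j hj => h j (by omega), fun j hj => h _ (by omega)⟩
      obtain ⟨J, hJ1, hJ2⟩ := hstep (c - i)
      rw [show i + 1 + (c - i) = c + 1 by omega] at hJ2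
      rw [hJ2]
      have hYle : ∀ j, Y (j + 1) ≤ Y j := fun j x hx =>
        (memY _ _).2 fun l hl => (memY _ _).1 hx l (by omega)
      have hYstab : ∀ j, Y (j + 1) = Y j → (Y j).map f = Y j := by
        intro j hj
        refine map_eq_of_le_map fun x hx => ?_
        rw [← pow_one f, hshift]
        intro l hl
        rw [← hj] at hx
        exact (memY _ _).1 hx (1 + l) (by omega)
      -- The decreasing sequence `Y` loses a dimension at each step until it first stagnates, and
      -- then it stays constant. Past `dim X` steps it must have stagnated.
      have hYdim : ∀ j, Y (j + 1) = Y j ∨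
          Module.finrank Qbar (Y (j + 1)) + (j + 1) ≤ Module.finrank Qbar X := by
        intro j
        induction j with
        | zero =>
          by_cases h : Y (0 + 1) = Y 0
          · exact Or.inl h
          · have hY0 : Y 0 ≤ X := fun x hx => by
              simpa [Module.End.one_eq_id] using (memY 0 x).1 hx 0 le_rfl
            have := finrank_lt_of_lt' (hYle 0) h
            exact Or.inr (this.trans (Submodule.finrank_mono hY0))
        | succ j ih =>
          rcases ih with h | h
          · left
            refine le_antisymm (hYle _) fun x hx => (memY _ _).2 fun l hl => ?_
            have hs := hYstab j h
            rcases Nat.lt_or_ge l (j + 2) with h' | h'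
            · exact (memY _ _).1 hx l (by omega)
            · obtain rfl : l = j + 1 + 1 := by omega
              rw [h, ← hs, ← pow_one f, hshift] at hx
              have hxj : x ∈ (Y (j + 1)).map (f ^ 1) := by
                rw [h, hshift]; exact hx
              rw [hshift] at hxj
              have := hxj (j + 1) le_rfl
              rwa [add_comm 1] at this
          · by_cases h' : Y (j + 1 + 1) = Y (j + 1)
            · exact Or.inl h'
            · have := finrank_lt_of_lt' (hYle (j + 1)) h'
              right; omega
      rcases hYdim J with h | h
      · exact hYstab J h
      · omega
  -- Without stagnation, the passes of index `1` to `c` each lower the dimension, and only the zero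
  -- subspace is left.
  · push Not at hex
    have hdim : ∀ j, 1 ≤ j → j ≤ c + 1 →
        Module.finrank Qbar (loopE f K j) + (j - 1) ≤ Module.finrank Qbar K := by
      intro j hj1 hj
      induction j, hj1 using Nat.le_induction with
      | base => rw [h1]; simp
      | succ j hj1 ih =>
        have h2 := ih (by omega)
        have := finrank_lt_of_lt' (loopE_succ_le f K j) (hex j hj1 (by omega))
        omega
    have h2 := hdim (c + 1) (by omega) le_rfl
    have h3 : Module.finrank Qbar K ≤ c := Submodule.finrank_le K
    have h4 : loopE f K (c + 1) = ⊥ := Submodule.finrank_eq_zero.1 (by omega)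
    rw [h4, Submodule.map_bot]

end stable

section loops
variable {ι κ : Type} [Fintype ι] [DecidableEq ι] [Fintype κ] (M : Matrix ι ι Qbar)
  (N : Matrix κ ι Qbar)

omit [Fintype κ] in
theorem loopOne_eq_loopE (i : ℕ) :
    loopOne M N i = loopE M.mulVecLin (LinearMap.ker N.mulVecLin) i := by
  induction i with
  | zero => rfl
  | succ i ih =>
    rw [loopOne, loopE, ih]
    congr 2
    rw [← Matrix.toLin'_apply', ← Matrix.toLin'_apply', Matrix.toLin'_pow]

theorem map_loopOne_eq :
    (loopOne M N (Fintype.card ι + 1)).map M.mulVecLin = loopOne M N (Fintype.card ι + 1) := by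
  have h := map_loopE_eq M.mulVecLin (LinearMap.ker N.mulVecLin)
  rw [Module.finrank_fintype_fun_eq_card] at h
  rw [loopOne_eq_loopE]; exact h

omit [Fintype κ] in
theorem loopOne_le_ker (i : ℕ) : loopOne M N i ≤ LinearMap.ker N.mulVecLin := by
  induction i with
  | zero => exact le_rfl
  | succ i ih => exact inf_le_left.trans ih

/-- The subspace is contained in `ker N` and `M` maps it onto itself, so every `N M ^ i` kills it.
-/
theorem loopTwo_eq (i : ℕ) :
    loopTwo M N (loopOne M N (Fintype.card ι + 1)) i = loopOne M N (Fintype.card ι + 1) := by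
  set X := loopOne M N (Fintype.card ι + 1) with hX
  have hMX : ∀ x ∈ X, M *ᵥ x ∈ X := fun x hx => by
    have := Submodule.mem_map_of_mem (f := M.mulVecLin) hx
    rwa [map_loopOne_eq] at this
  have hY : ∀ j, ∀ x ∈ X, loopY M N j *ᵥ x = 0 := by
    intro j
    induction j with
    | zero => exact fun x hx => loopOne_le_ker M N _ hx
    | succ j ih =>
      intro x hx
      rw [loopY, ← mulVec_mulVec]
      exact ih _ (hMX x hx)
  induction i with
  | zero => rfl
  | succ i ih => rw [loopTwo, ih]; exact inf_eq_left.2 fun x hx => hY (i + 1) x hx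

end loops

/-! ## Graded matrices -/

/-- The index set `ι` is split into classes, each of them embedded into `Ix J`. -/
structure Grading (ι τ : Type) (J : ℕ) where
  cl : ι → τ
  enc : ι → Ix J
  dec : τ → Ix J → Option ι
  dec_enc : ∀ i, dec (cl i) (enc i) = some i
  of_dec : ∀ {t x i}, dec t x = some i → cl i = t ∧ enc i = x

section grading
variable {ι ι' ι'' τ : Type} {J : ℕ}

def Grading.pack (g : Grading ι τ J) {R : Type} (z : R) (t : τ) (f : ι → R) (x : Ix J) : R :=
  (g.dec t x).elim z f

def Grading.packLin (g : Grading ι τ J) (t : τ) : (ι → Qbar) →ₗ[Qbar] (Ix J → Qbar) where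
  toFun := g.pack 0 t
  map_add' f f' := funext fun x => by
    simp only [Grading.pack, Pi.add_apply]; cases g.dec t x <;> simp
  map_smul' c f := funext fun x => by
    simp only [Grading.pack, Pi.smul_apply]; cases g.dec t x <;> simp

theorem Grading.packLin_apply (g : Grading ι τ J) (t : τ) (f : ι → Qbar) (x : Ix J) :
    g.packLin t f x = (g.dec t x).elim 0 f := rfl

theorem Grading.packLin_enc (g : Grading ι τ J) (f : ι → Qbar) (i : ι) :
    g.packLin (g.cl i) f (g.enc i) = f i := by
  rw [packLin_apply, g.dec_enc]; rfl

theorem Grading.ext_pack (g : Grading ι τ J) {f f' : ι → Qbar}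
    (h : ∀ t, g.packLin t f = g.packLin t f') : f = f' :=
  funext fun i => by rw [← g.packLin_enc f i, h, g.packLin_enc]

variable [DecidableEq τ]

def Grading.unpack (g : Grading ι τ J) {R : Type} (z : R) (t : τ) (h : Ix J → R) (i : ι) : R :=
  if g.cl i = t then h (g.enc i) else z

def Grading.unpackLin (g : Grading ι τ J) (t : τ) : (Ix J → Qbar) →ₗ[Qbar] (ι → Qbar) where
  toFun := g.unpack 0 t
  map_add' f f' := funext fun x => by
    simp only [Grading.unpack, Pi.add_apply]; split_ifs <;> simp
  map_smul' c f := funext fun x => by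
    simp only [Grading.unpack, Pi.smul_apply]; split_ifs <;> simp

/-- The vectors that vanish on the padding. -/
def Grading.valid (g : Grading ι τ J) (t : τ) : Submodule Qbar (Ix J → Qbar) where
  carrier := {h | ∀ x, g.dec t x = none → h x = 0}
  add_mem' ha hb x hx := by simp [ha x hx, hb x hx]
  zero_mem' _ _ := rfl
  smul_mem' c _ ha x hx := by simp [ha x hx]

omit [DecidableEq τ] in
theorem Grading.packLin_mem_valid (g : Grading ι τ J) (t : τ) (f : ι → Qbar) :
    g.packLin t f ∈ g.valid t := fun x hx => by rw [packLin_apply, hx]; rfl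

theorem Grading.pack_unpack (g : Grading ι τ J) {t : τ} {h : Ix J → Qbar} (hh : h ∈ g.valid t) :
    g.packLin t (g.unpackLin t h) = h := funext fun x => by
  rw [packLin_apply]
  cases hx : g.dec t x with
  | none => exact (hh x hx).symm
  | some i =>
    obtain ⟨h1, h2⟩ := g.of_dec hx
    change g.unpack 0 t h i = h x
    rw [unpack, if_pos h1, h2]

theorem Grading.pack_unpack_ne (g : Grading ι τ J) {t t' : τ} (h : Ix J → Qbar) (ht : t' ≠ t) :
    g.packLin t' (g.unpackLin t h) = 0 := funext fun x => by
  rw [packLin_apply]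
  cases hx : g.dec t' x with
  | none => rfl
  | some i =>
    obtain ⟨h1, h2⟩ := g.of_dec hx
    change g.unpack 0 t h i = 0
    rw [unpack, if_neg (by rw [h1]; exact ht)]

/-- The vectors whose components in the classes are in given subspaces. -/
def Grading.assemble (g : Grading ι τ J) (X : τ → Submodule Qbar (Ix J → Qbar)) :
    Submodule Qbar (ι → Qbar) := ⨅ t, (X t).comap (g.packLin t)

omit [DecidableEq τ] in
theorem Grading.mem_assemble (g : Grading ι τ J) {X : τ → Submodule Qbar (Ix J → Qbar)}
    {f : ι → Qbar} : f ∈ g.assemble X ↔ ∀ t, g.packLin t f ∈ X t := by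
  simp [assemble, Submodule.mem_iInf]

variable [Fintype τ] [Fintype ι] [Fintype ι']

/-- The union of bases of the components. -/
def Grading.joinList (g : Grading ι τ J) {R : Type} (z : R) (l : τ → List (Ix J → R))
    (T : List τ) : List (ι → R) :=
  (T.map fun t => (l t).map (g.unpack z t)).flatten

omit [Fintype ι] in
-- The space is the direct sum of its classes. The inclusion in `g.valid t` excludes vectors that
-- live on the padding and would be lost when unpacked.
theorem Grading.isBasisOf_joinList (g : Grading ι τ J) {X : τ → Submodule Qbar (Ix J → Qbar)}
    (hX : ∀ t, X t ≤ g.valid t) {l : τ → List (Ix J → Qbar)} (hl : ∀ t, IsBasisOf (l t) (X t)) :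
    IsBasisOf (g.joinList 0 l Finset.univ.toList) (g.assemble X) := by
  -- Induction over the classes already treated: the partial list spans the vectors of the assembled
  -- subspace that vanish outside of these classes.
  have key : ∀ T : List τ, T.Nodup → LIl (g.joinList 0 l T) ∧
      ∀ f, f ∈ spanL (g.joinList 0 l T) ↔ f ∈ g.assemble X ∧ ∀ t, t ∉ T → g.packLin t f = 0 := by
    intro T hT
    induction T with
    | nil =>
      refine ⟨LIl_nil, fun f => ?_⟩
      rw [joinList, List.map_nil, List.flatten_nil, spanL_nil, Submodule.mem_bot]
      constructor
      · rintro rfl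
        exact ⟨Submodule.zero_mem _, fun t _ => map_zero _⟩
      · rintro ⟨_, h⟩
        exact g.ext_pack fun t => by rw [h t (by simp), map_zero]
    | cons t T ih =>
      obtain ⟨ht, hT⟩ := List.nodup_cons.1 hT
      obtain ⟨ih1, ih2⟩ := ih hT
      obtain ⟨hb1, hb2⟩ := isBasisOf_iff.1 (hl t)
      have hsplit : g.joinList 0 l (t :: T) =
          (l t).map (g.unpackLin t) ++ g.joinList 0 l T := rfl
      have hmem : ∀ f, f ∈ spanL ((l t).map (g.unpackLin t)) ↔
          g.packLin t f ∈ X t ∧ ∀ t' ≠ t, g.packLin t' f = 0 := by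
        intro f
        rw [spanL_map, hb2]
        constructor
        · rintro ⟨h, hh, rfl⟩
          rw [g.pack_unpack (hX t hh)]
          exact ⟨hh, fun t' ht' => g.pack_unpack_ne h ht'⟩
        · rintro ⟨h1, h2⟩
          refine ⟨_, h1, g.ext_pack fun t' => ?_⟩
          by_cases htt : t' = t
          · subst htt; rw [g.pack_unpack (g.packLin_mem_valid _ _)]
          · rw [g.pack_unpack_ne _ htt, h2 t' htt]
      rw [hsplit]
      refine ⟨LIl_append (LIl_map _ hb1 fun x hx h0 => ?_) ih1 fun f hf hf' => ?_, fun f => ?_⟩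
      · rw [hb2] at hx
        rw [← g.pack_unpack (hX t hx), h0, map_zero]
      · rw [hmem] at hf
        rw [ih2] at hf'
        refine g.ext_pack fun t' => ?_
        rw [map_zero]
        by_cases htt : t' = t
        · subst htt; exact hf'.2 _ ht
        · exact hf.2 t' htt
      · rw [spanL_append, Submodule.mem_sup]
        constructor
        · rintro ⟨a, ha, b, hb, rfl⟩
          rw [hmem] at ha
          rw [ih2] at hb
          rw [g.mem_assemble]
          refine ⟨fun t' => ?_, fun t' ht' => ?_⟩
          · rw [map_add]
            refine Submodule.add_mem _ ?_ (g.mem_assemble.1 hb.1 t')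
            by_cases htt : t' = t
            · subst htt; exact ha.1
            · rw [ha.2 t' htt]; exact Submodule.zero_mem _
          · rw [List.mem_cons, not_or] at ht'
            rw [map_add, ha.2 t' ht'.1, hb.2 t' ht'.2, add_zero]
        · rintro ⟨h1, h2⟩
          rw [g.mem_assemble] at h1
          have hpu : ∀ t', g.packLin t' (g.unpackLin t (g.packLin t f)) =
              if t' = t then g.packLin t f else 0 := fun t' => by
            split_ifs with htt
            · subst htt; exact g.pack_unpack (g.packLin_mem_valid _ _)
            · exact g.pack_unpack_ne _ htt
          refine ⟨g.unpackLin t (g.packLin t f), ?_, f - g.unpackLin t (g.packLin t f), ?_, by abel⟩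
          · rw [hmem, hpu, if_pos rfl]
            exact ⟨h1 t, fun t' ht' => by rw [hpu, if_neg ht']⟩
          · rw [ih2, g.mem_assemble]
            constructor
            · intro t'
              rw [map_sub, hpu]
              split_ifs with htt
              · subst htt; rw [sub_self]; exact Submodule.zero_mem _
              · rw [sub_zero]; exact h1 t'
            · intro t' ht'
              rw [map_sub, hpu]
              split_ifs with htt
              · subst htt; rw [sub_self]
              · rw [sub_zero]
                exact h2 t' (by rw [List.mem_cons, not_or]; exact ⟨htt, ht'⟩)
  obtain ⟨h1, h2⟩ := key _ (Finset.nodup_toList Finset.univ)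
  refine isBasisOf_iff.2 ⟨h1, Submodule.ext fun f => ?_⟩
  rw [h2]
  exact and_iff_left_iff_imp.2 fun _ t ht => absurd (Finset.mem_toList.2 (Finset.mem_univ t)) ht

/-- After sorting the indices by classes, such a matrix has at most one nonzero block per row and
column of blocks, in the pattern of `σ`. Products compose the permutations. -/
def IsGraded (g' : Grading ι' τ J) (g : Grading ι τ J) (σ : Equiv.Perm τ) (D : Matrix ι' ι Qbar) :
    Prop := ∀ i j, D i j ≠ 0 → g'.cl i = σ (g.cl j)

/-- The block of a graded matrix in the columns of class `t`. -/
def gblk (g' : Grading ι' τ J) (g : Grading ι τ J) (σ : Equiv.Perm τ) {R : Type} (z : R)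
    (D : ι' → ι → R) (t : τ) : Ix J → Ix J → R := fun x y =>
  (g'.dec (σ t) x).elim z fun i => (g.dec t y).elim z fun j => D i j

def mgblk (g' : Grading ι' τ J) (g : Grading ι τ J) (σ : Equiv.Perm τ) (D : Matrix ι' ι Qbar)
    (t : τ) : Matrix (Ix J) (Ix J) Qbar := of (gblk g' g σ 0 D t)

omit [DecidableEq τ] [Fintype τ] [Fintype ι] [Fintype ι'] in
theorem rep_gblk {env : List Qbar} {z : Reg} (hz : rep env z 0) (g' : Grading ι' τ J)
    (g : Grading ι τ J) (σ : Equiv.Perm τ) {r : ι' → ι → Reg} {D : Matrix ι' ι Qbar}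
    (h : rep env r D) (t : τ) : rep env (gblk g' g σ z r t) (mgblk g' g σ D t) := fun x y => by
  change rep env (gblk g' g σ z r t x y) (gblk g' g σ 0 D t x y)
  unfold gblk
  cases g'.dec (σ t) x with
  | none => exact hz
  | some i =>
    cases g.dec t y with
    | none => exact hz
    | some j => exact h i j

omit [Fintype τ] [Fintype ι'] in
theorem Grading.sum_dec (g : Grading ι τ J) (t : τ) (h : ι → Qbar) :
    ∑ x, (g.dec t x).elim 0 h = ∑ i, if g.cl i = t then h i else 0 := by
  rw [← Finset.sum_filter]
  symm
  refine Finset.sum_of_injOn g.enc ?_ ?_ ?_ ?_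
  · intro i hi j hj hij
    have h1 := g.dec_enc i
    have h2 := g.dec_enc j
    rw [(Finset.mem_filter.1 hi).2] at h1
    rw [(Finset.mem_filter.1 hj).2, ← hij, h1] at h2
    exact Option.some_injective _ h2
  · exact fun i _ => Finset.mem_coe.2 (Finset.mem_univ _)
  · intro x _ hx
    cases hd : g.dec t x with
    | none => rfl
    | some i =>
      obtain ⟨h1, h2⟩ := g.of_dec hd
      exact absurd ⟨i, Finset.mem_coe.2 (Finset.mem_filter.2 ⟨Finset.mem_univ _, h1⟩), h2⟩ hx
  · intro i hi
    rw [← (Finset.mem_filter.1 hi).2, g.dec_enc]; rfl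

omit [Fintype τ] [Fintype ι'] in
theorem packLin_mulVec {g' : Grading ι' τ J} {g : Grading ι τ J} {σ : Equiv.Perm τ}
    {D : Matrix ι' ι Qbar} (h : IsGraded g' g σ D) (t : τ) (f : ι → Qbar) :
    g'.packLin (σ t) (D *ᵥ f) = mgblk g' g σ D t *ᵥ g.packLin t f := funext fun x => by
  rw [g'.packLin_apply]
  simp only [mulVec, dotProduct, mgblk, of_apply, gblk]
  cases hx : g'.dec (σ t) x with
  | none => simp
  | some i =>
    simp only [Option.elim_some]
    have e : ∀ y, ((g.dec t y).elim 0 fun j => D i j) * g.packLin t f y =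
        (g.dec t y).elim 0 fun j => D i j * f j := fun y => by
      rw [g.packLin_apply]; cases g.dec t y <;> simp
    rw [Finset.sum_congr rfl fun y _ => e y, g.sum_dec]
    refine Finset.sum_congr rfl fun j _ => ?_
    split_ifs with hj
    · rfl
    · have : D i j = 0 := by
        by_contra hne
        have h1 := h i j hne
        rw [(g'.of_dec hx).1] at h1
        exact hj (σ.injective h1.symm)
      change D i j * f j = 0
      rw [this, zero_mul]

omit [DecidableEq τ] [Fintype τ] [Fintype ι] in
theorem IsGraded.mul {g'' : Grading ι'' τ J} {g' : Grading ι' τ J} {g : Grading ι τ J}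
    {σ' σ : Equiv.Perm τ} {D' : Matrix ι'' ι' Qbar} {D : Matrix ι' ι Qbar}
    (h' : IsGraded g'' g' σ' D') (h : IsGraded g' g σ D) :
    IsGraded g'' g (σ' * σ) (D' * D) := fun i j hij => by
  rw [mul_apply] at hij
  obtain ⟨k, -, hk⟩ := Finset.exists_ne_zero_of_sum_ne_zero hij
  rw [h' i k (left_ne_zero_of_mul hk), h k j (right_ne_zero_of_mul hk)]; rfl

omit [Fintype τ] [Fintype ι] in
-- Only the class `σ t` contributes to the inner sum. A product of graded matrices thus costs one
-- small product per class.
theorem mgblk_mul (g'' : Grading ι'' τ J) {g' : Grading ι' τ J} {g : Grading ι τ J}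
    (σ' : Equiv.Perm τ) {σ : Equiv.Perm τ} (D' : Matrix ι'' ι' Qbar) {D : Matrix ι' ι Qbar}
    (h : IsGraded g' g σ D) (t : τ) :
    mgblk g'' g (σ' * σ) (D' * D) t = mgblk g'' g' σ' D' (σ t) * mgblk g' g σ D t := by
  ext x y : 1
  rw [mul_apply]
  simp only [mgblk, of_apply, gblk, Equiv.Perm.mul_apply]
  cases g''.dec (σ' (σ t)) x with
  | none => simp
  | some i =>
    cases hy : g.dec t y with
    | none =>
      simp only [Option.elim_none, Option.elim_some]
      refine (Finset.sum_eq_zero fun w _ => ?_).symm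
      cases g'.dec (σ t) w <;> simp
    | some j =>
      simp only [Option.elim_some]
      have e : ∀ w, ((g'.dec (σ t) w).elim 0 fun k => D' i k) *
          ((g'.dec (σ t) w).elim 0 fun k => D k j) =
          (g'.dec (σ t) w).elim 0 fun k => D' i k * D k j := fun w => by
        cases g'.dec (σ t) w <;> simp
      rw [Finset.sum_congr rfl fun w _ => e w, g'.sum_dec, mul_apply]
      refine Finset.sum_congr rfl fun k _ => ?_
      split_ifs with hk
      · rfl
      · have : D k j = 0 := by
          by_contra hne
          have h1 := h k j hne
          rw [(g.of_dec hy).1] at h1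
          exact hk h1
        rw [this, mul_zero]

omit [DecidableEq τ] [Fintype τ] [Fintype ι] in
theorem isGraded_one [DecidableEq ι] (g : Grading ι τ J) : IsGraded g g 1 1 := fun i j h => by
  rw [one_apply] at h
  split_ifs at h with hij
  · rw [hij]; rfl
  · exact absurd rfl h

omit [DecidableEq τ] [Fintype τ] in
theorem IsGraded.pow [DecidableEq ι] {g : Grading ι τ J} {σ : Equiv.Perm τ} {M : Matrix ι ι Qbar}
    (h : IsGraded g g σ M) (i : ℕ) : IsGraded g g (σ ^ i) (M ^ i) := by
  induction i with
  | zero => exact isGraded_one g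
  | succ i ih => rw [pow_succ, pow_succ]; exact ih.mul h

/-- The components of the subspaces computed by the first loop. -/
def loopC (g' : Grading ι' τ J) (g : Grading ι τ J) [DecidableEq ι] (σ' σ : Equiv.Perm τ)
    (N : Matrix ι' ι Qbar) (M : Matrix ι ι Qbar) : ℕ → τ → Submodule Qbar (Ix J → Qbar)
  | 0, t => g.valid t ⊓ LinearMap.ker (mgblk g' g σ' N t).mulVecLin
  | i + 1, s => loopC g' g σ' σ N M i s ⊓
      (loopC g' g σ' σ N M i ((σ ^ i).symm s)).map
        (mgblk g g (σ ^ i) (M ^ i) ((σ ^ i).symm s)).mulVecLin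

omit [DecidableEq τ] [Fintype τ] [Fintype ι'] in
theorem loopC_le_valid [DecidableEq ι] (g' : Grading ι' τ J) (g : Grading ι τ J)
    (σ' σ : Equiv.Perm τ) (N : Matrix ι' ι Qbar) (M : Matrix ι ι Qbar) (i : ℕ) (t : τ) :
    loopC g' g σ' σ N M i t ≤ g.valid t := by
  induction i with
  | zero => exact inf_le_left
  | succ i ih => exact inf_le_left.trans ih

omit [Fintype τ] [Fintype ι'] in
-- A graded matrix sends different classes to different classes, so kernels and images decompose and
-- the loop runs in all classes independently, up to the permutation `σ ^ i`.
theorem loopOne_eq_assemble [DecidableEq ι] {g' : Grading ι' τ J} {g : Grading ι τ J}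
    {σ' σ : Equiv.Perm τ} {N : Matrix ι' ι Qbar} {M : Matrix ι ι Qbar} (hN : IsGraded g' g σ' N)
    (hM : IsGraded g g σ M) (i : ℕ) :
    loopOne M N i = g.assemble (loopC g' g σ' σ N M i) := by
  induction i with
  | zero =>
    ext f
    rw [g.mem_assemble, loopOne, LinearMap.mem_ker, mulVecLin_apply]
    simp only [loopC, Submodule.mem_inf, LinearMap.mem_ker, mulVecLin_apply]
    constructor
    · intro h t
      refine ⟨g.packLin_mem_valid t f, ?_⟩
      rw [← packLin_mulVec hN, h, map_zero]
    · intro h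
      refine g'.ext_pack fun s => ?_
      obtain ⟨t, rfl⟩ := σ'.surjective s
      rw [packLin_mulVec hN, (h t).2, map_zero]
  | succ i ih =>
    ext f
    rw [g.mem_assemble, loopOne, ih, Submodule.mem_inf]
    simp only [loopC, Submodule.mem_inf, Submodule.mem_map, mulVecLin_apply]
    constructor
    · rintro ⟨h1, h, hh, rfl⟩ s
      refine ⟨g.mem_assemble.1 h1 s, g.packLin ((σ ^ i).symm s) h, g.mem_assemble.1 hh _, ?_⟩
      rw [← packLin_mulVec (hM.pow i), Equiv.apply_symm_apply]
    · intro h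
      refine ⟨g.mem_assemble.2 fun t => (h t).1, ?_⟩
      choose y hy1 hy2 using fun t => (h ((σ ^ i) t)).2
      simp only [Equiv.symm_apply_apply] at hy1 hy2
      -- The preimages chosen class by class glue to one vector because they vanish on the padding.
      have hpack : ∀ t, g.packLin t (fun j => y (g.cl j) (g.enc j)) = y t := by
        intro t
        funext x
        rw [g.packLin_apply]
        cases hx : g.dec t x with
        | none => exact (loopC_le_valid g' g σ' σ N M i t (hy1 t) x hx).symm
        | some j =>
          obtain ⟨e1, e2⟩ := g.of_dec hx
          rw [← e1, ← e2]; rfl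
      refine ⟨fun j => y (g.cl j) (g.enc j), g.mem_assemble.2 fun t => ?_, g.ext_pack fun s => ?_⟩
      · rw [hpack]; exact hy1 t
      · obtain ⟨t, rfl⟩ := (σ ^ i).surjective s
        rw [packLin_mulVec (hM.pow i), hpack]; exact hy2 t

end grading

/-! ## Programs for the loops -/

/-- Computes the successive states of a loop. -/
def iterP {α : Type} (a₀ : Prog α) (step : ℕ → α → Prog α) : ℕ → Prog (ℕ → α)
  | 0 => do
    let a ← a₀
    pure fun _ => a
  | i + 1 => do
    let h ← iterP a₀ step i
    let a ← step i (h i)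
    pure fun k => if k ≤ i then h k else a

theorem sat_iterP {α : Type} {a₀ : Prog α} {step : ℕ → α → Prog α} {env : List Qbar}
    {P : ℕ → List Qbar → α → Prop} {c₀ : ℝ} {c : ℕ → ℝ}
    (hP : ∀ i e e' a, e <+: e' → P i e a → P i e' a) (h₀ : Sat a₀ env c₀ (P 0)) (n : ℕ)
    (hs : ∀ i < n, ∀ env' a, env <+: env' → P i env' a → Sat (step i a) env' (c i) (P (i + 1))) :
    Sat (iterP a₀ step n) env (c₀ + ∑ i ∈ Finset.range n, c i)
      fun e h => ∀ k ≤ n, P k e (h k) := by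
  induction n with
  | zero =>
    refine Sat.bind h₀ fun e a _ ha => Sat.pure (by simp) fun k hk => ?_
    rw [Nat.le_zero.1 hk]; exact ha
  | succ n ih =>
    refine Sat.bind (ih fun i hi => hs i (by omega)) fun e h h1 hh => ?_
    refine Sat.bind (hs n (Nat.lt_succ_self n) e _ h1 (hh n le_rfl)) fun e' a h2 ha => ?_
    refine Sat.pure (by rw [Finset.sum_range_succ]; linarith) fun k hk => ?_
    by_cases hkn : k ≤ n
    · rw [if_pos hkn]; exact hP _ _ _ _ h2 (hh k hkn)
    · rw [if_neg hkn, show k = n + 1 by omega]; exact ha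

/-- The list of registers represents a basis of the subspace. -/
def BRep {κ : Type} (env : List Qbar) (l : List (κ → Reg)) (X : Submodule Qbar (κ → Qbar)) : Prop :=
  ∃ lv, rep env l lv ∧ IsBasisOf lv X

theorem BRep.mono {κ : Type} {env env' : List Qbar} {l : List (κ → Reg)}
    {X : Submodule Qbar (κ → Qbar)} (h : env <+: env') (hl : BRep env l X) : BRep env' l X :=
  let ⟨lv, h1, h2⟩ := hl
  ⟨lv, Rep.mono h h1, h2⟩

/-! ### Lists of vectors as columns of square matrices of size `2 ^ J`. -/

section cols
variable {J : ℕ}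

/-- The matrix with given columns, completed by zeros. -/
def cols {R : Type} (z : R) (l : List (Ix J → R)) : Ix J → Ix J → R := fun x y =>
  (l[(ixEquiv J y : ℕ)]?).elim z fun e => e x

def mcols (l : List (Ix J → Qbar)) : Matrix (Ix J) (Ix J) Qbar := of (cols 0 l)

theorem rep_cols {env : List Qbar} {z : Reg} (hz : rep env z 0) {l : List (Ix J → Reg)}
    {lv : List (Ix J → Qbar)} (h : rep env l lv) : rep env (cols z l) (mcols lv) := fun x y => by
  obtain ⟨hlen, hget⟩ := List.forall₂_iff_get.1 (show List.Forall₂ _ _ _ from h)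
  change rep env (cols z l x y) (cols 0 lv x y)
  unfold cols
  by_cases hy : (ixEquiv J y : ℕ) < l.length
  · rw [List.getElem?_eq_getElem hy, List.getElem?_eq_getElem (hlen ▸ hy)]
    exact hget _ hy (hlen ▸ hy) x
  · rw [List.getElem?_eq_none (not_lt.1 hy), List.getElem?_eq_none (hlen ▸ not_lt.1 hy)]
    exact hz

theorem length_le_of_LIl {lv : List (Ix J → Qbar)} (h : LIl lv) : lv.length ≤ 2 ^ J := by
  have h1 := LinearIndependent.fintype_card_le_finrank (show LinearIndependent Qbar _ from h)
  rwa [Fintype.card_fin, Module.finrank_fintype_fun_eq_card, card_Ix] at h1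

theorem mcols_mulVec {lv : List (Ix J → Qbar)} (h : lv.length ≤ 2 ^ J) (y : Ix J → Qbar) :
    mcols lv *ᵥ y = ∑ i : Fin lv.length, y ((ixEquiv J).symm (i.castLE h)) • lv.get i := by
  funext x
  rw [Finset.sum_apply]
  simp only [mulVec, dotProduct, mcols, of_apply, Pi.smul_apply, smul_eq_mul]
  symm
  refine Finset.sum_of_injOn (fun i : Fin lv.length => (ixEquiv J).symm (i.castLE h)) ?_ ?_ ?_ ?_
  · intro i _ i' _ hii
    exact Fin.castLE_injective h ((ixEquiv J).symm.injective hii)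
  · exact fun _ _ => Finset.mem_coe.2 (Finset.mem_univ _)
  · intro w _ hw
    have hlt : ¬ (ixEquiv J w : ℕ) < lv.length := fun hlt => hw
      ⟨⟨_, hlt⟩, Finset.mem_coe.2 (Finset.mem_univ _), by
        rw [Equiv.symm_apply_eq]; exact Fin.ext rfl⟩
    unfold cols
    rw [List.getElem?_eq_none (not_lt.1 hlt)]; simp
  · intro i _
    unfold cols
    rw [Equiv.apply_symm_apply, List.getElem?_eq_getElem (by simp), mul_comm]; rfl

theorem exists_mcols_mulVec {lv : List (Ix J → Qbar)} (h : lv.length ≤ 2 ^ J) {x : Ix J → Qbar} :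
    (∃ y, mcols lv *ᵥ y = x) ↔ x ∈ spanL lv := by
  have hsp : spanL lv = Submodule.span Qbar (Set.range fun i : Fin lv.length => lv.get i) := by
    rw [spanL]; congr 1; ext x; simp [List.mem_iff_get]
  rw [hsp, Submodule.mem_span_range_iff_exists_fun]
  constructor
  · rintro ⟨y, rfl⟩
    exact ⟨_, (mcols_mulVec h y).symm⟩
  · rintro ⟨c, rfl⟩
    refine ⟨fun w => if hw : (ixEquiv J w : ℕ) < lv.length then c ⟨_, hw⟩ else 0, ?_⟩
    rw [mcols_mulVec h]
    refine Finset.sum_congr rfl fun i _ => ?_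
    simp

/-- Each vector of a list, together with the corresponding column of a matrix. -/
def attachCols {κ : Type} (z : Reg) (w : κ → Ix J → Reg) (l : List (Ix J → Reg)) :
    List ((Ix J → Reg) × (κ → Reg)) :=
  l.mapIdx fun i e => (e, fun x => if h : i < 2 ^ J then w x ((ixEquiv J).symm ⟨i, h⟩) else z)

theorem rep_attachCols {env : List Qbar} {z : Reg} {w : Ix J → Ix J → Reg}
    {Z : Matrix (Ix J) (Ix J) Qbar} {l : List (Ix J → Reg)} {lv : List (Ix J → Qbar)}
    (hlv : lv.length ≤ 2 ^ J) (h : rep env l lv) (hw : rep env w (Z * mcols lv)) :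
    rep env (attachCols z w l) (lv.map fun e => (e, Z *ᵥ e)) := by
  obtain ⟨hlen, hget⟩ := List.forall₂_iff_get.1 (show List.Forall₂ _ _ _ from h)
  refine List.forall₂_iff_get.2 ⟨by simp [attachCols, hlen], fun i h1 h2 => ?_⟩
  simp only [attachCols, List.length_mapIdx] at h1
  have h2' : i < lv.length := hlen ▸ h1
  have hi : i < 2 ^ J := h2'.trans_le hlv
  simp only [attachCols, List.get_eq_getElem, List.getElem_mapIdx, List.getElem_map, dif_pos hi]
  refine ⟨hget i h1 h2', fun x => ?_⟩
  have := hw x ((ixEquiv J).symm ⟨i, hi⟩)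
  rw [mul_apply] at this
  convert this using 1
  simp only [mulVec, dotProduct, mcols, of_apply]
  refine Finset.sum_congr rfl fun y _ => ?_
  unfold cols
  rw [Equiv.apply_symm_apply, List.getElem?_eq_getElem h2']; rfl

end cols

/-! ### Intersections with kernels and images. -/

section fast
variable {s : ℕ → List Instr} {z : Reg} {j : ℕ} {V : ℝ} {env : List Qbar}

/-- Intersection of a subspace with the kernel of a matrix. -/
def restrict (s : ℕ → List Instr) (z : Reg) (j : ℕ) (w : Ix (j + 2) → Ix (j + 2) → Reg)
    (l : List (Ix (j + 2) → Reg)) : Prog (List (Ix (j + 2) → Reg)) := do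
  let u ← mm s z j (j + 2) w (cols z l)
  elim (2 ^ (j + 2)) (attachCols z u l)

/-- One fast product yields the images of all basis vectors. The elimination that follows is cubic
in the worst case, but is charged to the drop in dimension. -/
theorem sat_restrict (hs : MatMul s j V) {w : Ix (j + 2) → Ix (j + 2) → Reg}
    {Z : Matrix (Ix (j + 2)) (Ix (j + 2)) Qbar} {l : List (Ix (j + 2) → Reg)}
    {X Y : Submodule Qbar (Ix (j + 2) → Qbar)} (hz : rep env z 0) (hw : rep env w Z)
    (hl : BRep env l X) (hY : X ⊓ LinearMap.ker Z.mulVecLin = Y) :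
    Sat (restrict s z j w l) env (8 * (4 ^ (j + 2) * V) +
        ((Module.finrank Qbar X : ℝ) - Module.finrank Qbar Y) * (5 * 4 ^ (j + 2)))
      fun env' r => BRep env' r Y := by
  subst hY
  obtain ⟨lv, hlv, hb⟩ := hl
  obtain ⟨hb1, hb2⟩ := isBasisOf_iff.1 hb
  have hlen := length_le_of_LIl hb1
  refine Comp.bind (comp_mm hs le_rfl hz hw (rep_cols hz hlv)) fun e1 u h1 hu => ?_
  replace hlv := Rep.mono h1 hlv
  refine (sat_elim Z _ hlen (L := 2 ^ (j + 2)) (by exact_mod_cast hlen)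
    (rep_attachCols hlen hlv hu) hb1).mono ?_ ?_
  · rw [hb2, isBasisOf_length hb, card_Ix]
    have hV := hs.one_le
    have hd : (0 : ℝ) ≤ (Module.finrank Qbar X : ℝ) -
        Module.finrank Qbar ↥(X ⊓ LinearMap.ker Z.mulVecLin) := by
      rw [sub_nonneg]; exact_mod_cast Submodule.finrank_mono inf_le_left
    have hX : (Module.finrank Qbar X : ℝ) ≤ 2 ^ (j + 2) := by
      rw [← isBasisOf_length hb]; exact_mod_cast hlen
    have h4 : (4 : ℝ) ^ (j + 2) = 2 ^ (j + 2) * 2 ^ (j + 2) := by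
      rw [← mul_pow]; norm_num
    have h2 : (1 : ℝ) ≤ 2 ^ (j + 2) := one_le_pow₀ (by norm_num)
    push_cast
    have e1 : (Module.finrank Qbar X : ℝ) * 2 ^ (j + 2) ≤ 4 ^ (j + 2) * V := by
      rw [h4]
      nlinarith [mul_le_mul_of_nonneg_right hX (zero_le_one.trans h2), mul_self_nonneg ((2 : ℝ) ^ (j + 2))]
    have e2 : (2 : ℝ) ^ (j + 2) * (1 + 2 * 2 ^ (j + 2) + 2 * 2 ^ (j + 2)) ≤ 5 * 4 ^ (j + 2) := by
      rw [h4]; nlinarith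
    nlinarith [mul_le_mul_of_nonneg_left e2 hd]
  · rintro e a _ ⟨lv', h, h'⟩
    rw [hb2] at h'
    exact ⟨lv', h, h'⟩

/-- Intersection of a subspace with the image of another one. -/
def meetImage (s : ℕ → List Instr) (z : Reg) (j : ℕ) (b : Ix (j + 2) → Ix (j + 2) → Reg)
    (l' l : List (Ix (j + 2) → Reg)) : Prog (List (Ix (j + 2) → Reg)) := do
  let f ← mm s z j (j + 2) b (cols z l')
  let w ← pannih s z j (j + 2) f
  restrict s z j w l

/-- The image is the column space of `B` times the basis matrix, hence the kernel of its
annihilator, and `restrict` applies. No basis of the image is needed. -/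
theorem sat_meetImage (hs : MatMul s j V) {b : Ix (j + 2) → Ix (j + 2) → Reg}
    {B : Matrix (Ix (j + 2)) (Ix (j + 2)) Qbar} {l' l : List (Ix (j + 2) → Reg)}
    {X' X Y : Submodule Qbar (Ix (j + 2) → Qbar)} (hz : rep env z 0) (hb : rep env b B)
    (hl' : BRep env l' X') (hl : BRep env l X) (hY : X ⊓ X'.map B.mulVecLin = Y) :
    Sat (meetImage s z j b l' l) env (64 * (4 ^ (j + 2) * V) +
        ((Module.finrank Qbar X : ℝ) - Module.finrank Qbar Y) * (5 * 4 ^ (j + 2)))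
      fun env' r => BRep env' r Y := by
  obtain ⟨lv', hlv', hb'⟩ := hl'
  obtain ⟨hb1, hb2⟩ := isBasisOf_iff.1 hb'
  refine Comp.bind (comp_mm hs le_rfl hz hb (rep_cols hz hlv')) fun e1 f h1 hf => ?_
  refine Comp.bind (comp_pannih hs le_rfl (Rep.mono h1 hz) hf) fun e2 w h2 hw => ?_
  refine (sat_restrict hs (Rep.mono (h1.trans h2) hz) hw (hl.mono (h1.trans h2)) ?_).mono
    (by linarith) fun _ _ _ h => h
  rw [← hY]
  congr 1
  ext x
  rw [LinearMap.mem_ker, mulVecLin_apply, annih_mulVec_eq_zero, Submodule.mem_map]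
  constructor
  · rintro ⟨y, rfl⟩
    refine ⟨mcols lv' *ᵥ y, ?_, ?_⟩
    · rw [← hb2]; exact (exists_mcols_mulVec (length_le_of_LIl hb1)).1 ⟨y, rfl⟩
    · rw [mulVecLin_apply, mulVec_mulVec]
  · rintro ⟨v, hv, rfl⟩
    rw [← hb2] at hv
    obtain ⟨y, rfl⟩ := (exists_mcols_mulVec (length_le_of_LIl hb1)).2 hv
    exact ⟨y, by rw [mulVecLin_apply, mulVec_mulVec]⟩

def unitL (z o : Reg) (J : ℕ) : List (Ix J → Reg) :=
  (Finset.univ : Finset (Ix J)).toList.map fun x y => if y = x then o else z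

theorem bRep_unitL {z o : Reg} {J : ℕ} (hz : rep env z 0) (ho : rep env o 1) :
    BRep env (unitL z o J) ⊤ := by
  refine ⟨(Finset.univ : Finset (Ix J)).toList.map fun x => Pi.single x 1, ?_, ?_⟩
  · change List.Forall₂ _ _ _
    rw [unitL, List.forall₂_map_left_iff, List.forall₂_map_right_iff, List.forall₂_same]
    intro x _ y
    change rep env (if y = x then o else z) _
    by_cases h : y = x
    · subst h; rw [if_pos rfl, Pi.single_eq_same]; exact ho
    · rw [if_neg h, Pi.single_eq_of_ne h]; exact hz
  · have hsp : ⊤ ≤ spanL ((Finset.univ : Finset (Ix J)).toList.map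
        fun x => (Pi.single x 1 : Ix J → Qbar)) := by
      intro f _
      rw [pi_eq_sum_univ' f]
      refine Submodule.sum_mem _ fun x _ => Submodule.smul_mem _ _ (Submodule.subset_span ?_)
      refine List.mem_map.2 ⟨x, Finset.mem_toList.2 (Finset.mem_univ x), ?_⟩
      funext y
      by_cases h : y = x
      · subst h; simp
      · simp [h]
    refine isBasisOf_iff.2 ⟨?_, top_le_iff.1 hsp⟩
    refine linearIndependent_of_top_le_span_of_card_eq_finrank (hsp.trans ?_) ?_
    · rw [spanL]; refine Submodule.span_mono fun x hx => ?_
      obtain ⟨i, hi⟩ := List.mem_iff_get.1 (show x ∈ _ from hx)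
      exact ⟨i, hi⟩
    · rw [Fintype.card_fin, List.length_map, Finset.length_toList, Finset.card_univ,
        Module.finrank_fintype_fun_eq_card]

end fast

/-! ### The two loops, run class by class. -/

section loopsP
variable {ι ι' τ : Type} [Fintype τ] [DecidableEq τ] [Fintype ι] [DecidableEq ι] [Fintype ι']
variable {s : ℕ → List Instr} {z : Reg} {j : ℕ} {V : ℝ} {env : List Qbar}

/-- Bases of the components of the kernel of `N`. -/
def kerP (s : ℕ → List Instr) (z o : Reg) (j : ℕ) (g : Grading ι τ (j + 2))
    (b : τ → Ix (j + 2) → Ix (j + 2) → Reg) : Prog (τ → List (Ix (j + 2) → Reg)) :=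
  forAll fun t => do
    let l ← restrict s z j (fun x y => if x = y ∧ g.dec t x = none then o else z)
      (unitL z o (j + 2))
    restrict s z j (b t) l

omit [DecidableEq τ] [Fintype ι'] in
-- The unit vectors are first restricted by a diagonal matrix to those vanishing on the padding,
-- then to the kernel of the block of `N`. The drop is counted from the full dimension `2 ^ (j +
-- 2)`, where the telescoping sum of the loop begins.
theorem sat_kerP (hs : MatMul s j V) {o : Reg} (g' : Grading ι' τ (j + 2))
    (g : Grading ι τ (j + 2)) (σ' σ : Equiv.Perm τ) {N : Matrix ι' ι Qbar} {M : Matrix ι ι Qbar}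
    {b : τ → Ix (j + 2) → Ix (j + 2) → Reg} (hz : rep env z 0) (ho : rep env o 1)
    (hb : ∀ t, rep env (b t) (mgblk g' g σ' N t)) :
    Sat (kerP s z o j g b) env (∑ t : τ, (16 * (4 ^ (j + 2) * V) +
        ((2 : ℝ) ^ (j + 2) - Module.finrank Qbar (loopC g' g σ' σ N M 0 t)) * (5 * 4 ^ (j + 2))))
      fun env' r => ∀ t, BRep env' (r t) (loopC g' g σ' σ N M 0 t) := by
  refine sat_forAll (P := fun t e a => BRep e a (loopC g' g σ' σ N M 0 t))
    (fun _ _ _ _ h => BRep.mono h) fun t e1 h1 => ?_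
  have hD : rep e1 (fun x y => if x = y ∧ g.dec t x = none then o else z)
      (diagonal fun x => if g.dec t x = none then (1 : Qbar) else 0) := fun x y => by
    change rep e1 (if x = y ∧ g.dec t x = none then o else z) _
    by_cases hxy : x = y
    · subst hxy
      rw [diagonal_apply_eq]
      by_cases hd : g.dec t x = none
      · rw [if_pos ⟨rfl, hd⟩, if_pos hd]; exact Rep.mono h1 ho
      · rw [if_neg fun h => hd h.2, if_neg hd]; exact Rep.mono h1 hz
    · rw [diagonal_apply_ne _ hxy, if_neg fun h => hxy h.1]; exact Rep.mono h1 hz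
  have hval : (⊤ : Submodule Qbar (Ix (j + 2) → Qbar)) ⊓ LinearMap.ker
      (diagonal fun x => if g.dec t x = none then (1 : Qbar) else 0).mulVecLin = g.valid t := by
    ext x
    rw [top_inf_eq, LinearMap.mem_ker, mulVecLin_apply]
    constructor
    · intro h w hw
      have := congrFun h w
      rwa [mulVec_diagonal, if_pos hw, one_mul] at this
    · intro h
      funext w
      rw [mulVec_diagonal]
      split_ifs with hw
      · rw [h w hw]; simp
      · simp
  refine Sat.bind (sat_restrict hs (Rep.mono h1 hz) hD
    (bRep_unitL (Rep.mono h1 hz) (Rep.mono h1 ho)) hval) fun e2 l h2 hl => ?_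
  refine (sat_restrict hs (Rep.mono (h1.trans h2) hz) (Rep.mono (h1.trans h2) (hb t)) hl rfl).mono
    (le_of_eq ?_) fun _ _ _ h => h
  rw [finrank_top, Module.finrank_fintype_fun_eq_card, card_Ix]
  push_cast
  rw [loopC]; ring

/-- The state of the first loop: bases of the components of `𝔛`, and the blocks of `M ^ i`. -/
abbrev LoopState (τ : Type) (J : ℕ) : Type :=
  (τ → List (Ix J → Reg)) × (τ → Ix J → Ix J → Reg)

/-- The class `t` of `M ^ i 𝔛` comes from the class `(σ ^ i)⁻¹ t` of `𝔛`. The blocks of `M ^ i` are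
carried in the state, so that the next power costs one product per class. -/
def passP (s : ℕ → List Instr) (z : Reg) (j : ℕ) (σ : Equiv.Perm τ)
    (b : τ → Ix (j + 2) → Ix (j + 2) → Reg) (i : ℕ) (x : LoopState τ (j + 2)) :
    Prog (LoopState τ (j + 2)) := do
  let l ← forAll fun t => meetImage s z j (x.2 ((σ ^ i).symm t)) (x.1 ((σ ^ i).symm t)) (x.1 t)
  let c ← forAll fun t => mm s z j (j + 2) (b ((σ ^ i) t)) (x.2 t)
  pure (l, c)

def LoopInv (g' : Grading ι' τ (j + 2)) (g : Grading ι τ (j + 2)) (σ' σ : Equiv.Perm τ)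
    (N : Matrix ι' ι Qbar) (M : Matrix ι ι Qbar) (i : ℕ) (env : List Qbar)
    (x : LoopState τ (j + 2)) : Prop :=
  (∀ t, BRep env (x.1 t) (loopC g' g σ' σ N M i t)) ∧
    ∀ t, rep env (x.2 t) (mgblk g g (σ ^ i) (M ^ i) t)

omit [Fintype τ] [DecidableEq τ] [Fintype ι'] in
theorem LoopInv.mono {g' : Grading ι' τ (j + 2)} {g : Grading ι τ (j + 2)} {σ' σ : Equiv.Perm τ}
    {N : Matrix ι' ι Qbar} {M : Matrix ι ι Qbar} {i : ℕ} {env env' : List Qbar}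
    {x : LoopState τ (j + 2)} (h : env <+: env') (hx : LoopInv g' g σ' σ N M i env x) :
    LoopInv g' g σ' σ N M i env' x :=
  ⟨fun t => (hx.1 t).mono h, fun t => Rep.mono h (hx.2 t)⟩

omit [Fintype ι'] in
theorem sat_passP (hs : MatMul s j V) {g' : Grading ι' τ (j + 2)}
    {g : Grading ι τ (j + 2)} {σ' σ : Equiv.Perm τ} {N : Matrix ι' ι Qbar} {M : Matrix ι ι Qbar}
    (hM : IsGraded g g σ M) {b : τ → Ix (j + 2) → Ix (j + 2) → Reg} (hz : rep env z 0)
    (hb : ∀ t, rep env (b t) (mgblk g g σ M t)) {i : ℕ} {x : LoopState τ (j + 2)}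
    (hx : LoopInv g' g σ' σ N M i env x) :
    Sat (passP s z j σ b i x) env (∑ t : τ, (71 * (4 ^ (j + 2) * V) +
        ((Module.finrank Qbar (loopC g' g σ' σ N M i t) : ℝ) -
          Module.finrank Qbar (loopC g' g σ' σ N M (i + 1) t)) * (5 * 4 ^ (j + 2))))
      (LoopInv g' g σ' σ N M (i + 1)) := by
  refine Sat.bind (sat_forAll (P := fun t e a => BRep e a (loopC g' g σ' σ N M (i + 1) t))
    (fun _ _ _ _ h => BRep.mono h) fun t e1 h1 => sat_meetImage hs (Rep.mono h1 hz)
      (Rep.mono h1 (hx.2 _)) ((hx.1 _).mono h1) ((hx.1 t).mono h1) rfl) fun e1 l h1 hl => ?_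
  refine Comp.bind (comp_forAll' (v := fun t => mgblk g g (σ ^ (i + 1)) (M ^ (i + 1)) t)
    fun t e2 h2 => (comp_mm hs le_rfl (Rep.mono (h1.trans h2) hz)
      (Rep.mono (h1.trans h2) (hb ((σ ^ i) t))) (Rep.mono (h1.trans h2) (hx.2 t))).mono le_rfl ?_)
      fun e2 c h2 hc => ?_
  · rw [pow_succ', pow_succ', mgblk_mul g σ M (hM.pow i)]
  · refine Sat.pure (le_of_eq ?_) ⟨fun t => (hl t).mono h2, hc⟩
    simp only [Finset.sum_add_distrib, Finset.sum_const, Finset.card_univ, nsmul_eq_mul]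
    ring

/-- The blocks of `Y` in the successive passes of the second loop. -/
def loopYP (s : ℕ → List Instr) (z : Reg) (j : ℕ) (σ : Equiv.Perm τ)
    (bN bM : τ → Ix (j + 2) → Ix (j + 2) → Reg) (L : ℕ) :
    Prog (ℕ → τ → Ix (j + 2) → Ix (j + 2) → Reg) :=
  iterP (pure bN) (fun _ y => forAll fun t => mm s z j (j + 2) (y (σ t)) (bM t)) L

omit [Fintype τ] [DecidableEq τ] [DecidableEq ι] [Fintype ι'] in
theorem isGraded_loopY {J : ℕ} {g' : Grading ι' τ J} {g : Grading ι τ J}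
    {σ' σ : Equiv.Perm τ} {N : Matrix ι' ι Qbar} {M : Matrix ι ι Qbar} (hN : IsGraded g' g σ' N)
    (hM : IsGraded g g σ M) (i : ℕ) : IsGraded g' g (σ' * σ ^ i) (loopY M N i) := by
  induction i with
  | zero => rw [pow_zero, mul_one]; exact hN
  | succ i ih => rw [pow_succ, ← mul_assoc, loopY]; exact ih.mul hM

omit [DecidableEq ι] [Fintype ι'] in
theorem comp_loopYP (hs : MatMul s j V) {g' : Grading ι' τ (j + 2)}
    {g : Grading ι τ (j + 2)} {σ' σ : Equiv.Perm τ} {N : Matrix ι' ι Qbar} {M : Matrix ι ι Qbar}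
    (hM : IsGraded g g σ M) {bN bM : τ → Ix (j + 2) → Ix (j + 2) → Reg} (hz : rep env z 0)
    (hbN : ∀ t, rep env (bN t) (mgblk g' g σ' N t))
    (hbM : ∀ t, rep env (bM t) (mgblk g g σ M t)) (L : ℕ) :
    Sat (loopYP s z j σ bN bM L) env (L * (Fintype.card τ * (7 * (4 ^ (j + 2) * V))))
      fun e y => ∀ i ≤ L, ∀ t, rep e (y i t) (mgblk g' g (σ' * σ ^ i) (loopY M N i) t) := by
  refine (sat_iterP (c := fun _ => Fintype.card τ * (7 * (4 ^ (j + 2) * V))) (c₀ := 0)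
    (P := fun i e y => ∀ t, rep e (y t) (mgblk g' g (σ' * σ ^ i) (loopY M N i) t))
    (fun i e e' a h ha t => Rep.mono h (ha t)) (Sat.pure le_rfl ?_) L ?_).mono ?_ fun _ _ _ h => h
  · simpa [loopY] using hbN
  · intro i _ e1 y h1 hy
    refine comp_forAll' (v := fun t => mgblk g' g (σ' * σ ^ (i + 1)) (loopY M N (i + 1)) t)
      fun t e2 h2 => (comp_mm hs le_rfl (Rep.mono (h1.trans h2) hz)
        (Rep.mono h2 (hy (σ t))) (Rep.mono (h1.trans h2) (hbM t))).mono le_rfl ?_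
    rw [pow_succ, ← mul_assoc, loopY, mgblk_mul g' _ _ hM]
  · simp

/-- The entries of a graded matrix. -/
def ungblk {J : ℕ} (g' : Grading ι' τ J) (g : Grading ι τ J) (σ : Equiv.Perm τ) {R : Type} (z : R)
    (b : τ → Ix J → Ix J → R) : ι' → ι → R := fun x y =>
  if g'.cl x = σ (g.cl y) then b (g.cl y) (g'.enc x) (g.enc y) else z

omit [Fintype τ] [Fintype ι] [DecidableEq ι] [Fintype ι'] in
theorem rep_ungblk {J : ℕ} {g' : Grading ι' τ J} {g : Grading ι τ J} {σ : Equiv.Perm τ}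
    {D : Matrix ι' ι Qbar} (hD : IsGraded g' g σ D) {b : τ → Ix J → Ix J → Reg}
    (hz : rep env z 0) (hb : ∀ t, rep env (b t) (mgblk g' g σ D t)) :
    rep env (ungblk g' g σ z b) D := fun x y => by
  unfold ungblk
  split_ifs with h
  · have := hb (g.cl y) (g'.enc x) (g.enc y)
    have e : mgblk g' g σ D (g.cl y) (g'.enc x) (g.enc y) = D x y := by
      change (g'.dec (σ (g.cl y)) (g'.enc x)).elim 0
        (fun i => (g.dec (g.cl y) (g.enc y)).elim 0 fun j => D i j) = D x y
      rw [← h, g'.dec_enc, g.dec_enc]; rfl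
    rwa [e] at this
  · have : D x y = 0 := by
      by_contra hne; exact h (hD x y hne)
    rw [this]; exact hz

def loopsP (s : ℕ → List Instr) (z o : Reg) (j : ℕ) (g' : Grading ι' τ (j + 2))
    (g : Grading ι τ (j + 2)) (σ' σ : Equiv.Perm τ) (N : ι' → ι → Reg) (M : ι → ι → Reg) (L : ℕ) :
    Prog ((ℕ → List (ι → Reg)) × (ℕ → ι' → ι → Reg)) := do
  let x ← iterP (do
      let l ← kerP s z o j g (gblk g' g σ' z N)
      pure (l, gblk g g (σ ^ 0) z fun x y => if x = y then o else z))
    (passP s z j σ (gblk g g σ z M)) L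
  let y ← loopYP s z j σ (gblk g' g σ' z N) (gblk g g σ z M) L
  pure (fun i => g.joinList z (x i).1 Finset.univ.toList,
    fun i => ungblk g' g (σ' * σ ^ i) z (y i))

omit [Fintype τ] [Fintype ι] [DecidableEq ι] in
theorem bRep_joinList {J : ℕ} [Fintype τ] (g : Grading ι τ J)
    {X : τ → Submodule Qbar (Ix J → Qbar)} (hX : ∀ t, X t ≤ g.valid t)
    {l : τ → List (Ix J → Reg)} (hz : rep env z 0) (hl : ∀ t, BRep env (l t) (X t)) :
    BRep env (g.joinList z l Finset.univ.toList) (g.assemble X) := by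
  choose lv h1 h2 using hl
  refine ⟨_, ?_, g.isBasisOf_joinList hX h2⟩
  unfold Grading.joinList
  change List.Forall₂ _ _ _
  refine List.rel_flatten ?_
  rw [List.forall₂_map_left_iff, List.forall₂_map_right_iff, List.forall₂_same]
  intro t _
  rw [List.forall₂_map_left_iff, List.forall₂_map_right_iff]
  refine (show List.Forall₂ _ _ _ from h1 t).imp fun a v ha i => ?_
  unfold Grading.unpack
  split_ifs
  · exact ha _
  · exact hz

omit [Fintype ι'] in
-- Each pass has a fixed price of a bounded number of fast products per class. The eliminations are
-- paid once for the whole loop, since the dimension of a class can drop by at most `2 ^ (j + 2)` in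
-- total.
theorem sat_loopsP (hs : MatMul s j V) {o : Reg} {g' : Grading ι' τ (j + 2)}
    {g : Grading ι τ (j + 2)} {σ' σ : Equiv.Perm τ} {rN : ι' → ι → Reg} {rM : ι → ι → Reg}
    {N : Matrix ι' ι Qbar} {M : Matrix ι ι Qbar} (hN : IsGraded g' g σ' N) (hM : IsGraded g g σ M)
    (hz : rep env z 0) (ho : rep env o 1) (hrN : rep env rN N) (hrM : rep env rM M) (L : ℕ) :
    Sat (loopsP s z o j g' g σ' σ rN rM L) env
      (Fintype.card τ * ((16 + 78 * L) * (4 ^ (j + 2) * V) + 2 ^ (j + 2) * (5 * 4 ^ (j + 2))))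
      fun e r => ∀ i ≤ L, BRep e (r.1 i) (loopOne M N i) ∧ rep e (r.2 i) (loopY M N i) := by
  refine Sat.bind (sat_iterP (P := LoopInv g' g σ' σ N M) (fun _ _ _ _ h => LoopInv.mono h)
    (c₀ := ∑ t : τ, (16 * (4 ^ (j + 2) * V) +
        ((2 : ℝ) ^ (j + 2) - Module.finrank Qbar (loopC g' g σ' σ N M 0 t)) * (5 * 4 ^ (j + 2))))
    ?_ L fun i _ e1 x h1 hx => sat_passP hs hM (Rep.mono h1 hz)
      (rep_gblk (Rep.mono h1 hz) g g σ (Rep.mono h1 hrM)) hx) fun e1 x h1 hx => ?_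
  · refine Sat.bind (sat_kerP (M := M) hs g' g σ' σ hz ho (rep_gblk hz g' g σ' hrN)) fun e1 l h1 hl => ?_
    refine Sat.pure (by simp) ⟨hl, rep_gblk (Rep.mono h1 hz) g g (σ ^ 0) fun x y => ?_⟩
    rw [pow_zero, one_apply]
    split_ifs
    · exact Rep.mono h1 ho
    · exact Rep.mono h1 hz
  · refine Sat.bind (comp_loopYP hs hM (Rep.mono h1 hz)
      (rep_gblk (Rep.mono h1 hz) g' g σ' (Rep.mono h1 hrN))
      (rep_gblk (Rep.mono h1 hz) g g σ (Rep.mono h1 hrM)) L) fun e2 y h2 hy => ?_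
    refine Sat.pure ?_ fun i hi => ⟨?_, ?_⟩
    · rw [Finset.sum_comm]
      -- The dimension drops of one class telescope over the passes.
      have key : ∀ t : τ, ∑ i ∈ Finset.range L, (71 * (4 ^ (j + 2) * V) +
          ((Module.finrank Qbar (loopC g' g σ' σ N M i t) : ℝ) -
          Module.finrank Qbar (loopC g' g σ' σ N M (i + 1) t)) * (5 * 4 ^ (j + 2))) =
          L * (71 * (4 ^ (j + 2) * V)) + ((Module.finrank Qbar (loopC g' g σ' σ N M 0 t) : ℝ) -
          Module.finrank Qbar (loopC g' g σ' σ N M L t)) * (5 * 4 ^ (j + 2)) := fun t => by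
        rw [Finset.sum_add_distrib, ← Finset.sum_mul (f := fun i => (Module.finrank Qbar
            (loopC g' g σ' σ N M i t) : ℝ) - Module.finrank Qbar (loopC g' g σ' σ N M (i + 1) t)),
          Finset.sum_range_sub' (fun i => (Module.finrank Qbar (loopC g' g σ' σ N M i t) : ℝ))]
        simp
      rw [Finset.sum_congr rfl fun t _ => key t, sub_sub, sub_nonneg, ← Finset.sum_add_distrib]
      have : (Fintype.card τ : ℝ) *
          ((16 + 78 * L) * (4 ^ (j + 2) * V) + 2 ^ (j + 2) * (5 * 4 ^ (j + 2))) =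
          ∑ t : τ, ((16 + 71 * L) * (4 ^ (j + 2) * V) + 2 ^ (j + 2) * (5 * 4 ^ (j + 2))) +
            L * (Fintype.card τ * (7 * (4 ^ (j + 2) * V))) := by
        rw [Finset.sum_const, Finset.card_univ, nsmul_eq_mul]; ring
      rw [this, add_le_add_iff_right]
      refine Finset.sum_le_sum fun t _ => ?_
      have h0 : (0 : ℝ) ≤ Module.finrank Qbar (loopC g' g σ' σ N M L t) * (5 * 4 ^ (j + 2)) := by
        positivity
      linarith
    · rw [loopOne_eq_assemble hN hM]
      exact bRep_joinList g (loopC_le_valid g' g σ' σ N M i) (Rep.mono (h1.trans h2) hz)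
        fun t => ((hx i hi).1 t).mono h2
    · exact rep_ungblk (isGraded_loopY hN hM i) (Rep.mono (h1.trans h2) hz) (hy i hi)

end loopsP

/-! ## The verdict -/

section verdict
variable {ι : Type} [Fintype ι] [DecidableEq ι]

/-- The matrix whose columns are the vectors of the list. -/
def colsF {R : Type} (m : ℕ) (z : R) (l : List (ι → R)) : ι → Fin m → R := fun x i =>
  (l[(i : ℕ)]?).elim z fun e => e x

variable {s : ℕ → List Instr} {z : Reg} {j : ℕ} {V : ℝ} {env : List Qbar}

abbrev VerdictOf (ι : Type) (m : ℕ) (R : Type) : Type :=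
  Option (Matrix ι (Fin m) R × Matrix (Fin m) (Fin m) R × Matrix (Fin m) (Fin m) R)

/-- The dimension is the length of the list, so the test itself is free. The matrix `R` is a left
inverse of `E` applied to `M E`, and `Λ` is the generalized inverse of `R`. -/
def verdictP (s : ℕ → List Instr) (z : Reg) (j m : ℕ) (M : ι → ι → Reg) (l : List (ι → Reg)) :
    Prog (VerdictOf ι m Reg) :=
  if l.length = m then do
    let e := colsF m z l
    let e' ← ppinv s z j m (j + 2) e
    let t ← mulN z M e
    let r ← mulN z e' t
    let w ← ppinv s z j m (j + 2) r
    pure (some (e, r, w))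
  else pure none

/-- The matrices represented by a verdict on the subspace `X` are as they should. -/
def VerdictRep (m : ℕ) (M : Matrix ι ι Qbar) (X : Submodule Qbar (ι → Qbar)) (env : List Qbar) :
    VerdictOf ι m Reg → Prop
  | none => Module.finrank Qbar X ≠ m
  | some (e, r, w) => ∃ (E : Matrix ι (Fin m) Qbar) (R W : Matrix (Fin m) (Fin m) Qbar),
      rep env (fun x i => e x i) E ∧ rep env (fun x i => r x i) R ∧
      rep env (fun x i => w x i) W ∧ Module.finrank Qbar X = m ∧
      LinearIndependent Qbar (fun j : Fin m => fun x => E x j) ∧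
      Submodule.span Qbar (Set.range fun j : Fin m => fun x => E x j) = X ∧
      M * E = E * R ∧ R * W = 1

omit [Fintype ι] [DecidableEq ι] in
theorem rep_colsF {m : ℕ} {l : List (ι → Reg)} {lv : List (ι → Qbar)} (hz : rep env z 0)
    (h : rep env l lv) : rep env (colsF m z l) (of (colsF m 0 lv)) := fun x i => by
  obtain ⟨hlen, hget⟩ := List.forall₂_iff_get.1 (show List.Forall₂ _ _ _ from h)
  change rep env (colsF m z l x i) (colsF m 0 lv x i)
  unfold colsF
  by_cases hy : (i : ℕ) < l.length
  · rw [List.getElem?_eq_getElem hy, List.getElem?_eq_getElem (hlen ▸ hy)]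
    exact hget _ hy (hlen ▸ hy) x
  · rw [List.getElem?_eq_none (not_lt.1 hy), List.getElem?_eq_none (hlen ▸ not_lt.1 hy)]
    exact hz

/-- A matrix of full column rank whose column space is mapped onto itself by `M`. -/
theorem verdict_algebra {m k : ℕ} (hm : m ≤ 2 ^ k) {M : Matrix ι ι Qbar}
    {X : Submodule Qbar (ι → Qbar)} (hMX : X.map M.mulVecLin = X) {E : Matrix ι (Fin m) Qbar}
    (hE : LinearIndependent Qbar (fun j : Fin m => fun x => E x j))
    (hX : Submodule.span Qbar (Set.range fun j : Fin m => fun x => E x j) = X) :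
    M * E = E * (pinv m k E * (M * E)) ∧
      pinv m k E * (M * E) * pinv m k (pinv m k E * (M * E)) = 1 := by
  have hrange : ∀ x, x ∈ X ↔ ∃ y, E *ᵥ y = x := fun x => by
    have h := Matrix.range_mulVecLin E
    rw [← hX]
    change x ∈ Submodule.span Qbar (Set.range E.col) ↔ _
    rw [← h, LinearMap.mem_range]; rfl
  have hinj : Function.Injective E.mulVec := mulVec_injective_iff.2 hE
  have hL := mul_pinv_mul hm E
  -- `E` times its generalized inverse fixes the column space `X`, and the columns of `M E` stay in
  -- `X`.
  have hME : M * E = E * (pinv m k E * (M * E)) := by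
    refine Matrix.ext_of_mulVec_single fun i => ?_
    have hmem : (M * E) *ᵥ Pi.single i 1 ∈ X := by
      rw [← mulVec_mulVec, ← hMX]
      exact Submodule.mem_map_of_mem ((hrange _).2 ⟨_, rfl⟩)
    obtain ⟨y, hy⟩ := (hrange _).1 hmem
    rw [← mulVec_mulVec _ E, ← mulVec_mulVec _ (pinv m k E), ← hy, mulVec_mulVec, mulVec_mulVec, hL]
  refine ⟨hME, ?_⟩
  set R := pinv m k E * (M * E) with hR
  -- A surjective endomorphism of a finite-dimensional space is injective; with the injectivity of
  -- `E` this makes `R` invertible.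
  have hMinj : Set.InjOn M.mulVecLin X := by
    have hle : ∀ x ∈ X, M.mulVecLin x ∈ X := fun x hx => by
      have := Submodule.mem_map_of_mem (f := M.mulVecLin) hx
      rwa [hMX] at this
    have hsurj : Function.Surjective (M.mulVecLin.restrict hle) := by
      rintro ⟨x, hx⟩
      have hx' := hx
      rw [← hMX] at hx'
      obtain ⟨y, hy, rfl⟩ := hx'
      exact ⟨⟨y, hy⟩, Subtype.ext rfl⟩
    have := LinearMap.injective_iff_surjective.2 hsurj
    intro a ha b hb hab
    exact congrArg Subtype.val (@this ⟨a, ha⟩ ⟨b, hb⟩ (Subtype.ext hab))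
  have hRinj : Function.Injective R.mulVec := by
    intro x y hxy
    apply hinj
    refine hMinj ((hrange _).2 ⟨x, rfl⟩) ((hrange _).2 ⟨y, rfl⟩) ?_
    rw [mulVecLin_apply, mulVecLin_apply, mulVec_mulVec, mulVec_mulVec, hME, ← mulVec_mulVec x E R,
      ← mulVec_mulVec y E R]
    exact congrArg E.mulVec hxy
  rw [mul_eq_one_comm]
  refine Matrix.ext_of_mulVec_single fun i => hRinj ?_
  rw [mulVec_mulVec, ← Matrix.mul_assoc, mul_pinv_mul hm R, one_mulVec]

theorem sat_verdictP (hs : MatMul s j V) {m : ℕ} (hm : m ≤ 2 ^ (j + 2)) {rM : ι → ι → Reg}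
    {M : Matrix ι ι Qbar} {l : List (ι → Reg)} {X : Submodule Qbar (ι → Qbar)}
    (hMX : X.map M.mulVecLin = X) (hz : rep env z 0) (hM : rep env rM M) (hl : BRep env l X) :
    Sat (verdictP s z j m rM l) env (46 * (4 ^ (j + 2) * V) + 7 * (Fintype.card ι * m ^ 2) +
      2 * (Fintype.card ι ^ 2 * m) + 2 * (Fintype.card ι * m ^ 2) + 7 * m ^ 3)
      (VerdictRep m M X) := by
  have hV := hs.one_le
  obtain ⟨lv, hlv, hb⟩ := hl
  have hlen : l.length = lv.length := List.Forall₂.length_eq (show List.Forall₂ _ _ _ from hlv)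
  unfold verdictP
  split_ifs with hlm
  · have hlvm : lv.length = m := hlen ▸ hlm
    have hcol : (fun (j : Fin m) (x : ι) => of (colsF m 0 lv) x j) =
        fun j : Fin m => lv.get (j.cast hlvm.symm) := by
      funext j x
      change colsF m 0 lv x j = _
      unfold colsF
      rw [List.getElem?_eq_getElem (by rw [hlvm]; exact j.2)]; rfl
    have hE : LinearIndependent Qbar (fun (j : Fin m) (x : ι) => of (colsF m 0 lv) x j) := by
      rw [hcol]
      exact hb.1.comp _ (Fin.cast_injective _)
    have hX : Submodule.span Qbar
        (Set.range fun (j : Fin m) (x : ι) => of (colsF m 0 lv) x j) = X := by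
      rw [hcol, ← hb.2]
      congr 1
      exact (finCongr hlvm.symm).surjective.range_comp (fun i => lv.get i)
    obtain ⟨h1, h2⟩ := verdict_algebra hm hMX hE hX
    have he := rep_colsF (m := m) hz hlv
    refine Comp.bind (comp_ppinv hs le_rfl hm hz he) fun e1 e' k1 he' => ?_
    refine Comp.bind (comp_mulN (Rep.mono k1 hz) (Rep.mono k1 hM) (Rep.mono k1 he))
      fun e2 t k2 ht => ?_
    refine Comp.bind (comp_mulN (Rep.mono (k1.trans k2) hz) (Rep.mono k2 he') ht)
      fun e3 r k3 hr => ?_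
    refine Comp.bind (comp_ppinv hs le_rfl hm (Rep.mono ((k1.trans k2).trans k3) hz) hr)
      fun e4 w k4 hw => ?_
    refine Sat.pure ?_ ⟨_, _, _, Rep.mono (((k1.trans k2).trans k3).trans k4) he,
      Rep.mono k4 hr, hw, ?_, hE, hX, h1, h2⟩
    · rw [Fintype.card_fin]; ring_nf; exact le_rfl
    · rw [← isBasisOf_length hb, hlvm]
  · refine Sat.pure (by positivity) ?_
    change Module.finrank Qbar X ≠ m
    rw [← isBasisOf_length hb, ← hlen]; exact hlm

end verdict

/-! ## Rational functions and Laurent series -/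

/-- The embedding of the polynomials into the rational functions. -/
notation "fr" => algebraMap (Polynomial Qbar) (RatFunc Qbar)

/-- The embedding of the polynomials into the Laurent series. -/
notation "lau" => algebraMap (Polynomial Qbar) (LaurentSeries Qbar)

theorem fr_injective : Function.Injective fr := RatFunc.algebraMap_injective Qbar

theorem fr_ne_zero {f : Qbar[X]} : fr f ≠ 0 ↔ f ≠ 0 := by
  rw [Ne, map_eq_zero_iff _ fr_injective]

/-- `phi` is defined through the reduced fraction; the computation uses fractions that are not
reduced. -/
theorem phi_div {p : ℕ} (hp : 0 < p) {a b : Qbar[X]} (hb : b ≠ 0) :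
    phi p (fr a / fr b) = fr (Polynomial.expand Qbar p a) / fr (Polynomial.expand Qbar p b) := by
  set f := fr a / fr b with hf
  have h1 : fr f.num / fr f.denom = f := RatFunc.num_div_denom f
  have hd : f.denom ≠ 0 := f.denom_ne_zero
  have h2 : f.num * b = a * f.denom := by
    apply fr_injective
    rw [hf, div_eq_div_iff (fr_ne_zero.2 hd) (fr_ne_zero.2 hb)] at h1
    rw [map_mul, map_mul]; exact h1
  rw [phi, div_eq_div_iff, ← map_mul, ← map_mul, ← map_mul, ← map_mul, h2]
  · exact fr_ne_zero.2 ((Polynomial.expand_ne_zero hp).2 hd)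
  · exact fr_ne_zero.2 ((Polynomial.expand_ne_zero hp).2 hb)

theorem laurent_div (a b : Qbar[X]) : ((fr a / fr b : RatFunc Qbar) : Qbar⸨X⸩) = lau a / lau b :=
  RatFunc.algebraMap_apply_div a b

theorem lau_eq (f : Qbar[X]) : lau f = HahnSeries.ofPowerSeries ℤ Qbar (f : PowerSeries Qbar) := by
  have h := laurent_div f 1
  rw [map_one, map_one, div_one, div_one] at h
  rw [RatFunc.coe_coe]
  exact h.symm

theorem coeff_lau (f : Qbar[X]) (k : ℤ) :
    (lau f).coeff k = if k < 0 then 0 else f.coeff k.natAbs := by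
  rw [lau_eq, PowerSeries.coeff_coe, Polynomial.coeff_coe]

theorem lau_injective : Function.Injective lau := by
  intro f g h
  ext1 n
  have := congrArg (fun x => HahnSeries.coeff x (n : ℤ)) h
  simp only [coeff_lau, if_neg (not_lt.2 (Int.natCast_nonneg n)), Int.natAbs_natCast] at this
  exact this

theorem lau_ne_zero {f : Qbar[X]} : lau f ≠ 0 ↔ f ≠ 0 := by
  rw [Ne, map_eq_zero_iff _ lau_injective]

theorem order_lau {f : Qbar[X]} (hf : f ≠ 0) : (lau f).order = f.natTrailingDegree := by
  apply le_antisymm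
  · apply HahnSeries.order_le_of_coeff_ne_zero
    rw [coeff_lau, if_neg (by simp), Int.natAbs_natCast]
    exact Polynomial.trailingCoeff_nonzero_iff_nonzero.2 hf
  · have h := HahnSeries.coeff_order_eq_zero.not.2 (lau_ne_zero.2 hf)
    rw [coeff_lau] at h
    by_cases h0 : (lau f).order < 0
    · rw [if_pos h0] at h; exact absurd rfl h
    · rw [if_neg h0] at h
      have := Polynomial.natTrailingDegree_le_of_ne_zero h
      omega

theorem val0_div {a b : Qbar[X]} (ha : a ≠ 0) (hb : b ≠ 0) :
    val0 (fr a / fr b) = a.natTrailingDegree - b.natTrailingDegree := by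
  rw [val0, laurent_div]
  have h : (lau a / lau b) * lau b = lau a := div_mul_cancel₀ _ (lau_ne_zero.2 hb)
  have h2 := congrArg HahnSeries.order h
  rw [HahnSeries.order_mul (div_ne_zero (lau_ne_zero.2 ha) (lau_ne_zero.2 hb)) (lau_ne_zero.2 hb),
    order_lau ha, order_lau hb] at h2
  linarith

/-- `f(z) ↦ f(z ^ d)` on Laurent series. -/
def lauExpand {d : ℕ} (hd : 0 < d) : Qbar⸨X⸩ →+* Qbar⸨X⸩ :=
  HahnSeries.embDomainRingHom (AddMonoidHom.mulLeft (d : ℤ))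
    (by rw [AddMonoidHom.coe_mulLeft]; exact mul_right_injective₀ (by exact_mod_cast hd.ne'))
    fun a b => by
      rw [AddMonoidHom.coe_mulLeft]; exact mul_le_mul_iff_right₀ (by exact_mod_cast hd)

theorem coeff_lauExpand {d : ℕ} (hd : 0 < d) (f : Qbar⸨X⸩) (k : ℤ) :
    (lauExpand hd f).coeff k = if (d : ℤ) ∣ k then f.coeff (k / d) else 0 := by
  have hd' : (d : ℤ) ≠ 0 := by exact_mod_cast hd.ne'
  rw [lauExpand, HahnSeries.embDomainRingHom_apply]
  split_ifs with h
  · obtain ⟨e, rfl⟩ := h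
    rw [Int.mul_ediv_cancel_left _ hd']
    exact HahnSeries.embDomain_coeff
  · refine HahnSeries.embDomain_of_notMem_range ?_
    rintro ⟨e, he⟩
    exact h ⟨e, he.symm⟩

theorem lauExpand_lau {d : ℕ} (hd : 0 < d) (f : Qbar[X]) :
    lauExpand hd (lau f) = lau (Polynomial.expand Qbar d f) := by
  ext k : 2
  rw [coeff_lauExpand, coeff_lau, coeff_lau]
  have hd' : (0 : ℤ) < d := by exact_mod_cast hd
  by_cases hk : (d : ℤ) ∣ k
  · obtain ⟨e, rfl⟩ := hk
    rw [if_pos (dvd_mul_right _ _), Int.mul_ediv_cancel_left _ hd'.ne', Int.natAbs_mul,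
      Int.natAbs_natCast, mul_comm d, Polynomial.coeff_expand_mul hd]
    have : e < 0 ↔ (d : ℤ) * e < 0 := by
      constructor
      · intro h; nlinarith
      · intro h; by_contra h'; nlinarith [mul_nonneg hd'.le (not_lt.1 h')]
    simp only [this]
  · have hk' : ¬ d ∣ k.natAbs := by rwa [← Int.natCast_dvd]
    rw [if_neg hk, Polynomial.coeff_expand hd, if_neg hk', ite_self]

/-- Expanding at `0` commutes with the substitution of `z ^ d`, so the coefficients of `φ_d(A⁻¹)`
are those of `A⁻¹`, spread out. -/
theorem laurent_phi {d : ℕ} (hd : 0 < d) (f : RatFunc Qbar) :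
    ((phi d f : RatFunc Qbar) : Qbar⸨X⸩) = lauExpand hd (f : Qbar⸨X⸩) := by
  conv_rhs => rw [← RatFunc.num_div_denom f]
  rw [phi, laurent_div, laurent_div, map_div₀, lauExpand_lau, lauExpand_lau]

/-- The Laurent coefficients of a fraction. -/
theorem coeff_lau_div (a : Qbar[X]) {b : Qbar[X]} (hb : b ≠ 0) (k : ℤ) :
    (lau a / lau b).coeff k = if k + b.natTrailingDegree < 0 then 0 else
      PowerSeries.coeff (k + b.natTrailingDegree).natAbs ((a : PowerSeries Qbar) *
        ((hi b.natTrailingDegree b : Qbar[X]) : PowerSeries Qbar)⁻¹) := by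
  set w := b.natTrailingDegree with hw
  have hc : PowerSeries.constantCoeff ((hi w b : Qbar[X]) : PowerSeries Qbar) ≠ 0 := by
    rw [Polynomial.constantCoeff_coe, coeff_hi, zero_add]
    exact Polynomial.trailingCoeff_nonzero_iff_nonzero.2 hb
  have hlo : lo w b = 0 := by
    ext1 k
    rw [coeff_lo, Polynomial.coeff_zero]
    split_ifs with h
    · exact Polynomial.coeff_eq_zero_of_lt_natTrailingDegree h
    · rfl
  have hb' : b = Polynomial.X ^ w * hi w b := by
    conv_lhs => rw [← lo_add_hi w b, hlo, zero_add]
  have hX : lau (Polynomial.X ^ w) = HahnSeries.single (w : ℤ) 1 := by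
    ext k : 2
    rw [coeff_lau, HahnSeries.coeff_single, Polynomial.coeff_X_pow]
    by_cases hk : k = w
    · subst hk; simp
    · rw [if_neg hk]
      split_ifs with h1 h2
      · rfl
      · omega
      · rfl
  have key : lau a / lau b = HahnSeries.single (-(w : ℤ)) 1 * HahnSeries.ofPowerSeries ℤ Qbar
      ((a : PowerSeries Qbar) * ((hi w b : Qbar[X]) : PowerSeries Qbar)⁻¹) := by
    rw [div_eq_iff (lau_ne_zero.2 hb)]
    have hlb : lau b = HahnSeries.single (w : ℤ) 1 * lau (hi w b) := by
      rw [← hX, ← map_mul, ← hb']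
    rw [hlb, lau_eq (hi w b), show ∀ x y z u : Qbar⸨X⸩, x * y * (z * u) = (x * z) * (y * u) by intros; ring,
      HahnSeries.single_mul_single, ← map_mul, mul_assoc, PowerSeries.inv_mul_cancel _ hc, mul_one,
      mul_one, neg_add_cancel, lau_eq]
    exact (one_mul _).symm
  rw [key, HahnSeries.coeff_single_mul, one_mul, sub_neg_eq_add, PowerSeries.coeff_coe]

/-! ### Valuations, and the inequality `v ≥ 0`. -/

section blocks
variable {m : ℕ} (p : ℕ) (A : GL (Fin m) (RatFunc Qbar)) {d : ℕ}

theorem Bcoeff_apply (hd : 0 < d) (k : ℤ) (a b : Fin m) : Bcoeff A d k a b =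
    if (d : ℤ) ∣ k then (((A⁻¹ : GL (Fin m) (RatFunc Qbar)) a b : RatFunc Qbar) : Qbar⸨X⸩).coeff
      (k / d) else 0 := by
  rw [Bcoeff, laurent_phi hd, coeff_lauExpand]

/-- `φ_d(A⁻¹)` is a series in `z ^ d`. This is the source of the gridded structure. -/
theorem dvd_of_Bcoeff_ne_zero (hd : 0 < d) {k : ℤ} {a b : Fin m} (h : Bcoeff A d k a b ≠ 0) :
    (d : ℤ) ∣ k := by
  rw [Bcoeff_apply A hd] at h
  by_contra hk
  exact h (if_neg hk)

theorem matVal0_le {A : Matrix (Fin m) (Fin m) (RatFunc Qbar)} {i j : Fin m} (h : A i j ≠ 0) :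
    matVal0 A ≤ val0 (A i j) := by
  refine csInf_le ?_ ⟨i, j, h, rfl⟩
  refine (Set.Finite.subset (Set.finite_range fun ij : Fin m × Fin m => val0 (A ij.1 ij.2))
    ?_).bddBelow
  rintro _ ⟨i, j, -, rfl⟩
  exact ⟨(i, j), rfl⟩

theorem exists_matVal0_eq {A : Matrix (Fin m) (Fin m) (RatFunc Qbar)} (h : A ≠ 0) :
    ∃ i j, A i j ≠ 0 ∧ val0 (A i j) = matVal0 A := by
  have hne : {v : ℤ | ∃ i j, A i j ≠ 0 ∧ val0 (A i j) = v}.Nonempty := by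
    by_contra hcon
    apply h
    ext i j : 2
    by_contra hij
    exact hcon ⟨_, i, j, hij, rfl⟩
  refine Int.csInf_mem hne ?_
  refine (Set.Finite.subset (Set.finite_range fun ij : Fin m × Fin m => val0 (A ij.1 ij.2))
    ?_).bddBelow
  rintro _ ⟨i, j, -, rfl⟩
  exact ⟨(i, j), rfl⟩

/-- A diagonal entry of `A A⁻¹` is `1`, so some product of an entry of `A` and one of `A⁻¹` has a
nonzero constant coefficient and thus order at most `0`, while its order is at least the sum of the
two valuations. -/
theorem gap_nonneg (hm : 1 ≤ m) : 0 ≤ gap A := by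
  have h1 : (A : Matrix (Fin m) (Fin m) (RatFunc Qbar)) *
      ((A⁻¹ : GL (Fin m) (RatFunc Qbar)) : Matrix (Fin m) (Fin m) (RatFunc Qbar)) = 1 :=
    Units.mul_inv A
  let i : Fin m := ⟨0, hm⟩
  have h2 : ∑ k, ((A : Matrix (Fin m) (Fin m) (RatFunc Qbar)) i k : Qbar⸨X⸩) *
      (((A⁻¹ : GL (Fin m) (RatFunc Qbar)) : Matrix (Fin m) (Fin m) (RatFunc Qbar)) k i : Qbar⸨X⸩) =
      1 := by
    have := congrArg (fun x => ((x : RatFunc Qbar) : Qbar⸨X⸩)) (congrFun (congrFun h1 i) i)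
    simp only [Matrix.mul_apply, map_sum, map_mul, Matrix.one_apply_eq, map_one] at this
    exact this
  have h3 : ∃ k, (((A : Matrix (Fin m) (Fin m) (RatFunc Qbar)) i k : Qbar⸨X⸩) *
      (((A⁻¹ : GL (Fin m) (RatFunc Qbar)) : Matrix (Fin m) (Fin m) (RatFunc Qbar)) k i :
        Qbar⸨X⸩)).coeff 0 ≠ 0 := by
    by_contra hcon
    push Not at hcon
    have := congrArg (fun x => HahnSeries.coeff x (0 : ℤ)) h2
    simp only [HahnSeries.coeff_sum, hcon] at this
    simp at this
  obtain ⟨k, hk⟩ := h3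
  set x := (A : Matrix (Fin m) (Fin m) (RatFunc Qbar)) i k with hx
  set y := ((A⁻¹ : GL (Fin m) (RatFunc Qbar)) : Matrix (Fin m) (Fin m) (RatFunc Qbar)) k i with hy
  have hxy : ((x : Qbar⸨X⸩) * (y : Qbar⸨X⸩)) ≠ 0 := by
    intro h0; rw [h0] at hk; exact hk rfl
  have hx0 : (x : Qbar⸨X⸩) ≠ 0 := left_ne_zero_of_mul hxy
  have hy0 : (y : Qbar⸨X⸩) ≠ 0 := right_ne_zero_of_mul hxy
  have h4 := HahnSeries.order_le_of_coeff_ne_zero hk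
  rw [HahnSeries.order_mul hx0 hy0] at h4
  have h5 : vA A ≤ val0 x := matVal0_le fun h => hx0 (by rw [hx, h, map_zero])
  have h6 : vAinv A ≤ val0 y := matVal0_le fun h => hy0 (by rw [hy, h, map_zero])
  change val0 x + val0 y ≤ 0 at h4
  rw [gap]; linarith

/-- The default value `n` of a zero entry exceeds all trailing degrees, so zero entries do not
disturb the minimum. -/
theorem matVal0_eq_iInf {A : Matrix (Fin m) (Fin m) (RatFunc Qbar)} (hA : A ≠ 0) {b : Qbar[X]}
    (hb : b ≠ 0) {S : Fin m → Fin m → Qbar[X]} (hS : ∀ i j, A i j = fr (S i j) / fr b) {n : ℕ}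
    (hn : ∀ i j, (S i j).natDegree < n) {t : Fin m → Fin m → ℕ}
    (ht : ∀ i j, t i j = if S i j = 0 then n else (S i j).natTrailingDegree) :
    matVal0 A = ((⨅ ij : Fin m × Fin m, t ij.1 ij.2 : ℕ) : ℤ) - b.natTrailingDegree := by
  obtain ⟨i, j, hij, hv⟩ := exists_matVal0_eq hA
  have hS0 : ∀ i j, A i j ≠ 0 ↔ S i j ≠ 0 := fun i j => by
    rw [hS, div_ne_zero_iff, fr_ne_zero, fr_ne_zero]
    exact and_iff_left hb
  have hval : ∀ i j, A i j ≠ 0 → val0 (A i j) = t i j - b.natTrailingDegree := fun i j h => by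
    rw [ht, if_neg ((hS0 i j).1 h), hS, val0_div ((hS0 i j).1 h) hb]
  have : Nonempty (Fin m × Fin m) := ⟨(i, j)⟩
  rw [← hv, hval i j hij]
  congr 2
  refine le_antisymm (le_ciInf fun ⟨i', j'⟩ => ?_) (ciInf_le (OrderBot.bddBelow _) (i, j))
  by_cases h : A i' j' = 0
  · have : S i' j' = 0 := by by_contra h'; exact (hS0 i' j').2 h' h
    rw [ht i' j', if_pos this, ht i j, if_neg ((hS0 i j).1 hij)]
    exact (Polynomial.natTrailingDegree_le_natDegree _).trans (hn i j).le
  · have := matVal0_le h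
    rw [← hv, hval i j hij, hval i' j' h] at this
    exact_mod_cast (sub_le_sub_iff_right _).1 this

end blocks

/-! ## The blocks of `M_d` and `N_d` -/

section counts
variable {m p : ℕ} (hp : 2 ≤ p) (A : GL (Fin m) (RatFunc Qbar)) (d : ℕ)
include hp

theorem nu_bounds : (d : ℤ) * vA A ≤ (p - 1) * nu p A d ∧
    (p - 1) * nu p A d < (d : ℤ) * vA A + (p - 1) := by
  have hp' : (0 : ℚ) < (p : ℚ) - 1 := by
    have : (2 : ℚ) ≤ p := by exact_mod_cast hp
    linarith
  constructor
  · have h := Int.le_ceil (((d : ℚ) * (vA A : ℚ)) / ((p : ℚ) - 1))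
    rw [div_le_iff₀ hp'] at h
    have : ((d : ℤ) * vA A : ℚ) ≤ ((p - 1) * nu p A d : ℚ) := by rw [nu]; push_cast; linarith
    exact_mod_cast this
  · have h := Int.ceil_lt_add_one (((d : ℚ) * (vA A : ℚ)) / ((p : ℚ) - 1))
    rw [← sub_lt_iff_lt_add, lt_div_iff₀ hp'] at h
    have : ((p - 1) * nu p A d : ℚ) < ((d : ℤ) * vA A + (p - 1) : ℚ) := by
      rw [nu]; push_cast; linarith
    exact_mod_cast this

theorem mu_bounds : -((d : ℤ) * vAinv A) ≤ (p - 1) * mu p A d ∧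
    (p - 1) * mu p A d < -((d : ℤ) * vAinv A) + (p - 1) := by
  have hp' : (0 : ℚ) < (p : ℚ) - 1 := by
    have : (2 : ℚ) ≤ p := by exact_mod_cast hp
    linarith
  constructor
  · have h := Int.le_ceil ((-((d : ℚ) * (vAinv A : ℚ))) / ((p : ℚ) - 1))
    rw [div_le_iff₀ hp'] at h
    have : (-((d : ℤ) * vAinv A) : ℚ) ≤ ((p - 1) * mu p A d : ℚ) := by rw [mu]; push_cast; linarith
    exact_mod_cast this
  · have h := Int.ceil_lt_add_one ((-((d : ℚ) * (vAinv A : ℚ))) / ((p : ℚ) - 1))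
    rw [← sub_lt_iff_lt_add, lt_div_iff₀ hp'] at h
    have : ((p - 1) * mu p A d : ℚ) < (-((d : ℤ) * vAinv A) + (p - 1) : ℚ) := by
      rw [mu]; push_cast; linarith
    exact_mod_cast this

theorem nu_le_mu (hm : 1 ≤ m) : nu p A d ≤ mu p A d := by
  have hg := gap_nonneg A hm
  have h1 := (nu_bounds hp A d).2
  have h2 := (mu_bounds hp A d).1
  have hd : (0 : ℤ) ≤ d := Int.natCast_nonneg d
  have hp' : (1 : ℤ) ≤ (p : ℤ) - 1 := by have : (2 : ℤ) ≤ p := by exact_mod_cast hp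
                                         linarith
  rw [gap] at hg
  have : (p - 1 : ℤ) * nu p A d < (p - 1) * (mu p A d + 1) := by nlinarith [mul_nonneg hd hg]
  have := lt_of_mul_lt_mul_left this (by linarith)
  linarith

theorem colCount_cast (hm : 1 ≤ m) : (colCount p A d : ℤ) = mu p A d - nu p A d + 1 := by
  have := nu_le_mu hp A d hm
  rw [colCount, Int.toNat_of_nonneg (by linarith)]

/-- The factor `p - 1` is kept: it is what turns `d v ≤ p ^ m v` into `O(p ^ (m - 1) v)` block
columns. -/
theorem mul_colCount_le (hm : 1 ≤ m) :
    ((p : ℤ) - 1) * colCount p A d + 1 ≤ d * gap A + 2 * (p - 1) := by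
  rw [colCount_cast hp A d hm, gap]
  have h1 := (nu_bounds hp A d).1
  have h2 := (mu_bounds hp A d).2
  linarith

/-- A cruder bound, suited to counting the blocks in one class modulo `d`: at most `v + 1`. -/
theorem colCount_le (hm : 1 ≤ m) : (colCount p A d : ℤ) ≤ d * gap A + 1 := by
  have h := mul_colCount_le hp A d hm
  have hp' : (1 : ℤ) ≤ (p : ℤ) - 1 := by have : (2 : ℤ) ≤ p := by exact_mod_cast hp
                                         linarith
  have hx : 0 ≤ (d : ℤ) * gap A := mul_nonneg (Int.natCast_nonneg d) (gap_nonneg A hm)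
  by_contra hcon
  have hc : (d : ℤ) * gap A + 2 ≤ colCount p A d := by linarith
  nlinarith [mul_le_mul_of_nonneg_left hc (zero_le_one.trans hp')]

theorem rowCount_le (hm : 1 ≤ m) : (rowCount p A d : ℤ) ≤ max (d * gap A) 1 := by
  rw [rowCount]
  split_ifs with h
  · have h1 := (nu_bounds hp A d).1
    have hx : 0 ≤ (d : ℤ) * gap A := mul_nonneg (Int.natCast_nonneg d) (gap_nonneg A hm)
    refine le_max_of_le_left ?_
    have h3 : nu p A d - (d * vAinv A + p * nu p A d) ≤ d * gap A := by rw [gap]; linarith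
    omega
  · exact le_max_right _ _

end counts

/-- The grading of the block indices by their classes modulo `d`. -/
def gradZ (n m d J : ℕ) [NeZero d] (h : ∀ y < n, m * (y / d + 1) ≤ 2 ^ J) :
    Grading (Fin n × Fin m) (ZMod d) J where
  -- The block index `y` has class `y` modulo `d` and rank `y / d` in its class; the hypothesis `h`
  -- says that the last block of each class still fits.
  cl x := ((x.1 : ℕ) : ZMod d)
  enc x := (ixEquiv J).symm ⟨(x.1 : ℕ) / d * m + x.2, by
    have h1 := h x.1 x.1.2
    have h2 := x.2.2
    rw [mul_add, mul_one, mul_comm] at h1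
    omega⟩
  dec t w := if hw : t.val + d * ((ixEquiv J w : ℕ) / m) < n ∧ 0 < m then
    some (⟨_, hw.1⟩, ⟨(ixEquiv J w : ℕ) % m, Nat.mod_lt _ hw.2⟩) else none
  dec_enc x := by
    have hm : 0 < m := x.2.pos
    have e1 : ((x.1 : ℕ) / d * m + (x.2 : ℕ)) / m = (x.1 : ℕ) / d := by
      rw [mul_comm, Nat.mul_add_div hm, Nat.div_eq_of_lt x.2.2, add_zero]
    have e2 : ((x.1 : ℕ) / d * m + (x.2 : ℕ)) % m = x.2 := by
      rw [mul_comm, Nat.mul_add_mod, Nat.mod_eq_of_lt x.2.2]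
    simp only [Equiv.apply_symm_apply, ZMod.val_natCast, e1, e2, Nat.mod_add_div, x.1.2, hm,
      and_self, dite_true]
  of_dec {t w i} hi := by
    split_ifs at hi with hw
    obtain rfl := Option.some_injective _ hi
    have hd : 0 < d := NeZero.pos d
    constructor
    · simp
    · rw [Equiv.symm_apply_eq]
      apply Fin.ext
      simp only
      rw [Nat.add_mul_div_left _ _ hd, Nat.div_eq_of_lt (ZMod.val_lt t), zero_add, mul_comm,
        Nat.div_add_mod]

/-- Multiplication by `p` modulo `d`, as a permutation. -/
def mulPerm (p d : ℕ) (h : p.Coprime d) : Equiv.Perm (ZMod d) := Units.mulLeft (ZMod.unitOfCoprime p h)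

theorem mulPerm_apply (p d : ℕ) (h : p.Coprime d) (t : ZMod d) : mulPerm p d h t = p * t := rfl

def mulAddPerm (p d : ℕ) (h : p.Coprime d) (c : ZMod d) : Equiv.Perm (ZMod d) :=
  (mulPerm p d h).trans (Equiv.addRight c)

theorem mulAddPerm_apply (p d : ℕ) (h : p.Coprime d) (c t : ZMod d) :
    mulAddPerm p d h c t = p * t + c := rfl

section graded
variable {m p : ℕ} (A : GL (Fin m) (RatFunc Qbar)) {d : ℕ} (hd : 1 ≤ d) (hc : p.Coprime d)
include hd

/-- Indices are counted from `ν`, so the divisibility of `(ν + x) - p (ν + y)` by `d` produces the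
shift `(p - 1) ν`. -/
theorem Mmat_class {n : ℕ} {x y : Fin n × Fin m} (h : Mmat p A d n x y ≠ 0) :
    ((x.1 : ℕ) : ZMod d) = mulAddPerm p d hc (((p : ℤ) - 1) * nu p A d : ℤ) ((y.1 : ℕ) : ZMod d) := by
  have h1 := dvd_of_Bcoeff_ne_zero A hd h
  rw [← ZMod.intCast_zmod_eq_zero_iff_dvd] at h1
  rw [mulAddPerm_apply]
  push_cast at h1 ⊢
  linear_combination h1

/-- The rows start at `d v_0(A⁻¹) + p ν`; the first term vanishes modulo `d` and the second cancels,
so there is no shift. -/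
theorem Nmat_class {k n : ℕ} {x : Fin k × Fin m} {y : Fin n × Fin m}
    (h : Nmat p A d k n x y ≠ 0) :
    ((x.1 : ℕ) : ZMod d) = mulPerm p d hc ((y.1 : ℕ) : ZMod d) := by
  rw [Nmat] at h
  split_ifs at h with hlt
  · have h1 := dvd_of_Bcoeff_ne_zero A hd h
    rw [← ZMod.intCast_zmod_eq_zero_iff_dvd] at h1
    rw [mulPerm_apply]
    push_cast at h1 ⊢
    rw [ZMod.natCast_self] at h1
    linear_combination h1
  · exact absurd rfl h

omit hd in
-- The row class determines the column class because `σ` is injective, and the column class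
-- determines the row class because `σ` is a function.
theorem isGridded_of_class {r s : ℕ} {D : Matrix (Fin r × Fin m) (Fin s × Fin m) Qbar}
    (σ : Equiv.Perm (ZMod d))
    (h : ∀ x y, D x y ≠ 0 → ((x.1 : ℕ) : ZMod d) = σ ((y.1 : ℕ) : ZMod d)) : IsGridded d D := by
  rintro i₀ j₀ ⟨a, b, hab⟩
  have h0 := h _ _ hab
  refine ⟨fun j hj a b => ?_, fun i hi a b => ?_⟩ <;> by_contra hne <;> have h1 := h _ _ hne
  · apply hj
    rw [← ZMod.natCast_eq_natCast_iff]
    exact σ.injective (h1.symm.trans h0)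
  · apply hi
    rw [← ZMod.natCast_eq_natCast_iff]
    exact h1.trans h0.symm

end graded

theorem gap_and_gridded (p m : ℕ) (A : GL (Fin m) (RatFunc Qbar)) (hm : 1 ≤ m) :
    0 ≤ gap A ∧ ∀ d : ℕ, 1 ≤ d → d.Coprime p →
      IsGridded d (Mmat p A d (colCount p A d)) ∧
        IsGridded d (Nmat p A d (rowCount p A d) (colCount p A d)) :=
  ⟨gap_nonneg A hm, fun _ hd hc =>
    ⟨isGridded_of_class _ fun _ _ h => Mmat_class A hd hc.symm h,
      isGridded_of_class _ fun _ _ h => Nmat_class A hd hc.symm h⟩⟩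

/-! ## The ramification index -/

/-- The points, in terms of the valuations. -/
def hullPts {m : ℕ} (p : ℕ) (w : Fin m → Option ℤ) : Set (ℚ × ℚ) :=
  {x | (∃ i : Fin m, ∃ v : ℤ, w i = some v ∧ x = ((p : ℚ) ^ (i : ℕ), (v : ℚ))) ∨
    x = ((p : ℚ) ^ m, 0)}

/-- The slopes of the lower hull, in terms of the valuations. -/
def slopesOf {m : ℕ} (p : ℕ) (w : Fin m → Option ℤ) : Set ℚ :=
  {s | ∃ x ∈ hullPts p w, ∃ y ∈ hullPts p w, x.1 < y.1 ∧ s = (y.2 - x.2) / (y.1 - x.1) ∧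
    ∀ z ∈ hullPts p w, x.2 + s * (z.1 - x.1) ≤ z.2}

open Classical in
/-- The ramification index, in terms of the valuations. -/
def ramIdx {m : ℕ} (p : ℕ) (w : Fin m → Option ℤ) : ℕ :=
  if h : (slopesOf p w).Finite then (h.toFinset.filter fun s => s.den.Coprime p).lcm Rat.den else 1

open Classical in
theorem hullSlopes_eq {m : ℕ} (p : ℕ) (q : Fin m → RatFunc Qbar) :
    hullSlopes p q = slopesOf p fun i => if q i = 0 then none else some (val0 (q i)) := by
  have : ∀ x : ℚ × ℚ, (∃ i : Fin m, q i ≠ 0 ∧ x = ((p : ℚ) ^ (i : ℕ), (val0 (q i) : ℚ))) ↔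
      ∃ i : Fin m, ∃ v : ℤ, (if q i = 0 then none else some (val0 (q i))) = some v ∧
        x = ((p : ℚ) ^ (i : ℕ), (v : ℚ)) := fun x => by
    refine exists_congr fun i => ?_
    constructor
    · rintro ⟨h, rfl⟩; exact ⟨_, if_neg h, rfl⟩
    · rintro ⟨v, h, rfl⟩
      split_ifs at h with h0
      exact ⟨h0, by rw [Option.some_injective _ h]⟩
  simp only [hullSlopes, slopesOf, hullPts, this]

section slopes
variable {m p : ℕ} (hp : 2 ≤ p) (w : Fin m → Option ℤ)
include hp

omit hp in
theorem mem_slopesOf {s : ℚ} : s ∈ slopesOf p w ↔ ∃ x ∈ hullPts p w, ∃ y ∈ hullPts p w,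
    x.1 < y.1 ∧ s = (y.2 - x.2) / (y.1 - x.1) ∧ ∀ z ∈ hullPts p w, x.2 + s * (z.1 - x.1) ≤ z.2 :=
  Iff.rfl

omit hp in
theorem mem_hullPts {x : ℚ × ℚ} : x ∈ hullPts p w ↔
    ∃ i ≤ m, ∃ v : ℤ, x = ((p : ℚ) ^ i, (v : ℚ)) ∧ x ∈ hullPts p w := by
  refine ⟨fun h => ?_, fun ⟨_, _, _, _, h⟩ => h⟩
  have h' := h
  rcases h' with ⟨i, v, -, rfl⟩ | rfl
  · exact ⟨i, i.2.le, v, rfl, h⟩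
  · exact ⟨m, le_rfl, 0, by simp, h⟩

/-- Each slope belongs to a segment between two exponents. -/
theorem slopes_segment {s : ℚ} (hs : s ∈ slopesOf p w) :
    ∃ (a b : ℕ) (u v : ℤ), a < b ∧ b ≤ m ∧ s * ((p : ℚ) ^ b - p ^ a) = v - u ∧
      ((p : ℚ) ^ a, (u : ℚ)) ∈ hullPts p w ∧ ((p : ℚ) ^ b, (v : ℚ)) ∈ hullPts p w ∧
      ∀ z ∈ hullPts p w, u + s * (z.1 - (p : ℚ) ^ a) ≤ z.2 := by
  obtain ⟨x, hx, y, hy, hxy, hs, hz⟩ := (mem_slopesOf w).1 hs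
  obtain ⟨a, -, u, rfl, hx⟩ := (mem_hullPts w).1 hx
  obtain ⟨b, hb, v, rfl, hy⟩ := (mem_hullPts w).1 hy
  have hp1 : (1 : ℚ) < p := by exact_mod_cast hp
  refine ⟨a, b, u, v, (pow_lt_pow_iff_right₀ hp1).1 hxy, hb, ?_, hx, hy, hz⟩
  rw [hs, div_mul_cancel₀]
  exact (sub_pos.2 hxy).ne'

/-- A slope times `p ^ a (p ^ (b - a) - 1)` is an integer, so a denominator prime to `p` divides `p
^ (b - a) - 1`. By convexity, segments of different slopes do not overlap and occur in the order of
the slopes. -/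
theorem exists_segments : ∃ a b : ℚ → ℕ, (∀ s ∈ slopesOf p w, a s < b s ∧ b s ≤ m ∧
      (s.den.Coprime p → s.den ∣ p ^ (b s - a s) - 1)) ∧
    ∀ s ∈ slopesOf p w, ∀ s' ∈ slopesOf p w, s < s' → b s ≤ a s' := by
  have hp1 : (1 : ℚ) < p := by exact_mod_cast hp
  choose! a b u v hab hbm heq ha hb hz using fun s => slopes_segment (s := s) hp w
  refine ⟨a, b, fun s hs => ⟨hab s hs, hbm s hs, fun hcop => ?_⟩, fun s hs s' hs' hlt => ?_⟩
  · have h1 := heq s hs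
    have hle : p ^ a s ≤ p ^ b s := Nat.pow_le_pow_right (by omega) (hab s hs).le
    have h2 : s.num * ((p : ℤ) ^ b s - p ^ a s) = (v s - u s) * s.den := by
      have hden : (s.den : ℚ) ≠ 0 := by exact_mod_cast s.den_nz
      have h3 : (s.num : ℚ) * ((p : ℚ) ^ b s - p ^ a s) = (v s - u s) * s.den := by
        rw [← h1, ← Rat.mul_den_eq_num s]; ring
      exact_mod_cast h3
    have h4 : (s.den : ℤ) ∣ (p : ℤ) ^ b s - p ^ a s := by
      have h5 : IsCoprime (s.den : ℤ) s.num := by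
        rw [Int.isCoprime_iff_gcd_eq_one, Int.gcd_comm]
        exact s.reduced
      exact h5.dvd_of_dvd_mul_left ⟨v s - u s, by rw [h2]; ring⟩
    have h6 : s.den ∣ p ^ b s - p ^ a s := by
      rw [← Int.natCast_dvd_natCast, Nat.cast_sub hle]; push_cast; exact h4
    have h7 : p ^ b s - p ^ a s = p ^ a s * (p ^ (b s - a s) - 1) := by
      rw [Nat.mul_sub, ← pow_add, Nat.add_sub_cancel' (hab s hs).le, mul_one]
    rw [h7] at h6
    exact (Nat.Coprime.pow_right _ hcop).dvd_of_dvd_mul_left h6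
  -- Each segment lies above the line through the other one; comparing at the two facing endpoints
  -- orders them.
  · have h1 := hz s' hs' _ (hb s hs)
    have h2 := hz s hs _ (ha s' hs')
    have h3 := heq s hs
    simp only at h1 h2
    have h4 : (s' - s) * ((p : ℚ) ^ b s - p ^ a s') ≤ 0 := by linarith
    have h5 : (p : ℚ) ^ b s ≤ p ^ a s' := by
      by_contra hcon
      have := mul_pos (sub_pos.2 hlt) (sub_pos.2 (not_le.1 hcon))
      linarith
    exact (pow_le_pow_iff_right₀ hp1).1 h5

theorem slopesOf_finite : (slopesOf p w).Finite := by
  obtain ⟨a, b, h1, h2⟩ := exists_segments hp w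
  refine Set.Finite.of_finite_image ((Set.finite_lt_nat m).subset ?_) (f := a) ?_
  · rintro _ ⟨s, hs, rfl⟩
    exact (h1 s hs).1.trans_le (h1 s hs).2.1
  · intro s hs s' hs' hss
    by_contra hne
    rcases lt_or_gt_of_ne hne with h | h
    · have := h2 s hs s' hs' h; have := (h1 s hs).1; omega
    · have := h2 s' hs' s hs h; have := (h1 s' hs').1; omega

/-- The least common multiple divides the product of the numbers `p ^ (b - a) - 1`. This product is
at most `p` to the total length of disjoint intervals in `[0, m)`. -/
theorem ramIdx_props : (∀ s ∈ slopesOf p w, s.den.Coprime p → s.den ∣ ramIdx p w) ∧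
    (∀ e : ℕ, (∀ s ∈ slopesOf p w, s.den.Coprime p → s.den ∣ e) → ramIdx p w ∣ e) ∧
    1 ≤ ramIdx p w ∧ p.Coprime (ramIdx p w) ∧ ramIdx p w ≤ p ^ m := by
  have hfin := slopesOf_finite hp w
  obtain ⟨a, b, h1, h2⟩ := exists_segments hp w
  have hdef : ramIdx p w = (hfin.toFinset.filter fun s => s.den.Coprime p).lcm Rat.den := by
    rw [ramIdx, dif_pos hfin]
  set F := hfin.toFinset.filter fun s : ℚ => s.den.Coprime p with hF
  have hmem : ∀ s, s ∈ F ↔ s ∈ slopesOf p w ∧ s.den.Coprime p := fun s => by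
    rw [hF, Finset.mem_filter, Set.Finite.mem_toFinset]
  have hprod : ramIdx p w ∣ ∏ s ∈ F, (p ^ (b s - a s) - 1) := by
    rw [hdef]
    exact Finset.lcm_dvd fun s hs => ((h1 s ((hmem s).1 hs).1).2.2 ((hmem s).1 hs).2).trans
      (Finset.dvd_prod_of_mem _ hs)
  have hpos : 0 < ∏ s ∈ F, (p ^ (b s - a s) - 1) := Finset.prod_pos fun s hs => by
    have h := (h1 s ((hmem s).1 hs).1).1
    have : p ^ 1 ≤ p ^ (b s - a s) := Nat.pow_le_pow_right (by omega) (by omega)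
    rw [pow_one] at this
    omega
  refine ⟨fun s hs hc => ?_, fun e he => ?_, ?_, ?_, ?_⟩
  · rw [hdef]; exact Finset.dvd_lcm ((hmem s).2 ⟨hs, hc⟩)
  · rw [hdef]; exact Finset.lcm_dvd fun s hs => he s ((hmem s).1 hs).1 ((hmem s).1 hs).2
  · exact Nat.pos_of_dvd_of_pos hprod hpos
  · have : ramIdx p w ∣ ∏ s ∈ F, s.den := by
      rw [hdef]
      exact Finset.lcm_dvd fun s hs => Finset.dvd_prod_of_mem _ hs
    exact (Nat.Coprime.coprime_dvd_left this
      (Nat.Coprime.prod_left fun s hs => ((hmem s).1 hs).2)).symm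
  · refine (Nat.le_of_dvd hpos hprod).trans ?_
    calc ∏ s ∈ F, (p ^ (b s - a s) - 1) ≤ ∏ s ∈ F, p ^ (b s - a s) :=
          Finset.prod_le_prod' fun s _ => Nat.sub_le _ _
      _ = p ^ ∑ s ∈ F, (b s - a s) := Finset.prod_pow_eq_pow_sum _ _ _
      _ ≤ p ^ m := Nat.pow_le_pow_right (by omega) ?_
    have hdisj : (F : Set ℚ).PairwiseDisjoint fun s => Finset.Ico (a s) (b s) := by
      intro s hs s' hs' hne
      have hs := ((hmem s).1 hs).1
      have hs' := ((hmem s').1 hs').1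
      refine Finset.disjoint_left.2 fun k hk hk' => ?_
      rw [Finset.mem_Ico] at hk hk'
      rcases lt_or_gt_of_ne hne with h | h
      · have := h2 s hs s' hs' h; omega
      · have := h2 s' hs' s hs h; omega
    have hcard := Finset.card_biUnion hdisj
    simp only [Nat.card_Ico] at hcard
    rw [← hcard]
    calc _ ≤ (Finset.range m).card := Finset.card_le_card fun k hk => by
          obtain ⟨s, hs, hk⟩ := Finset.mem_biUnion.1 hk
          rw [Finset.mem_Ico] at hk
          exact Finset.mem_range.2 (hk.2.trans_le (h1 s ((hmem s).1 hs).1).2.1)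
      _ = m := Finset.card_range m

end slopes

/-! ## The Faddeev–LeVerrier recursion -/

section faddeev
variable {n R : Type*} [Fintype n] [DecidableEq n] [CommRing R] [Nontrivial R]

omit [Nontrivial R] in
theorem derivative_det (M : Matrix n n R[X]) : Polynomial.derivative M.det =
    ∑ i, (M.updateCol i fun k => Polynomial.derivative (M k i)).det := by
  simp only [det_apply', map_sum]
  rw [Finset.sum_comm]
  refine Finset.sum_congr rfl fun σ _ => ?_
  rw [Polynomial.derivative_intCast_mul, Polynomial.derivative_prod_finset, Finset.mul_sum]
  refine Finset.sum_congr rfl fun i _ => ?_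
  rw [← Finset.mul_prod_erase _ _ (Finset.mem_univ i), updateCol_self, mul_comm (∏ _ ∈ _, _)]
  congr 2
  refine Finset.prod_congr rfl fun k hk => ?_
  rw [updateCol_ne (Finset.ne_of_mem_erase hk)]

omit [Nontrivial R] in
-- Jacobi's formula: differentiating a row of the characteristic matrix leaves a unit vector, so the
-- product rule gives the diagonal cofactors.
theorem trace_adjugate_charmatrix (S : Matrix n n R) :
    (charmatrix S).adjugate.trace = Polynomial.derivative S.charpoly := by
  rw [Matrix.charpoly, ← det_transpose, derivative_det, trace]
  refine Finset.sum_congr rfl fun i _ => ?_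
  rw [diag_apply, adjugate_apply, ← det_transpose (M := updateRow _ _ _), ← updateCol_transpose]
  congr 2
  funext k
  change _ = Polynomial.derivative (charmatrix S i k)
  by_cases h : k = i
  · subst h; rw [charmatrix_apply_eq]; simp
  · rw [charmatrix_apply_ne _ _ _ (Ne.symm h)]; simp [h]

/-- The matrices of the Faddeev–LeVerrier recursion. -/
def faddeev [Algebra Qbar R] (S : Matrix n n R) : ℕ → Matrix n n R
  | 0 => 1
  | i + 1 => S * faddeev S i +
    (-(algebraMap Qbar R ((i : Qbar) + 1)⁻¹ * (S * faddeev S i).trace)) • (1 : Matrix n n R)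

/-- The coefficients of the adjugate of the characteristic matrix. -/
def adjCoeff (S : Matrix n n R) (k : ℕ) : Matrix n n R :=
  of fun i j => ((charmatrix S).adjugate i j).coeff k

omit [Nontrivial R] in
-- Comparison of coefficients in `(X - S) adj(X - S) = χ · 1`.
theorem coeff_charmatrix_mul_adjugate (S : Matrix n n R) (a b : n) (k : ℕ) :
    (Polynomial.X * (charmatrix S).adjugate a b).coeff k - (S * adjCoeff S k) a b =
      S.charpoly.coeff k * (1 : Matrix n n R) a b := by
  have hmul : charmatrix S * (charmatrix S).adjugate = S.charpoly • (1 : Matrix n n R[X]) :=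
    mul_adjugate _
  have h1 : (charmatrix S * (charmatrix S).adjugate) a b = Polynomial.X *
      (charmatrix S).adjugate a b - ∑ c, Polynomial.C (S a c) * (charmatrix S).adjugate c b := by
    conv_lhs => rw [charmatrix, sub_mul, Matrix.sub_apply, scalar_apply, diagonal_mul, mul_apply]
    rfl
  have h2 : S.charpoly.coeff k * (1 : Matrix n n R) a b =
      ((charmatrix S * (charmatrix S).adjugate) a b).coeff k := by
    rw [hmul, Matrix.smul_apply, smul_eq_mul, one_apply, one_apply]
    split_ifs <;> simp
  rw [h2, h1, Polynomial.coeff_sub, Polynomial.finsetSum_coeff, mul_apply]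
  congr 1
  exact Finset.sum_congr rfl fun c _ => (Polynomial.coeff_C_mul _).symm

omit [Nontrivial R] in
theorem adjCoeff_succ (S : Matrix n n R) (k : ℕ) :
    adjCoeff S k - S * adjCoeff S (k + 1) = S.charpoly.coeff (k + 1) • (1 : Matrix n n R) := by
  ext a b
  rw [Matrix.sub_apply, Matrix.smul_apply, smul_eq_mul, ← coeff_charmatrix_mul_adjugate,
    Polynomial.coeff_X_mul]
  rfl

omit [Nontrivial R] in
theorem mul_adjCoeff_zero (S : Matrix n n R) :
    S * adjCoeff S 0 = (-S.charpoly.coeff 0) • (1 : Matrix n n R) := by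
  ext a b
  have h := coeff_charmatrix_mul_adjugate S a b 0
  rw [Polynomial.coeff_X_mul_zero, zero_sub] at h
  rw [Matrix.smul_apply, smul_eq_mul, neg_mul, ← h, neg_neg]

omit [Nontrivial R] in
theorem trace_adjCoeff (S : Matrix n n R) (k : ℕ) :
    (adjCoeff S k).trace = S.charpoly.coeff (k + 1) * (k + 1) := by
  rw [← Polynomial.coeff_derivative, ← trace_adjugate_charmatrix, trace, trace,
    Polynomial.finsetSum_coeff]
  rfl

theorem adjCoeff_eq_zero (S : Matrix n n R) {k : ℕ} (hk : Fintype.card n ≤ k) :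
    adjCoeff S k = 0 := by
  obtain ⟨K, hK⟩ : ∃ K, ∀ k, K ≤ k → adjCoeff S k = 0 := by
    obtain ⟨D, hD⟩ := (Set.finite_range fun x : n × n =>
      ((charmatrix S).adjugate x.1 x.2).natDegree).bddAbove
    refine ⟨D + 1, fun k hk => ?_⟩
    ext a b
    have h : ((charmatrix S).adjugate a b).natDegree ≤ D := hD ⟨(a, b), rfl⟩
    have h2 : ((charmatrix S).adjugate a b).coeff k = 0 :=
      Polynomial.coeff_eq_zero_of_natDegree_lt (by omega)
    exact h2
  -- The adjugate has some degree, and the recursion `adjCoeff_succ` lets one descend to `k = n`, as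
  -- the coefficients of `χ` above `n` vanish.
  have hdesc : ∀ t k, Fintype.card n ≤ k → K ≤ k + t → adjCoeff S k = 0 := by
    intro t
    induction t with
    | zero => exact fun k _ hk => hK k hk
    | succ t ih =>
      intro k hk hkt
      have h := adjCoeff_succ S k
      have h2 : S.charpoly.coeff (k + 1) = 0 := Polynomial.coeff_eq_zero_of_natDegree_lt
        (by rw [charpoly_natDegree_eq_dim]; omega)
      rwa [ih (k + 1) (by omega) (by omega), Matrix.mul_zero, sub_zero, h2, zero_smul] at h
  exact hdesc K k hk (by omega)

omit [Nontrivial R] in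
theorem trace_mul_adjCoeff (S : Matrix n n R) {i : ℕ} (hi : i < Fintype.card n) :
    (S * adjCoeff S (Fintype.card n - 1 - i)).trace =
      -((i : R) + 1) * S.charpoly.coeff (Fintype.card n - 1 - i) := by
  rcases Nat.eq_zero_or_pos (Fintype.card n - 1 - i) with h0 | hpos
  · rw [h0, mul_adjCoeff_zero, trace_smul, trace_one, smul_eq_mul]
    have : (Fintype.card n : R) = (i : R) + 1 := by
      have : Fintype.card n = i + 1 := by omega
      rw [this]; push_cast; ring
    rw [this]; ring
  · obtain ⟨k, hk⟩ : ∃ k, Fintype.card n - 1 - i = k + 1 := ⟨Fintype.card n - 1 - i - 1, by omega⟩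
    have h5 := congrArg trace (adjCoeff_succ S k)
    rw [trace_sub, trace_adjCoeff, trace_smul, trace_one, smul_eq_mul] at h5
    have : (Fintype.card n : R) = (k : R) + 1 + ((i : R) + 1) := by
      have : Fintype.card n = k + 1 + (i + 1) := by omega
      rw [this]; push_cast; ring
    rw [this] at h5
    rw [hk]
    linear_combination -h5

omit [Nontrivial R] in
theorem faddeev_coeff [Algebra Qbar R] (S : Matrix n n R) {i : ℕ} (hi : i < Fintype.card n)
    (hF : faddeev S i = adjCoeff S (Fintype.card n - 1 - i)) :
    -(algebraMap Qbar R ((i : Qbar) + 1)⁻¹ * (S * faddeev S i).trace) =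
      S.charpoly.coeff (Fintype.card n - 1 - i) := by
  have h1 : algebraMap Qbar R ((i : Qbar) + 1)⁻¹ * ((i : R) + 1) = 1 := by
    have h : ((i : Qbar) + 1) ≠ 0 := Nat.cast_add_one_ne_zero i
    have e : ((i : R) + 1) = algebraMap Qbar R ((i : Qbar) + 1) := by
      rw [map_add, map_natCast, map_one]
    rw [e, ← map_mul, inv_mul_cancel₀ h, map_one]
  rw [hF, trace_mul_adjCoeff S hi, ← mul_assoc, mul_neg, h1]; ring

/-- The recursion runs through the coefficients of the adjugate downwards, each coefficient of `χ`
being read off a trace. Its only divisions are by integers, so it works over polynomials without any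
test. -/
theorem faddeev_eq [Algebra Qbar R] (S : Matrix n n R) {i : ℕ} (hi : i < Fintype.card n) :
    faddeev S i = adjCoeff S (Fintype.card n - 1 - i) := by
  induction i with
  | zero =>
    have h := adjCoeff_succ S (Fintype.card n - 1)
    have h1 : S.charpoly.coeff (Fintype.card n) = 1 := by
      have := (charpoly_monic S).coeff_natDegree
      rwa [charpoly_natDegree_eq_dim] at this
    rw [Nat.sub_add_cancel (by omega), adjCoeff_eq_zero S le_rfl, Matrix.mul_zero, sub_zero, h1,
      one_smul] at h
    exact h.symm
  | succ i ih =>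
    have hF := ih (by omega)
    have hC := faddeev_coeff S (by omega) hF
    have h := adjCoeff_succ S (Fintype.card n - 1 - (i + 1))
    rw [show Fintype.card n - 1 - (i + 1) + 1 = Fintype.card n - 1 - i by omega] at h
    rw [faddeev, hC, hF, ← h, add_sub_cancel]

/-- The adjugate matrix and the determinant, up to the same sign. -/
theorem mul_faddeev [Algebra Qbar R] (S : Matrix n n R) (hn : 1 ≤ Fintype.card n) :
    S * faddeev S (Fintype.card n - 1) = (algebraMap Qbar R (Fintype.card n : Qbar)⁻¹ *
      (S * faddeev S (Fintype.card n - 1)).trace) • (1 : Matrix n n R) ∧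
    (algebraMap Qbar R (Fintype.card n : Qbar)⁻¹ * (S * faddeev S (Fintype.card n - 1)).trace = S.det ∨
      algebraMap Qbar R (Fintype.card n : Qbar)⁻¹ * (S * faddeev S (Fintype.card n - 1)).trace =
        -S.det) := by
  have hF := faddeev_eq S (i := Fintype.card n - 1) (by omega)
  have hC := faddeev_coeff S (by omega) hF
  rw [Nat.sub_self] at hF hC
  have e : ((Fintype.card n - 1 : ℕ) : Qbar) + 1 = (Fintype.card n : Qbar) := by
    rw [Nat.cast_sub hn, Nat.cast_one, sub_add_cancel]
  rw [e, neg_eq_iff_eq_neg] at hC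
  rw [hC]
  constructor
  · rw [hF, mul_adjCoeff_zero]
  · rw [det_eq_sign_charpoly_coeff]
    rcases neg_one_pow_eq_or R (Fintype.card n) with h | h <;> rw [h]
    · right; ring
    · left; ring

end faddeev

/-! ## Bordered minors -/

section minors
variable {R : Type*} [CommRing R]

/-- The leading principal submatrix. -/
def leadM (a : ℕ → ℕ → R) (k : ℕ) : Matrix (Fin k) (Fin k) R := of fun x y => a x y

def border (k i x : ℕ) : ℕ := if x < k then x else i

/-- The minor with rows `0, …, k - 1, i` and columns `0, …, k - 1, j`. -/
def minor (a : ℕ → ℕ → R) (k i j : ℕ) : R :=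
  det (of fun x y : Fin (k + 1) => a (border k i x) (border k j y))

theorem minor_zero (a : ℕ → ℕ → R) (i j : ℕ) : minor a 0 i j = a i j := by
  change det (of fun x y : Fin 1 => a (border 0 i x) (border 0 j y)) = _
  rw [det_fin_one]; rfl

theorem minor_self (a : ℕ → ℕ → R) (k : ℕ) : minor a k k k = (leadM a (k + 1)).det := by
  have h : ∀ x : Fin (k + 1), border k k x = x := fun x => by
    unfold border; split_ifs <;> omega
  simp only [minor, h]; rfl

theorem map_minor {R' : Type*} [CommRing R'] (f : R →+* R') (a : ℕ → ℕ → R) (k i j : ℕ) :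
    f (minor a k i j) = minor (fun x y => f (a x y)) k i j := by
  rw [minor, RingHom.map_det]; rfl

theorem map_leadM {R' : Type*} [CommRing R'] (f : R →+* R') (a : ℕ → ℕ → R) (k : ℕ) :
    f (leadM a k).det = (leadM (fun x y => f (a x y)) k).det := by
  rw [RingHom.map_det]; rfl

end minors

/-! ### Bordered minors through Schur complements. -/

section field
variable {F : Type*} [Field F]

/-- The entries of the Schur complement of the leading submatrix. -/
def schur (a : ℕ → ℕ → F) (k i j : ℕ) : F :=
  a i j - ∑ x : Fin k, ∑ y : Fin k, a i x * (leadM a k)⁻¹ x y * a y j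

theorem det_border (a : ℕ → ℕ → F) {k n : ℕ} (h : (leadM a k).det ≠ 0) (I J : Fin n → ℕ) :
    det (fromBlocks (leadM a k) (of fun x y => a x (J y)) (of fun x y => a (I x) y)
      (of fun x y => a (I x) (J y))) =
    (leadM a k).det * det (of fun x y : Fin n => schur a k (I x) (J y)) := by
  let _ := invertibleOfIsUnitDet (leadM a k) (isUnit_iff_ne_zero.2 h)
  rw [det_fromBlocks₁₁, invOf_eq_nonsing_inv]
  congr 2
  ext x y
  simp only [Matrix.sub_apply, of_apply, mul_apply, schur]
  rw [Finset.sum_comm]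
  congr 1
  refine Finset.sum_congr rfl fun u _ => ?_
  rw [Finset.sum_mul]

theorem minor_eq_schur (a : ℕ → ℕ → F) {k : ℕ} (h : (leadM a k).det ≠ 0) (i j : ℕ) :
    minor a k i j = (leadM a k).det * schur a k i j := by
  have h1 := det_border a h (fun _ : Fin 1 => i) fun _ => j
  rw [det_unique (n := Fin 1)] at h1
  rw [← show _ = (leadM a k).det * schur a k i j from h1, minor,
    ← det_submatrix_equiv_self finSumFinEquiv]
  congr 1
  ext x y
  rcases x with x | x <;> rcases y with y | y <;>
    simp [border, leadM]

theorem minor_succ_eq_schur (a : ℕ → ℕ → F) {k : ℕ} (h : (leadM a k).det ≠ 0) (i j : ℕ) :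
    minor a (k + 1) i j = (leadM a k).det *
      (schur a k k k * schur a k i j - schur a k k j * schur a k i k) := by
  have h1 := det_border a h (fun x : Fin 2 => if x = 0 then k else i)
    fun y : Fin 2 => if y = 0 then k else j
  rw [det_fin_two] at h1
  rw [← show _ = (leadM a k).det *
      (schur a k k k * schur a k i j - schur a k k j * schur a k i k) from h1, minor,
    ← det_submatrix_equiv_self (finSumFinEquiv (m := k) (n := 2))]
  congr 1
  have e1 : ∀ (x : Fin k) (i : ℕ), border (k + 1) i (x : ℕ) = x := fun x i => by
    unfold border; split_ifs <;> omega
  have e2 : ∀ (x : Fin 2) (i : ℕ), border (k + 1) i (k + x : ℕ) = if x = 0 then k else i := by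
    intro x i
    fin_cases x <;> simp [border]
  ext x y
  rcases x with x | x <;> rcases y with y | y <;>
    simp [e1, e2, leadM]

end field

/-- Over the fraction field, bordered minors are the leading minor times minors of the Schur
complement, and the identity becomes the expansion of a determinant of size two. It says that a step
of fraction-free elimination may be divided exactly by the previous pivot. -/
theorem sylvester (a : ℕ → ℕ → Qbar[X]) {k : ℕ} (h : (leadM a k).det ≠ 0) (i j : ℕ) :
    minor a k k k * minor a k i j - minor a k k j * minor a k i k =
      (leadM a k).det * minor a (k + 1) i j := by
  apply fr_injective
  have h' : (leadM (fun x y => fr (a x y)) k).det ≠ 0 := by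
    rw [← map_leadM]; exact fr_ne_zero.2 h
  simp only [map_sub, map_mul, map_minor, map_leadM, minor_eq_schur _ h', minor_succ_eq_schur _ h']
  ring

/-- A bound row by row, because the degrees of the rows `r_i` grow geometrically. -/
theorem natDegree_det_le {n : ℕ} (M : Matrix (Fin n) (Fin n) Qbar[X]) {D : Fin n → ℕ}
    (h : ∀ i j, (M i j).natDegree ≤ D i) : M.det.natDegree ≤ ∑ i, D i := by
  rw [← det_transpose, det_apply]
  refine Polynomial.natDegree_sum_le_of_forall_le _ _ fun σ _ => ?_
  refine (Polynomial.natDegree_smul_le _ _).trans ((Polynomial.natDegree_prod_le _ _).trans ?_)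
  exact Finset.sum_le_sum fun i _ => h i (σ i)

/-! ## The cyclic vector -/

section cyclic
variable {m : ℕ} (p : ℕ) (Q : Qbar[X]) (S : Matrix (Fin m) (Fin m) Qbar[X])
  (r : Fin m → Fin m → Qbar)

/-- The numerators of the rows `r_i`. -/
def numRow : ℕ → Fin m → Qbar[X]
  | 0 => fun j => ∑ l : Fin m, Polynomial.C (r j l) * Polynomial.X ^ (l : ℕ)
  | i + 1 => fun j => ∑ l, Polynomial.expand Qbar p (numRow i l) * S l j

/-- The denominators of the rows `r_i`. -/
def denRow : ℕ → Qbar[X]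
  | 0 => 1
  | i + 1 => Polynomial.expand Qbar p (denRow i) * Q

variable {p Q S r}

theorem denRow_ne_zero (hp : 0 < p) (hQ : Q ≠ 0) (i : ℕ) : denRow p Q i ≠ 0 := by
  induction i with
  | zero => exact one_ne_zero
  | succ i ih => exact mul_ne_zero ((Polynomial.expand_ne_zero hp).2 ih) hQ

theorem cyclicRow_eq (hp : 0 < p) (hQ : Q ≠ 0) {A : Matrix (Fin m) (Fin m) (RatFunc Qbar)}
    (hA : ∀ i j, A i j = fr (S i j) / fr Q) (i : ℕ) (j : Fin m) :
    cyclicRow p A (fun j' => fr (∑ l : Fin m, Polynomial.C (r j' l) * Polynomial.X ^ (l : ℕ))) i j =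
      fr (numRow p S r i j) / fr (denRow p Q i) := by
  induction i generalizing j with
  | zero => rw [denRow, map_one, div_one]; rfl
  | succ i ih =>
    have hd := denRow_ne_zero hp hQ i
    rw [cyclicRow, vecMul, dotProduct, numRow, denRow, map_sum, Finset.sum_div]
    refine Finset.sum_congr rfl fun l _ => ?_
    simp only [ih, hA, phi_div hp hd]
    rw [div_mul_div_comm, map_mul, map_mul]

/-- The degrees obey `D' ≤ p D + δ`. The slack `δ + 1` makes the induction close: it is multiplied
by `p ≥ 2`, which pays for the new `δ`. -/
theorem numRow_natDegree (hp : 2 ≤ p) {δ : ℕ} (hm : 1 ≤ m) (hS : ∀ i j, (S i j).natDegree ≤ δ)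
    (i : ℕ) (j : Fin m) : (numRow p S r i j).natDegree + δ + 1 ≤ p ^ i * (δ + m) := by
  induction i generalizing j with
  | zero =>
    have : (numRow p S r 0 j).natDegree ≤ m - 1 := by
      refine Polynomial.natDegree_sum_le_of_forall_le _ _ fun l _ => ?_
      refine (Polynomial.natDegree_C_mul_X_pow_le _ _).trans ?_
      omega
    rw [pow_zero]; omega
  | succ i ih =>
    have : (numRow p S r (i + 1) j).natDegree + 2 * δ + p ≤ p ^ (i + 1) * (δ + m) + δ := by
      have h1 : (numRow p S r (i + 1) j).natDegree ≤ p * (p ^ i * (δ + m) - δ - 1) + δ := by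
        refine Polynomial.natDegree_sum_le_of_forall_le _ _ fun l _ => ?_
        refine Polynomial.natDegree_mul_le.trans (Nat.add_le_add ?_ (hS l j))
        rw [Polynomial.natDegree_expand, mul_comm]
        exact Nat.mul_le_mul_left p (by have := ih l; omega)
      have h2 := ih j
      obtain ⟨e, he⟩ : ∃ e, p ^ i * (δ + m) = e + δ + 1 := ⟨_, (Nat.sub_add_cancel (by omega :
        δ + 1 ≤ p ^ i * (δ + m))).symm⟩
      rw [he, show e + δ + 1 - δ - 1 = e by omega] at h1
      rw [pow_succ', mul_assoc, he]
      nlinarith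
    omega

theorem denRow_natDegree (hp : 2 ≤ p) {δ : ℕ} (hm : 1 ≤ m) (hQ : Q.natDegree ≤ δ)
    (i : ℕ) : (denRow p Q i).natDegree + δ + 1 ≤ p ^ i * (δ + m) := by
  induction i with
  | zero => rw [denRow, Polynomial.natDegree_one, pow_zero]; omega
  | succ i ih =>
    have h1 : (denRow p Q (i + 1)).natDegree ≤ p * (denRow p Q i).natDegree + δ := by
      refine Polynomial.natDegree_mul_le.trans (Nat.add_le_add ?_ hQ)
      rw [Polynomial.natDegree_expand, mul_comm]
    have h2 : p * ((denRow p Q i).natDegree + δ + 1) ≤ p ^ (i + 1) * (δ + m) := by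
      rw [pow_succ', mul_assoc]; exact Nat.mul_le_mul_left p ih
    nlinarith

theorem mul_inv_evalAt {x : Qbar} (hQ : Q.eval x ≠ 0) (hS : S.det.eval x ≠ 0) :
    S.map (Polynomial.eval x) * (evalAt Q S x)⁻¹ = Q.eval x • 1 := by
  have hu : IsUnit (S.map (Polynomial.eval x)).det := by
    rw [isUnit_iff_ne_zero]
    have : (S.map (Polynomial.eval x)).det = S.det.eval x :=
      ((Polynomial.evalRingHom x).map_det S).symm
    rwa [this]
  rw [evalAt]
  have h1 : ((Q.eval x)⁻¹ • S.map (Polynomial.eval x))⁻¹ =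
      Q.eval x • (S.map (Polynomial.eval x))⁻¹ := by
    refine inv_eq_right_inv ?_
    rw [smul_mul_smul_comm, inv_mul_cancel₀ hQ, mul_nonsing_inv _ hu, one_smul]
  rw [h1, Matrix.mul_smul, mul_nonsing_inv _ hu]

/-- The product `A(x)⁻¹ A(x ^ p)⁻¹ ⋯`. -/
def prodInv (p : ℕ) (Q : Qbar[X]) (S : Matrix (Fin m) (Fin m) Qbar[X]) (x : Qbar) (i : ℕ) :
    Matrix (Fin m) (Fin m) Qbar :=
  ((List.range i).map fun k => (evalAt Q S (x ^ p ^ k))⁻¹).prod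

theorem prodInv_succ' (x : Qbar) (i : ℕ) :
    prodInv p Q S x (i + 1) = (evalAt Q S x)⁻¹ * prodInv p Q S (x ^ p) i := by
  rw [prodInv, prodInv, List.range_succ_eq_map, List.map_cons, List.prod_cons, List.map_map,
    pow_zero, pow_one]
  congr 3
  funext k
  rw [Function.comp_apply, pow_succ', pow_mul]

theorem prodInv_succ (x : Qbar) (i : ℕ) :
    prodInv p Q S x (i + 1) = prodInv p Q S x i * (evalAt Q S (x ^ p ^ i))⁻¹ := by
  rw [prodInv, prodInv, List.range_succ, List.map_append, List.prod_append, List.map_singleton,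
    List.prod_singleton]

/-- Unfolded, the row of index `i` is `r(z ^ p ^ i) A(z ^ p ^ (i - 1)) ⋯ A(z)`; multiplying by the
inverse factors on the right recovers `r(x ^ p ^ i)`. -/
theorem numRow_eval {x : Qbar} (i : ℕ) (hQ : ∀ k, Q.eval (x ^ p ^ k) ≠ 0)
    (hS : ∀ k, S.det.eval (x ^ p ^ k) ≠ 0) :
    (fun j => (numRow p S r i j).eval x) ᵥ* prodInv p Q S x i =
      fun j => (denRow p Q i).eval x * ∑ l : Fin m, r j l * (x ^ p ^ i) ^ (l : ℕ) := by
  induction i generalizing x with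
  | zero =>
    funext j
    simp [prodInv, numRow, denRow, Polynomial.eval_finsetSum]
  | succ i ih =>
    have hx : ∀ k, (x ^ p) ^ p ^ k = x ^ p ^ (k + 1) := fun k => by rw [← pow_mul, ← pow_succ']
    have h1 := ih (x := x ^ p) (fun k => by rw [hx]; exact hQ _) (fun k => by rw [hx]; exact hS _)
    have h2 : (fun j => (numRow p S r (i + 1) j).eval x) =
        (fun j => (numRow p S r i j).eval (x ^ p)) ᵥ* S.map (Polynomial.eval x) := by
      funext j
      simp [numRow, Polynomial.eval_finsetSum, vecMul, dotProduct, Polynomial.expand_eval]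
    have hQ0 := hQ 0
    have hS0 := hS 0
    rw [pow_zero, pow_one] at hQ0 hS0
    rw [prodInv_succ', h2, vecMul_vecMul, ← Matrix.mul_assoc, mul_inv_evalAt hQ0 hS0,
      Matrix.smul_mul, Matrix.one_mul, vecMul_smul, h1]
    funext j
    simp only [Pi.smul_apply, smul_eq_mul, denRow, Polynomial.eval_mul, Polynomial.expand_eval, hx]
    ring

theorem isUnit_prodInv {x : Qbar} (i : ℕ) (hQ : ∀ k, Q.eval (x ^ p ^ k) ≠ 0)
    (hS : ∀ k, S.det.eval (x ^ p ^ k) ≠ 0) : IsUnit (prodInv p Q S x i) := by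
  induction i with
  | zero => exact isUnit_one
  | succ i ih =>
    rw [prodInv_succ]
    refine ih.mul ?_
    have h := mul_inv_evalAt (hQ i) (hS i)
    rw [isUnit_iff_isUnit_det]
    have h2 := congrArg det h
    rw [det_mul, det_smul, det_one, mul_one] at h2
    rw [isUnit_iff_ne_zero]
    refine right_ne_zero_of_mul (a := (S.map (Polynomial.eval (x ^ p ^ i))).det) ?_
    rw [h2]; exact pow_ne_zero _ (hQ i)

/-- The interpolation conditions are made for this: at `x`, the row of index `i` is the unit vector
`e_i`. -/
theorem numRow_eval_eq {x : Qbar} (i : Fin m) (hQ : ∀ k, Q.eval (x ^ p ^ k) ≠ 0)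
    (hS : ∀ k, S.det.eval (x ^ p ^ k) ≠ 0)
    (hr : ∀ i j : Fin m, ∑ l : Fin m, r j l * (x ^ p ^ (i : ℕ)) ^ (l : ℕ) =
      prodInv p Q S x i i j) (j : Fin m) :
    (numRow p S r i j).eval x = (denRow p Q i).eval x * (1 : Matrix (Fin m) (Fin m) Qbar) i j := by
  have h1 := numRow_eval (r := r) (i : ℕ) hQ hS
  have h2 : (fun j => (denRow p Q i).eval x * ∑ l : Fin m, r j l * (x ^ p ^ (i : ℕ)) ^ (l : ℕ)) =
      (fun j => (denRow p Q i).eval x * (1 : Matrix (Fin m) (Fin m) Qbar) i j) ᵥ*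
        prodInv p Q S x i := by
    funext j
    rw [hr, vecMul, dotProduct]
    simp [one_apply]
  rw [h2] at h1
  exact congrFun (vecMul_injective_of_isUnit (isUnit_prodInv (i : ℕ) hQ hS) h1) j

theorem denRow_eval_ne_zero {x : Qbar} (i : ℕ) (hQ : ∀ k, Q.eval (x ^ p ^ k) ≠ 0) :
    (denRow p Q i).eval x ≠ 0 := by
  induction i generalizing x with
  | zero => simp [denRow]
  | succ i ih =>
    rw [denRow, Polynomial.eval_mul, Polynomial.expand_eval]
    have hx : ∀ k, (x ^ p) ^ p ^ k = x ^ p ^ (k + 1) := fun k => by rw [← pow_mul, ← pow_succ']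
    refine mul_ne_zero (ih fun k => by rw [hx]; exact hQ _) ?_
    have := hQ 0
    rwa [pow_zero, pow_one] at this

/-- The rows `r_i`, completed by the identity matrix. -/
def augM (p : ℕ) (S : Matrix (Fin m) (Fin m) Qbar[X]) (r : Fin m → Fin m → Qbar) (i j : ℕ) : Qbar[X] :=
  -- The sign of the last row, together with the zeros to its right, makes the last bordered minors
  -- equal to the numerators of `r_m P⁻¹` without a further change of sign.
  if h : j < m then (if i < m then numRow p S r i ⟨j, h⟩ else -numRow p S r m ⟨j, h⟩)
  else if i < m ∧ j = m + i then 1 else 0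

/-- At `x` the leading submatrix is diagonal with the nonzero values of the denominators. So all
pivots are nonzero polynomials and the elimination needs no pivoting. -/
theorem leadM_augM_ne_zero {x : Qbar} (hQ : ∀ k, Q.eval (x ^ p ^ k) ≠ 0)
    (hS : ∀ k, S.det.eval (x ^ p ^ k) ≠ 0)
    (hr : ∀ i j : Fin m, ∑ l : Fin m, r j l * (x ^ p ^ (i : ℕ)) ^ (l : ℕ) =
      prodInv p Q S x i i j) {k : ℕ} (hk : k ≤ m) : (leadM (augM p S r) k).det ≠ 0 := by
  intro h
  have h1 := congrArg (Polynomial.evalRingHom x) h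
  rw [map_leadM, map_zero] at h1
  have h2 : leadM (fun i j => Polynomial.evalRingHom x (augM p S r i j)) k =
      diagonal fun i : Fin k => (denRow p Q i).eval x := by
    ext i j : 2
    have hi : (i : ℕ) < m := i.2.trans_le hk
    have hj : (j : ℕ) < m := j.2.trans_le hk
    rw [leadM, of_apply, augM, dif_pos hj, if_pos hi, Polynomial.coe_evalRingHom,
      numRow_eval_eq ⟨i, hi⟩ hQ hS hr]
    by_cases hij : i = j
    · subst hij; rw [one_apply_eq, mul_one, diagonal_apply_eq]
    · rw [one_apply_ne (fun h => hij (Fin.ext (Fin.mk.inj_iff.1 h))), mul_zero,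
        diagonal_apply_ne _ hij]
  rw [h2, det_diagonal] at h1
  exact Finset.prod_ne_zero_iff.2 (fun i _ => denRow_eval_ne_zero _ hQ) h1

end cyclic

/-! ## The bound on the roots -/

/-- `polyNorm` is Cauchy's bound on the absolute values of the roots. -/
theorem eval_ne_zero_of_polyNorm_le {f : Qbar[X]} (hf : f ≠ 0) {x : Qbar}
    (h : (polyNorm f : ℝ) ≤ ‖(x : ℂ)‖) : f.eval x ≠ 0 := by
  intro h0
  have hinj : Function.Injective (algebraMap Qbar ℂ) := (algebraMap Qbar ℂ).injective
  have hf' : f.map (algebraMap Qbar ℂ) ≠ 0 := (Polynomial.map_ne_zero_iff hinj).2 hf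
  have hr : (f.map (algebraMap Qbar ℂ)).IsRoot (x : ℂ) := by
    change Polynomial.eval (algebraMap Qbar ℂ x) _ = 0
    rw [Polynomial.eval_map_algebraMap, Polynomial.aeval_algebraMap_apply, Polynomial.coe_aeval_eq_eval,
      h0, map_zero]
  have h1 := hr.norm_lt_cauchyBound hf'
  have h2 : (f.map (algebraMap Qbar ℂ)).cauchyBound = polyNorm f := by
    rw [Polynomial.cauchyBound, polyNorm, Polynomial.natDegree_map_eq_of_injective hinj,
      Polynomial.leadingCoeff_map_of_injective hinj, add_comm, NNReal.finset_sup_div]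
    simp only [Polynomial.coeff_map]
    rfl
  rw [h2] at h1
  exact absurd h (not_le.2 (by exact_mod_cast h1))

theorem polyNorm_neg (f : Qbar[X]) : polyNorm (-f) = polyNorm f := by
  simp [polyNorm]

theorem injective_pow_pow {p : ℕ} (hp : 2 ≤ p) {x : Qbar} (hx : 2 ≤ ‖(x : ℂ)‖) :
    Function.Injective fun i : ℕ => x ^ p ^ i := by
  have h1 : StrictMono fun i : ℕ => ‖(x : ℂ)‖ ^ p ^ i :=
    (pow_right_strictMono₀ (by linarith)).comp (pow_right_strictMono₀ (by omega))
  intro i k hik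
  apply h1.injective
  have := congrArg (fun y : Qbar => ‖(y : ℂ)‖) hik
  simpa using this

theorem norm_le_norm_pow {p : ℕ} (hp : 2 ≤ p) {x : Qbar} (hx : 2 ≤ ‖(x : ℂ)‖) (k : ℕ) :
    ‖(x : ℂ)‖ ≤ ‖((x ^ p ^ k : Qbar) : ℂ)‖ := by
  have : ‖((x ^ p ^ k : Qbar) : ℂ)‖ = ‖(x : ℂ)‖ ^ p ^ k := by simp
  rw [this]
  exact le_self_pow₀ (by linarith) (pow_ne_zero _ (by omega))

/-! ## Computation of the adjugate matrix and of the determinant -/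

section programs
variable {s : ℕ → List Instr} {z : Reg} {N : ℕ} {U : ℝ} {env : List Qbar} {m : ℕ}

/-- Product of matrices of polynomials. -/
def polyMM (s : ℕ → List Instr) (z : Reg) (N n : ℕ) {m : ℕ} (a b : Fin m → Fin m → ℕ → Reg) :
    Prog (Fin m → Fin m → ℕ → Reg) :=
  forAll fun i => forAll fun j => polyDot s z N n (fun l => a i l) fun l => b l j

theorem comp_polyMM (hs : PolyMul s N U) {n : ℕ} (hn : 1 ≤ n) (hnN : n ≤ 8 * N)
    {a b : Fin m → Fin m → ℕ → Reg} {F G : Matrix (Fin m) (Fin m) Qbar[X]} (hz : rep env z 0)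
    (ha : rep env a fun i j => (F i j).coeff) (hb : rep env b fun i j => (G i j).coeff)
    (hF : ∀ i j, (F i j).natDegree ≤ n) (hG : ∀ i j, (G i j).natDegree ≤ n) :
    Comp (polyMM s z N n a b) env (739 * (m ^ 3 * (n * U))) fun i j => ((F * G) i j).coeff := by
  refine Comp.mono (v := fun i j => ((F * G) i j).coeff) (comp_forAll' fun i _ h1 => comp_forAll' fun j _ h2 =>
    (comp_polyDot hs hn hnN (f := fun l => F i l) (g := fun l => G l j) (Rep.mono (h1.trans h2) hz)
      (Rep.mono (h1.trans h2) (ha i)) (fun l => Rep.mono (h1.trans h2) (hb l j)) (hF i)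
      fun l => hG l j).mono le_rfl (by rw [Matrix.mul_apply])) ?_ rfl
  simp only [Fintype.card_fin]
  exact le_of_eq (by ring)

/-- The trace of a matrix of polynomials of degree less than `n`, multiplied by a constant. -/
def traceP (z : Reg) (n : ℕ) (c : Reg) (a : Fin m → Fin m → ℕ → Reg) : Prog (ℕ → Reg) :=
  tab z n fun k => do
    let t ← sumAll z fun i => a i i k
    pmul c t

theorem comp_traceP {n : ℕ} {c : Reg} {y : Qbar} {a : Fin m → Fin m → ℕ → Reg}
    {F : Matrix (Fin m) (Fin m) Qbar[X]} (hz : rep env z 0) (hc : rep env c y)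
    (ha : rep env a fun i j => (F i j).coeff) (hF : ∀ i j, (F i j).natDegree < n) :
    Comp (traceP z n c a) env (n * (m + 1)) (Polynomial.C y * F.trace).coeff := by
  refine comp_tab hz (fun k e _ he => Comp.bind (comp_sumAll (x := fun i => (F i i).coeff k)
    (Rep.mono he hz) fun i => Rep.mono he (ha i i k)) fun e' t h1 ht =>
      (comp_mul (Rep.mono (he.trans h1) hc) ht).mono (by simp) ?_) fun k hk => ?_
  · rw [Polynomial.coeff_C_mul, trace, Polynomial.finsetSum_coeff]; rfl
  · rw [Polynomial.coeff_C_mul, trace, Polynomial.finsetSum_coeff]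
    refine mul_eq_zero_of_right _ (Finset.sum_eq_zero fun i _ => ?_)
    exact Polynomial.coeff_eq_zero_of_natDegree_lt ((hF i i).trans_le hk)

def fadStepP (s : ℕ → List Instr) (z : Reg) (N n : ℕ) (a : Fin m → Fin m → ℕ → Reg) (i : ℕ)
    (f : Fin m → Fin m → ℕ → Reg) : Prog (Fin m → Fin m → ℕ → Reg) := do
  let g ← polyMM s z N n a f
  let c ← pconst (-((i : Qbar) + 1)⁻¹)
  let t ← traceP z n c g
  forAll fun i => forAll fun j => if i = j then tab z n fun k => padd (g i j k) (t k) else pure (g i j)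

def fadP (s : ℕ → List Instr) (z : Reg) (N n : ℕ) (a : Fin m → Fin m → ℕ → Reg) :
    ℕ → Prog (Fin m → Fin m → ℕ → Reg)
  | 0 => do
    let o ← pconst 1
    pure fun i j k => if i = j ∧ k = 0 then o else z
  | i + 1 => do
    let f ← fadP s z N n a i
    fadStepP s z N n a i f

theorem natDegree_mul_apply_le {S F : Matrix (Fin m) (Fin m) Qbar[X]} {δ d : ℕ}
    (hS : ∀ i j, (S i j).natDegree ≤ δ) (hF : ∀ i j, (F i j).natDegree ≤ d) (i j : Fin m) :
    ((S * F) i j).natDegree ≤ δ + d := by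
  rw [Matrix.mul_apply]
  exact Polynomial.natDegree_sum_le_of_forall_le _ _ fun l _ =>
    Polynomial.natDegree_mul_le.trans (Nat.add_le_add (hS i l) (hF l j))

theorem natDegree_trace_le {F : Matrix (Fin m) (Fin m) Qbar[X]} {d : ℕ} (y : Qbar)
    (hF : ∀ i j, (F i j).natDegree ≤ d) : (Polynomial.C y * F.trace).natDegree ≤ d :=
  (Polynomial.natDegree_C_mul_le _ _).trans
    (Polynomial.natDegree_sum_le_of_forall_le _ _ fun i _ => hF i i)

theorem faddeev_succ_apply (S : Matrix (Fin m) (Fin m) Qbar[X]) (k : ℕ) (i j : Fin m) :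
    faddeev S (k + 1) i j = (S * faddeev S k) i j +
      if i = j then Polynomial.C (-((k : Qbar) + 1)⁻¹) * (S * faddeev S k).trace else 0 := by
  rw [faddeev, Matrix.add_apply, Matrix.smul_apply, Matrix.one_apply, smul_eq_mul, mul_ite, mul_one,
    mul_zero, Polynomial.C_neg, neg_mul]
  rfl

theorem natDegree_faddeev_le {S : Matrix (Fin m) (Fin m) Qbar[X]} {δ : ℕ}
    (hS : ∀ i j, (S i j).natDegree ≤ δ) (k : ℕ) (i j : Fin m) :
    (faddeev S k i j).natDegree ≤ k * δ := by
  induction k generalizing i j with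
  | zero =>
    rw [faddeev, Matrix.one_apply]
    split_ifs <;> simp
  | succ k ih =>
    have h := natDegree_mul_apply_le hS ih
    have e : δ + k * δ = (k + 1) * δ := by ring
    rw [e] at h
    rw [faddeev_succ_apply]
    refine (Polynomial.natDegree_add_le _ _).trans (max_le (h i j) ?_)
    split_ifs
    · exact natDegree_trace_le _ h
    · simp

theorem comp_fadStepP (hs : PolyMul s N U) {δ n : ℕ} (hnN : n ≤ 8 * N)
    {a f : Fin m → Fin m → ℕ → Reg} {S : Matrix (Fin m) (Fin m) Qbar[X]}
    (hS : ∀ i j, (S i j).natDegree ≤ δ) {k : ℕ} (hk : (k + 1) * δ < n) (hz : rep env z 0)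
    (ha : rep env a fun i j => (S i j).coeff) (hf : rep env f fun i j => (faddeev S k i j).coeff) :
    Comp (fadStepP s z N n a k f) env (739 * (m ^ 3 * (n * U)) + 1 + n * (m + 1) + m * (m * n))
      fun i j => (faddeev S (k + 1) i j).coeff := by
  have hd := natDegree_faddeev_le hS k
  have h := natDegree_mul_apply_le hS hd
  have e : δ + k * δ = (k + 1) * δ := by ring
  rw [e] at h
  refine Comp.bind (comp_polyMM hs (by omega) hnN hz ha hf (fun i j => (hS i j).trans (by nlinarith))
    fun i j => (hd i j).trans (by nlinarith)) fun e1 g h1 hg => ?_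
  refine Comp.bind (comp_const _) fun e2 c h2 hc => ?_
  have hg2 := Rep.mono h2 hg
  refine Comp.bind (comp_traceP (Rep.mono (h1.trans h2) hz) hc hg2 fun i j => (h i j).trans_lt hk)
    fun e3 t h3 ht => ?_
  have hg3 := Rep.mono h3 hg2
  refine Comp.mono (v := fun i j => (faddeev S (k + 1) i j).coeff) (c := m * (m * n)) ?_ (by linarith) rfl
  have hc : ((Fintype.card (Fin m) : ℝ) * (Fintype.card (Fin m) * (n * 1)) : ℝ) = m * (m * n) := by simp
  rw [← hc]
  refine comp_forAll' fun i e4 h4 => comp_forAll' fun j e5 h5 => ?_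
  have hz5 : rep e5 z 0 := Rep.mono ((((h1.trans h2).trans h3).trans h4).trans h5) hz
  have hg5 := Rep.mono (h4.trans h5) (hg3 i j)
  by_cases hij : i = j
  · rw [if_pos hij]
    refine comp_tab hz5 (fun l e6 _ h6 => (comp_add (Rep.mono h6 (hg5 l))
      (Rep.mono ((h4.trans h5).trans h6) (ht l))).mono le_rfl ?_) fun l hl => ?_
    · rw [faddeev_succ_apply, if_pos hij, Polynomial.coeff_add]
    · exact Polynomial.coeff_eq_zero_of_natDegree_lt
        (((natDegree_faddeev_le hS (k + 1) i j).trans_lt hk).trans_le hl)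
  · rw [if_neg hij]
    refine Sat.pure (by positivity) ?_
    rw [faddeev_succ_apply, if_neg hij, add_zero]
    exact hg5

theorem comp_fadP (hs : PolyMul s N U) {δ n : ℕ} (hnN : n ≤ 8 * N) {a : Fin m → Fin m → ℕ → Reg}
    {S : Matrix (Fin m) (Fin m) Qbar[X]} (hS : ∀ i j, (S i j).natDegree ≤ δ) (k : ℕ)
    (hk : k * δ < n) (hz : rep env z 0) (ha : rep env a fun i j => (S i j).coeff) :
    Comp (fadP s z N n a k) env
      (1 + k * (739 * (m ^ 3 * (n * U)) + 1 + n * (m + 1) + m * (m * n)))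
      fun i j => (faddeev S k i j).coeff := by
  induction k with
  | zero =>
    refine Comp.bind (comp_const 1) fun e o h1 ho => Sat.pure (by simp) fun i j l => ?_
    change rep e _ (((1 : Matrix (Fin m) (Fin m) Qbar[X]) i j).coeff l)
    rw [Matrix.one_apply]
    by_cases hij : i = j
    · by_cases hl : l = 0
      · subst hl; simpa [hij] using ho
      · rw [if_pos hij, Polynomial.coeff_one, if_neg hl, if_neg (by tauto)]
        exact Rep.mono h1 hz
    · rw [if_neg hij, Polynomial.coeff_zero, if_neg (by tauto)]
      exact Rep.mono h1 hz
  | succ k ih =>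
    refine Comp.bind (ih (by nlinarith)) fun e f h1 hf => ?_
    exact (comp_fadStepP hs hnN hS hk (Rep.mono h1 hz) (Rep.mono h1 ha) hf).mono
      (by push_cast; ring_nf; exact le_rfl) rfl

/-! ## Computation of the norms -/

/-- The register contains a nonnegative real number. -/
def RepN (env : List Qbar) (r : Reg) (v : ℝ≥0) : Prop := ∃ x : Qbar, rep env r x ∧ (x : ℂ) = ((v : ℝ) : ℂ)

theorem RepN.mono {env' : List Qbar} {r : Reg} {v : ℝ≥0} (h : env <+: env') (hr : RepN env r v) :
    RepN env' r v :=
  let ⟨x, h1, h2⟩ := hr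
  ⟨x, Rep.mono h h1, h2⟩

/-- The maximum of nonnegative numbers. -/
def maxP (acc : Reg) : (n : ℕ) → (ℕ → Reg) → Prog Reg
  | 0, _ => pure acc
  | n + 1, r => do
    let t ← maxP acc n r
    ifle (r n) t (pure t) (pure (r n))

theorem sat_maxP {acc : Reg} {y : ℝ≥0} {n : ℕ} {r : ℕ → Reg} {v : ℕ → ℝ≥0} (hy : RepN env acc y)
    (hr : ∀ k < n, RepN env (r k) (v k)) :
    Sat (maxP acc n r) env n fun e t => RepN e t (max y ((Finset.range n).sup v)) := by
  induction n with
  | zero => exact Sat.pure (by simp) (by simpa using hy)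
  | succ n ih =>
    refine Sat.bind (ih fun k hk => hr k (by omega)) fun e t h1 ht => ?_
    have hrn := RepN.mono h1 (hr n (by omega))
    have e1 : max y ((Finset.range (n + 1)).sup v) =
        max (v n) (max y ((Finset.range n).sup v)) := by
      rw [Finset.range_add_one, Finset.sup_insert, max_left_comm]
    rw [e1]
    obtain ⟨b, hb, hb'⟩ := ht
    obtain ⟨x, hx, hx'⟩ := hrn
    have nx : ‖(x : ℂ)‖ = v n := by rw [hx']; simp
    have nb : ‖(b : ℂ)‖ = (max y ((Finset.range n).sup v) : ℝ≥0) := by rw [hb']; simp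
    refine sat_ifle hx hb (fun hle => Sat.pure (by push_cast; linarith) ?_)
      (fun hlt => Sat.pure (by push_cast; linarith) ?_)
    · rw [nx, nb, NNReal.coe_le_coe] at hle
      rw [max_eq_right hle]; exact ⟨b, hb, hb'⟩
    · rw [nx, nb, NNReal.coe_lt_coe] at hlt
      rw [max_eq_left hlt.le]; exact ⟨x, hx, hx'⟩

/-- The norm of a nonzero polynomial of degree at most `n`. -/
def normP (z : Reg) (n : ℕ) (a : ℕ → Reg) : Prog Reg := do
  -- The degree is found from the top. Testing the coefficients of degree `n` down to `1` suffices: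
  -- if they vanish, a nonzero polynomial is constant.
  let w ← findNZ (fun k => a (n - k)) n 0
  let l ← pabs (a (n - w))
  let r ← tab z (n - w) fun k => do
    let u ← pabs (a k)
    pdiv u l
  let t ← maxP z (n - w) r
  let o ← pconst 1
  padd o t

theorem sat_normP {n : ℕ} {a : ℕ → Reg} {f : Qbar[X]} (hf : f ≠ 0) (hn : f.natDegree ≤ n)
    (hz : rep env z 0) (ha : rep env a f.coeff) :
    Sat (normP z n a) env (4 * n + 3) fun e r => RepN e r (polyNorm f) := by
  refine Sat.bind (sat_findNZ (v := fun k => f.coeff (n - k)) n 0 fun k => ha (n - k))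
    fun e1 w h1 hw => ?_
  obtain ⟨-, hwn, hw0, hw1⟩ := hw
  rw [zero_add] at hwn hw1
  have hdeg : n - w = f.natDegree := by
    apply le_antisymm
    · by_contra hlt
      rw [not_le] at hlt
      have h3 : w < n := by omega
      exact hw1 h3 (Polynomial.coeff_eq_zero_of_natDegree_lt hlt)
    · by_contra hlt
      rw [not_le] at hlt
      have h3 := hw0 (n - f.natDegree) (Nat.zero_le _) (by omega)
      rw [show n - (n - f.natDegree) = f.natDegree by omega] at h3
      exact hf (Polynomial.leadingCoeff_eq_zero.1 h3)
  rw [hdeg]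
  have ha1 := Rep.mono h1 ha
  refine Comp.bind (comp_abs (ha1 f.natDegree)) fun e2 l h2 hl => ?_
  have hz2 := Rep.mono (h1.trans h2) hz
  refine Comp.bind (comp_tab (c := 2) (v := fun k => if k < f.natDegree then
    absQ (f.coeff k) / absQ (f.coeff f.natDegree) else 0) hz2 (fun k e3 hk h3 => ?_)
    fun k hk => if_neg (not_lt.2 hk)) fun e3 r h3 hr => ?_
  · refine Comp.bind (comp_abs (Rep.mono (h2.trans h3) (ha1 k))) fun e4 u h4 hu => ?_
    exact (comp_div hu (Rep.mono (h3.trans h4) hl)).mono (by norm_num) (by rw [if_pos hk])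
  refine Sat.bind (sat_maxP (y := 0) (n := f.natDegree)
    (v := fun k => ‖(f.coeff k : ℂ)‖₊ / ‖(f.leadingCoeff : ℂ)‖₊) ⟨0, Rep.mono h3 hz2, by simp⟩
    fun k hk => ⟨_, hr k, ?_⟩) fun e4 t h4 ht => ?_
  · simp only [if_pos hk]
    have hcoe : ((absQ (f.coeff k) / absQ (f.coeff f.natDegree) : Qbar) : ℂ) =
      (absQ (f.coeff k) : ℂ) / (absQ (f.coeff f.natDegree) : ℂ) := map_div₀ (algebraMap Qbar ℂ) _ _
    rw [hcoe]
    change (((‖(f.coeff k : ℂ)‖ : ℝ) : ℂ)) / (((‖(f.coeff f.natDegree : ℂ)‖ : ℝ) : ℂ)) = _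
    push_cast
    rfl
  refine Comp.bind (comp_const 1) fun e5 o h5 ho => ?_
  obtain ⟨y, hy, hy'⟩ := RepN.mono h5 ht
  refine Sat.mono (comp_add ho hy) ?_ fun e6 b h6 hb => ⟨_, hb, ?_⟩
  · have : (f.natDegree : ℝ) ≤ n := by exact_mod_cast hn
    linarith
  · rw [polyNorm]
    rw [max_eq_right zero_le] at hy'
    have hcoe : ((1 + y : Qbar) : ℂ) = 1 + (y : ℂ) := by push_cast; rfl
    rw [hcoe, hy']
    push_cast
    rfl

end programs

/-! ## Computation of the cyclic vector -/

section cyc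
variable {s : ℕ → List Instr} {z : Reg} {env : List Qbar} {m : ℕ}
  {Q e : Qbar[X]} {S G : Matrix (Fin m) (Fin m) Qbar[X]}

/-- The value at `x` of `Q e⁻¹ G`. -/
def invVal (Q e : Qbar[X]) (G : Matrix (Fin m) (Fin m) Qbar[X]) (x : Qbar) :
    Matrix (Fin m) (Fin m) Qbar :=
  of fun i j => Q.eval x / e.eval x * (G i j).eval x

theorem inv_evalAt_eq (hG : S * G = e • (1 : Matrix (Fin m) (Fin m) Qbar[X])) {x : Qbar}
    (hQ : Q.eval x ≠ 0) (he : e.eval x ≠ 0) : (evalAt Q S x)⁻¹ = invVal Q e G x := by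
  refine inv_eq_right_inv ?_
  have h1 : S.map (Polynomial.eval x) * G.map (Polynomial.eval x) = e.eval x • 1 := by
    have h2 := congrArg (fun M : Matrix (Fin m) (Fin m) Qbar[X] => M.map (Polynomial.evalRingHom x)) hG
    simp only [Matrix.map_mul] at h2
    refine h2.trans ?_
    ext i j : 2
    rw [Matrix.map_apply, Matrix.smul_apply, Matrix.smul_apply, Matrix.one_apply, Matrix.one_apply]
    split_ifs <;> simp
  have h3 : invVal Q e G x = (Q.eval x / e.eval x) • G.map (Polynomial.eval x) := by
    ext i j : 2; rfl
  rw [h3, evalAt, smul_mul_smul_comm, h1, smul_smul]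
  rw [show (Q.eval x)⁻¹ * (Q.eval x / e.eval x) * e.eval x = 1 by field_simp, one_smul]

def invAtP (z : Reg) (n : ℕ) (q e : ℕ → Reg) (g : Fin m → Fin m → ℕ → Reg) (x : Reg) :
    Prog (Fin m → Fin m → Reg) := do
  let a ← horner z n q x
  let b ← horner z n e x
  let c ← pdiv a b
  forAll fun i => forAll fun j => do
    let t ← horner z n (g i j) x
    pmul c t

theorem comp_invAtP {n : ℕ} {rq re : ℕ → Reg} {g : Fin m → Fin m → ℕ → Reg} {x : Reg} {y : Qbar}
    (hz : rep env z 0) (hq : rep env rq Q.coeff) (he : rep env re e.coeff)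
    (hg : rep env g fun i j => (G i j).coeff) (hx : rep env x y) (hQn : Q.natDegree < n)
    (hen : e.natDegree < n) (hGn : ∀ i j, (G i j).natDegree < n) :
    Comp (invAtP z n rq re g x) env (4 * n + 1 + m * (m * (2 * n + 1))) (invVal Q e G y) := by
  refine Comp.bind (comp_horner_eval hz hq hx hQn) fun e1 a h1 ha => ?_
  refine Comp.bind (comp_horner_eval (Rep.mono h1 hz) (Rep.mono h1 he) (Rep.mono h1 hx) hen)
    fun e2 b h2 hb => ?_
  refine Comp.bind (comp_div (Rep.mono h2 ha) hb) fun e3 c h3 hc => ?_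
  have h13 := (h1.trans h2).trans h3
  refine Comp.mono (v := invVal Q e G y) (c := m * (m * (2 * n + 1))) ?_ (by linarith) rfl
  have hcard : ((Fintype.card (Fin m) : ℝ) * (Fintype.card (Fin m) * (2 * n + 1)) : ℝ) =
      m * (m * (2 * n + 1)) := by simp
  rw [← hcard]
  refine comp_forAll' fun i e4 h4 => comp_forAll' fun j e5 h5 => ?_
  have h15 := (h13.trans h4).trans h5
  refine Comp.bind (comp_horner_eval (Rep.mono h15 hz) (Rep.mono h15 (hg i j)) (Rep.mono h15 hx)
    (hGn i j)) fun e6 t h6 ht => ?_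
  exact (comp_mul (Rep.mono ((h4.trans h5).trans h6) hc) ht).mono (by linarith) rfl

/-- Naive powering is enough: the `O(m p)` operations for all points are absorbed by `p ^ m`. -/
def powP (x : Reg) : ℕ → Prog Reg
  | 0 => pconst 1
  | k + 1 => do
    let y ← powP x k
    pmul y x

theorem comp_powP {x : Reg} {y : Qbar} (hx : rep env x y) (k : ℕ) :
    Comp (powP x k) env (k + 1) (y ^ k) := by
  induction k with
  | zero => exact (comp_const 1).mono (by simp) (pow_zero y).symm
  | succ k ih =>
    exact Comp.bind ih fun e1 t h1 ht => (comp_mul ht (Rep.mono h1 hx)).mono (by push_cast; linarith)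
      (pow_succ y k).symm

/-- The powers `x ^ p ^ k`. -/
def pointsP (x : Reg) (p n : ℕ) : Prog (ℕ → Reg) := iterP (pure x) (fun _ y => powP y p) n

theorem sat_pointsP {x : Reg} {y : Qbar} (hx : rep env x y) (p n : ℕ) :
    Sat (pointsP x p n) env (n * (p + 1)) fun e r => ∀ k ≤ n, rep e (r k) (y ^ p ^ k) := by
  refine Sat.mono (sat_iterP (P := fun k e a => rep e a (y ^ p ^ k)) (c₀ := 0)
    (c := fun _ => (p : ℝ) + 1) (fun _ _ _ _ => Rep.mono) (Sat.pure le_rfl (by simpa using hx)) n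
    fun k _ e1 a h1 ha => (comp_powP ha p).mono le_rfl (by rw [pow_succ, pow_mul]))
    (by rw [Finset.sum_const, Finset.card_range, nsmul_eq_mul, zero_add]) fun _ _ _ h => h

/-- The products `A(x)⁻¹ A(x ^ p)⁻¹ ⋯`. -/
def prodsP (z : Reg) (n : ℕ) (q e : ℕ → Reg) (g : Fin m → Fin m → ℕ → Reg) (x : ℕ → Reg) (L : ℕ) :
    Prog (ℕ → Fin m → Fin m → Reg) :=
  iterP (do
    let o ← pconst 1
    pure fun i j => if i = j then o else z)
    (fun k a => do
      let b ← invAtP z n q e g (x k)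
      mulN z a b) L

theorem sat_prodsP {p n L : ℕ} {rq re : ℕ → Reg} {g : Fin m → Fin m → ℕ → Reg} {x : ℕ → Reg}
    {y : Qbar} (hz : rep env z 0) (hq : rep env rq Q.coeff) (he : rep env re e.coeff)
    (hg : rep env g fun i j => (G i j).coeff) (hx : ∀ k ≤ L, rep env (x k) (y ^ p ^ k))
    (hQn : Q.natDegree < n) (hen : e.natDegree < n) (hGn : ∀ i j, (G i j).natDegree < n)
    (hG : S * G = e • (1 : Matrix (Fin m) (Fin m) Qbar[X]))
    (hQ : ∀ k, Q.eval (y ^ p ^ k) ≠ 0) (he' : ∀ k, e.eval (y ^ p ^ k) ≠ 0) :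
    Sat (prodsP z n rq re g x L) env
      (1 + L * ((4 * n + 1 + m * (m * (2 * n + 1))) + m * (m * (2 * m))))
      fun e r => ∀ k ≤ L, rep e (r k) (prodInv p Q S y k) := by
  refine Sat.mono (sat_iterP (P := fun k e a => rep e a (prodInv p Q S y k)) (c₀ := 1)
    (c := fun _ => (4 * n + 1 + m * (m * (2 * n + 1))) + m * (m * (2 * m)))
    (fun _ _ _ _ => Rep.mono) ?_ L (fun k hk e1 a h1 ha => ?_))
    (by rw [Finset.sum_const, Finset.card_range, nsmul_eq_mul]) fun _ _ _ h => h
  · refine Comp.bind (comp_const 1) fun e o h1 ho => Sat.pure (by simp) fun i j => ?_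
    change rep e _ ((1 : Matrix (Fin m) (Fin m) Qbar) i j)
    rw [Matrix.one_apply]
    split_ifs
    · exact ho
    · exact Rep.mono h1 hz
  · refine Comp.bind (comp_invAtP (Rep.mono h1 hz) (Rep.mono h1 hq) (Rep.mono h1 he)
      (Rep.mono h1 hg) (Rep.mono h1 (hx k hk.le)) hQn hen hGn) fun e2 b h2 hb => ?_
    refine (comp_mulN (Rep.mono (h1.trans h2) hz) (Rep.mono h2 ha) hb).mono (by simp) ?_
    rw [prodInv_succ, inv_evalAt_eq hG (hQ k) (he' k)]

/-- The powers of the points. -/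
def vanderP (x : ℕ → Reg) : Prog (Fin m → Fin m → Reg) :=
  forAll fun i : Fin m => do
    let h ← iterP (pconst 1) (fun _ a => pmul a (x i)) m
    pure fun l => h l

theorem comp_vanderP {x : ℕ → Reg} {y : ℕ → Qbar} (hx : ∀ k ≤ m, rep env (x k) (y k)) :
    Comp (vanderP x) env (m * (1 + m)) (vandermonde fun i : Fin m => y i) := by
  refine Comp.mono (v := vandermonde fun i : Fin m => y i) (comp_forAll' (c := 1 + m) fun i e1 h1 => ?_)
    (by simp) rfl
  refine Sat.bind (sat_iterP (P := fun l e a => rep e a (y i ^ l)) (c₀ := 1) (c := fun _ => 1)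
    (fun _ _ _ _ => Rep.mono) ((comp_const 1).mono le_rfl (pow_zero _).symm) m
    fun l _ e2 a h2 ha => (comp_mul ha (Rep.mono (h1.trans h2) (hx i i.2.le))).mono le_rfl
      (pow_succ _ _).symm) fun e2 h h2 hh => ?_
  exact Sat.pure (by simp) fun l => hh l l.2.le

/-- The coefficients of the polynomials of degree less than `m` with given values. -/
def interpP (s : ℕ → List Instr) (z : Reg) (j : ℕ) (x : ℕ → Reg) (t : ℕ → Fin m → Fin m → Reg) :
    Prog (Fin m → Fin m → Reg) := do
  let v ← vanderP x
  let w ← ppinv s z j m (j + 2) v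
  mulN z w fun i l => t i i l

/-- The nodes are distinct, so the Vandermonde matrix is invertible and its generalized inverse is
its inverse. -/
theorem sat_interpP {j : ℕ} {V : ℝ} (hs : MatMul s j V) (hm : m ≤ 2 ^ (j + 2)) {x : ℕ → Reg}
    {y : ℕ → Qbar} {t : ℕ → Fin m → Fin m → Reg} {T : ℕ → Matrix (Fin m) (Fin m) Qbar}
    (hz : rep env z 0) (hx : ∀ k ≤ m, rep env (x k) (y k)) (hy : Function.Injective y)
    (ht : ∀ k ≤ m, rep env (t k) (T k)) :
    Sat (interpP s z j x t) env (m * (1 + m) + (7 * (m * m ^ 2) + 23 * (4 ^ (j + 2) * V)) +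
      m * (m * (2 * m))) fun e a => ∃ r : Fin m → Fin m → Qbar, rep e (fun b l => a l b) r ∧
        ∀ i b : Fin m, ∑ l : Fin m, r b l * y i ^ (l : ℕ) = T i i b := by
  refine Comp.bind (comp_vanderP hx) fun e1 v h1 hv => ?_
  refine Comp.bind (comp_ppinv hs le_rfl hm (Rep.mono h1 hz) hv) fun e2 w h2 hw => ?_
  have ht2 : rep e2 (fun (i : Fin m) l => t i i l) (of fun (i : Fin m) l => T i i l) :=
    fun i l => Rep.mono (h1.trans h2) (ht i i.2.le i l)
  refine Sat.mono (comp_mulN (Rep.mono (h1.trans h2) hz) hw ht2)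
    (by simp only [Fintype.card_fin]; linarith) fun e3 a h3 ha => ?_
  refine ⟨_, fun b l => ha l b, fun i b => ?_⟩
  have hu : IsUnit (vandermonde fun i : Fin m => y i) := by
    rw [isUnit_iff_isUnit_det, isUnit_iff_ne_zero, det_vandermonde_ne_zero_iff]
    exact hy.comp Fin.val_injective
  have h4 := mul_pinv_mul (k := j + 2) hm (vandermonde fun i : Fin m => y i)
  rw [hu.mul_eq_right] at h4
  have h5 : (vandermonde fun i : Fin m => y i) * (pinv m (j + 2) (vandermonde fun i : Fin m => y i) *
    of fun (i : Fin m) l => T i i l) = of fun (i : Fin m) l => T i i l := by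
    rw [← Matrix.mul_assoc, h4, Matrix.one_mul]
  have h6 := congrFun (congrFun h5 i) b
  rw [Matrix.mul_apply] at h6
  refine Eq.trans (Finset.sum_congr rfl fun l _ => ?_) h6
  rw [vandermonde_apply, mul_comm]

/-- The point `z₀` and the coefficients of the vector `r`. -/
def cyclicP (s : ℕ → List Instr) (z : Reg) (j p n : ℕ) (q e : ℕ → Reg)
    (g : Fin m → Fin m → ℕ → Reg) : Prog (Reg × (Fin m → Fin m → Reg)) := do
  let a ← normP z n e
  let b ← normP z n q
  let c ← pconst 2
  let x ← maxP c 2 fun k => if k = 0 then a else b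
  let xs ← pointsP x p m
  let t ← prodsP z n q e g xs m
  let r ← interpP s z j xs t
  pure (x, fun j l => r l j)

/-- The specification of the cyclic vector. -/
def CyclicSpec (p : ℕ) (Q : Qbar[X]) (S : Matrix (Fin m) (Fin m) Qbar[X]) (x : Qbar)
    (r : Fin m → Fin m → Qbar) : Prop :=
  (x : ℂ) = ((max 2 (max (polyNorm S.det : ℝ) (polyNorm Q : ℝ)) : ℝ) : ℂ) ∧
    (∀ k, Q.eval (x ^ p ^ k) ≠ 0) ∧ (∀ k, S.det.eval (x ^ p ^ k) ≠ 0) ∧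
    ∀ i j : Fin m, ∑ l : Fin m, r j l * (x ^ p ^ (i : ℕ)) ^ (l : ℕ) = prodInv p Q S x i i j

/-- The determinant is only known up to sign, which its norm does not see. Since `z₀ ≥ 2`, all the
points `z₀ ^ p ^ k` are at least `z₀` and distinct, so they avoid the roots of `Q` and `det S`. -/
theorem sat_cyclicP {j p n : ℕ} {V : ℝ} (hp : 2 ≤ p) (hs : MatMul s j V) (hm : m ≤ 2 ^ (j + 2))
    {rq re : ℕ → Reg} {g : Fin m → Fin m → ℕ → Reg}
    (hz : rep env z 0) (hq : rep env rq Q.coeff) (he : rep env re e.coeff)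
    (hg : rep env g fun i j => (G i j).coeff)
    (hQn : Q.natDegree < n) (hen : e.natDegree < n) (hGn : ∀ i j, (G i j).natDegree < n)
    (hG : S * G = e • (1 : Matrix (Fin m) (Fin m) Qbar[X]))
    (hQ : Q ≠ 0) (hS : S.det ≠ 0) (hed : e = S.det ∨ e = -S.det) :
    Sat (cyclicP s z j p n rq re g) env (2 * (4 * n + 3) + 3 + m * (p + 1) +
      (1 + m * ((4 * n + 1 + m * (m * (2 * n + 1))) + m * (m * (2 * m)))) +
      (m * (1 + m) + (7 * (m * m ^ 2) + 23 * (4 ^ (j + 2) * V)) + m * (m * (2 * m))))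
      fun e a => ∃ x r, rep e a.1 x ∧ rep e a.2 r ∧ CyclicSpec p Q S x r := by
  have he0 : e ≠ 0 := by
    rcases hed with h | h <;> rw [h]
    · exact hS
    · exact neg_ne_zero.2 hS
  have hen' : polyNorm e = polyNorm S.det := by
    rcases hed with h | h <;> rw [h]
    exact polyNorm_neg _
  refine Sat.bind (sat_normP he0 hen.le hz he) fun e1 a h1 ha => ?_
  refine Sat.bind (sat_normP hQ hQn.le (Rep.mono h1 hz) (Rep.mono h1 hq)) fun e2 b h2 hb => ?_
  refine Comp.bind (comp_const 2) fun e3 c h3 hc => ?_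
  refine Sat.bind (sat_maxP (y := 2) (v := fun k => if k = 0 then polyNorm e else polyNorm Q)
    ⟨2, hc, by simp; rfl⟩ fun k hk => ?_) fun e4 x h4 hx => ?_
  · by_cases hk0 : k = 0
    · simp only [if_pos hk0]; exact RepN.mono (h2.trans h3) ha
    · simp only [if_neg hk0]; exact RepN.mono h3 hb
  obtain ⟨y, hy, hyv⟩ := hx
  have hmax : (max 2 ((Finset.range 2).sup fun k => if k = 0 then polyNorm e else polyNorm Q) : ℝ≥0) =
      max 2 (max (polyNorm S.det) (polyNorm Q)) := by
    rw [hen', Finset.range_add_one, Finset.sup_insert, Finset.range_one, Finset.sup_singleton,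
      if_neg one_ne_zero, if_pos rfl, max_comm (polyNorm S.det)]
  rw [hmax] at hyv
  have hny : ‖(y : ℂ)‖ = max 2 (max (polyNorm S.det : ℝ) (polyNorm Q : ℝ)) := by
    rw [hyv]; simp
  have hy2 : 2 ≤ ‖(y : ℂ)‖ := by rw [hny]; exact le_max_left _ _
  have hQ' : ∀ k, Q.eval (y ^ p ^ k) ≠ 0 := fun k =>
    eval_ne_zero_of_polyNorm_le hQ (le_trans (by rw [hny]; simp) (norm_le_norm_pow hp hy2 k))
  have hS' : ∀ k, S.det.eval (y ^ p ^ k) ≠ 0 := fun k =>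
    eval_ne_zero_of_polyNorm_le hS (le_trans (by rw [hny]; simp) (norm_le_norm_pow hp hy2 k))
  have he' : ∀ k, e.eval (y ^ p ^ k) ≠ 0 := fun k => by
    rcases hed with h | h <;> rw [h]
    · exact hS' k
    · rw [Polynomial.eval_neg]; exact neg_ne_zero.2 (hS' k)
  have h14 := ((h1.trans h2).trans h3).trans h4
  refine Sat.bind (sat_pointsP hy p m) fun e5 xs h5 hxs => ?_
  have h15 := h14.trans h5
  refine Sat.bind (sat_prodsP (L := m) (Rep.mono h15 hz) (Rep.mono h15 hq) (Rep.mono h15 he)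
    (Rep.mono h15 hg) hxs hQn hen hGn hG hQ' he') fun e6 t h6 ht => ?_
  refine Sat.bind (sat_interpP hs hm (Rep.mono (h15.trans h6) hz)
    (fun k hk => Rep.mono h6 (hxs k hk)) (injective_pow_pow hp hy2) ht) fun e7 r h7 hr => ?_
  obtain ⟨rv, hr1, hr2⟩ := hr
  refine Sat.pure (by push_cast; linarith) ⟨y, rv, Rep.mono ((h5.trans h6).trans h7) hy, hr1, ?_, hQ', hS', hr2⟩
  rw [hyv]; simp

end cyc

/-! ## The companion matrix -/

section companion
variable {m p : ℕ} {Q : Qbar[X]} {S : Matrix (Fin m) (Fin m) Qbar[X]} {r : Fin m → Fin m → Qbar}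

/-- The numerators of `q`, up to the common factor. -/
def lastMinor (p : ℕ) (S : Matrix (Fin m) (Fin m) Qbar[X]) (r : Fin m → Fin m → Qbar) (c : Fin m) :
    Qbar[X] := minor (augM p S r) m m (m + c)

theorem augM_lt (i : ℕ) (hi : i < m) (j : Fin m) : augM p S r i j = numRow p S r i j := by
  rw [augM, dif_pos j.2, if_pos hi]

theorem augM_last (j : Fin m) : augM p S r m j = -numRow p S r m j := by
  rw [augM, dif_pos j.2, if_neg (lt_irrefl m)]

theorem augM_right (i : ℕ) (hi : i < m) (c : Fin m) :
    augM p S r i (m + c) = if i = c then 1 else 0 := by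
  rw [augM, dif_neg (by omega)]
  by_cases h : i = c
  · rw [if_pos ⟨hi, by omega⟩, if_pos h]
  · rw [if_neg (fun h' => h (by omega)), if_neg h]

theorem augM_last_right (c : Fin m) : augM p S r m (m + c) = 0 := by
  rw [augM, dif_neg (by omega), if_neg (by omega)]

/-- Cramer's rule: by the Schur complement formula the bordered minor with unit column `c` is the
leading minor times the coordinate `c` of the last row multiplied by the inverse of the leading
matrix. -/
theorem sum_lastMinor_mul (h : (leadM (augM p S r) m).det ≠ 0) (j : Fin m) :
    ∑ c : Fin m, lastMinor p S r c * numRow p S r c j =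
      (leadM (augM p S r) m).det * numRow p S r m j := by
  apply fr_injective
  set a : ℕ → ℕ → RatFunc Qbar := fun x y => fr (augM p S r x y) with ha
  have h' : (leadM a m).det ≠ 0 := by
    rw [ha, ← map_leadM]; exact fr_ne_zero.2 h
  have hy : ∀ c : Fin m, fr (lastMinor p S r c) = (leadM a m).det *
      ∑ x : Fin m, fr (numRow p S r m x) * (leadM a m)⁻¹ x c := fun c => by
    have h0 : a m (m + c) = 0 := by simp only [ha]; rw [augM_last_right, map_zero]
    rw [lastMinor, map_minor, minor_eq_schur _ h', schur]
    change (leadM a m).det * (a m (m + c) - _) = _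
    rw [h0, zero_sub, ← Finset.sum_neg_distrib]
    congr 1
    refine Finset.sum_congr rfl fun x _ => ?_
    have hterm : ∀ y : Fin m, a m x * (leadM a m)⁻¹ x y * a y (m + c) =
        if y = c then -(fr (numRow p S r m x) * (leadM a m)⁻¹ x y) else 0 := fun y => by
      simp only [ha]
      rw [augM_last, augM_right y y.2, map_neg]
      by_cases hyc : y = c
      · rw [if_pos (congrArg Fin.val hyc), if_pos hyc, map_one]; ring
      · rw [if_neg (fun h => hyc (Fin.ext h)), if_neg hyc, map_zero, mul_zero]
    rw [Finset.sum_congr rfl fun y _ => hterm y, Finset.sum_ite_eq' Finset.univ c,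
      if_pos (Finset.mem_univ c), neg_neg]
  have hinv : (leadM a m)⁻¹ * leadM a m = 1 := nonsing_inv_mul _ (isUnit_iff_ne_zero.2 h')
  rw [map_sum, map_mul, map_leadM]
  simp only [map_mul, hy]
  have h1 : ∀ c : Fin m, ((leadM a m).det * ∑ x : Fin m, fr (numRow p S r m x) * (leadM a m)⁻¹ x c) *
      fr (numRow p S r c j) = (leadM a m).det *
        ((fun x => fr (numRow p S r m x)) ᵥ* (leadM a m)⁻¹) c * leadM a m c j := fun c => by
    rw [leadM, of_apply, vecMul, dotProduct]
    simp only [ha]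
    rw [augM_lt c c.2 j]
  rw [Finset.sum_congr rfl fun c _ => h1 c]
  have h2 := congrFun (vecMul_vecMul (fun x => fr (numRow p S r m x)) (leadM a m)⁻¹ (leadM a m)) j
  rw [hinv, vecMul_one] at h2
  rw [← h2]
  conv_rhs => rw [vecMul, dotProduct, Finset.mul_sum]
  exact Finset.sum_congr rfl fun c _ => by rw [mul_assoc]

/-- The matrix with rows `r_i`. -/
def gaugeM (p : ℕ) (Q : Qbar[X]) (S : Matrix (Fin m) (Fin m) Qbar[X]) (r : Fin m → Fin m → Qbar) :
    Matrix (Fin m) (Fin m) (RatFunc Qbar) :=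
  of fun i j => fr (numRow p S r i j) / fr (denRow p Q i)

def lastRow (p : ℕ) (Q : Qbar[X]) (S : Matrix (Fin m) (Fin m) Qbar[X]) (r : Fin m → Fin m → Qbar)
    (c : Fin m) : RatFunc Qbar :=
  fr (lastMinor p S r c * denRow p Q c) / fr ((leadM (augM p S r) m).det * denRow p Q m)

theorem isUnit_gaugeM (hp : 0 < p) (hQ : Q ≠ 0) (h : (leadM (augM p S r) m).det ≠ 0) :
    IsUnit (gaugeM p Q S r) := by
  have e : gaugeM p Q S r = diagonal (fun i : Fin m => (fr (denRow p Q i))⁻¹) *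
      leadM (fun x y => fr (augM p S r x y)) m := by
    ext i j : 2
    rw [diagonal_mul, gaugeM, of_apply, leadM, of_apply, augM_lt i i.2 j, div_eq_inv_mul]
  rw [e, isUnit_iff_isUnit_det, det_mul, det_diagonal, isUnit_iff_ne_zero, ← map_leadM]
  exact mul_ne_zero (Finset.prod_ne_zero_iff.2 fun i _ =>
    inv_ne_zero (fr_ne_zero.2 (denRow_ne_zero hp hQ _))) (fr_ne_zero.2 h)

theorem lastRow_eq (hp : 0 < p) (hQ : Q ≠ 0) {A : Matrix (Fin m) (Fin m) (RatFunc Qbar)}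
    (hA : ∀ i j, A i j = fr (S i j) / fr Q) (h : (leadM (augM p S r) m).det ≠ 0) (i : Fin m)
    (hi : (i : ℕ) + 1 = m) :
    lastRow p Q S r = (fun j => phi p (gaugeM p Q S r i j)) ᵥ* A ᵥ* (gaugeM p Q S r)⁻¹ := by
  have h1 : (fun j => phi p (gaugeM p Q S r i j)) ᵥ* A =
      fun j => fr (numRow p S r m j) / fr (denRow p Q m) := by
    have h2 : (fun j => phi p (gaugeM p Q S r i j)) ᵥ* A =
        cyclicRow p A (fun j' => fr (∑ l : Fin m, Polynomial.C (r j' l) * Polynomial.X ^ (l : ℕ)))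
          (i + 1) := by
      rw [cyclicRow]
      congr 1
      funext j
      rw [cyclicRow_eq hp hQ hA]; rfl
    rw [h2, hi]
    funext j
    exact cyclicRow_eq hp hQ hA m j
  have h3 : lastRow p Q S r ᵥ* gaugeM p Q S r =
      fun j => fr (numRow p S r m j) / fr (denRow p Q m) := by
    funext j
    have hΔ := fr_ne_zero.2 h
    have hD := fr_ne_zero.2 (denRow_ne_zero hp hQ m)
    have hs := congrArg (fun f => fr f) (sum_lastMinor_mul h j)
    simp only [map_sum, map_mul] at hs
    rw [vecMul, dotProduct]
    have ht : ∀ c : Fin m, lastRow p Q S r c * gaugeM p Q S r c j =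
        fr (lastMinor p S r c) * fr (numRow p S r c j) *
          (fr (leadM (augM p S r) m).det * fr (denRow p Q m))⁻¹ := fun c => by
      have hc := fr_ne_zero.2 (denRow_ne_zero hp hQ (c : ℕ))
      rw [lastRow, gaugeM, of_apply, map_mul, map_mul]
      field_simp
    rw [Finset.sum_congr rfl fun c _ => ht c, ← Finset.sum_mul, hs]
    field_simp
  rw [h1, ← h3, vecMul_vecMul, mul_nonsing_inv _ ((isUnit_iff_isUnit_det _).1 (isUnit_gaugeM hp hQ h)),
    vecMul_one]

/-- The geometric sum behind all savings of a factor `m`: earlier rows together cost no more than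
the next one. -/
theorem sum_pow_mul_le (hp : 2 ≤ p) (k c : ℕ) :
    ∑ l ∈ Finset.range k, p ^ l * c ≤ p ^ k * c := by
  induction k with
  | zero => simp
  | succ k ih =>
    rw [Finset.sum_range_succ, pow_succ]
    have : 2 * (p ^ k * c) ≤ p ^ k * p * c := by
      rw [mul_right_comm, mul_comm 2]; exact Nat.mul_le_mul_left _ hp
    omega

theorem natDegree_augM_lt (hp : 2 ≤ p) {δ : ℕ} (hm : 1 ≤ m) (hS : ∀ i j, (S i j).natDegree ≤ δ)
    (i j : ℕ) (hi : i ≤ m) : (augM p S r i j).natDegree < p ^ i * (δ + m) := by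
  have hpos : 0 < p ^ i * (δ + m) := Nat.mul_pos (pow_pos (by omega) _) (by omega)
  rw [augM]
  split_ifs with h1 h2 h3
  · have := numRow_natDegree (r := r) hp hm hS i ⟨j, h1⟩; omega
  · have := numRow_natDegree (r := r) hp hm hS m ⟨j, h1⟩
    obtain rfl : i = m := by omega
    rw [Polynomial.natDegree_neg]; omega
  · simpa using hpos
  · simpa using hpos

/-- The rows `0, …, k - 1` contribute together at most as much as row `i`, so the size of an entry
of the elimination depends on its row alone. -/
theorem natDegree_minor_augM (hp : 2 ≤ p) {δ : ℕ} (hm : 1 ≤ m) (hS : ∀ i j, (S i j).natDegree ≤ δ)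
    {k i : ℕ} (j : ℕ) (hk : k ≤ i) (hi : i ≤ m) :
    (minor (augM p S r) k i j).natDegree < 2 * (p ^ i * (δ + m)) := by
  have hpos : 0 < p ^ i * (δ + m) := Nat.mul_pos (pow_pos (by omega) _) (by omega)
  have h1 : (minor (augM p S r) k i j).natDegree ≤
      ∑ l : Fin (k + 1), (fun x : Fin (k + 1) => p ^ (border k i x) * (δ + m) - 1) l :=
    natDegree_det_le _ fun x y => by
      have hb : border k i x ≤ m := by unfold border; split_ifs <;> omega
      have := natDegree_augM_lt (r := r) hp hm hS _ (border k j y) hb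
      rw [of_apply]; omega
  rw [Fin.sum_univ_castSucc] at h1
  have h2 : ∑ x : Fin k, (p ^ border k i (x.castSucc : Fin (k + 1)) * (δ + m) - 1) ≤ p ^ i * (δ + m) := by
    calc _ ≤ ∑ x : Fin k, p ^ (x : ℕ) * (δ + m) := Finset.sum_le_sum fun x _ => by
            have : border k i (x.castSucc : Fin (k + 1)) = x := by simp [border]
            rw [this]; omega
      _ = ∑ l ∈ Finset.range k, p ^ l * (δ + m) := (Finset.sum_range fun l => p ^ l * (δ + m)).symm
      _ ≤ p ^ k * (δ + m) := sum_pow_mul_le hp _ _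
      _ ≤ _ := Nat.mul_le_mul_right _ (Nat.pow_le_pow_right (by omega) hk)
  have h3 : border k i (Fin.last k : Fin (k + 1)) = i := by simp [border]
  simp only [h3] at h1
  omega

theorem natDegree_leadM_augM (hp : 2 ≤ p) {δ : ℕ} (hm : 1 ≤ m) (hS : ∀ i j, (S i j).natDegree ≤ δ)
    {k : ℕ} (hk : k ≤ m) :
    (leadM (augM p S r) k).det.natDegree ≤ p ^ m * (δ + m) := by
  refine (natDegree_det_le _ (D := fun x : Fin k => p ^ (x : ℕ) * (δ + m)) fun x y => ?_).trans ?_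
  · rw [leadM, of_apply]
    exact (natDegree_augM_lt hp hm hS _ _ (by omega)).le
  · rw [← Finset.sum_range fun l => p ^ l * (δ + m)]
    exact (sum_pow_mul_le hp _ _).trans (Nat.mul_le_mul_right _ (Nat.pow_le_pow_right (by omega) hk))

end companion

/-! ## Computation of the rows -/

section rows
variable {s : ℕ → List Instr} {z : Reg} {N : ℕ} {U : ℝ} {env : List Qbar} {m p : ℕ}
  {Q : Qbar[X]} {S : Matrix (Fin m) (Fin m) Qbar[X]} {r : Fin m → Fin m → Qbar}

def expandR (z : Reg) (p : ℕ) (a : ℕ → Reg) : ℕ → Reg := fun k => if p ∣ k then a (k / p) else z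

theorem rep_expandR (hp : 0 < p) {a : ℕ → Reg} {f : Qbar[X]} (hz : rep env z 0)
    (ha : rep env a f.coeff) : rep env (expandR z p a) (Polynomial.expand Qbar p f).coeff := fun k => by
  rw [Polynomial.coeff_expand hp, expandR]
  split_ifs
  · exact ha _
  · exact hz

def rowsP (s : ℕ → List Instr) (z o : Reg) (N p c : ℕ) (q : ℕ → Reg) (a : Fin m → Fin m → ℕ → Reg)
    (r : Fin m → Fin m → Reg) : Prog (ℕ → (Fin m → ℕ → Reg) × (ℕ → Reg)) :=
  iterP (pure (fun j l => if h : l < m then r j ⟨l, h⟩ else z, fun k => if k = 0 then o else z))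
    (fun k x => do
      let u ← forAll fun j => polyDot s z N (p ^ (k + 1) * c) (fun l => expandR z p (x.1 l))
        fun l => a l j
      let d ← mulP s z N (p ^ (k + 1) * c) (expandR z p x.2) q
      pure (u, d)) m

/-- Each row takes about `m²` products at its own degree; these degrees sum to at most `2 N`, so all
rows together cost `O(m² N U)`. -/
theorem sat_rowsP {δ : ℕ} (hN : N = p ^ m * (δ + m)) (hp : 2 ≤ p) (hm : 1 ≤ m) (hs : PolyMul s N U)
    {o : Reg} {q : ℕ → Reg} {a : Fin m → Fin m → ℕ → Reg} {rr : Fin m → Fin m → Reg}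
    (hS : ∀ i j, (S i j).natDegree ≤ δ) (hQ : Q.natDegree ≤ δ) (hz : rep env z 0)
    (ho : rep env o 1) (hq : rep env q Q.coeff) (ha : rep env a fun i j => (S i j).coeff)
    (hr : rep env rr r) :
    Sat (rowsP s z o N p (δ + m) q a rr) env (2950 * (m ^ 2 * (N * U)))
      fun e x => ∀ k ≤ m, rep e (x k).1 (fun j => (numRow p S r k j).coeff) ∧
        rep e (x k).2 (denRow p Q k).coeff := by
  have hU := hs.one_le
  have hNk : ∀ k ≤ m, p ^ k * (δ + m) ≤ N := fun k hk => by
    rw [hN]; exact Nat.mul_le_mul_right _ (Nat.pow_le_pow_right (by omega) hk)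
  refine Sat.mono (sat_iterP (c₀ := 0)
    (c := fun k => m * (739 * (m * ((p ^ (k + 1) * (δ + m) : ℕ) * U))) +
      736 * ((p ^ (k + 1) * (δ + m) : ℕ) * U))
    (P := fun k e x => rep e x.1 (fun j => (numRow p S r k j).coeff) ∧
        rep e x.2 (denRow p Q k).coeff)
    (fun _ _ _ _ h hx => ⟨Rep.mono h hx.1, Rep.mono h hx.2⟩) ?_ m fun k hk e1 x h1 hx => ?_) ?_
    fun _ _ _ h => h
  · refine Sat.pure le_rfl ⟨fun j l => ?_, fun l => ?_⟩
    · have hc : (numRow p S r 0 j).coeff l = if h : l < m then r j ⟨l, h⟩ else 0 := by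
        rw [numRow, Polynomial.finsetSum_coeff]
        simp only [Polynomial.coeff_C_mul_X_pow]
        split_ifs with h
        · rw [Finset.sum_eq_single ⟨l, h⟩]
          · simp
          · intro b _ hb
            rw [if_neg fun h' => hb (Fin.ext h'.symm)]
          · simp
        · exact Finset.sum_eq_zero fun b _ => if_neg (by omega)
      simp only [hc]
      split_ifs
      · exact hr _ _
      · exact hz
    · simp only [denRow, Polynomial.coeff_one]
      split_ifs
      · exact ho
      · exact hz
  · have hpk : 1 ≤ p ^ (k + 1) * (δ + m) := Nat.mul_pos (pow_pos (by omega) _) (by omega)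
    have hδ : δ ≤ p ^ (k + 1) * (δ + m) := by
      have : 1 ≤ p ^ (k + 1) := Nat.pos_of_ne_zero (pow_ne_zero _ (by omega))
      nlinarith
    have hle := (hNk (k + 1) (by omega)).trans (show N ≤ 8 * N by omega)
    have hexp : ∀ f : Qbar[X], f.natDegree + δ + 1 ≤ p ^ k * (δ + m) →
        (Polynomial.expand Qbar p f).natDegree ≤ p ^ (k + 1) * (δ + m) := fun f hf => by
      rw [Polynomial.natDegree_expand, pow_succ, mul_comm, mul_right_comm, mul_comm _ p]
      exact Nat.mul_le_mul_left _ (by omega)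
    refine Comp.bind (v := fun j => (numRow p S r (k + 1) j).coeff) (comp_forAll'
      (c := 739 * (m * ((p ^ (k + 1) * (δ + m) : ℕ) * U))) fun j e2 h2 => ?_) fun e2 u h2 hu => ?_
    · exact (comp_polyDot hs hpk hle (Rep.mono (h1.trans h2) hz)
        (fun l => rep_expandR (by omega) (Rep.mono (h1.trans h2) hz) (Rep.mono h2 (hx.1 l)))
        (fun l => Rep.mono (h1.trans h2) (ha l j))
        (fun l => hexp _ (numRow_natDegree hp hm hS k l)) fun l => (hS l j).trans hδ).mono
          (by rw [Fintype.card_fin]) rfl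
    · refine Comp.bind (comp_mulP hs hpk hle (Rep.mono (h1.trans h2) hz)
        (rep_expandR (by omega) (Rep.mono (h1.trans h2) hz) (Rep.mono h2 hx.2))
        (Rep.mono (h1.trans h2) hq) (hexp _ (denRow_natDegree hp hm hQ k)) (hQ.trans hδ))
        fun e3 d h3 hd => Sat.pure ?_ ⟨Rep.mono h3 hu, hd⟩
      simp only [Fintype.card_fin]
      linarith
  · have hsum : ∑ k ∈ Finset.range m, p ^ (k + 1) * (δ + m) ≤ 2 * N := by
      have h1 := sum_pow_mul_le hp (m + 1) (δ + m)
      have h2 := sum_pow_mul_le hp m (δ + m)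
      rw [Finset.sum_range_succ'] at h1
      have h3 : ∑ k ∈ Finset.range m, p ^ (k + 1) * (δ + m) =
          ∑ k ∈ Finset.range m, p ^ k * (δ + m) + p ^ m * (δ + m) - p ^ 0 * (δ + m) := by
        rw [← Finset.sum_range_succ, Finset.sum_range_succ' (fun k => p ^ k * (δ + m))]
        omega
      omega
    have hsum' : ∑ k ∈ Finset.range m, ((p ^ (k + 1) * (δ + m) : ℕ) : ℝ) ≤ 2 * N := by
      rw [← Nat.cast_sum]; exact_mod_cast hsum
    have e1 : (0 : ℝ) + ∑ k ∈ Finset.range m, ((m : ℝ) * (739 * (m * ((p ^ (k + 1) * (δ + m) : ℕ) * U))) +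
      736 * ((p ^ (k + 1) * (δ + m) : ℕ) * U)) =
        (739 * m ^ 2 + 736) * U * ∑ k ∈ Finset.range m, ((p ^ (k + 1) * (δ + m) : ℕ) : ℝ) := by
      rw [zero_add, Finset.mul_sum]
      exact Finset.sum_congr rfl fun k _ => by ring
    rw [e1]
    have hm1 : (1 : ℝ) ≤ (m : ℝ) ^ 2 := one_le_pow₀ (by exact_mod_cast hm)
    calc (739 * (m : ℝ) ^ 2 + 736) * U * ∑ k ∈ Finset.range m, ((p ^ (k + 1) * (δ + m) : ℕ) : ℝ)
        ≤ (1475 * (m : ℝ) ^ 2) * U * (2 * N) := by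
          gcongr
          linarith
      _ = _ := by ring

end rows

/-! ## Fraction-free elimination -/

section bareiss
variable {s : ℕ → List Instr} {z : Reg} {N : ℕ} {U : ℝ} {env : List Qbar} {m p : ℕ}
  {S : Matrix (Fin m) (Fin m) Qbar[X]} {r : Fin m → Fin m → Qbar}

/-- One entry of a step of the elimination. -/
def bEntryP (s : ℕ → List Instr) (z : Reg) (N n w : ℕ) (a b c d e : ℕ → Reg) : Prog (ℕ → Reg) := do
  let u ← mulP s z N n a b
  let v ← mulP s z N n c d
  let t ← tab z (2 * n + 1) fun l => psub (u l) (v l)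
  divP s z N n w e t

theorem comp_bEntryP (hs : PolyMul s N U) {n w : ℕ} (hn : 1 ≤ n) (hnN : n ≤ 4 * N)
    {ra rb rc rd re : ℕ → Reg} {a b c d e f : Qbar[X]} (hz : rep env z 0)
    (ha : rep env ra a.coeff) (hb : rep env rb b.coeff) (hc : rep env rc c.coeff)
    (hd : rep env rd d.coeff) (he : rep env re e.coeff) (hna : a.natDegree < n)
    (hnb : b.natDegree < n) (hnc : c.natDegree < n) (hnd : d.natDegree < n) (hnf : f.natDegree < n)
    (hw : ∀ k < w, e.coeff k = 0) (hw' : e.coeff w ≠ 0) (h : a * b - c * d = e * f) :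
    Comp (bEntryP s z N n w ra rb rc rd re) env (8107 * (n * U)) f.coeff := by
  have hU := hs.one_le
  refine Comp.bind (comp_mulP hs hn (by omega) hz ha hb hna.le hnb.le) fun e1 u h1 hu => ?_
  refine Comp.bind (comp_mulP hs hn (by omega) (Rep.mono h1 hz) (Rep.mono h1 hc) (Rep.mono h1 hd)
    hnc.le hnd.le) fun e2 v h2 hv => ?_
  have h12 := h1.trans h2
  refine Comp.bind (comp_tab (c := 1) (v := (a * b - c * d).coeff) (Rep.mono h12 hz)
    (fun l e3 _ h3 => (comp_sub (Rep.mono (h2.trans h3) (hu l)) (Rep.mono h3 (hv l))).mono le_rfl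
      (Polynomial.coeff_sub _ _ _).symm) fun l hl => ?_) fun e3 t h3 ht => ?_
  · refine Polynomial.coeff_eq_zero_of_natDegree_lt ?_
    have h4 : (a * b).natDegree ≤ a.natDegree + b.natDegree := Polynomial.natDegree_mul_le
    have h5 : (c * d).natDegree ≤ c.natDegree + d.natDegree := Polynomial.natDegree_mul_le
    have h6 := Polynomial.natDegree_sub_le (a * b) (c * d)
    have h7 : max (a * b).natDegree (c * d).natDegree < l := max_lt (by omega) (by omega)
    omega
  · refine (comp_divP hs hn hnN hw hw' h hnf (Rep.mono (h12.trans h3) hz)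
      (Rep.mono (h12.trans h3) he) ht).mono ?_ rfl
    have h8 : (1 : ℝ) ≤ n := by exact_mod_cast hn
    have h9 : (n : ℝ) ≤ n * U := le_mul_of_one_le_right (by linarith) hU
    push_cast
    linarith

/-- The total family of registers which extends a finite one. -/
def extF {a b : ℕ} (z : Reg) (g : Fin a → Fin b → ℕ → Reg) (i j : ℕ) : ℕ → Reg :=
  if h : i < a ∧ j < b then g ⟨i, h.1⟩ ⟨j, h.2⟩ else fun _ => z

def bStepP (s : ℕ → List Instr) (z : Reg) (N m p c k : ℕ) (x : (ℕ → ℕ → ℕ → Reg) × (ℕ → Reg)) :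
    Prog ((ℕ → ℕ → ℕ → Reg) × (ℕ → Reg)) := do
  let w ← valP (N + 1) x.2
  let g ← forAll fun i : Fin (m + 1) =>
    if k < i then forAll fun j : Fin (2 * m) => bEntryP s z N (2 * (p ^ (i : ℕ) * c)) w (x.1 k k)
      (x.1 i j) (x.1 k j) (x.1 i k) x.2 else pure fun _ _ => z
  pure (extF z g, x.1 k k)

/-- The invariant of the elimination. -/
def BInv (a : ℕ → ℕ → Qbar[X]) (m k : ℕ) (e : List Qbar) (x : (ℕ → ℕ → ℕ → Reg) × (ℕ → Reg)) : Prop :=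
  (∀ i j, k ≤ i → i ≤ m → j < 2 * m → rep e (x.1 i j) (minor a k i j).coeff) ∧
    rep e x.2 (leadM a k).det.coeff

theorem BInv.mono {a : ℕ → ℕ → Qbar[X]} {m k : ℕ} {e e' : List Qbar}
    {x : (ℕ → ℕ → ℕ → Reg) × (ℕ → Reg)} (h : e <+: e') (hx : BInv a m k e x) : BInv a m k e' x :=
  ⟨fun i j h1 h2 h3 => Rep.mono h (hx.1 i j h1 h2 h3), Rep.mono h hx.2⟩

theorem coeff_natTrailingDegree_ne_zero {f : Qbar[X]} (hf : f ≠ 0) : f.coeff f.natTrailingDegree ≠ 0 :=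
  fun h => hf (Polynomial.trailingCoeff_eq_zero.1 h)

/-- An entry of row `i` is computed at precision `2 p ^ i (δ + m)` only. The valuation of the
previous pivot has to be found by tests, since the exact division is done on power series. -/
theorem sat_bStepP {δ k : ℕ} (hN : N = p ^ m * (δ + m)) (hp : 2 ≤ p) (hm : 1 ≤ m) (hk : k < m)
    (hs : PolyMul s N U) (hS : ∀ i j, (S i j).natDegree ≤ δ)
    (hd : ∀ k ≤ m, (leadM (augM p S r) k).det ≠ 0) (hz : rep env z 0)
    {x : (ℕ → ℕ → ℕ → Reg) × (ℕ → Reg)} (hx : BInv (augM p S r) m k env x) :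
    Sat (bStepP s z N m p (δ + m) k x) env
      ((N + 1) + ∑ i : Fin (m + 1), 2 * m * (8107 * ((2 * (p ^ (i : ℕ) * (δ + m)) : ℕ) * U)))
      (BInv (augM p S r) m (k + 1)) := by
  have hU := hs.one_le
  have hNk : ∀ k ≤ m, p ^ k * (δ + m) ≤ N := fun k hk => by
    rw [hN]; exact Nat.mul_le_mul_right _ (Nat.pow_le_pow_right (by omega) hk)
  refine Sat.bind (sat_valP (f := (leadM (augM p S r) k).det)
    (by have := natDegree_leadM_augM (r := r) hp hm hS hk.le; omega) hx.2) fun e1 w h1 hw => ?_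
  rw [if_neg (hd k hk.le)] at hw
  refine Sat.bind (sat_forAll (P := fun (i : Fin (m + 1)) e (a : Fin (2 * m) → ℕ → Reg) => k < i →
    rep e a fun j : Fin (2 * m) => (minor (augM p S r) (k + 1) i j).coeff)
    (c := fun i : Fin (m + 1) => 2 * m * (8107 * ((2 * (p ^ (i : ℕ) * (δ + m)) : ℕ) * U)))
    (fun _ _ _ _ h h' h'' => Rep.mono h (h' h'')) fun i e2 h2 => ?_) fun e2 g h2 hg => ?_
  · by_cases hki : k < i
    · rw [if_pos hki]
      have hi : (i : ℕ) ≤ m := by omega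
      refine Sat.mono (comp_forAll' (c := 8107 * ((2 * (p ^ (i : ℕ) * (δ + m)) : ℕ) * U))
        (v := fun j : Fin (2 * m) => (minor (augM p S r) (k + 1) i j).coeff) fun j e3 h3 => ?_)
        (by rw [Fintype.card_fin]; push_cast; exact le_rfl) fun _ _ _ h _ => h
      have h13 := (h1.trans h2).trans h3
      have hpow : p ^ k * (δ + m) ≤ p ^ (i : ℕ) * (δ + m) :=
        Nat.mul_le_mul_right _ (Nat.pow_le_pow_right (by omega) hki.le)
      have hpos : 0 < p ^ (i : ℕ) * (δ + m) := Nat.mul_pos (pow_pos (by omega) _) (by omega)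
      have hNi := hNk i hi
      have hkk : ∀ l, (minor (augM p S r) k k l).natDegree < 2 * (p ^ (i : ℕ) * (δ + m)) := fun l =>
        (natDegree_minor_augM hp hm hS l le_rfl hk.le).trans_le (by omega)
      refine comp_bEntryP hs (by omega) (by omega) (Rep.mono h13 hz)
        (Rep.mono h13 (hx.1 k k le_rfl hk.le (by omega)))
        (Rep.mono h13 (hx.1 i j hki.le hi j.2))
        (Rep.mono h13 (hx.1 k j le_rfl hk.le j.2))
        (Rep.mono h13 (hx.1 i k hki.le hi (by omega)))
        (Rep.mono h13 hx.2) (hkk k) (natDegree_minor_augM hp hm hS j hki.le hi) (hkk j)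
        (natDegree_minor_augM hp hm hS k hki.le hi) (natDegree_minor_augM hp hm hS j hki hi)
        (fun l hl => ?_) ?_ (sylvester _ (hd k hk.le) i j)
      · rw [hw] at hl; exact Polynomial.coeff_eq_zero_of_lt_natTrailingDegree hl
      · rw [hw]; exact coeff_natTrailingDegree_ne_zero (hd k hk.le)
    · rw [if_neg hki]
      exact Sat.pure (by positivity) fun h => absurd h hki
  · refine Sat.pure ?_ ⟨fun i j hi hi' hj => ?_, ?_⟩
    · push_cast; linarith
    · simp only [extF]
      rw [dif_pos ⟨by omega, hj⟩]
      exact hg ⟨i, by omega⟩ hi ⟨j, hj⟩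
    · rw [← minor_self]
      exact Rep.mono (h1.trans h2) (hx.1 k k le_rfl hk.le (by omega))

def bareissP (s : ℕ → List Instr) (z o : Reg) (N m p c : ℕ) (x : ℕ → Fin m → ℕ → Reg) :
    Prog ((ℕ → ℕ → ℕ → Reg) × (ℕ → Reg)) := do
  let t ← forAll fun j => tab z N fun l => psub z (x m j l)
  let h ← iterP (pure (fun i j => if h : j < m then (if i < m then x i ⟨j, h⟩ else t ⟨j, h⟩)
    else fun k => if (i < m ∧ j = m + i) ∧ k = 0 then o else z, fun k => if k = 0 then o else z))
    (bStepP s z N m p c) m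
  pure (h m)

/-- There are of the order of `m³` entries to compute, but in each step the `2 m` entries of a row
are paid at the degree of the row, and the sum over the rows is geometric. So `m` steps cost `O(m² N
U)`. -/
theorem sat_bareissP {δ : ℕ} (hN : N = p ^ m * (δ + m)) (hp : 2 ≤ p) (hm : 1 ≤ m)
    (hs : PolyMul s N U) (hS : ∀ i j, (S i j).natDegree ≤ δ)
    (hd : ∀ k ≤ m, (leadM (augM p S r) k).det ≠ 0) {o : Reg} (hz : rep env z 0) (ho : rep env o 1)
    {x : ℕ → Fin m → ℕ → Reg}
    (hx : ∀ k ≤ m, rep env (x k) fun j => (numRow p S r k j).coeff) :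
    Sat (bareissP s z o N m p (δ + m) x) env (64859 * (m ^ 2 * (N * U))) fun e y =>
      rep e (fun c : Fin m => y.1 m (m + c)) (fun c => (lastMinor p S r c).coeff) ∧
      rep e y.2 (leadM (augM p S r) m).det.coeff := by
  have hU := hs.one_le
  refine Comp.bind (v := fun j => (-numRow p S r m j).coeff) (comp_forAll' (c := N * 1) fun j e1 h1 =>
    comp_tab (Rep.mono h1 hz) (fun l e2 _ h2 => (comp_sub (Rep.mono (h1.trans h2) hz)
      (Rep.mono (h1.trans h2) (hx m le_rfl j l))).mono le_rfl (by simp)) fun l hl => ?_)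
    fun e1 t h1 ht => ?_
  · have := numRow_natDegree (r := r) hp hm hS m j
    rw [Polynomial.coeff_neg, Polynomial.coeff_eq_zero_of_natDegree_lt (by omega), neg_zero]
  refine Sat.bind (sat_iterP (P := BInv (augM p S r) m) (c₀ := 0)
    (c := fun k => (N + 1) +
      ∑ i : Fin (m + 1), 2 * m * (8107 * ((2 * (p ^ (i : ℕ) * (δ + m)) : ℕ) * U)))
    (fun _ _ _ _ => BInv.mono) ?_ m fun k hk e2 y h2 hy => ?_) fun e2 y h2 hy => ?_
  · refine Sat.pure le_rfl ⟨fun i j _ hi hj => ?_, fun l => ?_⟩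
    · rw [minor_zero, augM]
      by_cases hjm : j < m
      · simp only [dif_pos hjm]
        by_cases him : i < m
        · simp only [if_pos him]; exact Rep.mono h1 (hx i hi ⟨j, hjm⟩)
        · simp only [if_neg him]; exact ht ⟨j, hjm⟩
      · simp only [dif_neg hjm]
        intro l
        by_cases hij : i < m ∧ j = m + i
        · simp only [if_pos hij, Polynomial.coeff_one]
          by_cases hl : l = 0
          · simp only [if_pos hl, if_pos (And.intro hij hl)]; exact Rep.mono h1 ho
          · simp only [if_neg hl, if_neg (fun h : _ ∧ l = 0 => hl h.2)]; exact Rep.mono h1 hz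
        · simp only [if_neg hij, if_neg (fun h : (i < m ∧ j = m + i) ∧ _ => hij h.1), Polynomial.coeff_zero]
          exact Rep.mono h1 hz
    · have : (leadM (augM p S r) 0).det = 1 := det_isEmpty
      rw [this, Polynomial.coeff_one]
      simp only []
      split_ifs
      · exact Rep.mono h1 ho
      · exact Rep.mono h1 hz
  · exact sat_bStepP hN hp hm hk hs hS hd (Rep.mono (h1.trans h2) hz) hy
  · refine Sat.pure ?_ ⟨fun c => (hy m le_rfl).1 m (m + c) le_rfl le_rfl (by omega), (hy m le_rfl).2⟩
    have hsum : ∑ i : Fin (m + 1), p ^ (i : ℕ) * (δ + m) ≤ 2 * N := by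
      rw [Fin.sum_univ_castSucc, Fin.val_last, ← hN]
      have h3 := sum_pow_mul_le hp m (δ + m)
      rw [Finset.sum_range, ← hN] at h3
      simpa [two_mul] using h3
    have hsum' : ∑ i : Fin (m + 1), ((p ^ (i : ℕ) * (δ + m) : ℕ) : ℝ) ≤ 2 * N := by
      rw [← Nat.cast_sum]; exact_mod_cast hsum
    have e3 : ∑ i : Fin (m + 1), 2 * (m : ℝ) * (8107 * ((2 * (p ^ (i : ℕ) * (δ + m)) : ℕ) * U)) =
        32428 * m * U * ∑ i : Fin (m + 1), ((p ^ (i : ℕ) * (δ + m) : ℕ) : ℝ) := by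
      rw [Finset.mul_sum]
      exact Finset.sum_congr rfl fun i _ => by push_cast; ring
    have hm1 : (1 : ℝ) ≤ m := by exact_mod_cast hm
    have hN1 : (1 : ℝ) ≤ N := by exact_mod_cast hs.pos
    rw [Finset.sum_const, Finset.card_range, nsmul_eq_mul, e3, Fintype.card_fin]
    have e4 : 32428 * m * U * ∑ i : Fin (m + 1), ((p ^ (i : ℕ) * (δ + m) : ℕ) : ℝ) ≤
        32428 * m * U * (2 * N) := by gcongr
    have e5 : (m : ℝ) * (N + 1) ≤ m * (2 * (m * (N * U))) := by
      have : (N : ℝ) ≤ m * (N * U) := by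
        calc (N : ℝ) = 1 * (N * 1) := by ring
          _ ≤ _ := by gcongr
      have : (N : ℝ) + 1 ≤ 2 * (m * (N * U)) := by linarith
      gcongr
    have e6 : (m : ℝ) * (N * 1) ≤ m ^ 2 * (N * U) := by
      have : (m : ℝ) ≤ m ^ 2 := by nlinarith
      gcongr
    have e7 : (m : ℝ) * ((N + 1) + 32428 * m * U * ∑ i : Fin (m + 1), ((p ^ (i : ℕ) * (δ + m) : ℕ) : ℝ)) ≤
        m * (2 * (m * (N * U))) + m * (32428 * m * U * (2 * N)) := by
      rw [mul_add]; gcongr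
    have e8 : (m : ℝ) * (2 * (m * (N * U))) + m * (32428 * m * U * (2 * N)) = 64858 * (m ^ 2 * (N * U)) := by
      ring
    linarith

/-- The last row of the companion matrix: numerators and common denominator. -/
def companionP (s : ℕ → List Instr) (z : Reg) (N : ℕ) {m : ℕ} (x : ℕ → ℕ → Reg)
    (y : (ℕ → ℕ → ℕ → Reg) × (ℕ → Reg)) : Prog ((Fin m → ℕ → Reg) × (ℕ → Reg)) := do
  let a ← forAll fun c : Fin m => mulP s z N (2 * N) (y.1 m (m + c)) (x c)
  let b ← mulP s z N (2 * N) y.2 (x m)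
  pure (a, b)

theorem sat_companionP {Q : Qbar[X]} {δ : ℕ} (hN : N = p ^ m * (δ + m)) (hp : 2 ≤ p) (hm : 1 ≤ m)
    (hs : PolyMul s N U) (hS : ∀ i j, (S i j).natDegree ≤ δ) (hQ : Q.natDegree ≤ δ) (hz : rep env z 0)
    {x : ℕ → ℕ → Reg} {y : (ℕ → ℕ → ℕ → Reg) × (ℕ → Reg)}
    (hx : ∀ k ≤ m, rep env (x k) (denRow p Q k).coeff)
    (hy : rep env (fun c : Fin m => y.1 m (m + c)) (fun c => (lastMinor p S r c).coeff))
    (hy' : rep env y.2 (leadM (augM p S r) m).det.coeff) :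
    Sat (companionP s z N x y) env (2944 * (m ^ 2 * (N * U))) fun e a =>
      rep e a.1 (fun c => (lastMinor p S r c * denRow p Q c).coeff) ∧
      rep e a.2 ((leadM (augM p S r) m).det * denRow p Q m).coeff := by
  have hU := hs.one_le
  have hN1 := hs.pos
  have hNk : ∀ k ≤ m, p ^ k * (δ + m) ≤ N := fun k hk => by
    rw [hN]; exact Nat.mul_le_mul_right _ (Nat.pow_le_pow_right (by omega) hk)
  have hden : ∀ k ≤ m, (denRow p Q k).natDegree ≤ 2 * N := fun k hk => by
    have := denRow_natDegree hp hm hQ k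
    have := hNk k hk
    omega
  refine Comp.bind (v := fun c => (lastMinor p S r c * denRow p Q c).coeff)
    (comp_forAll' (c := 736 * ((2 * N : ℕ) * U)) fun c e1 h1 => ?_) fun e1 a h1 ha => ?_
  · refine comp_mulP hs (by omega) (by omega) (Rep.mono h1 hz) (Rep.mono h1 (hy c))
      (Rep.mono h1 (hx c c.2.le)) ?_ (hden c c.2.le)
    rw [lastMinor, hN]
    exact (natDegree_minor_augM hp hm hS _ le_rfl le_rfl).le
  · refine Comp.bind (comp_mulP hs (n := 2 * N) (by omega) (by omega) (Rep.mono h1 hz) (Rep.mono h1 hy')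
      (Rep.mono h1 (hx m le_rfl)) ?_ (hden m le_rfl)) fun e2 b h2 hb => Sat.pure ?_ ⟨Rep.mono h2 ha, hb⟩
    · have := natDegree_leadM_augM (r := r) hp hm hS le_rfl
      omega
    · have hm1 : (1 : ℝ) ≤ m := by exact_mod_cast hm
      have e1 : (m : ℝ) * (N * U) ≤ m ^ 2 * (N * U) := by
        have : (m : ℝ) ≤ m ^ 2 := by nlinarith
        gcongr
      have e2 : (N : ℝ) * U ≤ m * (N * U) := le_mul_of_one_le_left (by positivity) hm1
      rw [Fintype.card_fin]
      push_cast
      linarith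

/-- The ramification index. -/
def ramP (N p : ℕ) {m : ℕ} (x : (Fin m → ℕ → Reg) × (ℕ → Reg)) : Prog ℕ := do
  let v ← forAll fun c => valP (4 * N) (x.1 c)
  let w ← valP (4 * N) x.2
  -- The value `4 * N` signals the zero polynomial, since all degrees are smaller. The slopes are
  -- integer data, and handling them is free.
  pure (ramIdx p fun c => if v c = 4 * N then none else some ((v c : ℤ) - w))

theorem sat_ramP {f : Fin m → Qbar[X]} {g : Qbar[X]} (hg : g ≠ 0)
    (hfN : ∀ c, (f c).natDegree < 4 * N) (hgN : g.natDegree < 4 * N)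
    {x : (Fin m → ℕ → Reg) × (ℕ → Reg)} (hf : rep env x.1 fun c => (f c).coeff)
    (hg' : rep env x.2 g.coeff) :
    Sat (ramP N p x) env (m * (4 * N) + 4 * N) fun _ d =>
      d = ramIdx p fun c => if f c = 0 then none else
        some (((f c).natTrailingDegree : ℤ) - g.natTrailingDegree) := by
  refine Sat.bind (sat_forAll (P := fun c _ w => w = if f c = 0 then 4 * N else (f c).natTrailingDegree)
    (c := fun _ => 4 * N) (fun _ _ _ _ _ h => h) fun c e1 h1 => Sat.mono (sat_valP (hfN c) (Rep.mono h1 (hf c)))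
      (by push_cast; exact le_rfl) fun _ _ _ h => h) fun e1 v h1 hv => ?_
  refine Sat.bind (sat_valP hgN (Rep.mono h1 hg')) fun e2 w h2 hw => ?_
  refine Sat.pure (by simp) ?_
  rw [if_neg hg] at hw
  congr 1
  funext c
  rw [hv c, hw]
  by_cases hc : f c = 0
  · rw [if_pos hc, if_pos rfl, if_pos hc]
  · rw [if_neg hc, if_neg hc, if_neg]
    exact ((Polynomial.natTrailingDegree_le_natDegree _).trans_lt (hfN c)).ne

end bareiss

/-! ## Computation of the Laurent coefficients of the inverse matrix -/

section series
variable {s : ℕ → List Instr} {z : Reg} {N : ℕ} {U : ℝ} {env : List Qbar} {m p : ℕ}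
  {Q e : Qbar[X]} {S G : Matrix (Fin m) (Fin m) Qbar[X]} {A : GL (Fin m) (RatFunc Qbar)}

theorem inv_apply_eq (hA : ∀ i j, A.val i j = fr (S i j) / fr Q)
    (hQ : Q ≠ 0) (hG : S * G = e • (1 : Matrix (Fin m) (Fin m) Qbar[X])) (he : e ≠ 0) (i j : Fin m) :
    ((A⁻¹ : GL (Fin m) (RatFunc Qbar)) : Matrix (Fin m) (Fin m) (RatFunc Qbar)) i j =
      fr (Q * G i j) / fr e := by
  have h : A.val * of (fun i j => fr (Q * G i j) / fr e) = 1 := by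
    ext i j : 2
    have h1 := congrArg (fun f => fr f) (congrFun (congrFun hG i) j)
    simp only [Matrix.mul_apply, map_sum, map_mul, Matrix.smul_apply, smul_eq_mul] at h1
    have hQ' := fr_ne_zero.2 hQ
    have he' := fr_ne_zero.2 he
    rw [Matrix.mul_apply]
    have h2 : ∀ k, A.val i k * of (fun i j => fr (Q * G i j) / fr e) k j =
        fr (S i k) * fr (G k j) * (fr e)⁻¹ := fun k => by
      rw [hA, of_apply, map_mul]
      field_simp
    rw [Finset.sum_congr rfl fun k _ => h2 k, ← Finset.sum_mul, h1, Matrix.one_apply, Matrix.one_apply]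
    split_ifs
    · rw [map_one, mul_one, mul_inv_cancel₀ he']
    · rw [map_zero, mul_zero, zero_mul]
  rw [Matrix.coe_units_inv, inv_eq_right_inv h, of_apply]

/-- The register of the coefficient of index `k`. -/
def serReg (z : Reg) (w : ℕ) (u : Fin m → Fin m → ℕ → Reg) (k : ℤ) (i j : Fin m) : Reg :=
  if k + w < 0 then z else u i j (k + w).natAbs

structure InvData (m : ℕ) where
  vA : ℤ
  vAinv : ℤ
  w : ℕ
  u : Fin m → Fin m → ℕ → Reg

def seriesP (s : ℕ → List Instr) (z : Reg) (N δ n J : ℕ) (q e : ℕ → Reg)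
    (a g : Fin m → Fin m → ℕ → Reg) : Prog (InvData m) := do
  let t ← forAll fun i => forAll fun j => valP (δ + 1) (a i j)
  let h ← forAll fun i => forAll fun j => mulP s z N n q (g i j)
  let t' ← forAll fun i => forAll fun j => valP n (h i j)
  let v ← valP (δ + 1) q
  let w ← valP n e
  let f ← invP s z N (shiftR w e) J
  let u ← forAll fun i => forAll fun j => mulT s z N (2 ^ J) (h i j) f
  pure ⟨((⨅ ij : Fin m × Fin m, t ij.1 ij.2 : ℕ) : ℤ) - v,
    ((⨅ ij : Fin m × Fin m, t' ij.1 ij.2 : ℕ) : ℤ) - w, w, u⟩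

/-- The specification of the data on the inverse of `A`. -/
def InvSpec (A : GL (Fin m) (RatFunc Qbar)) (z : Reg) (δ J : ℕ) (env : List Qbar) (x : InvData m) : Prop :=
  x.vA = vA A ∧ x.vAinv = vAinv A ∧ x.w ≤ m * δ ∧ -(δ : ℤ) ≤ vA A ∧ -(x.w : ℤ) ≤ vAinv A ∧
    ∀ (k : ℤ), k + x.w < 2 ^ J → ∀ i j, rep env (serReg z x.w x.u k i j)
      ((((A⁻¹ : GL (Fin m) (RatFunc Qbar)) i j : RatFunc Qbar) : Qbar⸨X⸩).coeff k)

theorem coeff_lo_mul_trunc (f : Qbar[X]) (g : PowerSeries Qbar) {n k : ℕ} (hk : k < n) :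
    (lo n (f * PowerSeries.trunc n g)).coeff k = PowerSeries.coeff k ((f : PowerSeries Qbar) * g) := by
  rw [coeff_lo, if_pos hk, ← Polynomial.coeff_coe, Polynomial.coe_mul]
  rw [PowerSeries.coeff_mul, PowerSeries.coeff_mul]
  refine Finset.sum_congr rfl fun ij hij => ?_
  have := Finset.HasAntidiagonal.mem_antidiagonal.1 hij
  rw [Polynomial.coeff_coe, Polynomial.coeff_coe, PowerSeries.coeff_trunc, if_pos (by omega)]

/-- All entries of `A⁻¹ = Q G / e` share the denominator `e`, so a single power series inversion
serves them all. -/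
theorem sat_seriesP {δ n J : ℕ} (hm : 1 ≤ m) (hs : PolyMul s N U) (hn : n = m * δ + 1)
    (hnN : n ≤ 8 * N)
    (hJ : 2 ^ J ≤ 8 * N) {rq re : ℕ → Reg} {a g : Fin m → Fin m → ℕ → Reg}
    (hA : ∀ i j, A.val i j = fr (S i j) / fr Q)
    (hQ : Q ≠ 0) (hG : S * G = e • (1 : Matrix (Fin m) (Fin m) Qbar[X])) (he : e ≠ 0)
    (hQδ : Q.natDegree ≤ δ) (hSδ : ∀ i j, (S i j).natDegree ≤ δ)
    (hGδ : ∀ i j, (G i j).natDegree + δ ≤ m * δ) (heδ : e.natDegree ≤ m * δ)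
    (hz : rep env z 0) (hq : rep env rq Q.coeff)
    (hre : rep env re e.coeff) (ha : rep env a fun i j => (S i j).coeff)
    (hg : rep env g fun i j => (G i j).coeff) :
    Sat (seriesP s z N δ n J rq re a g) env
      (m * (m * (δ + 1)) + m * (m * (736 * (n * U))) + m * (m * n) + (δ + 1) + n +
        2948 * (2 ^ J * U) + m * (m * (736 * (2 ^ J * U)))) (InvSpec A z δ J) := by
  have hδn : δ ≤ n := by nlinarith
  have hm0 : Nonempty (Fin m × Fin m) := ⟨(⟨0, hm⟩, ⟨0, hm⟩)⟩
  refine Sat.bind (sat_forAll (P := fun i _ (t : Fin m → ℕ) => ∀ j, t j = if S i j = 0 then δ + 1 else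
    (S i j).natTrailingDegree) (c := fun _ => m * (δ + 1)) (fun _ _ _ _ _ h => h)
    fun i e1 h1 => ?_) fun e1 t h1 ht => ?_
  · refine Sat.mono (sat_forAll (P := fun j _ (t : ℕ) => t = if S i j = 0 then δ + 1 else
      (S i j).natTrailingDegree) (c := fun _ => ((δ + 1 : ℕ) : ℝ)) (fun _ _ _ _ _ h => h)
      fun j e2 h2 => sat_valP (Nat.lt_succ_of_le (hSδ i j)) (Rep.mono (h1.trans h2) (ha i j)))
      (by rw [Finset.sum_const, Finset.card_univ, Fintype.card_fin, nsmul_eq_mul]; push_cast; exact le_rfl)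
      fun _ _ _ h => h
  refine Comp.bind (v := fun i j => (Q * G i j).coeff) (comp_forAll' (c := m * (736 * (n * U)))
    fun i e2 h2 => ?_) fun e2 h h2 hh => ?_
  · refine (comp_forAll' (c := 736 * (n * U)) (v := fun j => (Q * G i j).coeff) fun j e3 h3 => ?_).mono
      (by rw [Fintype.card_fin]) rfl
    have h13 := (h1.trans h2).trans h3
    exact comp_mulP hs (by omega) hnN (Rep.mono h13 hz) (Rep.mono h13 hq) (Rep.mono h13 (hg i j))
      (by omega) (by have := hGδ i j; omega)
  have h12 := h1.trans h2
  have hHn : ∀ i j, (Q * G i j).natDegree < n := fun i j => by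
    have h1 : (Q * G i j).natDegree ≤ _ := Polynomial.natDegree_mul_le
    have := hGδ i j
    omega
  refine Sat.bind (sat_forAll (P := fun i _ (t : Fin m → ℕ) => ∀ j, t j = if Q * G i j = 0 then n else
    (Q * G i j).natTrailingDegree) (c := fun _ => m * n) (fun _ _ _ _ _ h => h)
    fun i e3 h3 => ?_) fun e3 t' h3 ht' => ?_
  · refine Sat.mono (sat_forAll (P := fun j _ (t : ℕ) => t = if Q * G i j = 0 then n else
      (Q * G i j).natTrailingDegree) (c := fun _ => (n : ℝ)) (fun _ _ _ _ _ h => h)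
      fun j e2 h2 => sat_valP (hHn i j) (Rep.mono (h3.trans h2) (hh i j)))
      (by rw [Finset.sum_const, Finset.card_univ, Fintype.card_fin, nsmul_eq_mul])
      fun _ _ _ h => h
  have h13 := h12.trans h3
  refine Sat.bind (sat_valP (Nat.lt_succ_of_le hQδ) (Rep.mono h13 hq)) fun e4 v h4 hv => ?_
  refine Sat.bind (sat_valP (show e.natDegree < n by omega) (Rep.mono (h13.trans h4) hre))
    fun e5 w h5 hw => ?_
  have h15 := (h13.trans h4).trans h5
  rw [if_neg hQ] at hv
  rw [if_neg he] at hw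
  refine Comp.bind (comp_invP hs (f := hi w e) ?_ J hJ (Rep.mono h15 hz)
    (rep_shiftR (Rep.mono h15 hre))) fun e6 f h6 hf => ?_
  · rw [coeff_hi, zero_add, hw]; exact coeff_natTrailingDegree_ne_zero he
  have h16 := h15.trans h6
  refine Comp.bind (v := fun i j => (lo (2 ^ J) (Q * G i j *
      PowerSeries.trunc (2 ^ J) ((hi w e : Qbar[X]) : PowerSeries Qbar)⁻¹)).coeff)
    (comp_forAll' (c := m * (736 * (2 ^ J * U))) fun i e7 h7 => ?_) fun e7 u h7 hu => ?_
  · refine (comp_forAll' (c := 736 * (2 ^ J * U)) (v := fun j => (lo (2 ^ J) (Q * G i j *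
      PowerSeries.trunc (2 ^ J) ((hi w e : Qbar[X]) : PowerSeries Qbar)⁻¹)).coeff) fun j e8 h8 => ?_).mono
      (by rw [Fintype.card_fin]) rfl
    have h38 := ((((h3.trans h4).trans h5).trans h6).trans h7).trans h8
    refine (comp_mulT hs Nat.one_le_two_pow hJ (Rep.mono ((h16.trans h7).trans h8) hz)
      (Rep.mono h38 (hh i j)) (Rep.mono (h7.trans h8) hf)).mono (by push_cast; exact le_rfl) rfl
  have hvA : ((⨅ ij : Fin m × Fin m, t ij.1 ij.2 : ℕ) : ℤ) - v = vA A := by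
    rw [vA, matVal0_eq_iInf ?_ hQ hA (fun i j => Nat.lt_succ_of_le (hSδ i j)) (fun i j => ht i j), hv]
    have : Nonempty (Fin m) := ⟨⟨0, hm⟩⟩
    exact A.ne_zero
  have hinv := inv_apply_eq hA hQ hG he
  have hvAi : ((⨅ ij : Fin m × Fin m, t' ij.1 ij.2 : ℕ) : ℤ) - w = vAinv A := by
    rw [vAinv, matVal0_eq_iInf ?_ he hinv hHn (fun i j => ht' i j), hw]
    have : Nonempty (Fin m) := ⟨⟨0, hm⟩⟩
    exact (A⁻¹).ne_zero
  have hwδ : w ≤ m * δ := by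
    rw [hw]; exact (Polynomial.natTrailingDegree_le_natDegree _).trans heδ
  have hvδ : v ≤ δ := by
    rw [hv]; exact (Polynomial.natTrailingDegree_le_natDegree _).trans hQδ
  refine Sat.pure ?_ ⟨hvA, hvAi, hwδ, ?_, ?_, fun k hk i j => ?_⟩
  · simp only [Finset.sum_const, Finset.card_univ, Fintype.card_fin, nsmul_eq_mul]
    push_cast
    linarith
  · rw [← hvA]; omega
  · rw [← hvAi]; simp only []; omega
  · have hc : (((A⁻¹ : GL (Fin m) (RatFunc Qbar)) i j : RatFunc Qbar) : Qbar⸨X⸩).coeff k =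
        (lau (Q * G i j) / lau e).coeff k := by
      rw [hinv, laurent_div]
    rw [hc, coeff_lau_div _ he, ← hw]
    simp only [serReg]
    by_cases hkw : k + w < 0
    · rw [if_pos hkw, if_pos hkw]; exact Rep.mono (h16.trans h7) hz
    · rw [if_neg hkw, if_neg hkw]
      have hk' : (k + w).natAbs < 2 ^ J := by
        have h8 : k + (w : ℤ) < 2 ^ J := hk
        zify
        rw [abs_of_nonneg (not_lt.1 hkw)]
        exact h8
      rw [← coeff_lo_mul_trunc _ _ hk']
      exact hu i j _

/-! ### The registers of the blocks -/

def coefReg (z : Reg) (d : ℕ) (x : InvData m) (k : ℤ) (i j : Fin m) : Reg :=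
  if (d : ℤ) ∣ k then serReg z x.w x.u (k / d) i j else z

/-- The largest index occurring in `M_d` or `N_d` is at most `μ - p ν`. After division by `d` it is
at most `v - v_0(A) = -2 v_0(A) - v_0(A⁻¹)`, so after the shift by `w` the precision `(2 m + 2) δ +
1` suffices, whatever `d` is. -/
theorem rep_coefReg {δ J d : ℕ} (hd : 1 ≤ d) (hJ : (2 * m + 2) * δ < 2 ^ J) (hz : rep env z 0)
    {x : InvData m} (hx : InvSpec A z δ J env x) (hp : 2 ≤ p) (hm : 1 ≤ m) {k : ℤ}
    (hk : k ≤ mu p A d - p * nu p A d) (i j : Fin m) :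
    rep env (coefReg z d x k i j) (Bcoeff A d k i j) := by
  obtain ⟨-, -, h1, h2, h3, h4⟩ := hx
  rw [Bcoeff_apply A hd, coefReg]
  split_ifs with hdk
  · refine h4 _ ?_ i j
    have hg := gap_nonneg A hm
    have hb1 := (nu_bounds hp A d).1
    have hb2 := (mu_bounds hp A d).2
    have hp' : (1 : ℤ) ≤ (p : ℤ) - 1 := by
      have : (2 : ℤ) ≤ p := by exact_mod_cast hp
      linarith
    have hd' : (1 : ℤ) ≤ d := by exact_mod_cast hd
    obtain ⟨l, rfl⟩ := hdk
    rw [Int.mul_ediv_cancel_left _ (by omega)]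
    have hgap : gap A = -(vA A + vAinv A) := rfl
    have hkl : ((p : ℤ) - 1) * (d * l) < (p - 1) * (d * (gap A - vA A) + 1) := by
      have e1 : ((p : ℤ) - 1) * (d * l) ≤ (p - 1) * (mu p A d - p * nu p A d) :=
        mul_le_mul_of_nonneg_left hk (by linarith)
      have e2 : (p : ℤ) * (d * vA A) ≤ p * ((p - 1) * nu p A d) :=
        mul_le_mul_of_nonneg_left hb1 (by linarith)
      have e3 : 0 ≤ ((p : ℤ) - 2) * (d * gap A) :=
        mul_nonneg (by linarith) (mul_nonneg (by linarith) hg)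
      have e4 : (d : ℤ) * gap A = -(d * vA A) - d * vAinv A := by rw [hgap]; ring
      nlinarith
    have hkl' : (d : ℤ) * l < d * (gap A - vA A) + 1 := lt_of_mul_lt_mul_left hkl (by linarith)
    have hl : l ≤ gap A - vA A := by
      have : (d : ℤ) * l ≤ d * (gap A - vA A) := by linarith
      exact le_of_mul_le_mul_left this (by linarith)
    have hJ' : ((2 * m + 2) * δ : ℤ) < 2 ^ J := by exact_mod_cast hJ
    have h1' : (x.w : ℤ) ≤ m * δ := by exact_mod_cast h1
    linarith
  · exact hz

/-- The registers of `M_d`. -/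
def regM (z : Reg) (p d : ℕ) (ν : ℤ) (n : ℕ) (x : InvData m) : Fin n × Fin m → Fin n × Fin m → Reg :=
  fun a b => coefReg z d x ((ν + a.1) - p * (ν + b.1)) a.2 b.2

/-- The registers of `N_d`. -/
def regN (z : Reg) (p d : ℕ) (ν μ : ℤ) (k n : ℕ) (x : InvData m) :
    Fin k × Fin m → Fin n × Fin m → Reg :=
  fun a b => if ν < μ then coefReg z d x ((d * x.vAinv + p * ν + a.1) - p * (ν + b.1)) a.2 b.2 else z

theorem rep_regM {δ J d : ℕ} (hd : 1 ≤ d) (hJ : (2 * m + 2) * δ < 2 ^ J) (hz : rep env z 0)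
    {x : InvData m} (hx : InvSpec A z δ J env x) (hp : 2 ≤ p) (hm : 1 ≤ m) :
    rep env (regM z p d (nu p A d) (colCount p A d) x) (Mmat p A d (colCount p A d)) := fun a b => by
  refine rep_coefReg hd hJ hz hx hp hm ?_ a.2 b.2
  have h1 := colCount_cast hp A d hm
  have h2 : ((a.1 : ℕ) : ℤ) < colCount p A d := by exact_mod_cast a.1.2
  have h3 : (0 : ℤ) ≤ p * (b.1 : ℕ) := by positivity
  linarith

theorem rep_regN {δ J d : ℕ} (hd : 1 ≤ d) (hJ : (2 * m + 2) * δ < 2 ^ J) (hz : rep env z 0)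
    {x : InvData m} (hx : InvSpec A z δ J env x) (hp : 2 ≤ p) (hm : 1 ≤ m) (n : ℕ) :
    rep env (regN z p d (nu p A d) (mu p A d) (rowCount p A d) n x)
      (Nmat p A d (rowCount p A d) n) := fun a b => by
  rw [regN, Nmat]
  split_ifs with h
  · rw [hx.2.1]
    refine rep_coefReg hd hJ hz hx hp hm ?_ a.2 b.2
    have h1 : ((a.1 : ℕ) : ℤ) < rowCount p A d := by exact_mod_cast a.1.2
    have h3 : (0 : ℤ) ≤ p * (b.1 : ℕ) := by positivity
    have h5 : rowCount p A d = (nu p A d - (d * vAinv A + p * nu p A d)).toNat := by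
      rw [rowCount, if_pos h]
    have h4 : ((a.1 : ℕ) : ℤ) < nu p A d - (d * vAinv A + p * nu p A d) := by omega
    linarith
  · exact hz

end series

/-! ## The assumptions on the multiplication algorithms -/

theorem reg_mem_or_eq_zero (env : List Qbar) (i : ℕ) : reg env i ∈ env ∨ reg env i = 0 := by
  unfold reg
  by_cases h : i < env.length
  · left; rw [List.getD_eq_getElem _ _ h]; exact List.getElem_mem h
  · right; exact List.getD_eq_default _ _ (not_lt.1 h)

/-- The product `2 * 3` is neither an input nor the default value `0`, so an empty program cannot
output it. This yields `M(1) ≥ 1`, and by regularity `M(N) ≥ N`, which absorbs linear terms. -/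
theorem one_le_length_of_isPolyMul {l : List Instr} (h : IsPolyMul 1 l) : 1 ≤ l.length := by
  obtain ⟨-, out, hout⟩ := h
  by_contra hl
  obtain rfl : l = [] := List.length_eq_zero_iff.1 (by omega)
  have h1 := hout (fun _ => 2) (fun _ => 3) 0
  have h2 : ∑ i : Fin 2, ∑ j : Fin 2, (if (i : ℕ) + j = (0 : Fin 3) then (2 : Qbar) * 3 else 0) = 6 := by
    simp [Fin.sum_univ_two]; norm_num
  have h4 : reg (List.ofFn (fun _ : Fin 2 => (2 : Qbar)) ++ List.ofFn fun _ : Fin 2 => (3 : Qbar))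
    (out 0) = 6 := h1.trans h2
  rcases reg_mem_or_eq_zero (List.ofFn (fun _ : Fin 2 => (2 : Qbar)) ++ List.ofFn fun _ : Fin 2 => (3 : Qbar))
    (out 0) with h3 | h3
  · rw [h4] at h3
    simp at h3
  · rw [h3] at h4
    norm_num at h4

theorem one_le_length_of_isMatMul {l : List Instr} (h : IsMatMul 1 l) : 1 ≤ l.length := by
  obtain ⟨-, out, hout⟩ := h
  by_contra hl
  obtain rfl : l = [] := List.length_eq_zero_iff.1 (by omega)
  let X : Matrix (Fin 1) (Fin 1) Qbar := of fun _ _ => 2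
  let Y : Matrix (Fin 1) (Fin 1) Qbar := of fun _ _ => 3
  have h2 : (X * Y) 0 0 = 6 := by
    rw [Matrix.mul_apply, Fin.sum_univ_one]
    change (2 : Qbar) * 3 = 6
    norm_num
  have h4 : reg (matrixWord X ++ matrixWord Y) (out 0 0) = 6 := (hout X Y 0 0).trans h2
  rcases reg_mem_or_eq_zero (matrixWord X ++ matrixWord Y) (out 0 0) with h3 | h3
  · rw [h4] at h3
    simp [matrixWord, X, Y] at h3
  · rw [h3] at h4
    norm_num at h4

theorem exists_polyMul {M : ℕ → ℝ} {s : ℕ → List Instr}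
    (hs : ∀ n, IsPolyMul n (s n) ∧ ((s n).length : ℝ) ≤ M n)
    (hMreg : ∀ a b : ℕ, 1 ≤ a → a ≤ b → M a / a ≤ M b / b) {N : ℕ} (hN : 1 ≤ N) :
    PolyMul s N (M N / N) where
  isMul n := (hs n).1
  cost n h1 h2 := by
    have h3 : (0 : ℝ) < n := by exact_mod_cast h1
    calc ((s n).length : ℝ) ≤ M n := (hs n).2
      _ = n * (M n / n) := by field_simp
      _ ≤ n * (M N / N) := mul_le_mul_of_nonneg_left (hMreg n N h1 h2) h3.le
  one_le := by
    have h1 := hMreg 1 N le_rfl hN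
    have h2 : (1 : ℝ) ≤ (s 1).length := by exact_mod_cast one_le_length_of_isPolyMul (hs 1).1
    rw [Nat.cast_one, div_one] at h1
    linarith [(hs 1).2]
  pos := hN

/-- With `V = MM(r) / r²`, regularity bounds the cost per entry for all powers of two up to `r`. -/
theorem exists_matMul {MM : ℕ → ℝ} {s : ℕ → List Instr}
    (hs : ∀ n, IsMatMul n (s n) ∧ ((s n).length : ℝ) ≤ MM n)
    (hMMreg : ∀ a b : ℕ, 1 ≤ a → a ≤ b → MM a / (a : ℝ) ^ 2 ≤ MM b / (b : ℝ) ^ 2) {r : ℕ}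
    (hr : 1 ≤ r) : MatMul s (Nat.log 2 r) (MM r / (r : ℝ) ^ 2) where
  isMul n := (hs n).1
  cost k hk := by
    have h1 : 2 ^ k ≤ r := (Nat.pow_le_pow_right (by norm_num) hk).trans (Nat.pow_log_le_self 2 (by omega))
    have h2 := hMMreg (2 ^ k) r Nat.one_le_two_pow h1
    have h3 : ((2 ^ k : ℕ) : ℝ) ^ 2 = 4 ^ k := by
      push_cast; rw [← pow_mul, mul_comm, pow_mul]; norm_num
    rw [h3] at h2
    calc ((s (2 ^ k)).length : ℝ) ≤ MM (2 ^ k) := (hs _).2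
      _ = 4 ^ k * (MM (2 ^ k) / 4 ^ k) := by field_simp
      _ ≤ _ := mul_le_mul_of_nonneg_left h2 (by positivity)
  one_le := by
    have h1 := hMMreg 1 r le_rfl hr
    have h2 : (1 : ℝ) ≤ (s 1).length := by exact_mod_cast one_le_length_of_isMatMul (hs 1).1
    rw [Nat.cast_one, one_pow, div_one] at h1
    linarith [(hs 1).2]

/-! ## The decision -/

section decide
variable {s : ℕ → List Instr} {z : Reg} {V : ℝ} {env : List Qbar} {m p : ℕ}

open Classical in
/-- The loops and the verdict. -/
def decideP (s : ℕ → List Instr) (z o : Reg) (p m d : ℕ) (ν : ℤ) (n k j : ℕ)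
    (rM : Fin n × Fin m → Fin n × Fin m → Reg) (rN : Fin k × Fin m → Fin n × Fin m → Reg) :
    Prog ((ℕ → List (Fin n × Fin m → Reg)) × (ℕ → Fin k × Fin m → Fin n × Fin m → Reg) ×
      VerdictOf (Fin n × Fin m) m Reg) :=
  -- These conditions on integers are free to test and hold in every actual run; they are needed to
  -- form the gradings and permutations. The other branch has arbitrary values.
  if h : d ≠ 0 ∧ p.Coprime d ∧ (∀ y < n, m * (y / d + 1) ≤ 2 ^ (j + 2)) ∧
      ∀ y < k, m * (y / d + 1) ≤ 2 ^ (j + 2) then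
    have : NeZero d := ⟨h.1⟩
    do
      let r ← loopsP s z o j (gradZ k m d (j + 2) h.2.2.2) (gradZ n m d (j + 2) h.2.2.1)
        (mulPerm p d h.2.1) (mulAddPerm p d h.2.1 (((p : ℤ) - 1) * ν : ℤ)) rN rM (m * n + 1)
      let v ← verdictP s z j m rM (r.1 (m * n + 1))
      pure (r.1, r.2, v)
  else pure (fun _ => [], fun _ _ _ => z, none)

theorem sat_decideP {j d n k : ℕ} (hs : MatMul s j V) (A : GL (Fin m) (RatFunc Qbar)) {o : Reg}
    (hd : 1 ≤ d) (hpd : p.Coprime d) (hm : m ≤ 2 ^ (j + 2))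
    (hn : ∀ y < n, m * (y / d + 1) ≤ 2 ^ (j + 2)) (hk : ∀ y < k, m * (y / d + 1) ≤ 2 ^ (j + 2))
    {rM : Fin n × Fin m → Fin n × Fin m → Reg} {rN : Fin k × Fin m → Fin n × Fin m → Reg}
    (hz : rep env z 0) (ho : rep env o 1) (hM : rep env rM (Mmat p A d n))
    (hN : rep env rN (Nmat p A d k n)) :
    Sat (decideP s z o p m d (nu p A d) n k j rM rN) env
      (d * ((16 + 78 * ((m * n + 1 : ℕ) : ℝ)) * (4 ^ (j + 2) * V) + 2 ^ (j + 2) * (5 * 4 ^ (j + 2))) +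
        (46 * (4 ^ (j + 2) * V) + 7 * (((n * m : ℕ) : ℝ) * m ^ 2) +
      2 * (((n * m : ℕ) : ℝ) ^ 2 * m) + 2 * (((n * m : ℕ) : ℝ) * m ^ 2) + 7 * m ^ 3))
      fun e r => (∀ i ≤ m * n + 1, BRep e (r.1 i) (loopOne (Mmat p A d n) (Nmat p A d k n) i)) ∧
        (∀ i ≤ m * n + 1, rep e (r.2.1 i) (loopY (Mmat p A d n) (Nmat p A d k n) i)) ∧
        VerdictRep m (Mmat p A d n) (loopOne (Mmat p A d n) (Nmat p A d k n) (m * n + 1)) e r.2.2 := by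
  have h : d ≠ 0 ∧ p.Coprime d ∧ (∀ y < n, m * (y / d + 1) ≤ 2 ^ (j + 2)) ∧
      ∀ y < k, m * (y / d + 1) ≤ 2 ^ (j + 2) := ⟨by omega, hpd, hn, hk⟩
  have hcard : Fintype.card (Fin n × Fin m) = n * m := by simp
  have : NeZero d := ⟨h.1⟩
  rw [decideP, dif_pos h]
  refine Sat.bind (sat_loopsP (g' := gradZ k m d (j + 2) h.2.2.2) (g := gradZ n m d (j + 2) h.2.2.1)
    (σ' := mulPerm p d h.2.1) (σ := mulAddPerm p d h.2.1 (((p : ℤ) - 1) * nu p A d : ℤ))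
    hs (fun _ _ hne => Nmat_class A hd hpd hne) (fun _ _ hne => Mmat_class A hd hpd hne) hz ho hN hM
    (m * n + 1)) fun e1 r h1 hr => ?_
  have hMX := map_loopOne_eq (Mmat p A d n) (Nmat p A d k n)
  rw [hcard, mul_comm n m] at hMX
  refine Sat.bind (sat_verdictP hs hm hMX (Rep.mono h1 hz) (Rep.mono h1 hM)
    (hr (m * n + 1) le_rfl).1) fun e2 v h2 hv => ?_
  refine Sat.pure ?_ ⟨fun i hi => BRep.mono h2 (hr i hi).1, fun i hi => Rep.mono h2 (hr i hi).2, hv⟩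
  rw [ZMod.card, hcard]
  linarith

end decide

/-! ## The adjugate matrix and the determinant -/

section adj
variable {s : ℕ → List Instr} {z : Reg} {N : ℕ} {U : ℝ} {env : List Qbar} {m : ℕ}

/-- The determinant, up to sign. -/
def fadDet (S : Matrix (Fin m) (Fin m) Qbar[X]) : Qbar[X] :=
  Polynomial.C ((m : Qbar)⁻¹) * (S * faddeev S (m - 1)).trace

theorem mul_faddeev_eq (S : Matrix (Fin m) (Fin m) Qbar[X]) (hm : 1 ≤ m) :
    S * faddeev S (m - 1) = fadDet S • (1 : Matrix (Fin m) (Fin m) Qbar[X]) ∧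
      (fadDet S = S.det ∨ fadDet S = -S.det) := by
  have h := mul_faddeev S (by rw [Fintype.card_fin]; exact hm)
  rw [Fintype.card_fin] at h
  exact h

theorem natDegree_mul_faddeev_le {S : Matrix (Fin m) (Fin m) Qbar[X]} {δ : ℕ} (hm : 1 ≤ m)
    (hS : ∀ i j, (S i j).natDegree ≤ δ) (i j : Fin m) :
    ((S * faddeev S (m - 1)) i j).natDegree ≤ m * δ := by
  have h := natDegree_mul_apply_le hS (natDegree_faddeev_le hS (m - 1)) i j
  obtain ⟨m, rfl⟩ := Nat.exists_eq_add_of_le' hm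
  rw [Nat.add_sub_cancel] at h
  rw [Nat.add_sub_cancel]
  linarith

theorem natDegree_fadDet_le {S : Matrix (Fin m) (Fin m) Qbar[X]} {δ : ℕ} (hm : 1 ≤ m)
    (hS : ∀ i j, (S i j).natDegree ≤ δ) : (fadDet S).natDegree ≤ m * δ :=
  natDegree_trace_le _ (natDegree_mul_faddeev_le hm hS)

def adjP (s : ℕ → List Instr) (z : Reg) (N m n : ℕ) (a : Fin m → Fin m → ℕ → Reg) :
    Prog ((Fin m → Fin m → ℕ → Reg) × (ℕ → Reg)) := do
  let f ← fadP s z N n a (m - 1)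
  let g ← polyMM s z N n a f
  let c ← pconst ((m : Qbar)⁻¹)
  let e ← traceP z n c g
  pure (f, e)

theorem sat_adjP (hs : PolyMul s N U) {δ n : ℕ} (hm : 1 ≤ m) (hn : n = m * δ + 1) (hnN : n ≤ 8 * N)
    {a : Fin m → Fin m → ℕ → Reg}
    {S : Matrix (Fin m) (Fin m) Qbar[X]} (hS : ∀ i j, (S i j).natDegree ≤ δ)
    (hz : rep env z 0) (ha : rep env a fun i j => (S i j).coeff) :
    Sat (adjP s z N m n a) env
      (1 + m * (739 * (m ^ 3 * (n * U)) + 1 + n * (m + 1) + m * (m * n)) +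
        739 * (m ^ 3 * (n * U)) + 1 + n * (m + 1))
      fun e x => rep e x.1 (fun i j => (faddeev S (m - 1) i j).coeff) ∧
        rep e x.2 (fadDet S).coeff := by
  have hU := hs.one_le
  have hle : (m - 1) * δ ≤ m * δ := Nat.mul_le_mul_right _ (Nat.sub_le _ _)
  have hδ : δ ≤ n := by nlinarith
  refine Comp.bind (comp_fadP hs hnN hS (m - 1) (by omega) hz ha) fun e1 f h1 hf => ?_
  refine Comp.bind (comp_polyMM hs (by omega) hnN (Rep.mono h1 hz) (Rep.mono h1 ha) hf
    (fun i j => (hS i j).trans hδ) fun i j => (natDegree_faddeev_le hS (m - 1) i j).trans (by omega))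
    fun e2 g h2 hg => ?_
  refine Comp.bind (comp_const _) fun e3 c h3 hc => ?_
  have h13 := (h1.trans h2).trans h3
  refine Comp.bind (comp_traceP (n := n) (Rep.mono h13 hz) hc (Rep.mono h3 hg) fun i j => by
    have := natDegree_mul_faddeev_le hm hS i j
    omega) fun e4 e h4 he => ?_
  refine Sat.pure ?_ ⟨Rep.mono ((h2.trans h3).trans h4) hf, he⟩
  have hx : (0 : ℝ) ≤ 739 * ((m : ℝ) ^ 3 * (n * U)) + 1 + n * (m + 1) + m * (m * n) := by positivity
  have hm' : ((m - 1 : ℕ) : ℝ) ≤ m := by exact_mod_cast Nat.sub_le _ _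
  have := mul_le_mul_of_nonneg_right hm' hx
  linarith

end adj

/-! ## The input -/

theorem getElem?_flatten_ofFn {α : Type} {n c : ℕ} (L : Fin n → List α) (hL : ∀ i, (L i).length = c)
    (i : Fin n) {k : ℕ} (hk : k < c) : (List.ofFn L).flatten[(i : ℕ) * c + k]? = (L i)[k]? := by
  induction n with
  | zero => exact i.elim0
  | succ n ih =>
    rw [List.ofFn_succ, List.flatten_cons]
    refine Fin.cases ?_ (fun i => ?_) i
    · rw [Fin.val_zero, zero_mul, zero_add, List.getElem?_append_left (by rw [hL]; exact hk)]
    · have h1 : ((i.succ : Fin (n + 1)) : ℕ) * c + k = c + ((i : ℕ) * c + k) := by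
        rw [Fin.val_succ]; ring
      rw [List.getElem?_append_right (by rw [hL, h1]; omega), hL, h1, Nat.add_sub_cancel_left]
      exact ih (fun i => L i.succ) (fun i => hL _) i

theorem length_flatten_ofFn {α : Type} {n c : ℕ} (L : Fin n → List α) (hL : ∀ i, (L i).length = c) :
    (List.ofFn L).flatten.length = n * c := by
  induction n with
  | zero => simp
  | succ n ih =>
    rw [List.ofFn_succ, List.flatten_cons, List.length_append, hL, ih _ fun i => hL _]
    ring

def inQ (z : Reg) (δ : ℕ) (k : ℕ) : Reg := if k < δ + 1 then k else z

def inS (z : Reg) (m δ : ℕ) (i j : Fin m) (k : ℕ) : Reg :=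
  if k < δ + 1 then δ + 1 + ((i : ℕ) * (m * (δ + 1)) + ((j : ℕ) * (δ + 1) + k)) else z

section input
variable {m δ : ℕ} {Q : Qbar[X]} {S : Matrix (Fin m) (Fin m) Qbar[X]} {env : List Qbar} {z : Reg}

theorem length_inputWord :
    (inputWord δ Q S).length = δ + 1 + m * (m * (δ + 1)) := by
  rw [inputWord, List.length_append, List.length_ofFn, length_flatten_ofFn (c := m * (δ + 1))]
  intro i
  rw [length_flatten_ofFn]
  intro j
  rw [List.length_ofFn]

theorem rep_inQ (henv : inputWord δ Q S <+: env) (hQ : Q.natDegree ≤ δ) (hz : rep env z 0) :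
    rep env (inQ z δ) Q.coeff := fun k => by
  rw [inQ]
  split_ifs with hk
  · refine Rep.mono henv ?_
    change (inputWord δ Q S)[k]? = _
    rw [inputWord, List.getElem?_append_left (by rw [List.length_ofFn]; exact hk), List.getElem?_ofFn,
      dif_pos hk]
  · rw [Polynomial.coeff_eq_zero_of_natDegree_lt (by omega)]; exact hz

theorem rep_inS (henv : inputWord δ Q S <+: env) (hS : ∀ i j, (S i j).natDegree ≤ δ)
    (hz : rep env z 0) : rep env (inS z m δ) fun i j => (S i j).coeff := fun i j k => by
  rw [inS]
  split_ifs with hk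
  · refine Rep.mono henv ?_
    change (inputWord δ Q S)[δ + 1 + ((i : ℕ) * (m * (δ + 1)) + ((j : ℕ) * (δ + 1) + k))]? = _
    have hjk : (j : ℕ) * (δ + 1) + k < m * (δ + 1) := by
      have h1 : ((j : ℕ) + 1) * (δ + 1) ≤ m * (δ + 1) := Nat.mul_le_mul_right _ j.2
      linarith
    rw [inputWord, List.getElem?_append_right (by rw [List.length_ofFn]; omega), List.length_ofFn,
      Nat.add_sub_cancel_left, getElem?_flatten_ofFn _ (fun i => ?_) i hjk,
      getElem?_flatten_ofFn _ (fun j => ?_) j hk, List.getElem?_ofFn, dif_pos hk]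
    · rw [List.length_ofFn]
    · rw [length_flatten_ofFn]
      intro j
      rw [List.length_ofFn]
  · simp only [Polynomial.coeff_eq_zero_of_natDegree_lt (show (S i j).natDegree < k by
      have := hS i j
      omega)]
    exact hz

end input

/-! ## From the input to the companion matrix -/

structure GaugeOut (m : ℕ) where
  z : Reg
  o : Reg
  x : Reg
  r : Fin m → Fin m → Reg
  rows : ℕ → (Fin m → ℕ → Reg) × (ℕ → Reg)
  last : (Fin m → ℕ → Reg) × (ℕ → Reg)
  d : ℕ
  inv : InvData m

def gaugeP (s₁ s₂ : ℕ → List Instr) (p m δ : ℕ) : Prog (GaugeOut m) := do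
  let z ← pconst 0
  let o ← pconst 1
  let N := p ^ m * (δ + m)
  let n := m * δ + 1
  let g ← adjP s₁ z N m n (inS z m δ)
  let x ← cyclicP s₂ z (Nat.log 2 m) p n (inQ z δ) g.2 g.1
  let h ← rowsP s₁ z o N p (δ + m) (inQ z δ) (inS z m δ) x.2
  let b ← bareissP s₁ z o N m p (δ + m) fun k => (h k).1
  let y ← companionP s₁ z N (fun k => (h k).2) b
  let d ← ramP N p y
  let w ← seriesP s₁ z N δ n (Nat.clog 2 ((2 * m + 2) * δ + 1)) (inQ z δ) g.2 (inS z m δ) g.1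
  pure ⟨z, o, x.1, x.2, h, y, d, w⟩

/-- The specification of the first part of the computation. -/
def GaugeSpec {m : ℕ} (p δ : ℕ) (A : GL (Fin m) (RatFunc Qbar)) (Q : Qbar[X])
    (S : Matrix (Fin m) (Fin m) Qbar[X]) (e : List Qbar) (g : GaugeOut m) : Prop :=
  rep e g.z 0 ∧ rep e g.o 1 ∧
    InvSpec A g.z δ (Nat.clog 2 ((2 * m + 2) * δ + 1)) e g.inv ∧
    ∃ x r, rep e g.x x ∧ rep e g.r r ∧ CyclicSpec p Q S x r ∧
      (∀ k ≤ m, (leadM (augM p S r) k).det ≠ 0) ∧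
      (∀ k ≤ m, rep e (g.rows k).1 (fun j => (numRow p S r k j).coeff) ∧
        rep e (g.rows k).2 (denRow p Q k).coeff) ∧
      rep e g.last.1 (fun c => (lastMinor p S r c * denRow p Q c).coeff) ∧
      rep e g.last.2 ((leadM (augM p S r) m).det * denRow p Q m).coeff ∧
      g.d = ramIdx p fun c : Fin m => if lastMinor p S r c * denRow p Q c = 0 then none else
        some (((lastMinor p S r c * denRow p Q c).natTrailingDegree : ℤ) -
          ((leadM (augM p S r) m).det * denRow p Q m).natTrailingDegree)

/-! ### Numerical estimates for the first summand. -/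

section bounds
variable {m p δ N : ℕ}

theorem cube_le (m : ℕ) : m ^ 3 ≤ 4 * 2 ^ m := by
  rcases Nat.lt_or_ge m 4 with h | h
  · interval_cases m <;> norm_num
  · induction m, h using Nat.le_induction with
    | base => norm_num
    | succ k hk ih =>
      have h1 : (k + 1) ^ 3 ≤ 2 * k ^ 3 := by nlinarith [mul_le_mul hk hk (by omega) (by omega)]
      rw [pow_succ 2]; omega

/-- The Faddeev–LeVerrier recursion takes `m⁴` products in degree `m δ`, two powers of `m` too many;
`p ^ m ≥ 2 ^ m` absorbs them together with the factor `m` of the degree. -/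
theorem sq_mul_le (hp : 2 ≤ p) (hm : 1 ≤ m) (hN : N = p ^ m * (δ + m)) :
    m ^ 2 * (m * δ + 1) ≤ 4 * N := by
  have h1 : 2 ^ m * (δ + m) ≤ N := by
    rw [hN]; exact Nat.mul_le_mul_right _ (Nat.pow_le_pow_left hp m)
  have h2 := Nat.mul_le_mul_right (δ + m) (cube_le m)
  have h3 : m ^ 2 * (m * δ + 1) ≤ m ^ 3 * (δ + m) := by
    have : m ^ 2 * 1 ≤ m ^ 2 * (m * m) := Nat.mul_le_mul_left _ (Nat.mul_pos hm hm)
    nlinarith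
  linarith

theorem mul_le_size (hp : 2 ≤ p) (hN : N = p ^ m * (δ + m)) : p ^ m * m ≤ N ∧ δ + m ≤ N := by
  have h0 : 1 ≤ p ^ m := Nat.one_le_pow _ _ (by omega)
  constructor <;> nlinarith

theorem clog_le_size (hp : 2 ≤ p) (hm : 1 ≤ m) (hN : N = p ^ m * (δ + m)) :
    2 ^ Nat.clog 2 ((2 * m + 2) * δ + 1) ≤ 8 * N := by
  have h1 : 2 ^ m * (δ + m) ≤ N := by
    rw [hN]; exact Nat.mul_le_mul_right _ (Nat.pow_le_pow_left hp m)
  have h2 := two_pow_clog_le (n := (2 * m + 2) * δ + 1) (by omega)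
  have h3 : m + 1 ≤ 2 ^ m := Nat.lt_two_pow_self
  nlinarith

theorem adj_cost_le {n m U : ℝ} (hm : 1 ≤ m) (hn : 1 ≤ n) (hU : 1 ≤ U) :
    1 + m * (739 * (m ^ 3 * (n * U)) + 1 + n * (m + 1) + m * (m * n)) +
      739 * (m ^ 3 * (n * U)) + 1 + n * (m + 1) ≤ 1486 * (m ^ 4 * n * U) := by
  -- With all variables written as `1` plus something nonnegative, the difference of the two sides
  -- expands with nonnegative coefficients.
  obtain ⟨a, ha, rfl⟩ : ∃ a : ℝ, 0 ≤ a ∧ m = a + 1 := ⟨m - 1, by linarith, by ring⟩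
  obtain ⟨b, hb, rfl⟩ : ∃ b : ℝ, 0 ≤ b ∧ n = b + 1 := ⟨n - 1, by linarith, by ring⟩
  obtain ⟨c, hc, rfl⟩ : ∃ c : ℝ, 0 ≤ c ∧ U = c + 1 := ⟨U - 1, by linarith, by ring⟩
  rw [← sub_nonneg]
  ring_nf
  positivity

theorem cyclic_cost_le {n m U : ℝ} (hm : 1 ≤ m) (hn : 1 ≤ n) (hU : 1 ≤ U) :
    2 * (4 * n + 3) + 3 + m + (1 + m * ((4 * n + 1 + m * (m * (2 * n + 1))) + m * (m * (2 * m)))) +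
      (m * (1 + m) + 7 * (m * m ^ 2) + m * (m * (2 * m))) ≤ 40 * (m ^ 4 * n * U) := by
  obtain ⟨a, ha, rfl⟩ : ∃ a : ℝ, 0 ≤ a ∧ m = a + 1 := ⟨m - 1, by linarith, by ring⟩
  obtain ⟨b, hb, rfl⟩ : ∃ b : ℝ, 0 ≤ b ∧ n = b + 1 := ⟨n - 1, by linarith, by ring⟩
  obtain ⟨c, hc, rfl⟩ : ∃ c : ℝ, 0 ≤ c ∧ U = c + 1 := ⟨U - 1, by linarith, by ring⟩
  rw [← sub_nonneg]
  ring_nf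
  positivity

theorem series_cost_le {m N U δ n K : ℝ} (hm : 1 ≤ m) (hN : 1 ≤ N) (hU : 1 ≤ U)
    (hδ : δ + 1 ≤ N) (hn : n ≤ 4 * N) (hK : K ≤ 8 * N) :
    m * (m * (δ + 1)) + m * (m * (736 * (n * U))) + m * (m * n) + (δ + 1) + n +
        2948 * (K * U) + m * (m * (736 * (K * U))) ≤ 32500 * (m ^ 2 * (N * U)) := by
  have h1 : m * (m * (δ + 1)) + m * (m * (736 * (n * U))) + m * (m * n) + (δ + 1) + n +
        2948 * (K * U) + m * (m * (736 * (K * U))) ≤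
      m * (m * N) + m * (m * (736 * ((4 * N) * U))) + m * (m * (4 * N)) + N + 4 * N +
        2948 * ((8 * N) * U) + m * (m * (736 * ((8 * N) * U))) := by gcongr
  refine h1.trans ?_
  obtain ⟨a, ha, rfl⟩ : ∃ a : ℝ, 0 ≤ a ∧ m = a + 1 := ⟨m - 1, by linarith, by ring⟩
  obtain ⟨b, hb, rfl⟩ : ∃ b : ℝ, 0 ≤ b ∧ N = b + 1 := ⟨N - 1, by linarith, by ring⟩
  obtain ⟨c, hc, rfl⟩ : ∃ c : ℝ, 0 ≤ c ∧ U = c + 1 := ⟨U - 1, by linarith, by ring⟩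
  rw [← sub_nonneg]
  ring_nf
  positivity

end bounds

/-! ### Cyclic vector, companion matrix, ramification index and series together. -/

section gauge
variable {m p δ N : ℕ} {A : GL (Fin m) (RatFunc Qbar)} {Q : Qbar[X]}
  {S : Matrix (Fin m) (Fin m) Qbar[X]} {s₁ s₂ : ℕ → List Instr} {U V : ℝ}

theorem det_ne_zero_of_presentation (hA : ∀ i j, A.val i j = fr (S i j) / fr Q) :
    S.det ≠ 0 := by
  intro h
  have h1 : A.val = (fr Q)⁻¹ • S.map (algebraMap Qbar[X] (RatFunc Qbar)) := by
    ext i j : 2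
    rw [hA, Matrix.smul_apply, Matrix.map_apply, smul_eq_mul, div_eq_inv_mul]
  have h2 : (S.map (algebraMap Qbar[X] (RatFunc Qbar))).det = 0 := by
    have h3 := RingHom.map_det (algebraMap Qbar[X] (RatFunc Qbar)) S
    rw [h, map_zero] at h3
    exact h3.symm
  have h3 : A.val.det ≠ 0 := ((isUnit_iff_isUnit_det _).1 A.isUnit).ne_zero
  rw [h1, det_smul, h2, mul_zero] at h3
  exact h3 rfl

theorem sat_gaugeP (hp : 2 ≤ p) (hm : 1 ≤ m) (hN : N = p ^ m * (δ + m)) (hs₁ : PolyMul s₁ N U)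
    (hs₂ : MatMul s₂ (Nat.log 2 m) V) (hA : IsPresentation A.val Q S δ) :
    Sat (gaugeP s₁ s₂ p m δ) (inputWord δ Q S)
      (110000 * (m ^ 2 * (N * U)) + 23 * (4 ^ (Nat.log 2 m + 2) * V)) (GaugeSpec p δ A Q S) := by
  obtain ⟨hQ, hQδ, hSδ, hA⟩ := hA
  have hU := hs₁.one_le
  have hN1 := hs₁.pos
  have hdet := det_ne_zero_of_presentation hA
  obtain ⟨hG, hed⟩ := mul_faddeev_eq S hm
  have he0 : fadDet S ≠ 0 := by
    rcases hed with h | h <;> rw [h]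
    · exact hdet
    · exact neg_ne_zero.2 hdet
  have heδ := natDegree_fadDet_le hm hSδ
  have hGδ := natDegree_faddeev_le hSδ (m - 1)
  have hGδ' : ∀ i j, (faddeev S (m - 1) i j).natDegree + δ ≤ m * δ := fun i j => by
    have h1 := hGδ i j
    have h2 : (m - 1) * δ + δ = m * δ := by
      rw [← Nat.succ_mul, Nat.succ_eq_add_one, Nat.sub_add_cancel hm]
    omega
  have hsq := sq_mul_le hp hm hN
  obtain ⟨hsz1, hsz2⟩ := mul_le_size hp hN
  have hnN : m * δ + 1 ≤ 4 * N := le_trans (Nat.le_mul_of_pos_left _ (by positivity)) hsq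
  have hmlog : m ≤ 2 ^ (Nat.log 2 m + 2) :=
    (Nat.lt_pow_succ_log_self one_lt_two m).le.trans (Nat.pow_le_pow_right (by norm_num) (by omega))
  have hδm : δ ≤ m * δ := Nat.le_mul_of_pos_left _ hm
  unfold gaugeP
  rw [← hN]
  refine Comp.bind (comp_const 0) fun e1 z h1 hz1 => ?_
  refine Comp.bind (comp_const 1) fun e2 o h2 ho2 => ?_
  have k2 := h1.trans h2
  have hz2 := Rep.mono h2 hz1
  refine Sat.bind (sat_adjP (n := m * δ + 1) (a := inS z m δ) hs₁ hm rfl (by omega) hSδ hz2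
    (rep_inS k2 hSδ hz2)) fun e3 g h3 hg => ?_
  have k3 := k2.trans h3
  have hz3 := Rep.mono h3 hz2
  refine Sat.bind (sat_cyclicP (n := m * δ + 1) (rq := inQ z δ) hp hs₂ hmlog hz3
    (rep_inQ k3 hQδ hz3) hg.2 hg.1 (by omega) (by omega) (fun i j => by have := hGδ' i j; omega)
    hG hQ hdet hed) fun e4 x h4 hx => ?_
  obtain ⟨xv, rv, hxv, hrv, hcs⟩ := hx
  have k4 := k3.trans h4
  have hz4 := Rep.mono h4 hz3
  have hlead : ∀ k ≤ m, (leadM (augM p S rv) k).det ≠ 0 := fun k hk =>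
    leadM_augM_ne_zero hcs.2.1 hcs.2.2.1 hcs.2.2.2 hk
  refine Sat.bind (sat_rowsP (o := o) (q := inQ z δ) (a := inS z m δ) hN hp hm hs₁ hSδ hQδ hz4
    (Rep.mono (h3.trans h4) ho2) (rep_inQ k4 hQδ hz4) (rep_inS k4 hSδ hz4) hrv) fun e5 h h5 hh => ?_
  have k5 := k4.trans h5
  have hz5 := Rep.mono h5 hz4
  refine Sat.bind (sat_bareissP (o := o) hN hp hm hs₁ hSδ hlead hz5
    (Rep.mono ((h3.trans h4).trans h5) ho2) fun k hk => (hh k hk).1) fun e6 b h6 hb => ?_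
  have hz6 := Rep.mono h6 hz5
  refine Sat.bind (sat_companionP (x := fun k => (h k).2) hN hp hm hs₁ hSδ hQδ hz6
    (fun k hk => Rep.mono h6 (hh k hk).2) hb.1 hb.2) fun e7 y h7 hy => ?_
  have hden : ∀ k ≤ m, (denRow p Q k).natDegree < N := fun k hk => by
    have h8 := denRow_natDegree hp hm hQδ k
    have h9 : p ^ k * (δ + m) ≤ N := by
      rw [hN]; exact Nat.mul_le_mul_right _ (Nat.pow_le_pow_right (by omega) hk)
    omega
  refine Sat.bind (sat_ramP (p := p) (N := N) (f := fun c => lastMinor p S rv c * denRow p Q c)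
    (mul_ne_zero (hlead m le_rfl) (denRow_ne_zero (by omega) hQ m)) (fun c => ?_) ?_ hy.1 hy.2)
    fun e8 d h8 hd => ?_
  · have h9 : (lastMinor p S rv c * denRow p Q c).natDegree ≤ _ := Polynomial.natDegree_mul_le
    have h10 := natDegree_minor_augM (r := rv) hp hm hSδ (m + c) le_rfl le_rfl
    have h11 := hden c c.2.le
    rw [← hN] at h10
    change (lastMinor p S rv c).natDegree < _ at h10
    omega
  · have h9 : ((leadM (augM p S rv) m).det * denRow p Q m).natDegree ≤ _ := Polynomial.natDegree_mul_le
    have h10 := natDegree_leadM_augM (r := rv) hp hm hSδ le_rfl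
    have h11 := hden m le_rfl
    omega
  have k8 := ((k5.trans h6).trans h7).trans h8
  have hz8 := Rep.mono (h7.trans h8) hz6
  have k38 := ((((h4.trans h5).trans h6).trans h7).trans h8)
  refine Sat.bind (sat_seriesP (rq := inQ z δ) (a := inS z m δ) hm hs₁ rfl (by omega)
    (clog_le_size hp hm hN) hA hQ hG he0 hQδ hSδ hGδ' heδ hz8 (rep_inQ k8 hQδ hz8)
    (Rep.mono k38 hg.2) (rep_inS k8 hSδ hz8) (Rep.mono k38 hg.1)) fun e9 w h9 hw => ?_
  have k59 := ((h6.trans h7).trans h8).trans h9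
  refine Sat.pure ?_ ⟨Rep.mono h9 hz8, Rep.mono (((h3.trans h4).trans h5).trans k59) ho2, hw,
    xv, rv, Rep.mono (h5.trans k59) hxv, Rep.mono (h5.trans k59) hrv, hcs, hlead,
    fun k hk => ⟨Rep.mono k59 (hh k hk).1, Rep.mono k59 (hh k hk).2⟩,
    Rep.mono (h8.trans h9) hy.1, Rep.mono (h8.trans h9) hy.2, hd⟩
  have rm : (1 : ℝ) ≤ m := by exact_mod_cast hm
  have rN : (1 : ℝ) ≤ N := by exact_mod_cast hN1
  have rn : (1 : ℝ) ≤ ((m * δ + 1 : ℕ) : ℝ) := by exact_mod_cast Nat.le_add_left 1 _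
  have c1 := adj_cost_le rm rn hU
  have c2 := cyclic_cost_le rm rn hU
  have c3 : (m : ℝ) ^ 4 * ((m * δ + 1 : ℕ) : ℝ) * U ≤ 4 * (m ^ 2 * (N * U)) := by
    have h10 : (m : ℝ) ^ 2 * ((m * δ + 1 : ℕ) : ℝ) ≤ 4 * N := by exact_mod_cast hsq
    calc (m : ℝ) ^ 4 * ((m * δ + 1 : ℕ) : ℝ) * U
        = m ^ 2 * ((m ^ 2 * ((m * δ + 1 : ℕ) : ℝ)) * U) := by ring
      _ ≤ m ^ 2 * ((4 * N) * U) := by gcongr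
      _ = _ := by ring
  have c4 := series_cost_le (m := m) (N := N) (U := U) (δ := δ) (n := ((m * δ + 1 : ℕ) : ℝ))
    (K := ((2 ^ Nat.clog 2 ((2 * m + 2) * δ + 1) : ℕ) : ℝ)) rm rN hU
    (by exact_mod_cast (by omega : δ + 1 ≤ N))
    (by exact_mod_cast hnN) (by exact_mod_cast clog_le_size hp hm hN)
  rw [Nat.cast_pow, Nat.cast_ofNat] at c4
  have hB : (N : ℝ) ≤ m ^ 2 * (N * U) := by
    calc (N : ℝ) = 1 * (N * 1) := by ring
      _ ≤ m ^ 2 * (N * U) := by gcongr; exact one_le_pow₀ rm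
  have hB' : (m : ℝ) * N ≤ m ^ 2 * (N * U) := by
    have : (m : ℝ) ≤ m ^ 2 := by nlinarith
    calc (m : ℝ) * N = m * (N * 1) := by ring
      _ ≤ m ^ 2 * (N * U) := by gcongr
  have c5 : (m : ℝ) * p ≤ m ^ 2 * (N * U) := by
    refine le_trans ?_ hB
    have h10 : m * p ≤ N := by
      refine le_trans ?_ hsz1
      rw [mul_comm]
      exact Nat.mul_le_mul_right _ (Nat.le_self_pow (by omega) p)
    exact_mod_cast h10
  linarith

end gauge

/-! ## The record of a run -/

theorem coeff_listPoly (l : List Qbar) (k : ℕ) : (listPoly l).coeff k = l.getD k 0 := by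
  induction l generalizing k with
  | nil => simp [listPoly]
  | cons a l ih =>
    have h : listPoly (a :: l) = Polynomial.C a + Polynomial.X * listPoly l := rfl
    rw [h, Polynomial.coeff_add]
    cases k with
    | zero => simp
    | succ k => rw [Polynomial.coeff_C_succ, Polynomial.coeff_X_mul, ih, zero_add, List.getD_cons_succ]

theorem listPoly_map_ofFn {env : List Qbar} {a : ℕ → Reg} {f : Qbar[X]} {n : ℕ}
    (ha : rep env a f.coeff) (hf : f.natDegree < n) :
    listPoly ((List.ofFn fun k : Fin n => a k).map (reg env)) = f := by
  refine Polynomial.ext fun k => ?_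
  rw [coeff_listPoly, List.getD_eq_getElem?_getD, List.getElem?_map, List.getElem?_ofFn]
  split_ifs with h
  · exact reg_eq (ha k)
  · exact (Polynomial.coeff_eq_zero_of_natDegree_lt (by omega)).symm

theorem represents_map {env : List Qbar} {a b : ℕ → Reg} {f g : Qbar[X]} {n k : ℕ}
    (ha : rep env a f.coeff) (hb : rep env b g.coeff) (hf : f.natDegree < n) (hg : g.natDegree < k)
    (hg0 : g ≠ 0) : Represents ((List.ofFn fun i : Fin n => a i).map (reg env),
      (List.ofFn fun i : Fin k => b i).map (reg env)) (fr f / fr g) := by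
  constructor
  · rw [listPoly_map_ofFn hb hg]; exact hg0
  · rw [listPoly_map_ofFn ha hf, listPoly_map_ofFn hb hg]

theorem map_reg_eq {ι κ : Type} {env : List Qbar} {r : ι → κ → Reg} {M : Matrix ι κ Qbar}
    (h : rep env r M) : Matrix.map (of r) (reg env) = M := by
  exact Matrix.ext fun i j => reg_eq (h i j)

theorem list_map_reg_eq {κ : Type} {env : List Qbar} {l : List (κ → Reg)} {lv : List (κ → Qbar)}
    (h : rep env l lv) : (l.map fun x y => reg env (x y)) = lv := by
  change List.Forall₂ _ _ _ at h
  induction h with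
  | nil => rfl
  | cons h1 _ ih => rw [List.map_cons, ih]; congr 1; funext y; exact reg_eq (h1 y)

theorem isBasisOf_map {κ : Type} {env : List Qbar} {l : List (κ → Reg)}
    {X : Submodule Qbar (κ → Qbar)} (h : BRep env l X) :
    IsBasisOf (l.map fun x y => reg env (x y)) X := by
  obtain ⟨lv, h1, h2⟩ := h
  rw [list_map_reg_eq h1]; exact h2

section final
variable {m p δ N : ℕ} {A : GL (Fin m) (RatFunc Qbar)} {Q : Qbar[X]}
  {S : Matrix (Fin m) (Fin m) Qbar[X]} {s₁ s₂ : ℕ → List Instr} {U V : ℝ}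

def mkTrace (N : ℕ) (g : GaugeOut m) (ν μ : ℤ) (n k L : ℕ)
    (rM : Fin n × Fin m → Fin n × Fin m → Reg) (rN : Fin k × Fin m → Fin n × Fin m → Reg)
    (r : (ℕ → List (Fin n × Fin m → Reg)) × (ℕ → Fin k × Fin m → Fin n × Fin m → Reg) ×
      VerdictOf (Fin n × Fin m) m Reg) : Trace m ℕ where
  z₀ := g.x
  r := g.r
  P := fun i j => (List.ofFn fun l : Fin N => (g.rows i).1 j l, List.ofFn fun l : Fin N => (g.rows i).2 l)
  q := fun c => (List.ofFn fun l : Fin (4 * N) => g.last.1 c l, List.ofFn fun l : Fin (4 * N) => g.last.2 l)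
  d := g.d
  ν := ν
  μ := μ
  n := n
  k := k
  M := of rM
  N := of rN
  X₁ := r.1
  Y := fun i => of (r.2.1 i)
  -- By `loopTwo_eq` the second loop does not change the subspace, so the last basis of the first
  -- loop is recorded at every pass.
  X₂ := fun _ => r.1 L
  verdict := r.2.2

def finishP (s : ℕ → List Instr) (N p : ℕ) (g : GaugeOut m) (ν μ : ℤ) (n k j : ℕ) : Prog (Trace m ℕ) := do
  let r ← decideP s g.z g.o p m g.d ν n k j (regM g.z p g.d ν n g.inv) (regN g.z p g.d ν μ k n g.inv)
  pure (mkTrace N g ν μ n k (m * n + 1) (regM g.z p g.d ν n g.inv) (regN g.z p g.d ν μ k n g.inv) r)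

open Classical in
theorem hullSlopes_lastRow {rv : Fin m → Fin m → Qbar}
    (hd0 : (leadM (augM p S rv) m).det * denRow p Q m ≠ 0) :
    hullSlopes p (lastRow p Q S rv) = slopesOf p fun c : Fin m =>
      if lastMinor p S rv c * denRow p Q c = 0 then none else
        some (((lastMinor p S rv c * denRow p Q c).natTrailingDegree : ℤ) -
          ((leadM (augM p S rv) m).det * denRow p Q m).natTrailingDegree) := by
  rw [hullSlopes_eq]
  congr 1
  funext c
  have hiff : lastRow p Q S rv c = 0 ↔ lastMinor p S rv c * denRow p Q c = 0 := by
    rw [lastRow, div_eq_zero_iff, or_iff_left (fr_ne_zero.2 hd0), ← not_iff_not]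
    exact fr_ne_zero
  by_cases h : lastMinor p S rv c * denRow p Q c = 0
  · rw [if_pos h, if_pos (hiff.2 h)]
  · rw [if_neg h, if_neg fun h' => h (hiff.1 h'), lastRow, val0_div h hd0]

theorem isCyclicStep_mkTrace (hp : 2 ≤ p) (hm : 1 ≤ m) (hN : N = p ^ m * (δ + m))
    (hA : IsPresentation A.val Q S δ) {env : List Qbar} {g : GaugeOut m}
    (hg : GaugeSpec p δ A Q S env g) {ν μ : ℤ} {n k L : ℕ}
    {rM : Fin n × Fin m → Fin n × Fin m → Reg} {rN : Fin k × Fin m → Fin n × Fin m → Reg}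
    {r : (ℕ → List (Fin n × Fin m → Reg)) × (ℕ → Fin k × Fin m → Fin n × Fin m → Reg) ×
      VerdictOf (Fin n × Fin m) m Reg} :
    ∃ q, IsCyclicStep p A.val Q S ((mkTrace N g ν μ n k L rM rN r).map (reg env)) q ∧
      IsRamificationIndex p q g.d := by
  obtain ⟨-, -, -, x, rv, hx, hr, hcs, hlead, hrows, hl1, hl2, hd⟩ := hg
  obtain ⟨hQ, hQδ, hSδ, hA⟩ := hA
  have hp0 : 0 < p := by omega
  have hNk : ∀ k ≤ m, p ^ k * (δ + m) ≤ N := fun k hk => by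
    rw [hN]; exact Nat.mul_le_mul_right _ (Nat.pow_le_pow_right hp0 hk)
  have hden : ∀ k ≤ m, (denRow p Q k).natDegree < N := fun k hk => by
    have h8 := denRow_natDegree hp hm hQδ k
    have h9 := hNk k hk
    omega
  have hnum : ∀ k ≤ m, ∀ j, (numRow p S rv k j).natDegree < N := fun k hk j => by
    have h8 := numRow_natDegree (r := rv) hp hm hSδ k j
    have h9 := hNk k hk
    omega
  have hrr : ∀ i j, reg env (g.r i j) = rv i j := fun i j => reg_eq (hr i j)
  have hxx : reg env g.x = x := reg_eq hx
  have hd0 : (leadM (augM p S rv) m).det * denRow p Q m ≠ 0 :=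
    mul_ne_zero (hlead m le_rfl) (denRow_ne_zero hp0 hQ m)
  refine ⟨lastRow p Q S rv, ⟨?_, ?_, gaugeM p Q S rv, ?_, isUnit_gaugeM hp0 hQ (hlead m le_rfl), ?_, ?_, ?_⟩, ?_, ?_⟩
  · change ((reg env g.x : Qbar) : ℂ) = _
    rw [hxx]; exact hcs.1
  · intro i j
    change ∑ l : Fin m, reg env (g.r j l) * (reg env g.x ^ p ^ (i : ℕ)) ^ (l : ℕ) =
      prodInv p Q S (reg env g.x) i i j
    simp only [hrr, hxx]
    exact hcs.2.2.2 i j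
  · intro i j
    change _ = cyclicRow p A.val (fun j' => fr
      (∑ l : Fin m, Polynomial.C (reg env (g.r j' l)) * Polynomial.X ^ (l : ℕ))) i j
    simp only [hrr]
    rw [cyclicRow_eq hp0 hQ hA]; rfl
  · intro i j
    exact represents_map ((hrows i i.2.le).1 j) (hrows i i.2.le).2 (hnum i i.2.le j) (hden i i.2.le)
      (denRow_ne_zero hp0 hQ i)
  · intro i hi
    exact lastRow_eq hp0 hQ hA (hlead m le_rfl) i hi
  · intro c
    refine represents_map (hl1 c) hl2 ?_ ?_ hd0
    · have h9 : (lastMinor p S rv c * denRow p Q c).natDegree ≤ _ := Polynomial.natDegree_mul_le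
      have h10 := natDegree_minor_augM (r := rv) hp hm hSδ (m + c) le_rfl le_rfl
      have h11 := hden c c.2.le
      rw [← hN] at h10
      change (lastMinor p S rv c).natDegree < _ at h10
      omega
    · have h9 : ((leadM (augM p S rv) m).det * denRow p Q m).natDegree ≤ _ := Polynomial.natDegree_mul_le
      have h10 := natDegree_leadM_augM (r := rv) hp hm hSδ le_rfl
      have h11 := hden m le_rfl
      omega
  · rw [hullSlopes_lastRow hd0, hd]
    exact (ramIdx_props hp _).1
  · rw [hullSlopes_lastRow hd0, hd]
    exact (ramIdx_props hp _).2.1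

theorem isVerdict_mkTrace {e : List Qbar} {g : GaugeOut m} {ν μ : ℤ} {n k L : ℕ}
    {rM : Fin n × Fin m → Fin n × Fin m → Reg} {rN : Fin k × Fin m → Fin n × Fin m → Reg}
    {r : (ℕ → List (Fin n × Fin m → Reg)) × (ℕ → Fin k × Fin m → Fin n × Fin m → Reg) ×
      VerdictOf (Fin n × Fin m) m Reg} {M : Matrix (Fin n × Fin m) (Fin n × Fin m) Qbar}
    {X : Submodule Qbar (Fin n × Fin m → Qbar)} (hM : Matrix.map (of rM) (reg e) = M)
    (h : VerdictRep m M X e r.2.2) :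
    IsVerdict ((mkTrace N g ν μ n k L rM rN r).map (reg e)) X := by
  subst hM
  obtain ⟨Y, Z, v⟩ := r
  rcases v with _ | ⟨E, R, W⟩
  · exact h
  · obtain ⟨Ev, Rv, Wv, hE, hR, hW, c⟩ := h
    obtain rfl : Matrix.map E (reg e) = Ev := map_reg_eq hE
    obtain rfl : Matrix.map R (reg e) = Rv := map_reg_eq hR
    obtain rfl : Matrix.map W (reg e) = Wv := map_reg_eq hW
    exact c

/-- The cost of the loops and of the verdict. -/
def decideCost (m d n j : ℕ) (V : ℝ) : ℝ :=
  d * ((16 + 78 * ((m * n + 1 : ℕ) : ℝ)) * (4 ^ (j + 2) * V) + 2 ^ (j + 2) * (5 * 4 ^ (j + 2))) +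
    (46 * (4 ^ (j + 2) * V) + 7 * (((n * m : ℕ) : ℝ) * m ^ 2) +
      2 * (((n * m : ℕ) : ℝ) ^ 2 * m) + 2 * (((n * m : ℕ) : ℝ) * m ^ 2) + 7 * m ^ 3)

/-- A class modulo `d` contains at most `v + 1 ≤ 2 max(v, 1)` block indices, hence at most `2 ^ (j +
2)` coordinates; this is what the padded size was chosen for. -/
theorem sat_finishP (hp : 2 ≤ p) (hm : 1 ≤ m) (hN : N = p ^ m * (δ + m))
    (hA : IsPresentation A.val Q S δ) {env : List Qbar} {g : GaugeOut m}
    (hg : GaugeSpec p δ A Q S env g) {j : ℕ} (hs : MatMul s₂ j V)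
    (hj : m * max (gap A).toNat 1 < 2 ^ (j + 1)) :
    Sat (finishP s₂ N p g (nu p A g.d) (mu p A g.d) (colCount p A g.d) (rowCount p A g.d) j) env
      (decideCost m g.d (colCount p A g.d) j V) fun e t => IsRun p A Q S (t.map (reg e)) := by
  have hd1 : 1 ≤ g.d ∧ p.Coprime g.d := by
    obtain ⟨-, -, -, x, rv, -, -, -, -, -, -, -, hd⟩ := hg
    rw [hd]
    exact ⟨(ramIdx_props hp _).2.2.1, (ramIdx_props hp _).2.2.2.1⟩
  have hpow : 2 ^ (j + 2) = 2 * 2 ^ (j + 1) := by rw [pow_succ 2 (j + 1), mul_comm]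
  have hmj : m ≤ 2 ^ (j + 2) := by
    have : m * 1 ≤ m * max (gap A).toNat 1 := Nat.mul_le_mul_left _ (le_max_right _ _)
    omega
  have hgap := gap_nonneg A hm
  have hblk : ∀ y : ℕ, y ≤ g.d * (gap A).toNat → m * (y / g.d + 1) ≤ 2 ^ (j + 2) := fun y hy => by
    have h1 : y / g.d ≤ (gap A).toNat := Nat.div_le_of_le_mul hy
    have h2 : y / g.d + 1 ≤ 2 * max (gap A).toNat 1 := by omega
    calc m * (y / g.d + 1) ≤ m * (2 * max (gap A).toNat 1) := Nat.mul_le_mul_left _ h2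
      _ = 2 * (m * max (gap A).toNat 1) := by ring
      _ ≤ _ := by omega
  have hcast : ((g.d * (gap A).toNat : ℕ) : ℤ) = g.d * gap A := by
    rw [Nat.cast_mul, Int.toNat_of_nonneg hgap]
  have hn : ∀ y < colCount p A g.d, m * (y / g.d + 1) ≤ 2 ^ (j + 2) := fun y hy => by
    have h1 := colCount_le hp A g.d hm
    rw [← hcast] at h1
    exact hblk y (by omega)
  have hk : ∀ y < rowCount p A g.d, m * (y / g.d + 1) ≤ 2 ^ (j + 2) := fun y hy => by
    have h1 := rowCount_le hp A g.d hm
    rw [← hcast] at h1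
    exact hblk y (by omega)
  have hJ : (2 * m + 2) * δ < 2 ^ Nat.clog 2 ((2 * m + 2) * δ + 1) :=
    Nat.lt_of_succ_le (Nat.le_pow_clog one_lt_two _)
  have hz := hg.1
  have ho := hg.2.1
  have hM := rep_regM (p := p) hd1.1 hJ hz hg.2.2.1 hp hm
  have hNr := rep_regN (p := p) hd1.1 hJ hz hg.2.2.1 hp hm (colCount p A g.d)
  refine Sat.bind (sat_decideP hs A hd1.1 hd1.2 hmj hn hk hz ho hM hNr) fun e r h1 hr => ?_
  refine Sat.pure (sub_nonneg.2 (le_refl (decideCost m g.d (colCount p A g.d) j V))) ?_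
  have hMv := map_reg_eq (Rep.mono h1 hM)
  have hNv := map_reg_eq (Rep.mono h1 hNr)
  have hg' : GaugeSpec p δ A Q S e g := by
    obtain ⟨g1, g2, ⟨i1, i2, i3, i4, i5, i6⟩, x, rv, g4, g5, g6, g7, g8, g9, g10, g11⟩ := hg
    exact ⟨Rep.mono h1 g1, Rep.mono h1 g2, ⟨i1, i2, i3, i4, i5, fun k hk i j => Rep.mono h1 (i6 k hk i j)⟩,
      x, rv, Rep.mono h1 g4, Rep.mono h1 g5, g6, g7,
      fun k hk => ⟨Rep.mono h1 (g8 k hk).1, Rep.mono h1 (g8 k hk).2⟩, Rep.mono h1 g9, Rep.mono h1 g10, g11⟩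
  have hcard : Fintype.card (Fin (colCount p A g.d) × Fin m) = m * colCount p A g.d := by simp [mul_comm]
  have hl2 := fun i => loopTwo_eq (Mmat p A g.d (colCount p A g.d))
    (Nmat p A g.d (rowCount p A g.d) (colCount p A g.d)) i
  simp only [hcard] at hl2
  refine ⟨isCyclicStep_mkTrace hp hm hN hA hg', rfl, rfl, rfl, rfl, hMv, hNv, ?_, ?_, ?_, ?_⟩
  · intro i hi
    exact (congrArg₂ (fun M N => IsBasisOf _ (loopOne M N i)) hMv hNv).mpr (isBasisOf_map (hr.1 i hi))
  · intro i hi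
    exact (map_reg_eq (hr.2.1 i hi)).trans (congrArg₂ (fun M N => loopY M N i) hMv hNv).symm
  · intro i hi
    refine (congrArg₂ (fun M N => IsBasisOf _ (loopTwo M N
      (loopOne M N (m * colCount p A g.d + 1)) i)) hMv hNv).mpr ?_
    rw [hl2]
    exact isBasisOf_map (hr.1 _ le_rfl)
  · refine (congrArg₂ (fun M N => IsVerdict _ (loopTwo M N (loopOne M N (m * colCount p A g.d + 1))
      (m * colCount p A g.d + 1))) hMv hNv).mpr ?_
    exact (congrArg (IsVerdict _) (hl2 _)).mpr (isVerdict_mkTrace hMv hr.2.2)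

end final

/-! ## The whole algorithm and its cost -/

/-- The tree must not depend on `A`: here the valuation is an integer found at run time, unlike in
`nu`. -/
def nuOf (p d : ℕ) (a : ℤ) : ℤ := ⌈((d : ℚ) * (a : ℚ)) / ((p : ℚ) - 1)⌉

def muOf (p d : ℕ) (b : ℤ) : ℤ := ⌈(-((d : ℚ) * (b : ℚ))) / ((p : ℚ) - 1)⌉

/-- The second part of the computation, for `v_0(A) = a` and `v_0(A⁻¹) = b`. -/
def loopsOfP {m : ℕ} (s : ℕ → List Instr) (N p : ℕ) (g : GaugeOut m) (a b : ℤ) : Prog (Trace m ℕ) :=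
  finishP s N p g (nuOf p g.d a) (muOf p g.d b) (muOf p g.d b - nuOf p g.d a + 1).toNat
    (if nuOf p g.d a < muOf p g.d b then (nuOf p g.d a - (g.d * b + p * nuOf p g.d a)).toNat else 1)
    (Nat.log 2 (m * max (-(a + b)).toNat 1))

def mainP (s₁ s₂ : ℕ → List Instr) (p m δ : ℕ) : Prog (Trace m ℕ) := do
  let g ← gaugeP s₁ s₂ p m δ
  loopsOfP s₂ (p ^ m * (δ + m)) p g g.inv.vA g.inv.vAinv

/-- The computation tree of the algorithm. -/
def mainTree (s₁ s₂ : ℕ → List Instr) (p m δ : ℕ) : CompTree (Trace m ℕ) :=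
  (mainP s₁ s₂ p m δ (δ + 1 + m * (m * (δ + 1)))).bind fun x => .leaf x.1

/-- The counter compiled into the tree is the length of the input, which depends on `m` and `δ`
only. -/
theorem mainTree_of_sat {s₁ s₂ : ℕ → List Instr} {p m δ : ℕ} {env : List Qbar} {c : ℝ}
    {P : List Qbar → Trace m ℕ → Prop} (hl : env.length = δ + 1 + m * (m * (δ + 1)))
    (h : Sat (mainP s₁ s₂ p m δ) env c P) :
    ((mainTree s₁ s₂ p m δ).cost env : ℝ) ≤ c ∧
      P ((mainTree s₁ s₂ p m δ).run env).2 ((mainTree s₁ s₂ p m δ).run env).1 := by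
  obtain ⟨-, -, h3, h4⟩ := h
  rw [hl] at h3 h4
  rw [mainTree, CompTree.cost_bind, CompTree.run_bind]
  exact ⟨h3, h4⟩

section cost
variable {M MM : ℕ → ℝ} {s₁ s₂ : ℕ → List Instr}

theorem le_of_polyMul (hs : ∀ n, IsPolyMul n (s₁ n) ∧ ((s₁ n).length : ℝ) ≤ M n)
    (hMreg : ∀ a b : ℕ, 1 ≤ a → a ≤ b → M a / a ≤ M b / b) {N : ℕ} (hN : 1 ≤ N) : (N : ℝ) ≤ M N := by
  have h := (exists_polyMul hs hMreg hN).one_le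
  rwa [one_le_div (by exact_mod_cast hN)] at h

theorem sq_le_of_matMul (hs : ∀ n, IsMatMul n (s₂ n) ∧ ((s₂ n).length : ℝ) ≤ MM n)
    (hMMreg : ∀ a b : ℕ, 1 ≤ a → a ≤ b → MM a / (a : ℝ) ^ 2 ≤ MM b / (b : ℝ) ^ 2) {r : ℕ}
    (hr : 1 ≤ r) : (r : ℝ) ^ 2 ≤ MM r := by
  have h := (exists_matMul hs hMMreg hr).one_le
  have hr' : (0 : ℝ) < r := by exact_mod_cast hr
  rwa [one_le_div (by positivity)] at h

theorem four_pow_log_le {r : ℕ} (hr : 1 ≤ r) {B : ℝ} (hB : 0 ≤ B) :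
    4 ^ (Nat.log 2 r + 2) * (B / (r : ℝ) ^ 2) ≤ 16 * B := by
  have hr' : (0 : ℝ) < r := by exact_mod_cast hr
  have h1 : ((2 ^ Nat.log 2 r : ℕ) : ℝ) ≤ r := by exact_mod_cast Nat.pow_log_le_self 2 (by omega)
  have h2 : (4 : ℝ) ^ (Nat.log 2 r + 2) = 16 * ((2 ^ Nat.log 2 r : ℕ) : ℝ) ^ 2 := by
    push_cast
    rw [pow_add, ← pow_mul, mul_comm (Nat.log 2 r) 2, pow_mul]; norm_num; ring
  rw [h2]
  calc 16 * ((2 ^ Nat.log 2 r : ℕ) : ℝ) ^ 2 * (B / (r : ℝ) ^ 2)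
      ≤ 16 * (r : ℝ) ^ 2 * (B / (r : ℝ) ^ 2) := by gcongr
    _ = 16 * B := by field_simp

/-- Rounding the size to a power of two costs a bounded factor, and the cubic cost of the
eliminations is `r³ ≤ r B` per class. -/
theorem decideCost_le {m d n r : ℕ} (hm : 1 ≤ m) (hd : 1 ≤ d) (hn : 1 ≤ n) (hr : 1 ≤ r) {B : ℝ}
    (hB : (r : ℝ) ^ 2 ≤ B) :
    decideCost m d n (Nat.log 2 r) (B / (r : ℝ) ^ 2) ≤
      3488 * (d * m * n * B) + 320 * (d * r * B) + 18 * ((n : ℝ) ^ 2 * m ^ 3) := by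
  have hB0 : 0 ≤ B := (sq_nonneg _).trans hB
  have hW := four_pow_log_le hr hB0
  set W := (4 : ℝ) ^ (Nat.log 2 r + 2) * (B / (r : ℝ) ^ 2) with hWdef
  have hm' : (1 : ℝ) ≤ m := by exact_mod_cast hm
  have hd' : (1 : ℝ) ≤ d := by exact_mod_cast hd
  have hn' : (1 : ℝ) ≤ n := by exact_mod_cast hn
  have h1 : ((2 ^ Nat.log 2 r : ℕ) : ℝ) ≤ r := by exact_mod_cast Nat.pow_log_le_self 2 (by omega)
  have h3 : (2 : ℝ) ^ (Nat.log 2 r + 2) * (5 * 4 ^ (Nat.log 2 r + 2)) ≤ 320 * (r * B) := by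
    have h2 : (2 : ℝ) ^ (Nat.log 2 r + 2) * (5 * 4 ^ (Nat.log 2 r + 2)) =
        320 * ((2 ^ Nat.log 2 r : ℕ) : ℝ) ^ 3 := by
      have h4 : (4 : ℝ) ^ (Nat.log 2 r) = (2 ^ Nat.log 2 r) ^ 2 := by
        rw [← pow_mul, mul_comm, pow_mul]; norm_num
      push_cast
      rw [pow_add, pow_add, h4]; ring
    rw [h2]
    calc 320 * ((2 ^ Nat.log 2 r : ℕ) : ℝ) ^ 3 ≤ 320 * (r : ℝ) ^ 3 := by gcongr
      _ = 320 * (r * (r : ℝ) ^ 2) := by ring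
      _ ≤ _ := by gcongr
  have hmn : (1 : ℝ) ≤ m * n := one_le_mul_of_one_le_of_one_le hm' hn'
  have h5 : (16 + 78 * ((m * n + 1 : ℕ) : ℝ)) * W ≤ 172 * (m * n) * (16 * B) := by
    push_cast
    refine mul_le_mul ?_ hW (by positivity) (by positivity)
    linarith
  have h6 : 46 * W ≤ d * (736 * (m * n) * B) := by
    have h7 : 1 * 1 ≤ (d : ℝ) * (m * n) := mul_le_mul hd' hmn zero_le_one (by linarith)
    nlinarith [mul_le_mul_of_nonneg_right h7 hB0]
  have h8 : (n : ℝ) * m ^ 3 ≤ (n : ℝ) ^ 2 * m ^ 3 := by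
    have : (n : ℝ) ≤ n ^ 2 := by nlinarith
    gcongr
  have h9 : (m : ℝ) ^ 3 ≤ (n : ℝ) ^ 2 * m ^ 3 :=
    le_mul_of_one_le_left (by positivity) (one_le_pow₀ hn')
  have h10 := mul_le_mul_of_nonneg_left (add_le_add h5 h3) (zero_le_one.trans hd')
  rw [decideCost, ← hWdef]
  push_cast at h10 ⊢
  linarith

variable {m p : ℕ} (A : GL (Fin m) (RatFunc Qbar)) {d : ℕ}

/-- From `(p - 1) n < d v + 2 (p - 1)`, with `d ≤ p ^ m` and `p ≤ 2 (p - 1)`, one gets `n ≤ 2 p ^ (m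
- 1) v + 2`. -/
theorem colCount_le_pow (hp : 2 ≤ p) (hm : 1 ≤ m) (hd : d ≤ p ^ m) (hv : 1 ≤ (gap A).toNat) :
    colCount p A d ≤ 4 * (p ^ (m - 1) * (gap A).toNat) := by
  have h := mul_colCount_le hp A d hm
  have hg : ((gap A).toNat : ℤ) = gap A := Int.toNat_of_nonneg (gap_nonneg A hm)
  rw [← hg] at h
  set v := (gap A).toNat
  obtain ⟨k, rfl⟩ : ∃ k, m = k + 1 := ⟨m - 1, by omega⟩
  rw [Nat.add_sub_cancel]
  have hd' : (d : ℤ) ≤ p * (p : ℤ) ^ k := by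
    rw [← pow_succ']; exact_mod_cast hd
  have hp' : (2 : ℤ) ≤ p := by exact_mod_cast hp
  have hq : (1 : ℤ) ≤ (p : ℤ) ^ k * v := by
    exact_mod_cast Nat.mul_pos (Nat.pow_pos (by omega)) hv
  have hdv := mul_le_mul_of_nonneg_right hd' (Int.natCast_nonneg v)
  have h2 : ((p : ℤ) - 1) * colCount p A d ≤ (p - 1) * (4 * ((p : ℤ) ^ k * v)) := by
    nlinarith
  have h3 := le_of_mul_le_mul_left h2 (by linarith)
  exact_mod_cast h3

theorem decideCost_le_bound (hp : 2 ≤ p) (hm : 1 ≤ m) (hd1 : 1 ≤ d) (hd : d ≤ p ^ m)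
    (hMM : ∀ r : ℕ, 1 ≤ r → (r : ℝ) ^ 2 ≤ MM r) (hM : ∀ N : ℕ, 1 ≤ N → (N : ℝ) ≤ M N)
    (δ : ℕ) :
    decideCost m d (colCount p A d) (Nat.log 2 (m * max (gap A).toNat 1))
      (MM (m * max (gap A).toNat 1) / ((m * max (gap A).toNat 1 : ℕ) : ℝ) ^ 2) ≤
      14560 * bound M MM p A δ := by
  have hm' : (1 : ℝ) ≤ m := by exact_mod_cast hm
  have hn1 : 1 ≤ colCount p A d := by
    have h1 := colCount_cast hp A d hm
    have h2 := nu_le_mu hp A d hm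
    omega
  have hr : 1 ≤ m * max (gap A).toNat 1 := Nat.mul_pos hm (by omega)
  have hcost := decideCost_le hm hd1 hn1 hr (hMM _ hr)
  have hp1 : (1 : ℝ) ≤ p := by exact_mod_cast (by omega : 1 ≤ p)
  have hd' : (d : ℝ) ≤ (p : ℝ) ^ m := by exact_mod_cast hd
  have hN : 1 ≤ p ^ m * (δ + m) := Nat.mul_pos (Nat.pow_pos (by omega)) (by omega)
  have hMN := hM _ hN
  have hMm : 0 ≤ MM m := (sq_nonneg _).trans (hMM m hm)
  have hM0 : 0 ≤ M (p ^ m * (δ + m)) := (Nat.cast_nonneg _).trans hMN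
  -- For `v = 0` the second summand vanishes. Then there is a single block column and the matrices
  -- of a class have size `O(m)`, so the cost is `O(d m MM(m))`, up to a term `O(m³)`; it is paid by
  -- the first summand because `d m ≤ p ^ m (δ + m)`.
  rcases Nat.eq_zero_or_pos (gap A).toNat with hv | hv
  · have hn : colCount p A d = 1 := by
      have h1 := colCount_le hp A d hm
      have hg := gap_nonneg A hm
      have : gap A = 0 := by omega
      rw [this, mul_zero] at h1
      omega
    rw [hv, hn] at hcost
    rw [bound, hv, hn]
    simp only [zero_le, max_eq_right, mul_one] at hcost ⊢
    have h1 : (d : ℝ) * m ≤ M (p ^ m * (δ + m)) := by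
      refine le_trans ?_ hMN
      push_cast
      have : (m : ℝ) ≤ δ + m := le_add_of_nonneg_left (Nat.cast_nonneg _)
      gcongr
    have h2 : (m : ℝ) ≤ M (p ^ m * (δ + m)) := by
      refine le_trans ?_ h1
      exact le_mul_of_one_le_left (by linarith) (by exact_mod_cast hd1)
    have h3 : (m : ℝ) ^ 3 ≤ MM m * M (p ^ m * (δ + m)) := by
      calc (m : ℝ) ^ 3 = m ^ 2 * m := by ring
        _ ≤ _ := mul_le_mul (hMM m hm) h2 (by linarith) hMm
    have h4 := mul_le_mul_of_nonneg_right h1 hMm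
    push_cast at hcost ⊢
    nlinarith [mul_nonneg hMm hM0]
  · have hmax : max (gap A).toNat 1 = (gap A).toNat := max_eq_left hv
    rw [hmax] at hcost hr ⊢
    have hn := colCount_le_pow A hp hm hd hv
    rw [bound]
    set v := (gap A).toNat
    set n := colCount p A d
    set B := MM (m * v)
    have hB : ((m * v : ℕ) : ℝ) ^ 2 ≤ B := hMM _ hr
    have hB0 : 0 ≤ B := (sq_nonneg _).trans hB
    have hv' : (1 : ℝ) ≤ v := by exact_mod_cast hv
    obtain ⟨k, rfl⟩ : ∃ k, m = k + 1 := ⟨m - 1, by omega⟩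
    rw [Nat.add_sub_cancel] at hn
    have hn' : (n : ℝ) ≤ 4 * ((p : ℝ) ^ k * v) := by exact_mod_cast hn
    have he : 2 * (k + 1) - 1 = (k + 1) + k := by omega
    rw [he]
    have hk1 : (1 : ℝ) ≤ (p : ℝ) ^ k := one_le_pow₀ hp1
    have h1 : (d : ℝ) * n ≤ (p : ℝ) ^ (k + 1) * (4 * ((p : ℝ) ^ k * v)) :=
      mul_le_mul hd' hn' (Nat.cast_nonneg _) (by positivity)
    set c : ℝ := ((k + 1 : ℕ) : ℝ)
    set X := (p : ℝ) ^ ((k + 1) + k) * c * v * B with hX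
    have hX1 : (d : ℝ) * c * n * B ≤ 4 * X := by
      calc (d : ℝ) * c * n * B = (d * n) * (c * B) := by ring
        _ ≤ ((p : ℝ) ^ (k + 1) * (4 * ((p : ℝ) ^ k * v))) * (c * B) := by gcongr
        _ = 4 * X := by rw [hX, pow_add]; ring
    have hX2 : (d : ℝ) * ((((k + 1) * v : ℕ) : ℝ)) * B ≤ X := by
      push_cast
      calc (d : ℝ) * (((k : ℝ) + 1) * v) * B ≤ ((p : ℝ) ^ (k + 1) * p ^ k) * (((k : ℝ) + 1) * v) * B := by
            gcongr
            exact hd'.trans (le_mul_of_one_le_right (by positivity) hk1)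
        _ = X := by rw [hX, pow_add]; simp only [c]; push_cast; ring
    have hX3 : (n : ℝ) ^ 2 * c ^ 3 ≤ 16 * X := by
      have h2 : (v : ℝ) * c ^ 2 ≤ B := by
        refine le_trans ?_ hB
        have : (v : ℝ) ≤ v ^ 2 := by nlinarith
        calc (v : ℝ) * c ^ 2 ≤ v ^ 2 * c ^ 2 := by gcongr
          _ = _ := by simp only [c]; push_cast; ring
      have h3 : (p : ℝ) ^ k ≤ (p : ℝ) ^ (k + 1) := pow_le_pow_right₀ hp1 (by omega)
      calc (n : ℝ) ^ 2 * c ^ 3 ≤ (4 * ((p : ℝ) ^ k * v)) ^ 2 * c ^ 3 := by gcongr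
        _ = 16 * ((p : ℝ) ^ k * p ^ k * (c * v) * (v * c ^ 2)) := by ring
        _ ≤ 16 * ((p : ℝ) ^ (k + 1) * p ^ k * (c * v) * B) := by gcongr
        _ = 16 * X := by rw [hX, pow_add]; ring
    nlinarith [mul_nonneg hMm hM0]

theorem sat_mainP (hp : 2 ≤ p) (hm : 1 ≤ m) {δ : ℕ} {Q : Qbar[X]} {S : Matrix (Fin m) (Fin m) Qbar[X]}
    (hs₁ : ∀ n, IsPolyMul n (s₁ n) ∧ ((s₁ n).length : ℝ) ≤ M n)
    (hMreg : ∀ a b : ℕ, 1 ≤ a → a ≤ b → M a / a ≤ M b / b)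
    (hs₂ : ∀ n, IsMatMul n (s₂ n) ∧ ((s₂ n).length : ℝ) ≤ MM n)
    (hMMreg : ∀ a b : ℕ, 1 ≤ a → a ≤ b → MM a / (a : ℝ) ^ 2 ≤ MM b / (b : ℝ) ^ 2)
    (hA : IsPresentation A.val Q S δ) :
    Sat (mainP s₁ s₂ p m δ) (inputWord δ Q S) (130000 * bound M MM p A δ)
      fun e t => IsRun p A Q S (t.map (reg e)) := by
  have hN : 1 ≤ p ^ m * (δ + m) := Nat.mul_pos (Nat.pow_pos (by omega)) (by omega)
  have hr : 1 ≤ m * max (gap A).toNat 1 := Nat.mul_pos hm (by omega)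
  have hMM := fun r (h : 1 ≤ r) => sq_le_of_matMul hs₂ hMMreg h
  have hM := fun N (h : 1 ≤ N) => le_of_polyMul hs₁ hMreg h
  have hMM0 : ∀ r, 0 ≤ MM r := fun r => (Nat.cast_nonneg _).trans (hs₂ r).2
  refine Sat.bind (sat_gaugeP hp hm rfl (exists_polyMul hs₁ hMreg hN) (exists_matMul hs₂ hMMreg hm) hA)
    fun e g h1 hg => ?_
  obtain ⟨ha, hb, -⟩ := hg.2.2.1
  rw [ha, hb]
  have hd : 1 ≤ g.d ∧ g.d ≤ p ^ m := by
    obtain ⟨-, -, -, x, rv, -, -, -, -, -, -, -, hd⟩ := hg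
    rw [hd]
    exact ⟨(ramIdx_props hp _).2.2.1, (ramIdx_props hp _).2.2.2.2⟩
  have hsat := sat_finishP hp hm rfl hA hg (exists_matMul hs₂ hMMreg hr)
    (Nat.lt_pow_succ_log_self one_lt_two _)
  refine Sat.mono hsat ?_ fun _ _ _ h => h
  have hc := decideCost_le_bound (M := M) A hp hm hd.1 hd.2 hMM hM δ
  have hNN : ((p ^ m * (δ + m) : ℕ) : ℝ) * (M (p ^ m * (δ + m)) / ((p ^ m * (δ + m) : ℕ) : ℝ)) =
      M (p ^ m * (δ + m)) := by
    have : ((p ^ m * (δ + m) : ℕ) : ℝ) ≠ 0 := by exact_mod_cast (by omega : p ^ m * (δ + m) ≠ 0)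
    field_simp
  rw [hNN]
  have hM1 : 1 ≤ M (p ^ m * (δ + m)) := le_trans (by exact_mod_cast hN) (hM _ hN)
  have h4 := four_pow_log_le hm (hMM0 m)
  have h5 := mul_le_mul_of_nonneg_right (hMM m hm) (zero_le_one.trans hM1)
  have h6 := le_mul_of_one_le_right (hMM0 m) hM1
  have h7 : MM m * M (p ^ m * (δ + m)) ≤ bound M MM p A δ := by
    rw [bound]
    have := hMM0 (m * (gap A).toNat)
    exact le_add_of_nonneg_right (by positivity)
  have h8 := mul_nonneg (hMM0 m) (zero_le_one.trans hM1)
  linarith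

end cost

/-! ## The degree and the degrees of the entries -/

/-- The product of all `m²` reduced denominators is a common denominator, and each numerator
replaces one factor. -/
theorem matDegree_le {m : ℕ} (A : Matrix (Fin m) (Fin m) (RatFunc Qbar)) :
    matDegree A ≤ m ^ 2 * entryDegree A := by
  have hle : ∀ i j, (A i j).num.natDegree ≤ entryDegree A ∧ (A i j).denom.natDegree ≤ entryDegree A :=
    fun i j => max_le_iff.1 (Finset.le_sup (f := fun ij : Fin m × Fin m =>
      max (A ij.1 ij.2).num.natDegree (A ij.1 ij.2).denom.natDegree) (Finset.mem_univ (i, j)))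
  have hcard : (Finset.univ : Finset (Fin m × Fin m)).card = m ^ 2 := by simp [sq]
  have hdeg : ∀ s : Finset (Fin m × Fin m), (∏ x ∈ s, (A x.1 x.2).denom).natDegree ≤
      s.card * entryDegree A := fun s => (Polynomial.natDegree_prod_le _ _).trans
    (by simpa using Finset.sum_le_card_nsmul s _ _ fun x _ => (hle x.1 x.2).2)
  refine Nat.sInf_le ⟨∏ x : Fin m × Fin m, (A x.1 x.2).denom,
    fun i j => (A i j).num * ∏ x ∈ Finset.univ.erase (i, j), (A x.1 x.2).denom,
    Finset.prod_ne_zero_iff.2 fun x _ => RatFunc.denom_ne_zero _, ?_, fun i j => ?_, fun i j => ?_⟩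
  · rw [← hcard]; exact hdeg _
  · refine Polynomial.natDegree_mul_le.trans ?_
    have h1 := hdeg (Finset.univ.erase (i, j))
    have h2 := Finset.card_erase_add_one (Finset.mem_univ (i, j))
    rw [hcard] at h2
    rw [← h2, add_mul, one_mul, add_comm]
    exact add_le_add h1 (hle i j).1
  · have h0 : ∀ x : Fin m × Fin m, algebraMap Qbar[X] (RatFunc Qbar) (A x.1 x.2).denom ≠ 0 := fun x =>
      RatFunc.algebraMap_ne_zero (RatFunc.denom_ne_zero _)
    rw [← Finset.mul_prod_erase _ _ (Finset.mem_univ (i, j)), map_mul, map_mul, map_prod,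
      mul_div_mul_right _ _ (Finset.prod_ne_zero_iff.2 fun x _ => h0 x), RatFunc.num_div_denom]

theorem monotone_of_div {M : ℕ → ℝ} (h0 : ∀ n, 0 ≤ M n)
    (hMreg : ∀ a b : ℕ, 1 ≤ a → a ≤ b → M a / a ≤ M b / b) {a b : ℕ} (ha : 1 ≤ a) (hab : a ≤ b) :
    M a ≤ M b := by
  have ha' : (0 : ℝ) < a := by exact_mod_cast ha
  have hab' : (a : ℝ) ≤ b := by exact_mod_cast hab
  calc M a = a * (M a / a) := by field_simp
    _ ≤ b * (M b / b) := mul_le_mul hab' (hMreg a b ha hab) (div_nonneg (h0 a) ha'.le) (by linarith)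
    _ = M b := by have : (b : ℝ) ≠ 0 := by linarith
                  field_simp

theorem doubling_iterate {M : ℕ → ℝ} (h0 : ∀ n, 0 ≤ M n) {C : ℝ}
    (hC : ∀ n : ℕ, 1 ≤ n → M (2 * n) ≤ C * M n) (k : ℕ) {n : ℕ} (hn : 1 ≤ n) :
    M (2 ^ k * n) ≤ max C 1 ^ k * M n := by
  induction k with
  | zero => simp
  | succ k ih =>
    have h1 : 1 ≤ 2 ^ k * n := Nat.mul_pos (Nat.pow_pos (by norm_num)) hn
    have h2 : (0 : ℝ) ≤ max C 1 := zero_le_one.trans (le_max_right _ _)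
    calc M (2 ^ (k + 1) * n) = M (2 * (2 ^ k * n)) := by congr 1; ring
      _ ≤ C * M (2 ^ k * n) := hC _ h1
      _ ≤ max C 1 * M (2 ^ k * n) := mul_le_mul_of_nonneg_right (le_max_left _ _) (h0 _)
      _ ≤ max C 1 * (max C 1 ^ k * M n) := mul_le_mul_of_nonneg_left ih h2
      _ = _ := by ring

/-- The degree changes by a factor at most `m² ≤ 2 ^ (m ^ 2)`, so `m ^ 2` doublings suffice. The
crude exponent is harmless, as the constant may depend on `m`; the second summand does not involve
the degree. -/
theorem bound_matDegree_le {M MM : ℕ → ℝ} (h0 : ∀ n, 0 ≤ M n) (hMM0 : ∀ n, 0 ≤ MM n)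
    (hMreg : ∀ a b : ℕ, 1 ≤ a → a ≤ b → M a / a ≤ M b / b) {C : ℝ}
    (hC : ∀ n : ℕ, 1 ≤ n → M (2 * n) ≤ C * M n) {p m : ℕ} (hp : 2 ≤ p) (hm : 1 ≤ m)
    (A : GL (Fin m) (RatFunc Qbar)) :
    bound M MM p A (matDegree A.val) ≤ max C 1 ^ (m ^ 2) * bound M MM p A (entryDegree A.val) := by
  have hc : 1 ≤ max C 1 ^ (m ^ 2) := one_le_pow₀ (le_max_right _ _)
  have hpm : 1 ≤ p ^ m := Nat.pow_pos (by omega)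
  have h1 : p ^ m * (matDegree A.val + m) ≤ 2 ^ (m ^ 2) * (p ^ m * (entryDegree A.val + m)) := by
    have h2 := matDegree_le A.val
    have h3 : m ^ 2 ≤ 2 ^ (m ^ 2) := Nat.lt_two_pow_self.le
    have h4 : matDegree A.val + m ≤ 2 ^ (m ^ 2) * (entryDegree A.val + m) := by
      have h5 := Nat.mul_le_mul_right (entryDegree A.val) h3
      have h6 : 1 * m ≤ 2 ^ (m ^ 2) * m := Nat.mul_le_mul_right m (Nat.pow_pos (by norm_num))
      rw [mul_add]; omega
    calc _ ≤ p ^ m * (2 ^ (m ^ 2) * (entryDegree A.val + m)) := Nat.mul_le_mul_left _ h4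
      _ = _ := by ring
  have h7 := (monotone_of_div h0 hMreg (Nat.mul_pos hpm (by omega)) h1).trans
    (doubling_iterate h0 hC (m ^ 2) (Nat.mul_pos hpm (by omega)))
  have h8 : 0 ≤ (p : ℝ) ^ (2 * m - 1) * m * (gap A).toNat * MM (m * (gap A).toNat) :=
    mul_nonneg (by positivity) (hMM0 _)
  rw [bound, bound, mul_add (max C 1 ^ m ^ 2)]
  refine add_le_add ?_ (le_mul_of_one_le_left h8 hc)
  calc _ ≤ MM m * (max C 1 ^ m ^ 2 * M (p ^ m * (entryDegree A.val + m))) :=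
        mul_le_mul_of_nonneg_left h7 (hMM0 m)
    _ = _ := by ring

end Mahler

end

theorem mainTheorem7 (M MM : ℕ → ℝ)
    (hM : ∀ n : ℕ, ∃ s : List Mahler.Instr, Mahler.IsPolyMul n s ∧ (s.length : ℝ) ≤ M n)
    (hMreg : ∀ a b : ℕ, 1 ≤ a → a ≤ b → M a / a ≤ M b / b)
    (hMM : ∀ n : ℕ, ∃ s : List Mahler.Instr, Mahler.IsMatMul n s ∧ (s.length : ℝ) ≤ MM n)
    (hMMreg : ∀ a b : ℕ, 1 ≤ a → a ≤ b → MM a / (a : ℝ) ^ 2 ≤ MM b / (b : ℝ) ^ 2) :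
    (∀ (p m : ℕ) (A : GL (Fin m) (RatFunc Mahler.Qbar)), 2 ≤ p → 1 ≤ m →
      0 ≤ Mahler.gap A ∧
      ∀ d : ℕ, 1 ≤ d → d.Coprime p →
        Mahler.IsGridded d (Mahler.Mmat p A d (Mahler.colCount p A d)) ∧
        Mahler.IsGridded d
          (Mahler.Nmat p A d (Mahler.rowCount p A d) (Mahler.colCount p A d))) ∧
    ∃ T : ∀ p m _δ : ℕ, Mahler.CompTree (Mahler.Trace m ℕ),
      (∀ (p m : ℕ) (A : GL (Fin m) (RatFunc Mahler.Qbar)) (Q : Polynomial Mahler.Qbar)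
        (S : Matrix (Fin m) (Fin m) (Polynomial Mahler.Qbar)), 2 ≤ p → 1 ≤ m →
        Mahler.IsPresentation A.val Q S (Mahler.matDegree A.val) →
        Mahler.IsRun p A Q S (Mahler.output (T p m (Mahler.matDegree A.val))
          (Mahler.inputWord (Mahler.matDegree A.val) Q S))) ∧
      (∃ κ : ℝ, 0 < κ ∧
        ∀ (p m : ℕ) (A : GL (Fin m) (RatFunc Mahler.Qbar)) (Q : Polynomial Mahler.Qbar)
          (S : Matrix (Fin m) (Fin m) (Polynomial Mahler.Qbar)), 2 ≤ p → 1 ≤ m →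
          Mahler.IsPresentation A.val Q S (Mahler.matDegree A.val) →
          ((T p m (Mahler.matDegree A.val)).cost
              (Mahler.inputWord (Mahler.matDegree A.val) Q S) : ℝ) ≤
            κ * Mahler.bound M MM p A (Mahler.matDegree A.val)) ∧
      ((∃ C : ℝ, ∀ n : ℕ, 1 ≤ n → M (2 * n) ≤ C * M n) →
        ∀ m : ℕ, 1 ≤ m → ∃ κ : ℝ, 0 < κ ∧
          ∀ (p : ℕ) (A : GL (Fin m) (RatFunc Mahler.Qbar)) (Q : Polynomial Mahler.Qbar)
            (S : Matrix (Fin m) (Fin m) (Polynomial Mahler.Qbar)), 2 ≤ p →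
            Mahler.IsPresentation A.val Q S (Mahler.matDegree A.val) →
            ((T p m (Mahler.matDegree A.val)).cost
                (Mahler.inputWord (Mahler.matDegree A.val) Q S) : ℝ) ≤
              κ * Mahler.bound M MM p A (Mahler.entryDegree A.val)) := by
  choose s₁ hs₁ using hM
  choose s₂ hs₂ using hMM
  have hM0 : ∀ n, 0 ≤ M n := fun n => (Nat.cast_nonneg _).trans (hs₁ n).2
  have hMM0 : ∀ n, 0 ≤ MM n := fun n => (Nat.cast_nonneg _).trans (hs₂ n).2
  have key := fun (p m : ℕ) (A : GL (Fin m) (RatFunc Mahler.Qbar)) (Q : Polynomial Mahler.Qbar)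
      (S : Matrix (Fin m) (Fin m) (Polynomial Mahler.Qbar)) (hp : 2 ≤ p) (hm : 1 ≤ m)
      (hA : Mahler.IsPresentation A.val Q S (Mahler.matDegree A.val)) =>
    Mahler.mainTree_of_sat Mahler.length_inputWord
      (Mahler.sat_mainP A hp hm hs₁ hMreg hs₂ hMMreg hA)
  refine ⟨fun p m A _ hm => Mahler.gap_and_gridded p m A hm, Mahler.mainTree s₁ s₂,
    fun p m A Q S hp hm hA => (key p m A Q S hp hm hA).2,
    ⟨130000, by norm_num, fun p m A Q S hp hm hA => (key p m A Q S hp hm hA).1⟩, ?_⟩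
  rintro ⟨C, hC⟩ m hm
  have hpos : 0 < max C 1 ^ (m ^ 2) := pow_pos (lt_max_of_lt_right one_pos) _
  refine ⟨130000 * max C 1 ^ (m ^ 2), by positivity, fun p A Q S hp hA =>
    (key p m A Q S hp hm hA).1.trans ?_⟩
  rw [mul_assoc]
  exact mul_le_mul_of_nonneg_left (Mahler.bound_matDegree_le hM0 hMM0 hMreg hC hp hm A) (by norm_num)
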